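/- **Theorem 4.** *Notation.* Let $\mathbb R_+=\,]0,\infty[$, let $\mathcal F_{\mathrm D},\mathcal F_{\mathrm N}$ be the unitary sine and cosine transformations of $L^2(\mathbb R_+)$, $(\mathcal F_{\mathrm D}f)(p)=\sqrt{2/\pi}\int_0^\infty\sin(px)f(x)\,dx$ and $(\mathcal F_{\mathrm N}f)(p)=\sqrt{2/\pi}\int_0^\infty\cos(px)f(x)\,dx$, and let $\gamma$ be the Euler constant. Let $\alpha<1$ be real. *Position space.* $L_\alpha^{\min}$ is the closure of $L_\alpha=-\frac{d^2}{dx^2}+(\alpha-\frac14)\frac1{x^2}$ on $C_c^\infty(\mathbb R_+)$, and $L_\alpha^{\max}$ is $L_\alpha$ (in the distributional sense) on $\{f\in L^2(\mathbb R_+): L_\alpha f\in L^2(\mathbb R_+)\}$. Let $\xi\in C_c^\infty([0,\infty[)$ with $\xi=1$ near $0$. For $m^2=\alpha$ and $\kappa\in\mathbb C\cup\{\infty\}$, $H_{m,\kappa}$ is the restriction of $L_{\alpha}^{\max}$ to $\mathcal D(L_{\alpha}^{\min})+\mathbb C\,\xi\,(\kappa x^{1/2-m}+x^{1/2+m})$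 (to $\mathcal D(L_\alpha^{\min})+\mathbb C\,\xi x^{1/2-m}$ if $\kappa=\infty$); for $\nu\in\mathbb C\cup\{\infty\}$, $H_0^\nu$ is the restriction of $L_0^{\max}$ to $\mathcal D(L_0^{\min})+\mathbb C\,\xi\,(x^{1/2}\log x+\nu x^{1/2})$ (to $\mathcal D(L_0^{\min})+\mathbb C\,\xi x^{1/2}$ if $\nu=\infty$). *Momentum space.* Put $k_{\mathrm D}(p,q)=\min(p,q)$, $w_{\mathrm D}(q)=q$, $k_{\mathrm N}(p,q)=-\max(p,q)$, $w_{\mathrm N}(q)=1$. For $b\in\{\mathrm D,\mathrm N\}$, $\tilde L_{\alpha,b}^{\min}$ is the closure of $\psi\mapsto p^2\psi(p)+(\alpha-\frac14)\int_0^\infty k_b(p,q)\psi(q)\,dq$ on the space of all $\psi\in L^2(\mathbb R_+)$ with $\int_0^\infty|\psi(p)|^2p^n\,dp<\infty$ for all $n\in\mathbb N$ and $\int_0^\infty w_b(q)\psi(q)\,dq=0$. Let $\psi_{s,b},\psi_{\log,b}\in L^2(\mathbb R_+)$ be any functions such that for some $\Lambda_0>0$: $\psi_{s,b}(p)=p^{-3/2-s}$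 and $\psi_{\log,b}(p)=p^{-3/2}\log p$ for $p>\Lambda_0$, and $$\int_0^{\Lambda_0}q\,\psi_{s,\mathrm D}\,dq=\frac{\Lambda_0^{1/2-s}}{\frac12-s},\quad \int_0^{\Lambda_0}\psi_{s,\mathrm N}\,dq=\frac{\Lambda_0^{-1/2-s}}{-\frac12-s},$$ $$\int_0^{\Lambda_0}q\,\psi_{\log,\mathrm D}\,dq=-4\Lambda_0^{1/2}+2\Lambda_0^{1/2}\log\Lambda_0,\quad \int_0^{\Lambda_0}\psi_{\log,\mathrm N}\,dq=-4\Lambda_0^{-1/2}-2\Lambda_0^{-1/2}\log\Lambda_0 .$$ For $m^2=\alpha\neq0,\frac14$, the maximal operator $\tilde L_{\alpha,b}^{\max}$ has domain $\mathcal D(\tilde L_{\alpha,b}^{\min})+\mathbb C\psi_{m,b}+\mathbb C\psi_{-m,b}$ and acts on $\psi\in\mathcal D(\tilde L_{\alpha,b}^{\min})+c_+\psi_{m,b}+c_-\psi_{-m,b}$ by $$\tilde L_{\alpha,b}^{\max}\psi(p)=p^2\psi(p)+\Big(\alpha-\tfrac14\Big)\lim_{\Lambda\to\infty}\Big(\int_0^\Lambda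 k_b(p,q)\psi(q)\,dq+c_+t_{m,b}(p,\Lambda)+c_-t_{-m,b}(p,\Lambda)\Big),$$ where $t_{s,\mathrm D}(p,\Lambda)=\frac{p\Lambda^{-1/2-s}}{\frac12+s}$, $t_{s,\mathrm N}(p,\Lambda)=\frac{\Lambda^{1/2-s}}{\frac12-s}$. For $\alpha=0$ the same definition is used with $\psi_{\log,b},\psi_{0,b}$ in place of $\psi_{m,b},\psi_{-m,b}$ and $t_{\log,b},t_{0,b}$ in place of $t_{m,b},t_{-m,b}$, where $t_{\log,\mathrm D}=p\,(4\Lambda^{-1/2}+2\Lambda^{-1/2}\log\Lambda)$, $t_{\log,\mathrm N}=-4\Lambda^{1/2}+2\Lambda^{1/2}\log\Lambda$. For $\tilde\kappa,\tilde\nu\in\mathbb C\cup\{\infty\}$, $\tilde H_{m,\tilde\kappa,b}$ is the restriction of $\tilde L^{\max}_{m^2,b}$ to $\mathcal D(\tilde L_{m^2,b}^{\min})+\mathbb C(\psi_{m,b}+\tilde\kappa\psi_{-m,b})$ (to $\mathcal D(\tilde L_{m^2,b}^{\min})+\mathbb C\psi_{-m,b}$ if $\tilde\kappa=\infty$), and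 $\tilde H_{0,b}^{\tilde\nu}$ is the restriction of $\tilde L^{\max}_{0,b}$ to $\mathcal D(\tilde L_{0,b}^{\min})+\mathbb C(\psi_{\log,b}+\tilde\nu\psi_{0,b})$ (to $\mathcal D(\tilde L_{0,b}^{\min})+\mathbb C\psi_{0,b}$ if $\tilde\nu=\infty$). *Statement.* Let $m\in\mathbb C$ with $m^2$ real, $m^2<1$ and $m\neq\pm\frac12$. The above operators are self-adjoint in the following situations: * $\tilde H_{m,\tilde\kappa,\mathrm D}$ and $\tilde H_{m,\tilde\kappa,\mathrm N}$ for $m\in\,]-1,1[\,\setminus\{0\}$ and $\tilde\kappa\in\mathbb R\cup\{\infty\}$; * $\tilde H_{m,\tilde\kappa,\mathrm D}$ and $\tilde H_{m,\tilde\kappa,\mathrm N}$ for $m\in i\mathbb R\setminus\{0\}$ and $|\tilde\kappa|=1$; * $\tilde H_{0,\mathrm D}^{\tilde\nu}$ and $\tilde H_{0,\mathrm N}^{\tilde\nu}$ for $\tilde\nu\in\mathbb R\cup\{\infty\}$. Moreover, for all $\kappa,\nu\in\mathbb C\cup\{\infty\}$, $$\mathcal F_{\mathrm D}H_{m,\kappa}\mathcal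 F_{\mathrm D}=\tilde H_{m,\tilde\kappa_{\mathrm D},\mathrm D},\qquad \tilde\kappa_{\mathrm D}=\frac{\sin(\frac\pi4+\frac{\pi m}2)\,\Gamma(-\frac12-m)}{\sin(\frac\pi4-\frac{\pi m}2)\,\Gamma(-\frac12+m)}\,\kappa,$$ $$\mathcal F_{\mathrm N}H_{m,\kappa}\mathcal F_{\mathrm N}=\tilde H_{m,\tilde\kappa_{\mathrm N},\mathrm N},\qquad \tilde\kappa_{\mathrm N}=\frac{\cos(\frac\pi4+\frac{\pi m}2)\,\Gamma(-\frac12-m)}{\cos(\frac\pi4-\frac{\pi m}2)\,\Gamma(-\frac12+m)}\,\kappa,$$ $$\mathcal F_{\mathrm D}H_0^\nu\mathcal F_{\mathrm D}=\tilde H_{0,\mathrm D}^{\tilde\nu_{\mathrm D}},\qquad \tilde\nu_{\mathrm D}=-\nu-2+\gamma+\tfrac\pi2+\log4,$$ $$\mathcal F_{\mathrm N}H_0^\nu\mathcal F_{\mathrm N}=\tilde H_{0,\mathrm N}^{\tilde\nu_{\mathrm N}},\qquad \tilde\nu_{\mathrm N}=-\nu-2+\gamma-\tfrac\pi2+\log4,$$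 with $\tilde\kappa=\infty$ for $\kappa=\infty$ and $\tilde\nu=\infty$ for $\nu=\infty$. -/

import Mathlib

open MeasureTheory Set Filter Topology FourierTransform
open scoped ContDiff

noncomputable section

namespace Bessel

/-! ## The Hilbert space and operators with a prescribed domain and action -/

/-- Lebesgue measure on the open half-line `]0, ∞[`. -/
abbrev posMeasure : Measure ℝ := volume.restrict (Ioi (0 : ℝ))

/-- The Hilbert space `L²(ℝ₊)`. -/
abbrev HalfLineL2 : Type := Lp ℂ 2 posMeasure

open Classical in
/-- The operator with domain `D` which sends `g ∈ D` to the `h` with `R g h`.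
Every `R` used below determines `h` uniquely from `g ∈ D`, and linearly.
(If no linear map on `D` acts by `R`, the value is the zero map on `D`.) -/
def operatorOn (D : Submodule ℂ HalfLineL2) (R : HalfLineL2 → HalfLineL2 → Prop) :
    HalfLineL2 →ₗ.[ℂ] HalfLineL2 where
  domain := D
  toFun := if h : ∃ T : D →ₗ[ℂ] HalfLineL2, ∀ g : D, R g (T g) then h.choose else 0

/-- The operator `F A F`, with domain `{g | F g ∈ 𝓓(A)}`. -/
def sandwich (F : HalfLineL2 →ₗ[ℂ] HalfLineL2) (A : HalfLineL2 →ₗ.[ℂ] HalfLineL2) :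
    HalfLineL2 →ₗ.[ℂ] HalfLineL2 where
  domain := A.domain.comap F
  toFun := F ∘ₗ A.toFun ∘ₗ F.restrict (p := A.domain.comap F) (q := A.domain) (fun _ hx => hx)

/-! ## The sine and cosine transformations -/

/-- Extension by zero from the half-line to the line. -/
def extendZero : HalfLineL2 →ₗ[ℂ] Lp ℂ 2 (volume : Measure ℝ) where
  toFun f := ((memLp_indicator_iff_restrict measurableSet_Ioi).2 (Lp.memLp f)).toLp
  map_add' f g := by
    rw [← MemLp.toLp_add]
    refine MemLp.toLp_congr _ _ ?_
    have h := (ae_restrict_iff' measurableSet_Ioi).1 (Lp.coeFn_add f g)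
    filter_upwards [h] with x hx
    by_cases hx0 : x ∈ Ioi (0 : ℝ)
    · rw [indicator_of_mem hx0, hx hx0, Pi.add_apply, Pi.add_apply, indicator_of_mem hx0,
        indicator_of_mem hx0]
    · simp [indicator_of_notMem hx0]
  map_smul' c f := by
    rw [RingHom.id_apply, ← MemLp.toLp_const_smul]
    refine MemLp.toLp_congr _ _ ?_
    have h := (ae_restrict_iff' measurableSet_Ioi).1 (Lp.coeFn_smul c f)
    filter_upwards [h] with x hx
    by_cases hx0 : x ∈ Ioi (0 : ℝ)
    · rw [indicator_of_mem hx0, hx hx0, Pi.smul_apply, Pi.smul_apply, indicator_of_mem hx0]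
    · simp [indicator_of_notMem hx0]

theorem coeFn_extendZero (f : HalfLineL2) :
    extendZero f =ᵐ[volume] (Ioi (0 : ℝ)).indicator f := by
  have h : MemLp ((Ioi (0 : ℝ)).indicator f) 2 volume :=
    (memLp_indicator_iff_restrict measurableSet_Ioi).2 (Lp.memLp f)
  have e : extendZero f = h.toLp := rfl
  rw [e]
  exact MemLp.coeFn_toLp h

theorem quasiMeasurePreserving_dilate {c : ℝ} (hc : c ≠ 0) :
    Measure.QuasiMeasurePreserving (fun p : ℝ => c * p) posMeasure volume := by
  refine ⟨measurable_const_mul c, ?_⟩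
  refine (Measure.map_mono Measure.restrict_le_self
    (measurable_const_mul c)).absolutelyContinuous.trans ?_
  rw [Real.map_volume_mul_left hc]
  exact Measure.smul_absolutelyContinuous

theorem memLp_dilate {c : ℝ} (hc : c ≠ 0) (G : Lp ℂ 2 (volume : Measure ℝ)) :
    MemLp (fun p : ℝ => G (c * p)) 2 posMeasure := by
  have h : MemLp G 2 (Measure.map (fun p : ℝ => c * p) volume) := by
    rw [Real.map_volume_mul_left hc]
    exact (Lp.memLp G).smul_measure ENNReal.ofReal_ne_top
  exact (h.comp_of_map (measurable_const_mul c).aemeasurable).mono_measure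
    Measure.restrict_le_self

/-- The map `G ↦ G (c ·)`, followed by restriction to the half-line. -/
def dilateRestrict (c : ℝ) (hc : c ≠ 0) : Lp ℂ 2 (volume : Measure ℝ) →ₗ[ℂ] HalfLineL2 where
  toFun G := (memLp_dilate hc G).toLp
  map_add' f g := by
    rw [← MemLp.toLp_add]
    refine MemLp.toLp_congr _ _ ?_
    exact (quasiMeasurePreserving_dilate hc).ae_eq_comp (Lp.coeFn_add f g)
  map_smul' k f := by
    rw [RingHom.id_apply, ← MemLp.toLp_const_smul]
    refine MemLp.toLp_congr _ _ ?_
    exact (quasiMeasurePreserving_dilate hc).ae_eq_comp (Lp.coeFn_smul k f)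

theorem coeFn_dilateRestrict (c : ℝ) (hc : c ≠ 0) (G : Lp ℂ 2 (volume : Measure ℝ)) :
    dilateRestrict c hc G =ᵐ[posMeasure] fun p => G (c * p) :=
  MemLp.coeFn_toLp (memLp_dilate hc G)

theorem two_pi_inv_ne_zero : (2 * Real.pi)⁻¹ ≠ 0 := by positivity

theorem neg_two_pi_inv_ne_zero : -(2 * Real.pi)⁻¹ ≠ 0 := neg_ne_zero.2 two_pi_inv_ne_zero

/-- The unitary Fourier transformation of the line, `G(ξ) = ∫ e^{-2πixξ} g(x) dx`, applied to the
extension by zero. -/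
def lineFourier : HalfLineL2 →ₗ[ℂ] Lp ℂ 2 (volume : Measure ℝ) :=
  (Lp.fourierTransformₗᵢ ℝ ℂ).toLinearEquiv.toLinearMap ∘ₗ extendZero

/-- The sine transformation on `L²(ℝ₊)`; `sineTransform_ae_eq` is its integral formula. -/
def sineTransform : HalfLineL2 →ₗ[ℂ] HalfLineL2 :=
  ((√(2 / Real.pi) : ℂ) / (2 * Complex.I)) •
    ((dilateRestrict (-(2 * Real.pi)⁻¹) neg_two_pi_inv_ne_zero -
        dilateRestrict ((2 * Real.pi)⁻¹) two_pi_inv_ne_zero) ∘ₗ lineFourier)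

/-- The cosine transformation on `L²(ℝ₊)`; `cosineTransform_ae_eq` is its integral formula. -/
def cosineTransform : HalfLineL2 →ₗ[ℂ] HalfLineL2 :=
  ((√(2 / Real.pi) : ℂ) / 2) •
    ((dilateRestrict (-(2 * Real.pi)⁻¹) neg_two_pi_inv_ne_zero +
        dilateRestrict ((2 * Real.pi)⁻¹) two_pi_inv_ne_zero) ∘ₗ lineFourier)

theorem fourier_Lp_ae_eq (f : Lp ℂ 2 (volume : Measure ℝ)) (hf : Integrable f) :
    (𝓕 f : Lp ℂ 2 (volume : Measure ℝ)) =ᵐ[volume] 𝓕 (f : ℝ → ℂ) := by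
  have hc : Continuous (𝓕 (f : ℝ → ℂ)) :=
    VectorFourier.fourierIntegral_continuous Real.continuous_fourierChar
      (by exact continuous_inner) hf
  refine ae_eq_of_integral_contDiff_smul_eq
    ((Lp.memLp (𝓕 f)).locallyIntegrable (by norm_num)) hc.locallyIntegrable ?_
  intro g hg hgc
  have hg1 : ContDiff ℝ ∞ (fun x => (g x : ℂ)) := Complex.ofRealCLM.contDiff.comp hg
  have hg2 : HasCompactSupport (fun x => (g x : ℂ)) := hgc.comp_left (g := ((↑) : ℝ → ℂ)) (by simp)
  set φ := hg2.toSchwartzMap hg1 with hφ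
  have hφ' : ∀ x, φ x = (g x : ℂ) := fun x => rfl
  have h1 := congrArg (fun T => T φ) (Lp.fourier_toTemperedDistribution_eq f)
  simp only [TemperedDistribution.fourier_apply, Lp.toTemperedDistribution_apply] at h1
  have h2 : ∫ x, 𝓕 (φ : ℝ → ℂ) x * f x = ∫ x, φ x * 𝓕 (f : ℝ → ℂ) x := by
    simpa using! VectorFourier.integral_bilin_fourierIntegral_eq_flip (ContinuousLinearMap.mul ℂ ℂ)
      (L := innerₗ ℝ) (f := φ) (g := f) Real.continuous_fourierChar continuous_inner
      φ.integrable hf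
  simp only [SchwartzMap.fourier_coe, smul_eq_mul] at h1
  simp only [Complex.real_smul, ← hφ']
  rw [← h1, h2]

theorem dilate_lineFourier_ae_eq (f : HalfLineL2) (hf : Integrable f posMeasure) (c : ℝ)
    (hc : c ≠ 0) :
    dilateRestrict c hc (lineFourier f) =ᵐ[posMeasure] fun p =>
      ∫ x, Complex.exp (-(2 * Real.pi * c * p * x : ℝ) * Complex.I) * f x ∂posMeasure := by
  have hfi : Integrable (extendZero f) :=
    ((integrable_indicator_iff measurableSet_Ioi).2 hf).congr (coeFn_extendZero f).symm
  have h1 := (quasiMeasurePreserving_dilate hc).ae_eq_comp (fourier_Lp_ae_eq (extendZero f) hfi)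
  refine (coeFn_dilateRestrict c hc _).trans (h1.trans (Eventually.of_forall fun p => ?_))
  simp only [Function.comp]
  rw [Real.fourier_eq', ← integral_indicator measurableSet_Ioi]
  refine integral_congr_ae ?_
  filter_upwards [coeFn_extendZero f] with x hx
  rw [hx]
  by_cases hx0 : x ∈ Ioi (0 : ℝ)
  · rw [indicator_of_mem hx0, indicator_of_mem hx0, smul_eq_mul]
    congr 2
    simp only [RCLike.inner_apply, conj_trivial]
    push_cast
    ring
  · simp [indicator_of_notMem hx0]

theorem integrable_exp_mul {f : ℝ → ℂ} (hf : Integrable f posMeasure) (t : ℝ) :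
    Integrable (fun x : ℝ => Complex.exp ((t * x : ℝ) * Complex.I) * f x) posMeasure := by
  refine hf.bdd_mul (c := 1) (by fun_prop) (Eventually.of_forall fun x => ?_)
  rw [Complex.norm_exp_ofReal_mul_I]

theorem sineTransform_ae_eq (f : HalfLineL2) (hf : Integrable f posMeasure) :
    sineTransform f =ᵐ[posMeasure] fun p =>
      √(2 / Real.pi) * ∫ x, (Real.sin (p * x) : ℂ) * f x ∂posMeasure := by
  have h1 := dilate_lineFourier_ae_eq f hf _ neg_two_pi_inv_ne_zero
  have h2 := dilate_lineFourier_ae_eq f hf _ two_pi_inv_ne_zero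
  have hpi : (2 * Real.pi) ≠ 0 := by positivity
  simp only [sineTransform, LinearMap.smul_apply, LinearMap.comp_apply, LinearMap.sub_apply]
  refine (Lp.coeFn_smul _ _).trans ?_
  filter_upwards [h1, h2, Lp.coeFn_sub (dilateRestrict _ neg_two_pi_inv_ne_zero (lineFourier f))
    (dilateRestrict _ two_pi_inv_ne_zero (lineFourier f))] with p hp1 hp2 hp3
  rw [Pi.smul_apply, hp3, Pi.sub_apply, hp1, hp2, smul_eq_mul]
  have e1 : ∀ x : ℝ, -(2 * Real.pi * -(2 * Real.pi)⁻¹ * p * x) = p * x := fun x => by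
    field_simp
  have e2 : ∀ x : ℝ, -(2 * Real.pi * (2 * Real.pi)⁻¹ * p * x) = -p * x := fun x => by
    field_simp
  have e3 : ∀ x : ℝ, (-((2 * Real.pi * -(2 * Real.pi)⁻¹ * p * x : ℝ) : ℂ)) = ((p * x : ℝ) : ℂ) :=
    fun x => by rw [← Complex.ofReal_neg, e1]
  have e4 : ∀ x : ℝ, (-((2 * Real.pi * (2 * Real.pi)⁻¹ * p * x : ℝ) : ℂ)) = ((-p * x : ℝ) : ℂ) :=
    fun x => by rw [← Complex.ofReal_neg, e2]
  simp only [e3, e4]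
  rw [← integral_sub (integrable_exp_mul hf p) (integrable_exp_mul hf (-p)), div_mul_eq_mul_div,
    mul_div_assoc, ← integral_div]
  congr 2
  funext x
  rw [← sub_mul, mul_div_right_comm]
  congr 1
  rw [Complex.ofReal_sin, Complex.sin]
  push_cast
  have hI : Complex.I ≠ 0 := Complex.I_ne_zero
  field_simp
  rw [Complex.I_sq]
  ring_nf

theorem cosineTransform_ae_eq (f : HalfLineL2) (hf : Integrable f posMeasure) :
    cosineTransform f =ᵐ[posMeasure] fun p =>
      √(2 / Real.pi) * ∫ x, (Real.cos (p * x) : ℂ) * f x ∂posMeasure := by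
  have h1 := dilate_lineFourier_ae_eq f hf _ neg_two_pi_inv_ne_zero
  have h2 := dilate_lineFourier_ae_eq f hf _ two_pi_inv_ne_zero
  have hpi : (2 * Real.pi) ≠ 0 := by positivity
  simp only [cosineTransform, LinearMap.smul_apply, LinearMap.comp_apply, LinearMap.add_apply]
  refine (Lp.coeFn_smul _ _).trans ?_
  filter_upwards [h1, h2, Lp.coeFn_add (dilateRestrict _ neg_two_pi_inv_ne_zero (lineFourier f))
    (dilateRestrict _ two_pi_inv_ne_zero (lineFourier f))] with p hp1 hp2 hp3
  rw [Pi.smul_apply, hp3, Pi.add_apply, hp1, hp2, smul_eq_mul]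
  have e1 : ∀ x : ℝ, -(2 * Real.pi * -(2 * Real.pi)⁻¹ * p * x) = p * x := fun x => by
    field_simp
  have e2 : ∀ x : ℝ, -(2 * Real.pi * (2 * Real.pi)⁻¹ * p * x) = -p * x := fun x => by
    field_simp
  have e3 : ∀ x : ℝ, (-((2 * Real.pi * -(2 * Real.pi)⁻¹ * p * x : ℝ) : ℂ)) = ((p * x : ℝ) : ℂ) :=
    fun x => by rw [← Complex.ofReal_neg, e1]
  have e4 : ∀ x : ℝ, (-((2 * Real.pi * (2 * Real.pi)⁻¹ * p * x : ℝ) : ℂ)) = ((-p * x : ℝ) : ℂ) :=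
    fun x => by rw [← Complex.ofReal_neg, e2]
  simp only [e3, e4]
  rw [← integral_add (integrable_exp_mul hf p) (integrable_exp_mul hf (-p)), div_mul_eq_mul_div,
    mul_div_assoc, ← integral_div]
  congr 2
  funext x
  rw [← add_mul, mul_div_right_comm]
  congr 1
  rw [Complex.ofReal_cos, Complex.cos]
  push_cast
  ring_nf

/-! ## Position representation -/

/-- The formal expression `-φ'' + (α - 1/4) x⁻² φ`. -/
def besselExpr (α : ℝ) (φ : ℝ → ℂ) (x : ℝ) : ℂ :=
  -deriv (deriv φ) x + ((α : ℂ) - 1 / 4) / (x : ℂ) ^ 2 * φ x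

/-- `φ ∈ C_c^∞(]0, ∞[)`. -/
structure IsTestFunction (φ : ℝ → ℂ) : Prop where
  contDiff : ContDiff ℝ ∞ φ
  hasCompactSupport : HasCompactSupport φ
  tsupport_subset : tsupport φ ⊆ Ioi 0

theorem IsTestFunction.memLp {φ : ℝ → ℂ} (h : IsTestFunction φ) : MemLp φ 2 posMeasure :=
  (h.contDiff.continuous.memLp_of_hasCompactSupport h.hasCompactSupport).mono_measure
    Measure.restrict_le_self

theorem IsTestFunction.memLp_besselExpr {φ : ℝ → ℂ} (h : IsTestFunction φ) (α : ℝ) :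
    MemLp (besselExpr α φ) 2 posMeasure := by
  have h1 : ContDiff ℝ ∞ (deriv φ) := ((contDiff_infty_iff_deriv (𝕜 := ℝ)).1 h.contDiff).2
  have h2 : ContDiff ℝ ∞ (deriv (deriv φ)) := ((contDiff_infty_iff_deriv (𝕜 := ℝ)).1 h1).2
  have hA : MemLp (fun x => -deriv (deriv φ) x) 2 (volume : Measure ℝ) :=
    (h2.continuous.memLp_of_hasCompactSupport h.hasCompactSupport.deriv.deriv).neg
  have hB : MemLp (fun x : ℝ => ((α : ℂ) - 1 / 4) / (x : ℂ) ^ 2 * φ x) 2 (volume : Measure ℝ) := by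
    refine Continuous.memLp_of_hasCompactSupport ?_ h.hasCompactSupport.mul_left
    refine continuous_of_tsupport fun x hx => ?_
    have hx0 : (x : ℂ) ^ 2 ≠ 0 := by
      have : (0 : ℝ) < x := h.tsupport_subset (tsupport_mul_subset_right hx)
      exact pow_ne_zero 2 (Complex.ofReal_ne_zero.2 this.ne')
    exact (ContinuousAt.div continuousAt_const
      (Complex.continuous_ofReal.pow 2).continuousAt hx0).mul
      h.contDiff.continuous.continuousAt
  exact (hA.add hB).mono_measure Measure.restrict_le_self

theorem IsTestFunction.add {φ χ : ℝ → ℂ} (h : IsTestFunction φ) (h' : IsTestFunction χ) :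
    IsTestFunction (φ + χ) :=
  ⟨h.contDiff.add h'.contDiff, h.hasCompactSupport.add h'.hasCompactSupport,
    (tsupport_add φ χ).trans (union_subset h.tsupport_subset h'.tsupport_subset)⟩

theorem IsTestFunction.const_smul {φ : ℝ → ℂ} (h : IsTestFunction φ) (c : ℂ) :
    IsTestFunction (c • φ) :=
  ⟨contDiff_const.smul h.contDiff, h.hasCompactSupport.smul_left (f := fun _ => c),
    (tsupport_smul_subset_right (fun _ => c) φ).trans h.tsupport_subset⟩

/-- `C_c^∞(]0, ∞[)` as a subspace of `L²(ℝ₊)`. -/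
def testSpace : Submodule ℂ HalfLineL2 where
  carrier := {f | ∃ φ, IsTestFunction φ ∧ f =ᵐ[posMeasure] φ}
  add_mem' := by
    rintro f g ⟨φ, hφ, hf⟩ ⟨χ, hχ, hg⟩
    exact ⟨φ + χ, hφ.add hχ, (Lp.coeFn_add f g).trans (hf.add hg)⟩
  zero_mem' := ⟨0, ⟨contDiff_const, HasCompactSupport.zero, by simp [tsupport]⟩,
    Lp.coeFn_zero ℂ 2 posMeasure⟩
  smul_mem' := by
    rintro c f ⟨φ, hφ, hf⟩
    exact ⟨c • φ, hφ.const_smul c, (Lp.coeFn_smul c f).trans (hf.const_smul c)⟩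

/-- The minimal realization: the closure of the expression `besselExpr α` on `C_c^∞(]0, ∞[)`. -/
def posMin (α : ℝ) : HalfLineL2 →ₗ.[ℂ] HalfLineL2 :=
  (operatorOn testSpace fun f h => ∃ φ, IsTestFunction φ ∧ f =ᵐ[posMeasure] φ ∧
    h =ᵐ[posMeasure] besselExpr α φ).closure

/-- `-f'' + (α - 1/4) x⁻² f = h` on `]0, ∞[` in the sense of distributions. -/
def IsWeakBessel (α : ℝ) (f h : HalfLineL2) : Prop :=
  ∀ φ, IsTestFunction φ → ∫ x, f x * besselExpr α φ x ∂posMeasure = ∫ x, h x * φ x ∂posMeasure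

/-- The maximal domain: all `f ∈ L²(ℝ₊)` with `-f'' + (α - 1/4) x⁻² f ∈ L²(ℝ₊)`. -/
def posMaxDomain (α : ℝ) : Submodule ℂ HalfLineL2 where
  carrier := {f | ∃ h, IsWeakBessel α f h}
  add_mem' := by
    rintro f g ⟨h, hf⟩ ⟨k, hg⟩
    refine ⟨h + k, fun φ hφ => ?_⟩
    have i1 := (Lp.memLp f).integrable_mul (hφ.memLp_besselExpr α)
    have i2 := (Lp.memLp g).integrable_mul (hφ.memLp_besselExpr α)
    have i3 := (Lp.memLp h).integrable_mul hφ.memLp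
    have i4 := (Lp.memLp k).integrable_mul hφ.memLp
    have e1 : ∫ x, (f + g) x * besselExpr α φ x ∂posMeasure =
        ∫ x, (f x * besselExpr α φ x + g x * besselExpr α φ x) ∂posMeasure := by
      refine integral_congr_ae ?_
      filter_upwards [Lp.coeFn_add f g] with x hx
      rw [hx, Pi.add_apply, add_mul]
    have e2 : ∫ x, (h + k) x * φ x ∂posMeasure =
        ∫ x, (h x * φ x + k x * φ x) ∂posMeasure := by
      refine integral_congr_ae ?_
      filter_upwards [Lp.coeFn_add h k] with x hx
      rw [hx, Pi.add_apply, add_mul]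
    rw [e1, e2]
    exact (integral_add i1 i2).trans
      ((congrArg₂ (· + ·) (hf φ hφ) (hg φ hφ)).trans (integral_add i3 i4).symm)
  zero_mem' := by
    refine ⟨0, fun φ _ => ?_⟩
    rw [integral_eq_zero_of_ae, integral_eq_zero_of_ae]
    · filter_upwards [Lp.coeFn_zero ℂ 2 posMeasure] with x hx
      simp only [hx, Pi.zero_apply, zero_mul]
    · filter_upwards [Lp.coeFn_zero ℂ 2 posMeasure] with x hx
      simp only [hx, Pi.zero_apply, zero_mul]
  smul_mem' := by
    rintro c f ⟨h, hf⟩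
    refine ⟨c • h, fun φ hφ => ?_⟩
    have e1 : ∫ x, (c • f) x * besselExpr α φ x ∂posMeasure =
        ∫ x, c * (f x * besselExpr α φ x) ∂posMeasure := by
      refine integral_congr_ae ?_
      filter_upwards [Lp.coeFn_smul c f] with x hx
      rw [hx, Pi.smul_apply, smul_eq_mul, mul_assoc]
    have e2 : ∫ x, (c • h) x * φ x ∂posMeasure = ∫ x, c * (h x * φ x) ∂posMeasure := by
      refine integral_congr_ae ?_
      filter_upwards [Lp.coeFn_smul c h] with x hx
      rw [hx, Pi.smul_apply, smul_eq_mul, mul_assoc]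
    rw [e1, e2, integral_const_mul, integral_const_mul, hf φ hφ]

/-- The maximal realization. -/
def posMax (α : ℝ) : HalfLineL2 →ₗ.[ℂ] HalfLineL2 :=
  operatorOn (posMaxDomain α) (IsWeakBessel α)

/-- `ξ ∈ C_c^∞([0, ∞[)` with `ξ = 1` near `0`. -/
structure IsCutoff (ξ : ℝ → ℂ) : Prop where
  contDiff : ContDiff ℝ ∞ ξ
  hasCompactSupport : HasCompactSupport ξ
  eq_one : ∀ᶠ x in 𝓝 0, ξ x = 1

/-- `κ x^(1/2-m) + x^(1/2+m)`, and `x^(1/2-m)` for `κ = ∞`. -/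
def posAsymptotics (m : ℂ) (κ : OnePoint ℂ) (x : ℝ) : ℂ :=
  κ.elim ((x : ℂ) ^ (1 / 2 - m)) fun k => k * (x : ℂ) ^ (1 / 2 - m) + (x : ℂ) ^ (1 / 2 + m)

/-- `x^(1/2) log x + ν x^(1/2)`, and `x^(1/2)` for `ν = ∞`. -/
def posAsymptoticsLog (ν : OnePoint ℂ) (x : ℝ) : ℂ :=
  ν.elim (√x : ℂ) fun n => √x * Real.log x + n * √x

/-- The restriction of the maximal realization to the functions which differ from a multiple of
`ξ a` by an element of the minimal domain, where `ξ` is a cutoff. The span runs over all cutoffs: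
two of them differ by an element of `C_c^∞(]0, ∞[)`, so any single one gives the same space. -/
def posRealization (α : ℝ) (a : ℝ → ℂ) : HalfLineL2 →ₗ.[ℂ] HalfLineL2 :=
  (posMax α).domRestrict ((posMin α).domain ⊔ Submodule.span ℂ
    {f | ∃ ξ, IsCutoff ξ ∧ f =ᵐ[posMeasure] fun x => ξ x * a x})

/-- The operator `H_{m,κ}`, for `m² = α` real. -/
def posH (m : ℂ) (κ : OnePoint ℂ) : HalfLineL2 →ₗ.[ℂ] HalfLineL2 :=
  posRealization (m ^ 2).re (posAsymptotics m κ)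

/-- The operator `H_0^ν`. -/
def posHLog (ν : OnePoint ℂ) : HalfLineL2 →ₗ.[ℂ] HalfLineL2 :=
  posRealization 0 (posAsymptoticsLog ν)

/-! ## Momentum representation -/

/-- The Dirichlet and the Neumann variant. -/
inductive Variant
  | D
  | N

/-- The kernel `θ(p-q) q + θ(q-p) p = min(p,q)` in the Dirichlet case, and
`-(θ(p-q) p + θ(q-p) q) = -max(p,q)` in the Neumann case. -/
def kernel : Variant → ℝ → ℝ → ℝ
  | .D, p, q => min p q
  | .N, p, q => -max p q

/-- The weight of the moment condition: `q` (Dirichlet) or `1` (Neumann). -/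
def weight : Variant → ℝ → ℝ
  | .D, q => q
  | .N, _ => 1

/-- The space `L^{2,∞}_1(ℝ₊)` (Dirichlet) or `L^{2,∞}_0(ℝ₊)` (Neumann): all moments of `|ψ|²` are
finite, and `∫ q ψ(q) dq = 0` or `∫ ψ(q) dq = 0`, respectively. -/
def momCore (b : Variant) : Submodule ℂ HalfLineL2 where
  carrier := {ψ | (∀ n : ℕ, Integrable (fun p : ℝ => ‖ψ p‖ ^ 2 * p ^ n) posMeasure) ∧
    Integrable (fun q => (weight b q : ℂ) * ψ q) posMeasure ∧
    ∫ q, (weight b q : ℂ) * ψ q ∂posMeasure = 0}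
  add_mem' := by
    rintro f g ⟨hf, hfi, hf0⟩ ⟨hg, hgi, hg0⟩
    have e : (fun q => (weight b q : ℂ) * (f + g) q) =ᵐ[posMeasure]
        fun q => (weight b q : ℂ) * f q + (weight b q : ℂ) * g q := by
      filter_upwards [Lp.coeFn_add f g] with x hx
      rw [hx, Pi.add_apply, mul_add]
    refine ⟨fun n => ?_, (hfi.add hgi).congr e.symm, ?_⟩
    · refine (((hf n).const_mul 2).add ((hg n).const_mul 2)).mono' ?_ ?_
      · exact ((Lp.aestronglyMeasurable _).norm.pow 2).mul (by fun_prop)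
      · filter_upwards [Lp.coeFn_add f g, ae_restrict_mem measurableSet_Ioi] with x hx hx0
        have hx1 : (0 : ℝ) ≤ x ^ n := pow_nonneg (le_of_lt hx0) n
        rw [hx, Pi.add_apply, Pi.add_apply, Real.norm_of_nonneg (by positivity)]
        have h1 : ‖f x + g x‖ ^ 2 ≤ 2 * ‖f x‖ ^ 2 + 2 * ‖g x‖ ^ 2 := by
          have h2 := norm_add_le (f x) (g x)
          have h3 : ‖f x + g x‖ ^ 2 ≤ (‖f x‖ + ‖g x‖) ^ 2 := by gcongr
          nlinarith [sq_nonneg (‖f x‖ - ‖g x‖)]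
        nlinarith [mul_le_mul_of_nonneg_right h1 hx1]
    · rw [integral_congr_ae e, integral_add hfi hgi, hf0, hg0, add_zero]
  zero_mem' := by
    have e : (fun q => (weight b q : ℂ) * (0 : HalfLineL2) q) =ᵐ[posMeasure] fun _ => 0 := by
      filter_upwards [Lp.coeFn_zero ℂ 2 posMeasure] with x hx
      simp only [hx, Pi.zero_apply, mul_zero]
    refine ⟨fun n => ?_, (integrable_zero _ _ _).congr e.symm, ?_⟩
    · refine (integrable_zero ℝ ℝ posMeasure).congr ?_
      filter_upwards [Lp.coeFn_zero ℂ 2 posMeasure] with x hx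
      simp only [hx, Pi.zero_apply, zero_mul, norm_zero, ne_eq, OfNat.ofNat_ne_zero,
        not_false_eq_true, zero_pow]
    · rw [integral_congr_ae e, integral_zero]
  smul_mem' := by
    rintro c f ⟨hf, hfi, hf0⟩
    have e : (fun q => (weight b q : ℂ) * (c • f) q) =ᵐ[posMeasure]
        fun q => c * ((weight b q : ℂ) * f q) := by
      filter_upwards [Lp.coeFn_smul c f] with x hx
      rw [hx, Pi.smul_apply, smul_eq_mul, mul_left_comm]
    refine ⟨fun n => ?_, (hfi.const_mul c).congr e.symm, ?_⟩
    · refine ((hf n).const_mul (‖c‖ ^ 2)).congr ?_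
      filter_upwards [Lp.coeFn_smul c f] with x hx
      rw [hx, Pi.smul_apply, norm_smul, mul_pow, mul_assoc]
    · rw [integral_congr_ae e, integral_const_mul, hf0, mul_zero]

/-- The minimal operator in the momentum representation: the closure of
`ψ ↦ p² ψ(p) + (α - 1/4) ∫₀^∞ kernel(p,q) ψ(q) dq` on `momCore`. -/
def momMin (b : Variant) (α : ℝ) : HalfLineL2 →ₗ.[ℂ] HalfLineL2 :=
  (operatorOn (momCore b) fun ψ h => h =ᵐ[posMeasure] fun p =>
    (p : ℂ) ^ 2 * ψ p + ((α : ℂ) - 1 / 4) * ∫ q, (kernel b p q : ℂ) * ψ q ∂posMeasure).closure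

/-- The value prescribed for `∫₀^Λ q ψ(q) dq` (Dirichlet) or `∫₀^Λ ψ(q) dq` (Neumann) if
`ψ(p) = p^(-3/2-s)` for large `p`. -/
def momentValue : Variant → ℂ → ℝ → ℂ
  | .D, s, Λ => (Λ : ℂ) ^ (1 / 2 - s) / (1 / 2 - s)
  | .N, s, Λ => (Λ : ℂ) ^ (-1 / 2 - s) / (-1 / 2 - s)

/-- The value prescribed for `∫₀^Λ q ψ(q) dq` (Dirichlet) or `∫₀^Λ ψ(q) dq` (Neumann) if
`ψ(p) = p^(-3/2) log p` for large `p`. -/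
def momentValueLog : Variant → ℝ → ℝ
  | .D, Λ => -4 * √Λ + 2 * √Λ * Real.log Λ
  | .N, Λ => -4 / √Λ - 2 / √Λ * Real.log Λ

/-- `ψ` is an admissible choice of the function `ψ_{s,D}` or `ψ_{s,N}`. -/
def IsPsi (b : Variant) (s : ℂ) (ψ : HalfLineL2) : Prop :=
  ∃ Λ₀ : ℝ, 0 < Λ₀ ∧ (∀ᵐ p ∂posMeasure, Λ₀ < p → ψ p = (p : ℂ) ^ (-3 / 2 - s)) ∧
    ∫ q in (0 : ℝ)..Λ₀, (weight b q : ℂ) * ψ q = momentValue b s Λ₀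

/-- `ψ` is an admissible choice of the function `ψ_{log,D}` or `ψ_{log,N}`. -/
def IsPsiLog (b : Variant) (ψ : HalfLineL2) : Prop :=
  ∃ Λ₀ : ℝ, 0 < Λ₀ ∧
    (∀ᵐ p ∂posMeasure, Λ₀ < p → ψ p = (p : ℂ) ^ (-3 / 2 : ℂ) * Real.log p) ∧
    ∫ q in (0 : ℝ)..Λ₀, (weight b q : ℂ) * ψ q = momentValueLog b Λ₀

/-- The counterterm belonging to the asymptotics `p^(-3/2-s)`. -/
def counterterm : Variant → ℂ → ℝ → ℝ → ℂ
  | .D, s, p, Λ => p * (Λ : ℂ) ^ (-1 / 2 - s) / (1 / 2 + s)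
  | .N, s, _, Λ => (Λ : ℂ) ^ (1 / 2 - s) / (1 / 2 - s)

/-- The counterterm belonging to the asymptotics `p^(-3/2) log p`. -/
def countertermLog : Variant → ℝ → ℝ → ℝ
  | .D, p, Λ => p * (4 / √Λ + 2 / √Λ * Real.log Λ)
  | .N, _, Λ => -(4 * √Λ - 2 * √Λ * Real.log Λ)

/-- The sum of the minimal domain and the lines spanned by the functions in `P` and in `M`. -/
def momMaxDomain (b : Variant) (α : ℝ) (P M : Set HalfLineL2) : Submodule ℂ HalfLineL2 :=
  (momMin b α).domain ⊔ Submodule.span ℂ P ⊔ Submodule.span ℂ M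

/-- The renormalized expression. The coefficients `cp`, `cm` are those of `ψ` along the
functions in `P` and `M`, modulo the minimal domain, and `ctP`, `ctM` are the counterterms:
`h(p) = p² ψ(p) + (α - 1/4) lim_{Λ → ∞} (∫₀^Λ kernel(p,q) ψ(q) dq + cp ctP(p,Λ) + cm ctM(p,Λ))`. -/
def IsRenormalized (b : Variant) (α : ℝ) (P M : Set HalfLineL2) (ctP ctM : ℝ → ℝ → ℂ)
    (ψ h : HalfLineL2) : Prop :=
  ∃ cp cm : ℂ, (∃ ψp ∈ P, ∃ ψm ∈ M, ψ - cp • ψp - cm • ψm ∈ (momMin b α).domain) ∧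
    ∀ᵐ p ∂posMeasure, ∃ l : ℂ,
      Tendsto (fun Λ : ℝ => (∫ q in (0 : ℝ)..Λ, (kernel b p q : ℂ) * ψ q)
        + cp * ctP p Λ + cm * ctM p Λ) atTop (𝓝 l) ∧
      h p = (p : ℂ) ^ 2 * ψ p + ((α : ℂ) - 1 / 4) * l

/-- The operator given by the renormalized expression on `momMaxDomain`. The sets `P`, `M`
consist of all admissible choices of two functions; two choices of the same function differ by
an element of `momCore`, so any single choice gives the same operator. -/
def momMaxOf (b : Variant) (α : ℝ) (P M : Set HalfLineL2) (ctP ctM : ℝ → ℝ → ℂ) :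
    HalfLineL2 →ₗ.[ℂ] HalfLineL2 :=
  operatorOn (momMaxDomain b α P M) (IsRenormalized b α P M ctP ctM)

open Classical in
/-- The maximal operator in the momentum representation for `α = m²` (real), with the
logarithmic version for `m = 0`. -/
def momMax (b : Variant) (m : ℂ) : HalfLineL2 →ₗ.[ℂ] HalfLineL2 :=
  if m = 0 then
    momMaxOf b 0 {ψ | IsPsiLog b ψ} {ψ | IsPsi b 0 ψ}
      (fun p Λ => (countertermLog b p Λ : ℂ)) (counterterm b 0)
  else
    momMaxOf b (m ^ 2).re {ψ | IsPsi b m ψ} {ψ | IsPsi b (-m) ψ}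
      (counterterm b m) (counterterm b (-m))

/-- The operator `H̃_{m,κ̃,D}` or `H̃_{m,κ̃,N}`: the maximal operator restricted to the sum of the
minimal domain and the line through `ψ_m + κ̃ ψ_{-m}` (through `ψ_{-m}` for `κ̃ = ∞`). -/
def momH (b : Variant) (m : ℂ) (κ : OnePoint ℂ) : HalfLineL2 →ₗ.[ℂ] HalfLineL2 :=
  (momMax b m).domRestrict ((momMin b (m ^ 2).re).domain ⊔ Submodule.span ℂ
    (κ.elim {ψ | IsPsi b (-m) ψ}
      fun k => {ψ | ∃ ψp ψm, IsPsi b m ψp ∧ IsPsi b (-m) ψm ∧ ψ = ψp + k • ψm}))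

/-- The operator `H̃_{0,D}^ν̃` or `H̃_{0,N}^ν̃`: the maximal operator restricted to the sum of the
minimal domain and the line through `ψ_log + ν̃ ψ_0` (through `ψ_0` for `ν̃ = ∞`). -/
def momHLog (b : Variant) (ν : OnePoint ℂ) : HalfLineL2 →ₗ.[ℂ] HalfLineL2 :=
  (momMax b 0).domRestrict ((momMin b 0).domain ⊔ Submodule.span ℂ
    (ν.elim {ψ | IsPsi b 0 ψ}
      fun n => {ψ | ∃ ψ₁ ψ₀, IsPsiLog b ψ₁ ∧ IsPsi b 0 ψ₀ ∧ ψ = ψ₁ + n • ψ₀}))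

/-- The factor `κ̃_D / κ`. -/
def ratioD (m : ℂ) : ℂ :=
  Complex.sin (Real.pi / 4 + Real.pi * m / 2) * Complex.Gamma (-1 / 2 - m) /
    (Complex.sin (Real.pi / 4 - Real.pi * m / 2) * Complex.Gamma (-1 / 2 + m))

/-- The factor `κ̃_N / κ`. -/
def ratioN (m : ℂ) : ℂ :=
  Complex.cos (Real.pi / 4 + Real.pi * m / 2) * Complex.Gamma (-1 / 2 - m) /
    (Complex.cos (Real.pi / 4 - Real.pi * m / 2) * Complex.Gamma (-1 / 2 + m))

end Bessel

end

noncomputable section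

namespace Bessel

/-! ## The bilinear pairing and bilinear adjoints of relations -/

/-! The operators are handled through their graphs and the bilinear pairing `∫ f g`. For this
pairing the double adjoint of a linear relation is its closure, so a minimal operator is the adjoint
of the corresponding maximal relation. Complex conjugation enters only at the end, when bilinear
adjoints are turned into Hilbert space adjoints.

In momentum space the kernel `min(p,q)`, respectively `-max(p,q)`, is the Green function of
`-d²/dp²` with Dirichlet, respectively Neumann, condition at `0`. On the core the integral term is
therefore a function `v` with `v'' = -ψ` and that boundary condition. For general `ψ ∈ L²` the
integral may diverge, but `v` still makes sense up to a multiple `l` of the weight. The pairs `(ψ,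
h)` with `h = p² ψ + (α - 1/4) v` for some `l` form `maxRel`, and this is exactly the adjoint of the
core operator (`bilinAdjoint_momPre`). By Green's identity the boundary form on `maxRel` is the
limit at infinity of Wronskians of the `v`'s. Wronskians satisfy the Plücker relation, hence so does
the form: modulo the minimal relation it has rank at most two, and an element annihilating two
vectors with non-zero form is minimal (`mem_minRel_of_bform`).

The admissible functions `ψ_s`, `ψ_log` are those whose potential coincides near infinity with an
exact solution of the Euler equation; the prescribed moment fixes the integration constant that `l`
cannot absorb. The truncated kernel integral differs from `v` by a boundary term, which equals the
counterterm for a tail and tends to `0` for a minimal element. So the renormalized maximal operator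
is a restriction of `maxRel` (`IsBoundaryPair.mem_graph_momMaxOf`). A line in the two-dimensional
boundary space is its own annihilator for the skew form, and the realization is self-adjoint as soon
as the line is invariant under conjugation (`isSelfAdjoint_of_graph`).

For the comparison with position space, the sine and cosine transformations are symmetric
involutions that map test functions into the momentum core and the momentum core into the minimal
domain. Taking adjoints, they exchange the maximal relations (`weakRel_eq`), hence the minimal ones.
It remains to transform one boundary vector. Modulo the minimal domain the cutoff `ξ` may be
replaced by `(1 + x) e^{-x}`, which agrees with it to first order at `0`. The transforms are then
explicit Gamma integrals: `x^(1/2+s)` yields a multiple `leadCoef b (3/2 + s)` of `p^(-3/2-s)` with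
an error smaller by `p^(-2)`, and differentiation in the exponent gives the logarithmic case.
Elements of `maxRel` with such fast decay are minimal (`IsBoundaryPair.mem_minRel_of_decay`), so the
leading coefficients determine the new boundary parameter; their quotients are `ratioD` and
`ratioN`, and the digamma value at `3/2` gives the shift of `ν`. -/

theorem integrable_mul_Lp (f g : HalfLineL2) : Integrable (fun x => f x * g x) posMeasure :=
  (Lp.memLp f).integrable_mul (Lp.memLp g)

/-- The bilinear pairing `∫ f g`. -/
def pair : HalfLineL2 →ₗ[ℂ] HalfLineL2 →ₗ[ℂ] ℂ :=
  LinearMap.mk₂ ℂ (fun f g => ∫ x, f x * g x ∂posMeasure)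
    (fun f f' g => by
      rw [← integral_add (integrable_mul_Lp f g) (integrable_mul_Lp f' g)]
      refine integral_congr_ae ?_
      filter_upwards [Lp.coeFn_add f f'] with x hx
      rw [hx, Pi.add_apply, add_mul])
    (fun c f g => by
      rw [smul_eq_mul, ← integral_const_mul]
      refine integral_congr_ae ?_
      filter_upwards [Lp.coeFn_smul c f] with x hx
      rw [hx, Pi.smul_apply, smul_eq_mul, mul_assoc])
    (fun f g g' => by
      rw [← integral_add (integrable_mul_Lp f g) (integrable_mul_Lp f g')]
      refine integral_congr_ae ?_
      filter_upwards [Lp.coeFn_add g g'] with x hx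
      rw [hx, Pi.add_apply, mul_add])
    (fun c f g => by
      rw [smul_eq_mul, ← integral_const_mul]
      refine integral_congr_ae ?_
      filter_upwards [Lp.coeFn_smul c g] with x hx
      rw [hx, Pi.smul_apply, smul_eq_mul, mul_left_comm])

theorem pair_apply (f g : HalfLineL2) : pair f g = ∫ x, f x * g x ∂posMeasure := rfl

theorem pair_comm (f g : HalfLineL2) : pair f g = pair g f := by
  simp only [pair_apply, mul_comm]

theorem pair_eq_inner (f g : HalfLineL2) : pair f g = inner ℂ (star f) g := by
  rw [pair_apply, L2.inner_def]
  refine integral_congr_ae ?_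
  filter_upwards [Lp.coeFn_star f] with x hx
  rw [hx]
  simp [mul_comm]

theorem inner_eq_pair (f g : HalfLineL2) : inner ℂ f g = pair (star f) g := by
  rw [pair_eq_inner, star_star]

theorem continuous_pair_right (f : HalfLineL2) : Continuous (pair f) := by
  have : (pair f : HalfLineL2 → ℂ) = fun g => inner ℂ (star f) g := funext (pair_eq_inner f)
  rw [this]; fun_prop

theorem eq_zero_of_pair {f : HalfLineL2} (h : ∀ g, pair f g = 0) : f = 0 := by
  have := h (star f)
  rwa [pair_comm, ← inner_eq_pair, inner_self_eq_zero] at this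

theorem Lp_star_smul (c : ℂ) (f : HalfLineL2) : star (c • f) = star c • star f := by
  refine Lp.ext ?_
  filter_upwards [Lp.coeFn_star (c • f), Lp.coeFn_smul c f, Lp.coeFn_smul (star c) (star f),
    Lp.coeFn_star f] with x h1 h2 h3 h4
  rw [h1, h3, Pi.star_apply, h2, Pi.smul_apply, Pi.smul_apply, h4, Pi.star_apply, star_smul]

theorem Lp_star_add (f g : HalfLineL2) : star (f + g) = star f + star g := by
  refine Lp.ext ?_
  filter_upwards [Lp.coeFn_star (f + g), Lp.coeFn_add f g, Lp.coeFn_add (star f) (star g),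
    Lp.coeFn_star f, Lp.coeFn_star g] with x h1 h2 h3 h4 h5
  rw [h1, h3, Pi.star_apply, h2, Pi.add_apply, Pi.add_apply, h4, h5, Pi.star_apply, Pi.star_apply,
    star_add]

/-- The adjoint of a linear relation with respect to the bilinear pairing. -/
def bilinAdjoint (G : Submodule ℂ (HalfLineL2 × HalfLineL2)) :
    Submodule ℂ (HalfLineL2 × HalfLineL2) where
  carrier := {x | ∀ y ∈ G, pair x.2 y.1 = pair x.1 y.2}
  add_mem' := by
    intro a b ha hb y hy
    simp [ha y hy, hb y hy]
  zero_mem' := by intro y _; simp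
  smul_mem' := by
    intro c a ha y hy
    simp [ha y hy]

theorem mem_bilinAdjoint {G : Submodule ℂ (HalfLineL2 × HalfLineL2)}
    {x : HalfLineL2 × HalfLineL2} :
    x ∈ bilinAdjoint G ↔ ∀ y ∈ G, pair x.2 y.1 = pair x.1 y.2 := Iff.rfl

theorem bilinAdjoint_anti {G G' : Submodule ℂ (HalfLineL2 × HalfLineL2)} (h : G ≤ G') :
    bilinAdjoint G' ≤ bilinAdjoint G := fun _ hx y hy => hx y (h hy)

theorem isClosed_bilinAdjoint (G : Submodule ℂ (HalfLineL2 × HalfLineL2)) :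
    IsClosed (bilinAdjoint G : Set (HalfLineL2 × HalfLineL2)) := by
  have : (bilinAdjoint G : Set (HalfLineL2 × HalfLineL2)) =
      ⋂ y ∈ G, {x | pair y.1 x.2 = pair y.2 x.1} := by
    ext x
    simp only [SetLike.mem_coe, mem_bilinAdjoint, mem_iInter, mem_ofPred_eq]
    exact forall₂_congr fun y _ => by rw [pair_comm x.2, pair_comm x.1]
  rw [this]
  exact isClosed_biInter fun y _ => isClosed_eq
    ((continuous_pair_right _).comp continuous_snd) ((continuous_pair_right _).comp continuous_fst)

theorem le_bilinAdjoint_bilinAdjoint (G : Submodule ℂ (HalfLineL2 × HalfLineL2)) :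
    G ≤ bilinAdjoint (bilinAdjoint G) := by
  intro x hx y hy
  rw [pair_comm, pair_comm x.1]
  exact (hy x hx).symm

/-- The bilinear double adjoint of a relation is its closure. -/
theorem bilinAdjoint_bilinAdjoint (G : Submodule ℂ (HalfLineL2 × HalfLineL2)) :
    bilinAdjoint (bilinAdjoint G) = G.topologicalClosure := by
  refine le_antisymm ?_ (Submodule.topologicalClosure_minimal _ (le_bilinAdjoint_bilinAdjoint G)
    (isClosed_bilinAdjoint _))
  intro x hx
  -- The product carries the sup norm; orthogonal complements are taken in `WithLp 2`, which has the
  -- same topology.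
  set e := WithLp.prodContinuousLinearEquiv 2 ℂ HalfLineL2 HalfLineL2
  set K : Submodule ℂ (WithLp 2 (HalfLineL2 × HalfLineL2)) :=
    G.comap (e : WithLp 2 (HalfLineL2 × HalfLineL2) →ₗ[ℂ] HalfLineL2 × HalfLineL2) with hK
  have h1 : e.symm x ∈ K.topologicalClosure := by
    rw [← Submodule.orthogonal_orthogonal_eq_closure, Submodule.mem_orthogonal]
    intro u hu
    rw [Submodule.mem_orthogonal] at hu
    -- A quarter turn combined with conjugation carries the orthogonal complement of `G` into its
    -- bilinear adjoint. Pairing `x` with the turned vector says that `x` is orthogonal to `u`.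
    have h2 : (star u.snd, -star u.fst) ∈ bilinAdjoint G := by
      intro y hy
      have h3 := hu (e.symm y) (by simpa [hK] using hy)
      have h4 : inner ℂ u (e.symm y) = 0 := by rw [← inner_conj_symm, h3, map_zero]
      rw [WithLp.prod_inner_apply] at h4
      have h5 : inner ℂ u.fst y.1 + inner ℂ u.snd y.2 = 0 := h4
      rw [inner_eq_pair, inner_eq_pair] at h5
      simp only [map_neg, LinearMap.neg_apply]
      linear_combination -h5
    have h6 := hx _ h2
    simp only [map_neg] at h6
    rw [WithLp.prod_inner_apply]
    change inner ℂ u.fst x.1 + inner ℂ u.snd x.2 = 0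
    rw [inner_eq_pair, inner_eq_pair, pair_comm, pair_comm (star u.snd)]
    linear_combination h6
  have h2 : e (e.symm x) ∈ closure (e '' (K : Set (WithLp 2 (HalfLineL2 × HalfLineL2)))) :=
    image_closure_subset_closure_image e.continuous ⟨_, h1, rfl⟩
  rw [e.apply_symm_apply] at h2
  refine closure_mono ?_ h2
  rintro _ ⟨y, hy, rfl⟩
  exact hy

/-- If a relation is single-valued and contained in a given graph-like relation `R`, then
`operatorOn D R` acts by that relation. -/
theorem mem_graph_operatorOn {D : Submodule ℂ HalfLineL2} {R : HalfLineL2 → HalfLineL2 → Prop}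
    (W : Submodule ℂ (HalfLineL2 × HalfLineL2)) (hW : ∀ y, (0, y) ∈ W → y = 0)
    (h1 : ∀ x ∈ D, ∃ y, (x, y) ∈ W ∧ R x y) (h2 : ∀ x ∈ D, ∀ y, R x y → (x, y) ∈ W)
    {x y : HalfLineL2} : (x, y) ∈ (operatorOn D R).graph ↔ x ∈ D ∧ (x, y) ∈ W := by
  have uniq : ∀ x y y', (x, y) ∈ W → (x, y') ∈ W → y = y' := fun x y y' h h' => by
    have := W.sub_mem h h'
    rw [Prod.mk_sub_mk, sub_self] at this
    exact sub_eq_zero.1 (hW _ this)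
  choose f hf hfR using h1
  let T : D →ₗ[ℂ] HalfLineL2 :=
    { toFun := fun x => f x x.2
      map_add' := fun a b => uniq _ _ _ (hf _ _) (W.add_mem (hf a a.2) (hf b b.2))
      map_smul' := fun c a => uniq _ _ _ (hf _ _) (W.smul_mem c (hf a a.2)) }
  -- This rules out the default value of `operatorOn`. Which map is chosen does not matter, since
  -- `h2` puts every admissible value into the single-valued `W`.
  have hex : ∃ T : D →ₗ[ℂ] HalfLineL2, ∀ g : D, R g (T g) := ⟨T, fun g => hfR g g.2⟩
  have key : ∀ g : D, ((g : HalfLineL2), (operatorOn D R).toFun g) ∈ W := by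
    intro g
    refine h2 g g.2 _ ?_
    have : (operatorOn D R).toFun = hex.choose := dif_pos hex
    rw [this]
    exact hex.choose_spec g
  constructor
  · intro h
    obtain ⟨g, hg, rfl⟩ := (LinearPMap.mem_graph_iff _).1 h
    simp only at hg
    subst hg
    exact ⟨g.2, key g⟩
  · rintro ⟨hx, hxy⟩
    refine (LinearPMap.mem_graph_iff _).2 ⟨⟨x, hx⟩, rfl, ?_⟩
    exact uniq _ _ _ (key ⟨x, hx⟩) hxy

theorem isClosable_of_closure_graph {f : HalfLineL2 →ₗ.[ℂ] HalfLineL2}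
    (h : ∀ y, (0, y) ∈ f.graph.topologicalClosure → y = 0) : f.IsClosable := by
  refine ⟨f.graph.topologicalClosure.toLinearPMap, ?_⟩
  rw [Submodule.toLinearPMap_graph_eq]
  intro x hx hx0
  obtain ⟨a, b⟩ := x
  simp only at hx0
  subst hx0
  exact h b hx

theorem mem_graph_domRestrict {f : HalfLineL2 →ₗ.[ℂ] HalfLineL2} {S : Submodule ℂ HalfLineL2}
    {x y : HalfLineL2} : (x, y) ∈ (f.domRestrict S).graph ↔ x ∈ S ∧ (x, y) ∈ f.graph := by
  constructor
  · intro h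
    obtain ⟨g, hg, hy⟩ := (LinearPMap.mem_graph_iff _).1 h
    simp only at hg hy
    subst hg
    have := g.2
    refine ⟨this.1, (LinearPMap.mem_graph_iff _).2 ⟨⟨g, this.2⟩, rfl, ?_⟩⟩
    rw [← hy]
    exact (LinearPMap.domRestrict_apply rfl).symm
  · rintro ⟨hS, h⟩
    obtain ⟨g, hg, hy⟩ := (LinearPMap.mem_graph_iff _).1 h
    simp only at hg hy
    subst hg
    refine (LinearPMap.mem_graph_iff _).2 ⟨⟨g, hS, g.2⟩, rfl, ?_⟩
    rw [← hy]
    exact LinearPMap.domRestrict_apply rfl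

theorem mem_graph_sandwich {F : HalfLineL2 →ₗ[ℂ] HalfLineL2} (hF : ∀ f, F (F f) = f)
    {A : HalfLineL2 →ₗ.[ℂ] HalfLineL2} {x y : HalfLineL2} :
    (x, y) ∈ (sandwich F A).graph ↔ (F x, F y) ∈ A.graph := by
  constructor
  · intro h
    obtain ⟨g, hg, hy⟩ := (LinearPMap.mem_graph_iff _).1 h
    simp only at hg hy
    subst hg
    refine (LinearPMap.mem_graph_iff _).2 ⟨⟨F g, g.2⟩, rfl, ?_⟩
    rw [← hy]
    exact (hF _).symm
  · intro h
    obtain ⟨g, hg, hy⟩ := (LinearPMap.mem_graph_iff _).1 h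
    simp only at hg hy
    have hx : F x ∈ A.domain := hg ▸ g.2
    refine (LinearPMap.mem_graph_iff _).2 ⟨⟨x, hx⟩, rfl, ?_⟩
    have : F (A g) = y := by rw [hy, hF]
    rw [← this]
    change F (A ⟨F x, hx⟩) = F (A g)
    congr 2
    exact Subtype.ext hg.symm

/-! ## Primitives of functions on the half-line and their Wronskians -/

/-- Integration by parts for primitives of integrable functions. -/
theorem integral_primitive_mul_add {f g : ℝ → ℂ} {R : ℝ} (hR : 0 ≤ R)
    (hf : IntervalIntegrable f volume 0 R) (hg : IntervalIntegrable g volume 0 R) :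
    ∫ x in (0 : ℝ)..R, ((∫ y in (0 : ℝ)..x, f y) * g x + f x * ∫ y in (0 : ℝ)..x, g y) =
      (∫ x in (0 : ℝ)..R, f x) * ∫ x in (0 : ℝ)..R, g x := by
  set ν : Measure ℝ := volume.restrict (Ioc 0 R) with hν
  have hf' : Integrable f ν := (intervalIntegrable_iff_integrableOn_Ioc_of_le hR).1 hf
  have hg' : Integrable g ν := (intervalIntegrable_iff_integrableOn_Ioc_of_le hR).1 hg
  have prim : ∀ h : ℝ → ℂ, ∀ x ∈ Ioc 0 R, ∫ y in (0 : ℝ)..x, h y =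
      ∫ y, (Iic x).indicator h y ∂ν := by
    intro h x hx
    rw [intervalIntegral.integral_of_le hx.1.le, integral_indicator measurableSet_Iic, hν,
      Measure.restrict_restrict measurableSet_Iic]
    congr 2
    ext y
    simp only [mem_Ioc, mem_inter_iff, mem_Iic]
    constructor
    · rintro ⟨h1, h2⟩; exact ⟨h2, h1, h2.trans hx.2⟩
    · rintro ⟨h1, h2, _⟩; exact ⟨h2, h1⟩
  -- Fubini on the square `]0, R]²`: the two summands are the integrals of `f(y) g(x)` over the two
  -- triangles cut out by the diagonal. The diagonal itself is a null set, which is why strict and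
  -- weak inequalities may be confused in `p2`.
  have hfg : Integrable (fun z : ℝ × ℝ => f z.1 * g z.2) (ν.prod ν) := hf'.mul_prod hg'
  have hS : MeasurableSet {z : ℝ × ℝ | z.1 ≤ z.2} := measurableSet_le measurable_fst measurable_snd
  have e1 : ∫ x in (0 : ℝ)..R, ((∫ y in (0 : ℝ)..x, f y) * g x + f x * ∫ y in (0 : ℝ)..x, g y) =
      ∫ x, ((∫ y, (Iic x).indicator f y ∂ν) * g x + f x * ∫ y, (Iic x).indicator g y ∂ν) ∂ν := by
    rw [intervalIntegral.integral_of_le hR]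
    refine setIntegral_congr_fun measurableSet_Ioc fun x hx => ?_
    rw [prim f x hx, prim g x hx]
  have i1 : Integrable ({z : ℝ × ℝ | z.1 ≤ z.2}.indicator fun z => f z.1 * g z.2) (ν.prod ν) :=
    hfg.indicator hS
  have i2 : Integrable ({z : ℝ × ℝ | z.1 ≤ z.2}ᶜ.indicator fun z => f z.1 * g z.2) (ν.prod ν) :=
    hfg.indicator hS.compl
  have p1 : ∀ x, ∫ y, {z : ℝ × ℝ | z.1 ≤ z.2}.indicator (fun z => f z.1 * g z.2) (y, x) ∂ν =
      (∫ y, (Iic x).indicator f y ∂ν) * g x := by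
    intro x
    rw [← integral_mul_const]
    congr 1; funext y
    by_cases h : y ≤ x <;> simp [indicator, h]
  have p2 : ∀ x, ∫ y, {z : ℝ × ℝ | z.1 ≤ z.2}ᶜ.indicator (fun z => f z.1 * g z.2) (x, y) ∂ν =
      f x * ∫ y, (Iic x).indicator g y ∂ν := by
    intro x
    rw [← integral_const_mul]
    refine integral_congr_ae ?_
    have hne : ∀ᵐ y ∂ν, y ≠ x := by
      refine ae_restrict_of_ae ?_
      simp [ae_iff, measure_singleton]
    filter_upwards [hne] with y hy
    by_cases h : x ≤ y
    · have h' : ¬ y ≤ x := fun h'' => hy (le_antisymm h'' h)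
      simp [indicator, h, h']
    · have h' : y ≤ x := (not_le.1 h).le
      simp [indicator, h, h']
  have q1 := i1.integral_prod_right
  have q2 := i2.integral_prod_left
  simp only [p1] at q1
  simp only [p2] at q2
  rw [e1, integral_add q1 q2, intervalIntegral.integral_of_le hR,
    intervalIntegral.integral_of_le hR, ← integral_prod_mul]
  have t1 := integral_prod_symm _ i1
  have t2 := integral_prod _ i2
  simp only [p1] at t1
  simp only [p2] at t2
  rw [← t1, ← t2, ← integral_add i1 i2]
  congr 1
  funext z
  exact congrFun (indicator_self_add_compl {z : ℝ × ℝ | z.1 ≤ z.2} fun z : ℝ × ℝ => f z.1 * g z.2) z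

theorem intervalIntegrable_Lp (ψ : HalfLineL2) {a b : ℝ} (ha : 0 ≤ a) (hb : 0 ≤ b) :
    IntervalIntegrable ψ volume a b := by
  have h : ∀ R : ℝ, 0 ≤ R → IntervalIntegrable ψ volume 0 R := fun R hR => by
    rw [intervalIntegrable_iff_integrableOn_Ioc_of_le hR]
    have h1 : MemLp ψ 2 (volume.restrict (Ioc 0 R)) :=
      (Lp.memLp ψ).mono_measure (Measure.restrict_mono Ioc_subset_Ioi_self le_rfl)
    exact h1.integrable (by norm_num)
  exact (h a ha).symm.trans (h b hb)

theorem intervalIntegrable_mul_Lp {f : ℝ → ℂ} (hf : Continuous f) (ψ : HalfLineL2) {a b : ℝ}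
    (ha : 0 ≤ a) (hb : 0 ≤ b) : IntervalIntegrable (fun q => f q * ψ q) volume a b :=
  (intervalIntegrable_Lp ψ ha hb).continuousOn_mul hf.continuousOn

/-- `∫₀ᵖ ψ`. -/
def prim (ψ : HalfLineL2) (p : ℝ) : ℂ := ∫ q in (0 : ℝ)..p, ψ q

/-- `∫₀ᵖ q ψ(q) dq`. -/
def primMul (ψ : HalfLineL2) (p : ℝ) : ℂ := ∫ q in (0 : ℝ)..p, (q : ℂ) * ψ q

/-- The derivative of `weight b`. -/
def weightDeriv : Variant → ℝ
  | .D => 1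
  | .N => 0

/-- The solution `v` of `v'' = -ψ`, with `v ~ λ w` at `0`. -/
def potential (b : Variant) (l : ℂ) (ψ : HalfLineL2) (p : ℝ) : ℂ :=
  l * weight b p + primMul ψ p - p * prim ψ p

/-- The derivative of `potential b l ψ`. -/
def potentialDeriv (b : Variant) (l : ℂ) (ψ : HalfLineL2) (p : ℝ) : ℂ :=
  l * weightDeriv b - prim ψ p

/-- The Wronskian of two potentials. -/
def wronskian (b : Variant) (l₁ : ℂ) (ψ₁ : HalfLineL2) (l₂ : ℂ) (ψ₂ : HalfLineL2) (p : ℝ) : ℂ :=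
  potentialDeriv b l₁ ψ₁ p * potential b l₂ ψ₂ p - potential b l₁ ψ₁ p * potentialDeriv b l₂ ψ₂ p

theorem continuousOn_prim (ψ : HalfLineL2) : ContinuousOn (prim ψ) (Ici 0) := by
  have : ∀ R : ℝ, 0 ≤ R → ContinuousOn (prim ψ) (Icc 0 R) := fun R hR => by
    have := intervalIntegral.continuousOn_primitive_interval
      (f := ψ) (μ := volume) (a := 0) (b := R)
      (by rw [uIcc_of_le hR, integrableOn_Icc_iff_integrableOn_Ioc]
          exact (intervalIntegrable_iff_integrableOn_Ioc_of_le hR).1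
            (intervalIntegrable_Lp ψ le_rfl hR))
    rwa [uIcc_of_le hR] at this
  intro x hx
  have h1 := this (x + 1) (by have : (0:ℝ) ≤ x := hx; linarith) x ⟨hx, by linarith⟩
  refine h1.mono_of_mem_nhdsWithin ?_
  refine mem_of_superset (inter_mem_nhdsWithin (Ici 0) (Iic_mem_nhds (show x < x + 1 by linarith))) ?_
  intro y hy; exact ⟨hy.1, hy.2⟩

theorem continuousOn_primMul (ψ : HalfLineL2) : ContinuousOn (primMul ψ) (Ici 0) := by
  have : ∀ R : ℝ, 0 ≤ R → ContinuousOn (primMul ψ) (Icc 0 R) := fun R hR => by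
    have := intervalIntegral.continuousOn_primitive_interval
      (f := fun q => (q : ℂ) * ψ q) (μ := volume) (a := 0) (b := R)
      (by rw [uIcc_of_le hR, integrableOn_Icc_iff_integrableOn_Ioc]
          exact (intervalIntegrable_iff_integrableOn_Ioc_of_le hR).1
            (intervalIntegrable_mul_Lp Complex.continuous_ofReal ψ le_rfl hR))
    rwa [uIcc_of_le hR] at this
  intro x hx
  have h1 := this (x + 1) (by have : (0:ℝ) ≤ x := hx; linarith) x ⟨hx, by linarith⟩
  refine h1.mono_of_mem_nhdsWithin ?_
  refine mem_of_superset (inter_mem_nhdsWithin (Ici 0) (Iic_mem_nhds (show x < x + 1 by linarith))) ?_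
  intro y hy; exact ⟨hy.1, hy.2⟩

theorem continuous_weight (b : Variant) : Continuous (weight b) := by
  cases b
  · exact continuous_id
  · exact continuous_const

theorem continuousOn_potential (b : Variant) (l : ℂ) (ψ : HalfLineL2) :
    ContinuousOn (potential b l ψ) (Ici 0) := by
  unfold potential
  have := (continuous_weight b)
  exact ((by fun_prop : Continuous fun p : ℝ => l * (weight b p : ℂ)).continuousOn.add
    (continuousOn_primMul ψ)).sub (Complex.continuous_ofReal.continuousOn.mul (continuousOn_prim ψ))

theorem intervalIntegrable_potential_mul (b : Variant) (l : ℂ) (ψ χ : HalfLineL2) {R S : ℝ}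
    (hR : 0 ≤ R) (hS : 0 ≤ S) :
    IntervalIntegrable (fun q => potential b l ψ q * χ q) volume R S := by
  refine (intervalIntegrable_Lp χ hR hS).continuousOn_mul ?_
  exact (continuousOn_potential b l ψ).mono fun x hx => (le_min hR hS).trans hx.1

/-- Green's identity on `[0, R]`. -/
theorem integral_potential_sub (b : Variant) (l₁ l₂ : ℂ) (ψ₁ ψ₂ : HalfLineL2) {R : ℝ}
    (hR : 0 ≤ R) :
    ∫ q in (0 : ℝ)..R, (potential b l₁ ψ₁ q * ψ₂ q - ψ₁ q * potential b l₂ ψ₂ q) =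
      wronskian b l₁ ψ₁ l₂ ψ₂ R := by
  have m : ∀ ψ : HalfLineL2, IntervalIntegrable (fun q => (q : ℂ) * ψ q) volume 0 R :=
    fun ψ => intervalIntegrable_mul_Lp Complex.continuous_ofReal ψ le_rfl hR
  have z : ∀ ψ : HalfLineL2, IntervalIntegrable ψ volume 0 R :=
    fun ψ => intervalIntegrable_Lp ψ le_rfl hR
  -- The potential is a combination of the primitives of `ψ` and `q ψ`, so integrating by parts with
  -- the pairs `(q ψ₁, ψ₂)` and `(ψ₁, q ψ₂)` is enough; the potentials need not be twice
  -- differentiable.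
  have h1 := integral_primitive_mul_add hR (m ψ₁) (z ψ₂)
  have h2 := integral_primitive_mul_add hR (z ψ₁) (m ψ₂)
  have cI : ∀ ψ : HalfLineL2, ContinuousOn (prim ψ) (uIcc 0 R) := fun ψ =>
    (continuousOn_prim ψ).mono (by rw [uIcc_of_le hR]; exact fun x hx => hx.1)
  have cM : ∀ ψ : HalfLineL2, ContinuousOn (primMul ψ) (uIcc 0 R) := fun ψ =>
    (continuousOn_primMul ψ).mono (by rw [uIcc_of_le hR]; exact fun x hx => hx.1)
  change ∫ x in (0 : ℝ)..R, (primMul ψ₁ x * ψ₂ x + x * ψ₁ x * prim ψ₂ x) =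
    primMul ψ₁ R * prim ψ₂ R at h1
  change ∫ x in (0 : ℝ)..R, (prim ψ₁ x * (x * ψ₂ x) + ψ₁ x * primMul ψ₂ x) =
    prim ψ₁ R * primMul ψ₂ R at h2
  have j1 : IntervalIntegrable (fun x : ℝ => primMul ψ₁ x * ψ₂ x + x * ψ₁ x * prim ψ₂ x)
      volume 0 R := ((z ψ₂).continuousOn_mul (cM ψ₁)).add ((m ψ₁).mul_continuousOn (cI ψ₂))
  have j2 : IntervalIntegrable (fun x : ℝ => prim ψ₁ x * (x * ψ₂ x) + ψ₁ x * primMul ψ₂ x)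
      volume 0 R := ((m ψ₂).continuousOn_mul (cI ψ₁)).add ((z ψ₁).mul_continuousOn (cM ψ₂))
  have cw : Continuous fun q : ℝ => (weight b q : ℂ) :=
    Complex.continuous_ofReal.comp (continuous_weight b)
  have jw : ∀ ψ : HalfLineL2, IntervalIntegrable (fun q => (weight b q : ℂ) * ψ q) volume 0 R :=
    fun ψ => intervalIntegrable_mul_Lp cw ψ le_rfl hR
  have e : ∀ q : ℝ, potential b l₁ ψ₁ q * ψ₂ q - ψ₁ q * potential b l₂ ψ₂ q =
      (l₁ * (weight b q * ψ₂ q) - l₂ * (weight b q * ψ₁ q)) +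
      ((primMul ψ₁ q * ψ₂ q + q * ψ₁ q * prim ψ₂ q) -
        (prim ψ₁ q * (q * ψ₂ q) + ψ₁ q * primMul ψ₂ q)) := by
    intro q; unfold potential; ring
  simp only [e]
  rw [intervalIntegral.integral_add (((jw ψ₂).const_mul l₁).sub ((jw ψ₁).const_mul l₂))
    (j1.sub j2), intervalIntegral.integral_sub ((jw ψ₂).const_mul l₁) ((jw ψ₁).const_mul l₂),
    intervalIntegral.integral_sub j1 j2, h1, h2, intervalIntegral.integral_const_mul,
    intervalIntegral.integral_const_mul]
  cases b
  · change l₁ * primMul ψ₂ R - l₂ * primMul ψ₁ R + _ = _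
    simp only [wronskian, potential, potentialDeriv, weight, weightDeriv]
    push_cast; ring
  · simp only [weight, Complex.ofReal_one, one_mul]
    change l₁ * prim ψ₂ R - l₂ * prim ψ₁ R + _ = _
    simp only [wronskian, potential, potentialDeriv, weight, weightDeriv]
    push_cast; ring

/-! ### Linearity of primitives and potentials. -/

theorem ae_Ioc_of_ae_pos {P : ℝ → Prop} (h : ∀ᵐ x ∂posMeasure, P x) {a b : ℝ} (ha : 0 ≤ a) :
    ∀ᵐ x, x ∈ Ioc a b → P x := by
  filter_upwards [(ae_restrict_iff' measurableSet_Ioi).1 h] with x hx h'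
  exact hx (lt_of_le_of_lt ha h'.1)

theorem intervalIntegral_congr_pos {f g : ℝ → ℂ} (h : f =ᵐ[posMeasure] g) {a b : ℝ} (ha : 0 ≤ a)
    (hab : a ≤ b) : ∫ q in a..b, f q = ∫ q in a..b, g q :=
  intervalIntegral.integral_congr_ae (by rw [uIoc_of_le hab]; exact ae_Ioc_of_ae_pos h ha)

theorem intervalIntegral_mul_add (f : ℝ → ℂ) (hf : Continuous f) (ψ χ : HalfLineL2) {a p : ℝ}
    (ha : 0 ≤ a) (hp : a ≤ p) :
    ∫ q in a..p, f q * (ψ + χ) q = (∫ q in a..p, f q * ψ q) + ∫ q in a..p, f q * χ q := by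
  rw [← intervalIntegral.integral_add (intervalIntegrable_mul_Lp hf ψ ha (ha.trans hp))
    (intervalIntegrable_mul_Lp hf χ ha (ha.trans hp))]
  refine intervalIntegral_congr_pos ?_ ha hp
  filter_upwards [Lp.coeFn_add ψ χ] with x hx
  rw [hx, Pi.add_apply, mul_add]

theorem intervalIntegral_mul_smul (f : ℝ → ℂ) (c : ℂ) (ψ : HalfLineL2) {a p : ℝ}
    (ha : 0 ≤ a) (hp : a ≤ p) :
    ∫ q in a..p, f q * (c • ψ) q = c * ∫ q in a..p, f q * ψ q := by
  rw [← intervalIntegral.integral_const_mul]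
  refine intervalIntegral_congr_pos ?_ ha hp
  filter_upwards [Lp.coeFn_smul c ψ] with x hx
  rw [hx, Pi.smul_apply, smul_eq_mul]; ring

theorem prim_add (ψ χ : HalfLineL2) {p : ℝ} (hp : 0 ≤ p) :
    prim (ψ + χ) p = prim ψ p + prim χ p := by
  simpa [prim] using intervalIntegral_mul_add (fun _ => 1) continuous_const ψ χ le_rfl hp

theorem prim_smul (c : ℂ) (ψ : HalfLineL2) {p : ℝ} (hp : 0 ≤ p) :
    prim (c • ψ) p = c * prim ψ p := by
  simpa [prim] using intervalIntegral_mul_smul (fun _ => 1) c ψ le_rfl hp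

theorem primMul_add (ψ χ : HalfLineL2) {p : ℝ} (hp : 0 ≤ p) :
    primMul (ψ + χ) p = primMul ψ p + primMul χ p :=
  intervalIntegral_mul_add _ Complex.continuous_ofReal ψ χ le_rfl hp

theorem primMul_smul (c : ℂ) (ψ : HalfLineL2) {p : ℝ} (hp : 0 ≤ p) :
    primMul (c • ψ) p = c * primMul ψ p :=
  intervalIntegral_mul_smul _ c ψ le_rfl hp

theorem potential_add (b : Variant) (l k : ℂ) (ψ χ : HalfLineL2) {p : ℝ} (hp : 0 ≤ p) :
    potential b (l + k) (ψ + χ) p = potential b l ψ p + potential b k χ p := by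
  simp only [potential, prim_add _ _ hp, primMul_add _ _ hp]; ring

theorem potential_smul (b : Variant) (c l : ℂ) (ψ : HalfLineL2) {p : ℝ} (hp : 0 ≤ p) :
    potential b (c * l) (c • ψ) p = c * potential b l ψ p := by
  simp only [potential, prim_smul _ _ hp, primMul_smul _ _ hp]; ring

theorem potentialDeriv_add (b : Variant) (l k : ℂ) (ψ χ : HalfLineL2) {p : ℝ} (hp : 0 ≤ p) :
    potentialDeriv b (l + k) (ψ + χ) p = potentialDeriv b l ψ p + potentialDeriv b k χ p := by
  simp only [potentialDeriv, prim_add _ _ hp]; ring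

theorem potentialDeriv_smul (b : Variant) (c l : ℂ) (ψ : HalfLineL2) {p : ℝ} (hp : 0 ≤ p) :
    potentialDeriv b (c * l) (c • ψ) p = c * potentialDeriv b l ψ p := by
  simp only [potentialDeriv, prim_smul _ _ hp]; ring

/-- The relation `h = p² ψ + (α - 1/4) v` with `v'' = -ψ` and the boundary condition at `0` that
belongs to the variant `b`, where `v` has the free parameter `l`. -/
def HasPotential (b : Variant) (α : ℝ) (ψ h : HalfLineL2) (l : ℂ) : Prop :=
  h =ᵐ[posMeasure] fun p => (p : ℂ) ^ 2 * ψ p + ((α : ℂ) - 1 / 4) * potential b l ψ p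

theorem HasPotential.add {b : Variant} {α : ℝ} {ψ h χ k : HalfLineL2} {l l' : ℂ}
    (h1 : HasPotential b α ψ h l) (h2 : HasPotential b α χ k l') :
    HasPotential b α (ψ + χ) (h + k) (l + l') := by
  unfold HasPotential at *
  filter_upwards [h1, h2, Lp.coeFn_add ψ χ, Lp.coeFn_add h k, ae_restrict_mem measurableSet_Ioi]
    with p a1 a2 a3 a4 hp
  rw [a4, Pi.add_apply, a1, a2, a3, Pi.add_apply, potential_add _ _ _ _ _ (le_of_lt hp)]; ring

theorem HasPotential.smul {b : Variant} {α : ℝ} {ψ h : HalfLineL2} {l : ℂ} (c : ℂ)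
    (h1 : HasPotential b α ψ h l) : HasPotential b α (c • ψ) (c • h) (c * l) := by
  unfold HasPotential at *
  filter_upwards [h1, Lp.coeFn_smul c ψ, Lp.coeFn_smul c h, ae_restrict_mem measurableSet_Ioi]
    with p a1 a3 a4 hp
  rw [a4, Pi.smul_apply, a1, a3, Pi.smul_apply, potential_smul _ _ _ _ (le_of_lt hp), smul_eq_mul,
    smul_eq_mul]
  ring

theorem ae_zero_Lp : ∀ᵐ p ∂posMeasure, (0 : HalfLineL2) p = 0 := by
  filter_upwards [Lp.coeFn_zero ℂ 2 posMeasure] with p hp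
  rw [hp, Pi.zero_apply]

theorem prim_zero (p : ℝ) (hp : 0 ≤ p) : prim 0 p = 0 := by
  have := prim_smul 0 0 hp; simpa using this

theorem primMul_zero (p : ℝ) (hp : 0 ≤ p) : primMul 0 p = 0 := by
  have := primMul_smul 0 0 hp; simpa using this

theorem potential_zero_right (b : Variant) (l : ℂ) {p : ℝ} (hp : 0 ≤ p) :
    potential b l 0 p = l * weight b p := by
  simp [potential, prim_zero p hp, primMul_zero p hp]

/-- The maximal relation: all pairs `(ψ, h)` with `h = p² ψ + (α - 1/4) v`. -/
def maxRel (b : Variant) (α : ℝ) : Submodule ℂ (HalfLineL2 × HalfLineL2) where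
  carrier := {x | ∃ l, HasPotential b α x.1 x.2 l}
  add_mem' := by
    rintro x y ⟨l, hl⟩ ⟨k, hk⟩
    exact ⟨l + k, hl.add hk⟩
  zero_mem' := by
    refine ⟨0, ?_⟩
    unfold HasPotential
    filter_upwards [ae_zero_Lp, ae_restrict_mem measurableSet_Ioi] with p hp h0
    simp only [Prod.fst_zero, Prod.snd_zero]
    rw [hp, potential_zero_right _ _ (le_of_lt (mem_Ioi.1 h0))]
    simp
  smul_mem' := by
    rintro c x ⟨l, hl⟩
    exact ⟨c * l, hl.smul c⟩

theorem one_le_weight (b : Variant) {p : ℝ} (hp : 1 ≤ p) : 1 ≤ weight b p := by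
  cases b
  · exact hp
  · exact le_rfl

theorem weight_pos (b : Variant) {p : ℝ} (hp : 0 < p) : 0 < weight b p := by
  cases b
  · exact hp
  · exact one_pos

/-- A multiple of the weight which lies in `L²` vanishes. -/
theorem eq_zero_of_ae_eq_weight {b : Variant} {h : HalfLineL2} {k : ℂ}
    (hk : h =ᵐ[posMeasure] fun p => k * weight b p) : k = 0 := by
  by_contra hne
  have h1 : MemLp h 2 (volume.restrict (Ioi (1 : ℝ))) :=
    (Lp.memLp h).mono_measure (Measure.restrict_mono (Ioi_subset_Ioi zero_le_one) le_rfl)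
  have h2 : ∀ᵐ p ∂(volume.restrict (Ioi (1 : ℝ))), ‖(k : ℂ)‖ ≤ ‖h p‖ := by
    have h3 : ∀ᵐ p ∂(volume.restrict (Ioi (1 : ℝ))), h p = k * weight b p :=
      ae_mono (Measure.restrict_mono (Ioi_subset_Ioi zero_le_one) le_rfl) hk
    filter_upwards [h3, ae_restrict_mem measurableSet_Ioi] with p hp h1p
    have := one_le_weight b (le_of_lt (mem_Ioi.1 h1p))
    rw [hp, norm_mul, Complex.norm_real, Real.norm_of_nonneg (by linarith)]
    exact le_mul_of_one_le_right (norm_nonneg _) this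
  have h4 : MemLp (fun _ : ℝ => k) 2 (volume.restrict (Ioi (1 : ℝ))) :=
    h1.mono aestronglyMeasurable_const h2
  rw [memLp_const_iff (by norm_num) (by norm_num)] at h4
  simp [hne] at h4

/-- For `ψ = 0` the only freedom left is `h = (α - 1/4) l w`, and the weight `w` is at least `1` on
`[1, ∞[`, so no non-zero multiple of it lies in `L²`. -/
theorem maxRel_single_valued {b : Variant} {α : ℝ} (y : HalfLineL2)
    (hy : (0, y) ∈ maxRel b α) : y = 0 := by
  obtain ⟨l, hl⟩ := hy
  have h1 : y =ᵐ[posMeasure] fun p => (((α : ℂ) - 1 / 4) * l) * weight b p := by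
    unfold HasPotential at hl
    filter_upwards [hl, ae_zero_Lp, ae_restrict_mem measurableSet_Ioi] with p hp h0 hpos
    rw [hp]
    simp only [h0, potential_zero_right _ _ (le_of_lt (mem_Ioi.1 hpos))]; ring
  have h2 := eq_zero_of_ae_eq_weight h1
  refine Lp.ext ?_
  filter_upwards [h1, ae_zero_Lp] with p hp h0
  rw [hp, h2, h0, zero_mul]

/-! ## Decay of functions in the core -/

/-- Weighted arithmetic-geometric mean: `(1+q)^k |φ|` is at most `(1+q)^(2k+2) |φ|² + (1+q)^(-2)`,
and the moments of `|φ|²` are finite by definition of the core. -/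
theorem integrable_pow_mul_core {b : Variant} {φ : HalfLineL2} (hφ : φ ∈ momCore b) (k : ℕ) :
    Integrable (fun q : ℝ => (1 + q) ^ k * ‖φ q‖) posMeasure := by
  have h1 : Integrable (fun q : ℝ => 2 ^ (2 * k + 2) * (‖φ q‖ ^ 2 * q ^ 0 +
      ‖φ q‖ ^ 2 * q ^ (2 * k + 2)) + (1 + q ^ 2)⁻¹) posMeasure :=
    (((hφ.1 0).add (hφ.1 (2 * k + 2))).const_mul _).add
      (integrable_inv_one_add_sq.mono_measure Measure.restrict_le_self)
  refine h1.mono' ?_ ?_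
  · exact (by fun_prop : Continuous fun q : ℝ => (1 + q) ^ k).aestronglyMeasurable.mul
      (Lp.aestronglyMeasurable φ).norm
  · filter_upwards [ae_restrict_mem measurableSet_Ioi] with q hq
    have hq : 0 < q := hq
    rw [Real.norm_of_nonneg (by positivity)]
    set a := ‖φ q‖
    have e1 : (1 + q) ^ (2 * k + 2) ≤ 2 ^ (2 * k + 2) * (1 + q ^ (2 * k + 2)) := by
      rcases le_total q 1 with h | h
      · calc (1 + q) ^ (2 * k + 2) ≤ 2 ^ (2 * k + 2) := by gcongr; linarith
          _ ≤ _ := by nlinarith [pow_pos (show (0:ℝ) < 2 by norm_num) (2 * k + 2),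
                        pow_pos hq (2 * k + 2)]
      · calc (1 + q) ^ (2 * k + 2) ≤ (2 * q) ^ (2 * k + 2) := by gcongr; linarith
          _ = 2 ^ (2 * k + 2) * q ^ (2 * k + 2) := by rw [mul_pow]
          _ ≤ _ := by gcongr; linarith
    have e2 : (1 + q) ^ k * a ≤ (1 + q) ^ (2 * k + 2) * a ^ 2 + ((1 + q) ^ 2)⁻¹ := by
      set t := (1 + q)
      have ht : 0 < t := by positivity
      have : 0 ≤ (t ^ (k + 1) * a - t⁻¹) ^ 2 := sq_nonneg _
      have e3 : (t ^ (k + 1) * a - t⁻¹) ^ 2 =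
          t ^ (2 * k + 2) * a ^ 2 - 2 * (t ^ k * a) + (t ^ 2)⁻¹ := by
        field_simp; ring
      have : 0 ≤ t ^ k * a := by positivity
      linarith
    have e4 : ((1 + q) ^ 2)⁻¹ ≤ (1 + q ^ 2)⁻¹ := by
      gcongr; nlinarith
    calc (1 + q) ^ k * a ≤ (1 + q) ^ (2 * k + 2) * a ^ 2 + ((1 + q) ^ 2)⁻¹ := e2
      _ ≤ 2 ^ (2 * k + 2) * (1 + q ^ (2 * k + 2)) * a ^ 2 + (1 + q ^ 2)⁻¹ := by gcongr
      _ = _ := by ring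

theorem integrable_cpow_mul_core {b : Variant} {φ : HalfLineL2} (hφ : φ ∈ momCore b) (k : ℕ) :
    Integrable (fun q : ℝ => (q : ℂ) ^ k * φ q) posMeasure := by
  refine (integrable_pow_mul_core hφ k).mono' ?_ ?_
  · exact (by fun_prop : Continuous fun q : ℝ => (q : ℂ) ^ k).aestronglyMeasurable.mul
      (Lp.aestronglyMeasurable φ)
  · filter_upwards [ae_restrict_mem measurableSet_Ioi] with q hq
    have hq : 0 < q := hq
    rw [norm_mul, norm_pow, Complex.norm_real, Real.norm_of_nonneg hq.le]
    gcongr; linarith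

theorem integrable_core {b : Variant} {φ : HalfLineL2} (hφ : φ ∈ momCore b) :
    Integrable φ posMeasure := by
  simpa using integrable_cpow_mul_core hφ 0

theorem integrable_mul_core {b : Variant} {φ : HalfLineL2} (hφ : φ ∈ momCore b) :
    Integrable (fun q : ℝ => (q : ℂ) * φ q) posMeasure := by
  simpa using integrable_cpow_mul_core hφ 1

theorem integral_pos_split {f : ℝ → ℂ} (hf : Integrable f posMeasure) {p : ℝ} (hp : 0 ≤ p) :
    ∫ q, f q ∂posMeasure = (∫ q in (0 : ℝ)..p, f q) + ∫ q in Ioi p, f q := by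
  rw [intervalIntegral.integral_of_le hp, posMeasure, ← Ioc_union_Ioi_eq_Ioi hp]
  have hf' : IntegrableOn f (Ioc 0 p ∪ Ioi p) := by rw [Ioc_union_Ioi_eq_Ioi hp]; exact hf
  exact setIntegral_union (by
    rw [disjoint_left]; intro x hx hx'; exact absurd hx.2 (not_le.2 hx')) measurableSet_Ioi
    hf'.left_of_union hf'.right_of_union

/-- The parameter of the potential of a function in the core. -/
def coreParam (b : Variant) (φ : HalfLineL2) : ℂ :=
  match b with
  | .D => ∫ q, φ q ∂posMeasure
  | .N => -∫ q, (q : ℂ) * φ q ∂posMeasure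

/-- The integral is split at `q = p`. Completing the part beyond `p` to an integral over the whole
half-line leaves primitives starting at `0`, and the completed integral is the parameter
`coreParam`. -/
theorem integral_kernel_core {b : Variant} {φ : HalfLineL2} (hφ : φ ∈ momCore b) {p : ℝ}
    (hp : 0 ≤ p) :
    ∫ q, (kernel b p q : ℂ) * φ q ∂posMeasure = potential b (coreParam b φ) φ p := by
  have i0 := integrable_core hφ
  have i1 := integrable_mul_core hφ
  have ik : Integrable (fun q => (kernel b p q : ℂ) * φ q) posMeasure := by
    refine ((i0.norm.const_mul p).add i1.norm).mono' ?_ ?_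
    · refine Continuous.aestronglyMeasurable ?_ |>.mul (Lp.aestronglyMeasurable φ)
      refine Complex.continuous_ofReal.comp ?_
      cases b
      · exact continuous_const.min continuous_id
      · exact (continuous_const.max continuous_id).neg
    · filter_upwards [ae_restrict_mem measurableSet_Ioi] with q hq
      have hq : 0 < q := hq
      have hk : |kernel b p q| ≤ p + q := by
        cases b
        · simp only [kernel]
          rw [abs_of_nonneg (le_min hp hq.le)]
          exact (min_le_left _ _).trans (by linarith)
        · simp only [kernel]
          rw [abs_neg, abs_of_nonneg (hp.trans (le_max_left _ _))]
          exact max_le (by linarith) (by linarith)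
      simp only [Pi.add_apply, norm_mul, Complex.norm_real, Real.norm_eq_abs, abs_of_pos hq]
      rw [← add_mul]
      gcongr
  rw [integral_pos_split ik hp]
  have m0 : p ∈ Ici (0 : ℝ) := hp
  cases b
  · have e1 : ∫ q in (0 : ℝ)..p, (kernel .D p q : ℂ) * φ q = primMul φ p := by
      refine intervalIntegral.integral_congr fun q hq => ?_
      rw [uIcc_of_le hp] at hq
      simp [kernel, min_eq_right hq.2]
    have e2 : ∫ q in Ioi p, (kernel .D p q : ℂ) * φ q = p * ∫ q in Ioi p, φ q := by
      rw [← integral_const_mul]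
      refine setIntegral_congr_fun measurableSet_Ioi fun q hq => ?_
      simp [kernel, min_eq_left (le_of_lt (mem_Ioi.1 hq))]
    rw [e1, e2]
    simp only [potential, coreParam, weight]
    rw [integral_pos_split i0 hp]
    simp only [prim]; ring
  · have e1 : ∫ q in (0 : ℝ)..p, (kernel .N p q : ℂ) * φ q = -p * prim φ p := by
      rw [prim, ← intervalIntegral.integral_const_mul]
      refine intervalIntegral.integral_congr fun q hq => ?_
      rw [uIcc_of_le hp] at hq
      simp [kernel, max_eq_left hq.2]
    have e2 : ∫ q in Ioi p, (kernel .N p q : ℂ) * φ q = -∫ q in Ioi p, (q : ℂ) * φ q := by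
      rw [← integral_neg]
      refine setIntegral_congr_fun measurableSet_Ioi fun q hq => ?_
      simp [kernel, max_eq_right (le_of_lt (mem_Ioi.1 hq))]
    rw [e1, e2]
    simp only [potential, coreParam, weight]
    rw [integral_pos_split i1 hp]
    simp only [primMul]; push_cast; ring

/-- The moment condition cancels the affine part of the potential, so that it is expressed by
integrals over `]p, ∞[` alone. This form exhibits its decay. -/
theorem potential_core {b : Variant} {φ : HalfLineL2} (hφ : φ ∈ momCore b) {p : ℝ}
    (hp : 0 ≤ p) :
    potentialDeriv b (coreParam b φ) φ p = ∫ q in Ioi p, φ q ∧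
    potential b (coreParam b φ) φ p = p * (∫ q in Ioi p, φ q) - ∫ q in Ioi p, (q : ℂ) * φ q := by
  have i0 := integral_pos_split (integrable_core hφ) hp
  have i1 := integral_pos_split (integrable_mul_core hφ) hp
  have h0 := hφ.2.2
  cases b
  · simp only [weight] at h0
    rw [i1] at h0
    simp only [potential, potentialDeriv, coreParam, weight, weightDeriv, i0, prim, primMul]
    constructor
    · push_cast; ring
    · linear_combination h0
  · simp only [weight, Complex.ofReal_one, one_mul] at h0
    rw [i0] at h0
    simp only [potential, potentialDeriv, coreParam, weight, weightDeriv, i1, prim, primMul]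
    constructor
    · push_cast; linear_combination -h0
    · push_cast; linear_combination -p * h0

theorem norm_tail_core_le {b : Variant} {φ : HalfLineL2} (hφ : φ ∈ momCore b) {p : ℝ}
    (hp : 0 ≤ p) (k j : ℕ) :
    ‖∫ q in Ioi p, (q : ℂ) ^ j * φ q‖ ≤
      (∫ q, (1 + q) ^ (k + j) * ‖φ q‖ ∂posMeasure) * ((1 + p) ^ k)⁻¹ := by
  have hp1 : 0 < (1 + p) ^ k := by positivity
  rw [← div_eq_mul_inv, le_div_iff₀ hp1]
  calc ‖∫ q in Ioi p, (q : ℂ) ^ j * φ q‖ * (1 + p) ^ k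
      ≤ (∫ q in Ioi p, ‖(q : ℂ) ^ j * φ q‖) * (1 + p) ^ k := by
        gcongr; exact norm_integral_le_integral_norm _
    _ = ∫ q in Ioi p, ‖(q : ℂ) ^ j * φ q‖ * (1 + p) ^ k := (integral_mul_const _ _).symm
    _ ≤ ∫ q in Ioi p, (1 + q) ^ (k + j) * ‖φ q‖ := by
        refine setIntegral_mono_on ?_ ?_ measurableSet_Ioi ?_
        · exact ((integrable_cpow_mul_core hφ j).norm.mul_const _).mono_measure
            (Measure.restrict_mono (Ioi_subset_Ioi hp) le_rfl)
        · exact (integrable_pow_mul_core hφ (k + j)).mono_measure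
            (Measure.restrict_mono (Ioi_subset_Ioi hp) le_rfl)
        · intro q hq
          have hq : p < q := hq
          have hq0 : 0 < q := lt_of_le_of_lt hp hq
          rw [norm_mul, norm_pow, Complex.norm_real, Real.norm_of_nonneg hq0.le, pow_add]
          have : q ^ j * (1 + p) ^ k ≤ (1 + q) ^ j * (1 + q) ^ k := by (gcongr; all_goals linarith)
          nlinarith [norm_nonneg (φ q), mul_le_mul_of_nonneg_right this (norm_nonneg (φ q))]
    _ ≤ _ := by
        refine setIntegral_mono_set (integrable_pow_mul_core hφ (k + j)) ?_
          (Ioi_subset_Ioi hp).eventuallyLE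
        filter_upwards [ae_restrict_mem measurableSet_Ioi] with q hq
        have hq : 0 < q := hq
        exact mul_nonneg (by positivity) (norm_nonneg _)

/-- All moments are finite, so the tail integrals decay faster than any power. The cube is what is
needed to beat the quadratic growth of `exists_growth` in the Wronskian. -/
theorem exists_decay_core {b : Variant} {φ : HalfLineL2} (hφ : φ ∈ momCore b) :
    ∃ C : ℝ, 0 ≤ C ∧ ∀ p, 0 ≤ p →
      ‖potentialDeriv b (coreParam b φ) φ p‖ ≤ C * ((1 + p) ^ 3)⁻¹ ∧
      ‖potential b (coreParam b φ) φ p‖ ≤ C * ((1 + p) ^ 3)⁻¹ := by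
  set A := ∫ q, (1 + q) ^ (4 + 0) * ‖φ q‖ ∂posMeasure
  set B := ∫ q, (1 + q) ^ (3 + 1) * ‖φ q‖ ∂posMeasure
  have pos : ∀ k : ℕ, 0 ≤ ∫ q, (1 + q) ^ k * ‖φ q‖ ∂posMeasure := fun k => by
    refine integral_nonneg_of_ae ?_
    filter_upwards [ae_restrict_mem measurableSet_Ioi] with q hq
    have hq : 0 < q := hq
    exact mul_nonneg (by positivity) (norm_nonneg _)
  have hA : 0 ≤ A := pos _
  have hB : 0 ≤ B := pos _
  refine ⟨A + B, by positivity, fun p hp => ?_⟩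
  obtain ⟨e1, e2⟩ := potential_core hφ hp
  have b1 := norm_tail_core_le hφ hp 4 0
  have b2 := norm_tail_core_le hφ hp 3 1
  simp only [pow_zero, one_mul, pow_one] at b1 b2
  have hp1 : 0 < 1 + p := by positivity
  have b3 : ((1 + p) ^ 4)⁻¹ ≤ ((1 + p) ^ 3)⁻¹ := by
    gcongr
    · linarith
    · norm_num
  have b4 : p * ((1 + p) ^ 4)⁻¹ ≤ ((1 + p) ^ 3)⁻¹ := by
    rw [pow_succ (1 + p) 3, mul_inv, mul_comm, mul_assoc]
    refine mul_le_of_le_one_right (by positivity) ?_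
    rw [inv_mul_le_iff₀ hp1]; linarith
  have i3 : 0 ≤ ((1 + p) ^ 3)⁻¹ := by positivity
  constructor
  · rw [e1]
    refine b1.trans ?_
    calc A * ((1 + p) ^ 4)⁻¹ ≤ A * ((1 + p) ^ 3)⁻¹ := by gcongr
      _ ≤ (A + B) * ((1 + p) ^ 3)⁻¹ := by gcongr; linarith
  · rw [e2]
    refine (norm_sub_le _ _).trans ?_
    rw [norm_mul, Complex.norm_real, Real.norm_of_nonneg hp, add_mul]
    refine add_le_add ?_ b2
    calc p * ‖∫ q in Ioi p, φ q‖ ≤ p * (A * ((1 + p) ^ 4)⁻¹) := by gcongr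
      _ = A * (p * ((1 + p) ^ 4)⁻¹) := by ring
      _ ≤ _ := by gcongr

theorem aestronglyMeasurable_potential (b : Variant) (l : ℂ) (ψ : HalfLineL2) :
    AEStronglyMeasurable (potential b l ψ) posMeasure :=
  ((continuousOn_potential b l ψ).mono Ioi_subset_Ici_self).aestronglyMeasurable measurableSet_Ioi

theorem memLp_sq_mul_core {b : Variant} {φ : HalfLineL2} (hφ : φ ∈ momCore b) :
    MemLp (fun p : ℝ => (p : ℂ) ^ 2 * φ p) 2 posMeasure := by
  rw [memLp_two_iff_integrable_sq_norm]
  · refine (hφ.1 4).congr ?_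
    filter_upwards with p
    rw [norm_mul, norm_pow, Complex.norm_real, Real.norm_eq_abs, sq_abs]; ring
  · exact (by fun_prop : Continuous fun q : ℝ => (q : ℂ) ^ 2).aestronglyMeasurable.mul
      (Lp.aestronglyMeasurable φ)

theorem memLp_inv_one_add_sq : MemLp (fun p : ℝ => (1 + p ^ 2)⁻¹) 2 posMeasure := by
  rw [memLp_two_iff_integrable_sq_norm]
  · refine (integrable_inv_one_add_sq.mono_measure Measure.restrict_le_self).mono' ?_ ?_
    · exact (Measurable.aestronglyMeasurable (by fun_prop))
    · filter_upwards with p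
      have h1 : (0 : ℝ) < 1 + p ^ 2 := by positivity
      have h2 : (1 + p ^ 2)⁻¹ ≤ 1 := inv_le_one_of_one_le₀ (by nlinarith [sq_nonneg p])
      rw [norm_pow, norm_norm, Real.norm_of_nonneg (by positivity)]
      have : 0 < (1 + p ^ 2)⁻¹ := by positivity
      nlinarith
  · exact (Measurable.aestronglyMeasurable (by fun_prop))

theorem memLp_potential_core {b : Variant} {φ : HalfLineL2} (hφ : φ ∈ momCore b) :
    MemLp (potential b (coreParam b φ) φ) 2 posMeasure := by
  obtain ⟨C, hC, h⟩ := exists_decay_core hφ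
  refine (memLp_inv_one_add_sq.const_mul C).mono' (aestronglyMeasurable_potential _ _ _) ?_
  filter_upwards [ae_restrict_mem measurableSet_Ioi] with p hp
  have hp : 0 < p := hp
  refine (h p hp.le).2.trans ?_
  gcongr
  nlinarith [pow_pos hp 3]

theorem exists_hasPotential_core {b : Variant} (α : ℝ) {φ : HalfLineL2} (hφ : φ ∈ momCore b) :
    ∃ h, HasPotential b α φ h (coreParam b φ) :=
  ⟨_, MemLp.coeFn_toLp ((memLp_sq_mul_core hφ).add
    ((memLp_potential_core hφ).const_mul ((α : ℂ) - 1 / 4)))⟩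

/-- The operator whose closure is `momMin b α`. -/
abbrev momPre (b : Variant) (α : ℝ) : HalfLineL2 →ₗ.[ℂ] HalfLineL2 :=
  operatorOn (momCore b) fun ψ h => h =ᵐ[posMeasure] fun p =>
    (p : ℂ) ^ 2 * ψ p + ((α : ℂ) - 1 / 4) * ∫ q, (kernel b p q : ℂ) * ψ q ∂posMeasure

theorem core_image_iff {b : Variant} {α : ℝ} {φ h : HalfLineL2} (hφ : φ ∈ momCore b) :
    (h =ᵐ[posMeasure] fun p =>
      (p : ℂ) ^ 2 * φ p + ((α : ℂ) - 1 / 4) * ∫ q, (kernel b p q : ℂ) * φ q ∂posMeasure) ↔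
    HasPotential b α φ h (coreParam b φ) := by
  unfold HasPotential
  have e : (fun p : ℝ => (p : ℂ) ^ 2 * φ p + ((α : ℂ) - 1 / 4) *
      ∫ q, (kernel b p q : ℂ) * φ q ∂posMeasure) =ᵐ[posMeasure]
      fun p => (p : ℂ) ^ 2 * φ p + ((α : ℂ) - 1 / 4) * potential b (coreParam b φ) φ p := by
    filter_upwards [ae_restrict_mem measurableSet_Ioi] with p hp
    rw [integral_kernel_core hφ (le_of_lt hp)]
  exact ⟨fun h' => h'.trans e, fun h' => h'.trans e.symm⟩

theorem mem_graph_momPre {b : Variant} {α : ℝ} {φ h : HalfLineL2} :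
    (φ, h) ∈ (momPre b α).graph ↔ φ ∈ momCore b ∧ HasPotential b α φ h (coreParam b φ) := by
  rw [mem_graph_operatorOn (maxRel b α) maxRel_single_valued]
  · refine and_congr_right fun hφ => ⟨fun hm => ?_, fun hm => ⟨_, hm⟩⟩
    obtain ⟨k, hk⟩ := exists_hasPotential_core α hφ
    have := (maxRel b α).sub_mem hm (show (φ, k) ∈ maxRel b α from ⟨_, hk⟩)
    rw [Prod.mk_sub_mk, sub_self] at this
    rwa [sub_eq_zero.1 (maxRel_single_valued _ this)]
  · intro x hx
    obtain ⟨k, hk⟩ := exists_hasPotential_core α hx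
    exact ⟨k, ⟨_, hk⟩, (core_image_iff hx).2 hk⟩
  · intro x hx y hy
    exact ⟨_, (core_image_iff hx).1 hy⟩

/-! ## The maximal relation is the adjoint of the core operator -/

theorem integrable_norm_sq (ψ : HalfLineL2) : Integrable (fun q => ‖ψ q‖ ^ 2) posMeasure :=
  (memLp_two_iff_integrable_sq_norm (Lp.aestronglyMeasurable ψ)).1 (Lp.memLp ψ)

/-- The inequality `‖ψ‖ ≤ 1 + ‖ψ‖²` takes the place of Cauchy–Schwarz; only polynomial growth of the
potentials is wanted, not a sharp power. -/
theorem norm_integral_mul_le (f : ℝ → ℂ) (M : ℝ) (ψ : HalfLineL2) {p : ℝ}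
    (hp : 0 ≤ p) (hM : ∀ q ∈ Ioc 0 p, ‖f q‖ ≤ M) (hM0 : 0 ≤ M) :
    ‖∫ q in (0 : ℝ)..p, f q * ψ q‖ ≤ M * (p + ∫ q, ‖ψ q‖ ^ 2 ∂posMeasure) := by
  have h1 : IntegrableOn (fun q => ‖ψ q‖ ^ 2) (Ioc 0 p) :=
    (integrable_norm_sq ψ).mono_measure (Measure.restrict_mono Ioc_subset_Ioi_self le_rfl)
  have h2 : IntegrableOn (fun _ => (1 : ℝ)) (Ioc 0 p) := integrableOn_const (by simp)
  rw [intervalIntegral.integral_of_le hp]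
  calc ‖∫ q in Ioc 0 p, f q * ψ q‖ ≤ ∫ q in Ioc 0 p, M * (1 + ‖ψ q‖ ^ 2) := by
        refine norm_integral_le_of_norm_le ((h2.add h1).const_mul M) ?_
        filter_upwards [ae_restrict_mem measurableSet_Ioc] with q hq
        rw [norm_mul]
        refine mul_le_mul (hM q hq) ?_ (norm_nonneg _) hM0
        nlinarith [sq_nonneg (‖ψ q‖ - 1), norm_nonneg (ψ q)]
    _ = M * (p + ∫ q in Ioc 0 p, ‖ψ q‖ ^ 2) := by
        rw [integral_const_mul, integral_add h2 h1]
        simp [hp]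
    _ ≤ _ := by
        have h3 : ∫ q in Ioc 0 p, ‖ψ q‖ ^ 2 ≤ ∫ q, ‖ψ q‖ ^ 2 ∂posMeasure :=
          setIntegral_mono_set (integrable_norm_sq ψ)
            (Eventually.of_forall fun q => by positivity) Ioc_subset_Ioi_self.eventuallyLE
        exact mul_le_mul_of_nonneg_left (by linarith) hM0

theorem exists_growth (b : Variant) (l : ℂ) (ψ : HalfLineL2) :
    ∃ C : ℝ, 0 ≤ C ∧ ∀ p, 0 ≤ p → ‖potentialDeriv b l ψ p‖ ≤ C * (1 + p) ^ 2 ∧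
      ‖potential b l ψ p‖ ≤ C * (1 + p) ^ 2 := by
  set B := ∫ q, ‖ψ q‖ ^ 2 ∂posMeasure
  have hB : 0 ≤ B := integral_nonneg fun q => by positivity
  refine ⟨‖l‖ + 2 * (1 + B), by positivity, fun p hp => ?_⟩
  have h1 : ‖prim ψ p‖ ≤ p + B := by
    simpa [prim] using norm_integral_mul_le (fun _ => 1) 1 ψ hp (by simp) zero_le_one
  have h2 : ‖primMul ψ p‖ ≤ p * (p + B) := by
    refine norm_integral_mul_le _ p ψ hp (fun q hq => ?_) hp
    rw [Complex.norm_real, Real.norm_of_nonneg hq.1.le]; exact hq.2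
  have hw : ‖(weight b p : ℂ)‖ ≤ 1 + p := by
    rw [Complex.norm_real]
    cases b
    · simp only [weight]; rw [Real.norm_of_nonneg hp]; linarith
    · simp only [weight]; rw [norm_one]; linarith
  have hw' : ‖(weightDeriv b : ℂ)‖ ≤ 1 := by
    cases b <;> simp [weightDeriv]
  have hl := norm_nonneg l
  constructor
  · calc ‖potentialDeriv b l ψ p‖ ≤ ‖l‖ * 1 + (p + B) := by
          unfold potentialDeriv
          refine (norm_sub_le _ _).trans (add_le_add ?_ h1)
          rw [norm_mul]; gcongr
      _ ≤ _ := by nlinarith [mul_nonneg hl hp, mul_nonneg hB hp, mul_nonneg hl (sq_nonneg p), mul_nonneg hB (sq_nonneg p)]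
  · calc ‖potential b l ψ p‖ ≤ ‖l‖ * (1 + p) + p * (p + B) + p * (p + B) := by
          unfold potential
          refine (norm_sub_le _ _).trans (add_le_add ((norm_add_le _ _).trans (add_le_add ?_ h2)) ?_)
          · rw [norm_mul]; gcongr
          · rw [norm_mul, Complex.norm_real, Real.norm_of_nonneg hp]; gcongr
      _ ≤ _ := by nlinarith [mul_nonneg hl hp, mul_nonneg hB hp, mul_nonneg hl (sq_nonneg p), mul_nonneg hB (sq_nonneg p)]

/-- The boundary form is the limit of the Wronskians. -/
theorem tendsto_wronskian {b : Variant} {α : ℝ} {ψ₁ h₁ ψ₂ h₂ : HalfLineL2} {l₁ l₂ : ℂ}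
    (H₁ : HasPotential b α ψ₁ h₁ l₁) (H₂ : HasPotential b α ψ₂ h₂ l₂) :
    Tendsto (fun R => ((α : ℂ) - 1 / 4) * wronskian b l₁ ψ₁ l₂ ψ₂ R) atTop
      (𝓝 (pair h₁ ψ₂ - pair ψ₁ h₂)) := by
  have hi : Integrable (fun q => h₁ q * ψ₂ q - ψ₁ q * h₂ q) posMeasure :=
    (integrable_mul_Lp h₁ ψ₂).sub (integrable_mul_Lp ψ₁ h₂)
  have h1 := intervalIntegral_tendsto_integral_Ioi (0 : ℝ) hi tendsto_id
  rw [integral_sub (integrable_mul_Lp h₁ ψ₂) (integrable_mul_Lp ψ₁ h₂)] at h1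
  refine Tendsto.congr' ?_ h1
  filter_upwards [eventually_ge_atTop (0 : ℝ)] with R hR
  rw [← integral_potential_sub b l₁ l₂ ψ₁ ψ₂ hR, ← intervalIntegral.integral_const_mul]
  refine intervalIntegral_congr_pos ?_ le_rfl hR
  unfold HasPotential at H₁ H₂
  filter_upwards [H₁, H₂] with q e1 e2
  rw [e1, e2]; ring

theorem tendsto_growth_mul_decay (C D : ℝ) :
    Tendsto (fun p : ℝ => 2 * ((C * (1 + p) ^ 2) * (D * ((1 + p) ^ 3)⁻¹))) atTop (𝓝 0) := by
  have h : Tendsto (fun p : ℝ => (1 + p)⁻¹) atTop (𝓝 0) :=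
    tendsto_inv_atTop_zero.comp (tendsto_atTop_add_const_left _ _ tendsto_id)
  have h2 := h.const_mul (2 * (C * D))
  rw [mul_zero] at h2
  refine Tendsto.congr' ?_ h2
  filter_upwards [eventually_ge_atTop (0 : ℝ)] with p hp
  have : 0 < 1 + p := by positivity
  field_simp

/-- By Green's identity the defect of adjointness is a limit of Wronskians. The growth `(1+p)²` of a
general potential against the decay `(1+p)^(-3)` of a core potential makes them tend to `0`. -/
theorem maxRel_le_bilinAdjoint (b : Variant) (α : ℝ) :
    maxRel b α ≤ bilinAdjoint (momPre b α).graph := by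
  rintro ⟨ψ, h⟩ ⟨l, hl⟩ ⟨φ, k⟩ hφ
  obtain ⟨hφ, hk⟩ := mem_graph_momPre.1 hφ
  have h1 := tendsto_wronskian hl hk
  obtain ⟨C, hC, hψ⟩ := exists_growth b l ψ
  obtain ⟨D, hD, hφ'⟩ := exists_decay_core hφ
  have h2 : Tendsto (fun R => wronskian b l ψ (coreParam b φ) φ R) atTop (𝓝 0) := by
    refine squeeze_zero_norm' ?_ (tendsto_growth_mul_decay C D)
    filter_upwards [eventually_ge_atTop (0 : ℝ)] with p hp
    obtain ⟨a1, a2⟩ := hψ p hp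
    obtain ⟨a3, a4⟩ := hφ' p hp
    refine (norm_sub_le _ _).trans ?_
    rw [norm_mul, norm_mul, two_mul]
    gcongr
  have h3 := h2.const_mul ((α : ℂ) - 1 / 4)
  rw [mul_zero] at h3
  exact sub_eq_zero.1 (tendsto_nhds_unique h1 h3)

/-- Source of test elements for computing the adjoint of the core operator: with bounded support,
only the moment condition remains to be imposed. -/
theorem mem_momCore_of_support {b : Variant} {φ : HalfLineL2} {N : ℝ} (hN : 0 ≤ N)
    (hφ : ∀ᵐ p ∂posMeasure, N < p → φ p = 0)
    (h0 : ∫ q in (0 : ℝ)..N, (weight b q : ℂ) * φ q = 0) : φ ∈ momCore b := by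
  have cw : Continuous fun q : ℝ => (weight b q : ℂ) :=
    Complex.continuous_ofReal.comp (continuous_weight b)
  have hw : ∀ q, 0 < q → q ≤ N → weight b q ≤ 1 + N := fun q h1 h2 => by
    cases b <;> simp only [weight] <;> linarith
  have hi : Integrable (fun q => (weight b q : ℂ) * φ q) posMeasure := by
    have h1 := intervalIntegrable_mul_Lp cw φ le_rfl hN
    rw [intervalIntegrable_iff_integrableOn_Ioc_of_le hN] at h1
    have h2 : Integrable (indicator (Ioc 0 N) fun q => (weight b q : ℂ) * φ q) posMeasure :=
      ((integrable_indicator_iff measurableSet_Ioc).2 h1).mono_measure Measure.restrict_le_self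
    refine h2.congr ?_
    filter_upwards [hφ, ae_restrict_mem measurableSet_Ioi] with q hq hq0
    by_cases h : q ≤ N
    · rw [indicator_of_mem (show q ∈ Ioc 0 N from ⟨hq0, h⟩)]
    · rw [indicator_of_notMem (fun h' => h h'.2), hq (not_le.1 h), mul_zero]
  refine ⟨fun n => ?_, hi, ?_⟩
  · refine ((integrable_norm_sq φ).mul_const (N ^ n)).mono' ?_ ?_
    · exact ((Lp.aestronglyMeasurable _).norm.pow 2).mul (by fun_prop)
    · filter_upwards [hφ, ae_restrict_mem measurableSet_Ioi] with q hq hq0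
      have hq0 : 0 < q := hq0
      rw [Real.norm_of_nonneg (by positivity)]
      by_cases h : q ≤ N
      · gcongr
      · rw [hq (not_le.1 h)]; simp
  · rw [integral_pos_split hi hN, h0, zero_add]
    refine integral_eq_zero_of_ae ?_
    have h1 : ∀ᵐ p ∂(volume.restrict (Ioi N)), N < p → φ p = 0 :=
      ae_mono (Measure.restrict_mono (Ioi_subset_Ioi hN) le_rfl) hφ
    filter_upwards [h1, ae_restrict_mem measurableSet_Ioi] with q hq hqN
    rw [hq hqN, mul_zero, Pi.zero_apply]

theorem setIntegral_Ioi_eq_zero {φ : HalfLineL2} {N : ℝ} (hN : 0 ≤ N)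
    (hφ : ∀ᵐ p ∂posMeasure, N < p → φ p = 0) (f : ℝ → ℂ) {p : ℝ} (hp : N ≤ p) :
    ∫ q in Ioi p, f q * φ q = 0 := by
  refine integral_eq_zero_of_ae ?_
  have h1 : ∀ᵐ q ∂(volume.restrict (Ioi p)), N < q → φ q = 0 :=
    ae_mono (Measure.restrict_mono (Ioi_subset_Ioi (hN.trans hp)) le_rfl) hφ
  filter_upwards [h1, ae_restrict_mem measurableSet_Ioi] with q hq hqN
  rw [hq (lt_of_le_of_lt hp hqN), mul_zero, Pi.zero_apply]

theorem potential_core_of_support {b : Variant} {φ : HalfLineL2} {N : ℝ} (hN : 0 ≤ N)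
    (hφ : ∀ᵐ p ∂posMeasure, N < p → φ p = 0) (hc : φ ∈ momCore b) {p : ℝ} (hp : N ≤ p) :
    potentialDeriv b (coreParam b φ) φ p = 0 ∧ potential b (coreParam b φ) φ p = 0 := by
  obtain ⟨e1, e2⟩ := potential_core hc (hN.trans hp)
  have z0 := setIntegral_Ioi_eq_zero hN hφ (fun _ => 1) hp
  have z1 := setIntegral_Ioi_eq_zero hN hφ (fun q => (q : ℂ)) hp
  simp only [one_mul] at z0
  rw [e1, e2, z0, z1]
  simp

theorem pair_eq_intervalIntegral {f g : HalfLineL2} {N : ℝ} (hN : 0 ≤ N)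
    (h : ∀ᵐ p ∂posMeasure, N < p → g p = 0) :
    pair f g = ∫ q in (0 : ℝ)..N, f q * g q := by
  rw [pair_apply, integral_pos_split (integrable_mul_Lp f g) hN,
    setIntegral_Ioi_eq_zero hN h f le_rfl, add_zero]

/-- The defect of `h = p² ψ + (α - 1/4) v` with `l = 0`. -/
def defect (b : Variant) (α : ℝ) (ψ h : HalfLineL2) (p : ℝ) : ℂ :=
  (p : ℂ) ^ 2 * ψ p + ((α : ℂ) - 1 / 4) * potential b 0 ψ p - h p

theorem memLp_defect (b : Variant) (α : ℝ) (ψ h : HalfLineL2) {N : ℝ} :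
    MemLp (defect b α ψ h) 2 (volume.restrict (Ioc 0 N)) := by
  have hle : volume.restrict (Ioc 0 N) ≤ posMeasure :=
    Measure.restrict_mono Ioc_subset_Ioi_self le_rfl
  have h1 : MemLp (fun p : ℝ => (p : ℂ) ^ 2 * ψ p) 2 (volume.restrict (Ioc 0 N)) := by
    have h2 : MemLp (fun p => N ^ 2 * ‖ψ p‖) 2 (volume.restrict (Ioc 0 N)) :=
      (((Lp.memLp ψ).norm).const_mul (N ^ 2)).mono_measure hle
    refine h2.mono' ?_ ?_
    · exact (by fun_prop : Continuous fun q : ℝ => (q : ℂ) ^ 2).aestronglyMeasurable.mul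
        ((Lp.aestronglyMeasurable ψ).mono_measure hle)
    · filter_upwards [ae_restrict_mem measurableSet_Ioc] with p hp
      rw [norm_mul, norm_pow, Complex.norm_real, Real.norm_of_nonneg hp.1.le]
      have := hp.1.le
      gcongr
      exact hp.2
  have h2 : MemLp (potential b 0 ψ) 2 (volume.restrict (Ioc 0 N)) := by
    obtain ⟨C, hC, h3⟩ := exists_growth b 0 ψ
    refine MemLp.of_bound ((aestronglyMeasurable_potential b 0 ψ).mono_measure hle)
      (C * (1 + N) ^ 2) ?_
    filter_upwards [ae_restrict_mem measurableSet_Ioc] with p hp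
    refine ((h3 p hp.1.le).2).trans ?_
    have := hp.1
    gcongr
    exact hp.2
  exact (h1.add (h2.const_mul _)).sub ((Lp.memLp h).mono_measure hle)

/-- The potential of a core function supported in `]0, N]` vanishes with its derivative from `N` on.
Green's identity on `[0, N]` thus has no boundary term, and adjointness says that the defect
annihilates `φ`. -/
theorem integral_defect_mul {b : Variant} {α : ℝ} {ψ h : HalfLineL2}
    (hψ : (ψ, h) ∈ bilinAdjoint (momPre b α).graph) {φ : HalfLineL2} {N : ℝ} (hN : 0 ≤ N)
    (hφ : ∀ᵐ p ∂posMeasure, N < p → φ p = 0)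
    (h0 : ∫ q in (0 : ℝ)..N, (weight b q : ℂ) * φ q = 0) :
    ∫ q in (0 : ℝ)..N, defect b α ψ h q * φ q = 0 := by
  have hc := mem_momCore_of_support hN hφ h0
  obtain ⟨k, hk⟩ := exists_hasPotential_core α hc
  have h1 : pair h φ = pair ψ k := hψ (φ, k) (mem_graph_momPre.2 ⟨hc, hk⟩)
  have hk0 : ∀ᵐ p ∂posMeasure, N < p → k p = 0 := by
    unfold HasPotential at hk
    filter_upwards [hk, hφ] with p e1 e2 hp
    rw [e1, e2 hp, (potential_core_of_support hN hφ hc hp.le).2]; simp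
  rw [pair_eq_intervalIntegral hN hφ, pair_eq_intervalIntegral hN hk0] at h1
  have h2 := integral_potential_sub b 0 (coreParam b φ) ψ φ hN
  obtain ⟨z1, z2⟩ := potential_core_of_support hN hφ hc le_rfl
  rw [wronskian, z1, z2, mul_zero, mul_zero, sub_zero] at h2
  have iv := intervalIntegrable_potential_mul b 0 ψ φ le_rfl hN
  have iv2 : IntervalIntegrable (fun q => ψ q * potential b (coreParam b φ) φ q) volume 0 N := by
    simpa only [mul_comm] using intervalIntegrable_potential_mul b (coreParam b φ) φ ψ le_rfl hN
  have iL : ∀ f g : HalfLineL2, IntervalIntegrable (fun q => f q * g q) volume 0 N := fun f g => by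
    rw [intervalIntegrable_iff_integrableOn_Ioc_of_le hN]
    exact (integrable_mul_Lp f g).mono_measure (Measure.restrict_mono Ioc_subset_Ioi_self le_rfl)
  have e : ∫ q in (0 : ℝ)..N, defect b α ψ h q * φ q =
      ∫ q in (0 : ℝ)..N, (ψ q * k q - h q * φ q + ((α : ℂ) - 1 / 4) *
        (potential b 0 ψ q * φ q - ψ q * potential b (coreParam b φ) φ q)) := by
    refine intervalIntegral_congr_pos ?_ le_rfl hN
    unfold HasPotential at hk
    filter_upwards [hk] with q hq
    rw [hq, defect]; ring
  rw [e, intervalIntegral.integral_add ((iL ψ k).sub (iL h φ)) ((iv.sub iv2).const_mul _),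
    intervalIntegral.integral_sub (iL ψ k) (iL h φ), intervalIntegral.integral_const_mul, h2, h1]
  simp

/-- On `]0, N]` the defect annihilates every square-integrable function annihilated by the weight,
so it is a multiple of the weight. Concretely, the projection `m w` is removed and the remainder `g`
is tested against its own conjugate, which gives `∫ |g|² = 0`. -/
theorem defect_eq_weight_on {b : Variant} {α : ℝ} {ψ h : HalfLineL2}
    (hψ : (ψ, h) ∈ bilinAdjoint (momPre b α).graph) {N : ℝ} (hN : 0 < N) :
    ∃ m : ℂ, ∀ᵐ p ∂(volume.restrict (Ioc 0 N)), defect b α ψ h p = m * weight b p := by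
  set ν : Measure ℝ := volume.restrict (Ioc 0 N) with hν
  have cw : Continuous fun q : ℝ => (weight b q : ℂ) :=
    Complex.continuous_ofReal.comp (continuous_weight b)
  have hwL : MemLp (fun q : ℝ => (weight b q : ℂ)) 2 ν := by
    refine MemLp.of_bound cw.aestronglyMeasurable (1 + N) ?_
    filter_upwards [ae_restrict_mem measurableSet_Ioc] with p hp
    rw [Complex.norm_real, Real.norm_of_nonneg (weight_pos b hp.1).le]
    have := hp.2
    cases b <;> simp only [weight] <;> linarith
  have hr := memLp_defect b α ψ h (N := N)
  set W : ℂ := ∫ q, (weight b q : ℂ) * weight b q ∂ν with hW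
  have hW0 : W ≠ 0 := by
    have e1 : W = ((∫ q, weight b q * weight b q ∂ν : ℝ) : ℂ) := by
      rw [hW, ← integral_complex_ofReal]; simp
    rw [e1, Complex.ofReal_ne_zero]
    refine ne_of_gt ?_
    rw [hν, ← intervalIntegral.integral_of_le hN.le]
    refine intervalIntegral.intervalIntegral_pos_of_pos_on
      (((continuous_weight b).mul (continuous_weight b)).intervalIntegrable _ _) ?_ hN
    intro q hq
    exact mul_pos (weight_pos b hq.1) (weight_pos b hq.1)
  set m : ℂ := (∫ q, (weight b q : ℂ) * defect b α ψ h q ∂ν) / W with hm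
  refine ⟨m, ?_⟩
  set g : ℝ → ℂ := fun q => defect b α ψ h q - m * weight b q with hg
  have hgL : MemLp g 2 ν := hr.sub (hwL.const_mul m)
  have hgw : ∫ q, (weight b q : ℂ) * g q ∂ν = 0 := by
    have e : ∀ q, (weight b q : ℂ) * g q = (weight b q : ℂ) * defect b α ψ h q -
        m * ((weight b q : ℂ) * weight b q) := fun q => by simp only [hg]; ring
    simp only [e]
    have i1 : Integrable (fun q => (weight b q : ℂ) * defect b α ψ h q) ν := hwL.integrable_mul hr
    have i2 : Integrable (fun q => (weight b q : ℂ) * weight b q) ν := hwL.integrable_mul hwL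
    rw [integral_sub i1 (i2.const_mul m),
      integral_const_mul, ← hW, hm, div_mul_cancel₀ _ hW0, sub_self]
  have hgs : MemLp (star g) 2 ν := hgL.star
  have hφL : MemLp (indicator (Ioc 0 N) (star g)) 2 posMeasure :=
    ((memLp_indicator_iff_restrict measurableSet_Ioc).2 hgs).mono_measure
      Measure.restrict_le_self
  set φ : HalfLineL2 := hφL.toLp with hφ
  have hφe : φ =ᵐ[posMeasure] indicator (Ioc 0 N) (star g) := MemLp.coeFn_toLp hφL
  have hφν : φ =ᵐ[ν] star g := by
    have h1 : φ =ᵐ[ν] indicator (Ioc 0 N) (star g) :=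
      ae_mono (Measure.restrict_mono Ioc_subset_Ioi_self le_rfl) hφe
    filter_upwards [h1, ae_restrict_mem measurableSet_Ioc] with q hq hq'
    rw [hq, indicator_of_mem hq']
  have hφ0 : ∀ᵐ p ∂posMeasure, N < p → φ p = 0 := by
    filter_upwards [hφe] with p hp hNp
    rw [hp, indicator_of_notMem (fun h' => absurd h'.2 (not_le.2 hNp))]
  have hφw : ∫ q in (0 : ℝ)..N, (weight b q : ℂ) * φ q = 0 := by
    rw [intervalIntegral.integral_of_le hN.le]
    have e : ∫ q, (weight b q : ℂ) * φ q ∂ν = star (∫ q, (weight b q : ℂ) * g q ∂ν) := by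
      change _ = (starRingEnd ℂ) _
      rw [← integral_conj]
      refine integral_congr_ae ?_
      filter_upwards [hφν] with q hq
      rw [hq]; simp
    rw [e, hgw, star_zero]
  have h1 := integral_defect_mul hψ hN.le hφ0 hφw
  rw [intervalIntegral.integral_of_le hN.le] at h1 hφw
  have iφ : MemLp φ 2 ν := (Lp.memLp φ).mono_measure
    (Measure.restrict_mono Ioc_subset_Ioi_self le_rfl)
  have h2 : ∫ q, g q * φ q ∂ν = 0 := by
    have e : ∀ q, g q * φ q = defect b α ψ h q * φ q - m * ((weight b q : ℂ) * φ q) :=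
      fun q => by simp only [hg]; ring
    simp only [e]
    have i1 : Integrable (fun q => defect b α ψ h q * φ q) ν := hr.integrable_mul iφ
    have i2 : Integrable (fun q => (weight b q : ℂ) * φ q) ν := hwL.integrable_mul iφ
    rw [integral_sub i1 (i2.const_mul m),
      integral_const_mul, hφw, h1]; simp
  have h3 : ∫ q, ‖g q‖ ^ 2 ∂ν = 0 := by
    have e : ∫ q, g q * φ q ∂ν = ((∫ q, ‖g q‖ ^ 2 ∂ν : ℝ) : ℂ) := by
      rw [← integral_complex_ofReal]
      refine integral_congr_ae ?_
      filter_upwards [hφν] with q hq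
      rw [hq, Pi.star_apply]
      change g q * (starRingEnd ℂ) (g q) = _
      rw [Complex.mul_conj, Complex.normSq_eq_norm_sq]
    rw [e] at h2
    exact_mod_cast h2
  rw [integral_eq_zero_iff_of_nonneg (fun q => by positivity)
    ((memLp_two_iff_integrable_sq_norm hgL.1).1 hgL)] at h3
  filter_upwards [h3] with q hq
  have : g q = 0 := by simpa using hq
  exact sub_eq_zero.1 this

/-- The multiples of the weight found on the intervals `]0, n+1]` agree because they agree on `]0,
1]`. The common multiple is absorbed into the parameter `l`, which requires dividing by `α - 1/4`.
-/
theorem bilinAdjoint_momPre_le {b : Variant} {α : ℝ} (hα : (α : ℂ) - 1 / 4 ≠ 0) :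
    bilinAdjoint (momPre b α).graph ≤ maxRel b α := by
  rintro ⟨ψ, h⟩ hψ
  have key : ∀ n : ℕ, ∃ m : ℂ, ∀ᵐ p ∂(volume.restrict (Ioc 0 ((n : ℝ) + 1))),
      defect b α ψ h p = m * weight b p := fun n => defect_eq_weight_on hψ (by positivity)
  choose m hm using key
  have hm0 : ∀ n, m n = m 0 := by
    intro n
    have h1 : ∀ᵐ p ∂(volume.restrict (Ioc (0 : ℝ) 1)), defect b α ψ h p = m n * weight b p :=
      ae_mono (Measure.restrict_mono (Ioc_subset_Ioc_right (by
        have : (0 : ℝ) ≤ n := n.cast_nonneg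
        linarith)) le_rfl) (hm n)
    have h2 : ∀ᵐ p ∂(volume.restrict (Ioc (0 : ℝ) 1)), defect b α ψ h p = m 0 * weight b p := by
      simpa using hm 0
    have h3 : NeBot (ae (volume.restrict (Ioc (0 : ℝ) 1))) := by
      rw [ae_neBot]
      intro h0
      have := congrArg (fun ν : Measure ℝ => ν univ) h0
      simp at this
    obtain ⟨p, a1, a2, a3⟩ := (h1.and (h2.and (ae_restrict_mem measurableSet_Ioc))).exists
    have hw : (weight b p : ℂ) ≠ 0 := Complex.ofReal_ne_zero.2 (weight_pos b a3.1).ne'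
    exact mul_right_cancel₀ hw (a1.symm.trans a2)
  have hall : ∀ᵐ p ∂posMeasure, defect b α ψ h p = m 0 * weight b p := by
    rw [ae_restrict_iff' measurableSet_Ioi]
    have h1 : ∀ᵐ p : ℝ, ∀ n : ℕ, p ∈ Ioc 0 ((n : ℝ) + 1) →
        defect b α ψ h p = m 0 * weight b p := by
      rw [ae_all_iff]
      intro n
      have := (ae_restrict_iff' measurableSet_Ioc).1 (hm n)
      rwa [hm0 n] at this
    filter_upwards [h1] with p hp hp0
    obtain ⟨n, hn⟩ := exists_nat_ge p
    exact hp n ⟨hp0, by linarith⟩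
  refine ⟨-(m 0) / ((α : ℂ) - 1 / 4), ?_⟩
  unfold HasPotential
  filter_upwards [hall] with p hp
  simp only [defect, potential] at hp
  simp only [potential]
  have e := div_mul_cancel₀ (-(m 0)) hα
  linear_combination -hp - weight b p * e

/-- The maximal relation is the adjoint of the core operator. -/
theorem bilinAdjoint_momPre {b : Variant} {α : ℝ} (hα : (α : ℂ) - 1 / 4 ≠ 0) :
    bilinAdjoint (momPre b α).graph = maxRel b α :=
  le_antisymm (bilinAdjoint_momPre_le hα) (maxRel_le_bilinAdjoint b α)

theorem momPre_graph_le (b : Variant) (α : ℝ) : (momPre b α).graph ≤ maxRel b α := by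
  rintro ⟨φ, h⟩ hφ
  exact ⟨_, (mem_graph_momPre.1 hφ).2⟩

theorem closure_momPre_le {b : Variant} {α : ℝ} (hα : (α : ℂ) - 1 / 4 ≠ 0) :
    (momPre b α).graph.topologicalClosure ≤ maxRel b α := by
  refine Submodule.topologicalClosure_minimal _ (momPre_graph_le b α) ?_
  rw [← bilinAdjoint_momPre hα]
  exact isClosed_bilinAdjoint _

/-- The closure of the core graph is its double adjoint, and `maxRel`, its first adjoint, is
single-valued and closed; this also makes the core operator closable. -/
theorem graph_momMin {b : Variant} {α : ℝ} (hα : (α : ℂ) - 1 / 4 ≠ 0) :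
    (momMin b α).graph = bilinAdjoint (maxRel b α) := by
  have h : (momPre b α).IsClosable := isClosable_of_closure_graph fun y hy =>
    maxRel_single_valued y (closure_momPre_le hα hy)
  rw [← bilinAdjoint_momPre hα, bilinAdjoint_bilinAdjoint]
  exact h.graph_closure_eq_closure_graph.symm

theorem bilinAdjoint_maxRel_le {b : Variant} {α : ℝ} (hα : (α : ℂ) - 1 / 4 ≠ 0) :
    bilinAdjoint (maxRel b α) ≤ maxRel b α := by
  rw [← bilinAdjoint_momPre hα, bilinAdjoint_bilinAdjoint, bilinAdjoint_momPre hα]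
  exact closure_momPre_le hα

/-! ## The boundary form -/

/-- The boundary form on pairs `(ψ, h)`. -/
def bform (x y : HalfLineL2 × HalfLineL2) : ℂ := pair x.2 y.1 - pair x.1 y.2

theorem bform_self (x : HalfLineL2 × HalfLineL2) : bform x x = 0 := by
  rw [bform, pair_comm, sub_self]

theorem bform_swap (x y : HalfLineL2 × HalfLineL2) : bform y x = -bform x y := by
  rw [bform, bform, pair_comm, pair_comm y.1]; ring

theorem bform_add_left (x y z : HalfLineL2 × HalfLineL2) :
    bform (x + y) z = bform x z + bform y z := by
  simp only [bform, Prod.fst_add, Prod.snd_add, map_add, LinearMap.add_apply]; ring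

theorem bform_smul_left (c : ℂ) (x z : HalfLineL2 × HalfLineL2) :
    bform (c • x) z = c * bform x z := by
  simp only [bform, Prod.smul_fst, Prod.smul_snd, map_smul, LinearMap.smul_apply, smul_eq_mul]; ring

theorem bform_sub_left (x y z : HalfLineL2 × HalfLineL2) :
    bform (x - y) z = bform x z - bform y z := by
  simp only [bform, Prod.fst_sub, Prod.snd_sub, map_sub, LinearMap.sub_apply]; ring

theorem mem_bilinAdjoint_iff_bform {G : Submodule ℂ (HalfLineL2 × HalfLineL2)}
    {x : HalfLineL2 × HalfLineL2} : x ∈ bilinAdjoint G ↔ ∀ y ∈ G, bform x y = 0 :=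
  forall₂_congr fun _ _ => sub_eq_zero.symm

/-- The minimal relation. -/
abbrev minRel (b : Variant) (α : ℝ) : Submodule ℂ (HalfLineL2 × HalfLineL2) :=
  bilinAdjoint (maxRel b α)

/-- The Plücker relation for the boundary form. -/
theorem bform_plucker {b : Variant} {α : ℝ} {x y z w : HalfLineL2 × HalfLineL2}
    (hx : x ∈ maxRel b α) (hy : y ∈ maxRel b α) (hz : z ∈ maxRel b α) (hw : w ∈ maxRel b α) :
    bform x y * bform z w = bform x z * bform y w - bform x w * bform y z := by
  obtain ⟨lx, hx⟩ := hx
  obtain ⟨ly, hy⟩ := hy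
  obtain ⟨lz, hz⟩ := hz
  obtain ⟨lw, hw⟩ := hw
  -- At each `R` this is the Plücker identity for the 2×2 determinants of the four vectors `(v,
  -- v')`; it survives the limit.
  refine tendsto_nhds_unique ((tendsto_wronskian hx hy).mul (tendsto_wronskian hz hw)) ?_
  refine (((tendsto_wronskian hx hz).mul (tendsto_wronskian hy hw)).sub
    ((tendsto_wronskian hx hw).mul (tendsto_wronskian hy hz))).congr fun R => ?_
  simp only [wronskian]; ring

/-- The Plücker relation bounds the rank of the form by two, so `u` and `w` with `bform u w ≠ 0`
detect every class modulo the minimal relation. -/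
theorem mem_minRel_of_bform {b : Variant} {α : ℝ} {x u w : HalfLineL2 × HalfLineL2}
    (hx : x ∈ maxRel b α) (hu : u ∈ maxRel b α) (hw : w ∈ maxRel b α) (huw : bform u w ≠ 0)
    (h1 : bform x u = 0) (h2 : bform x w = 0) : x ∈ minRel b α := by
  rw [mem_bilinAdjoint_iff_bform]
  intro y hy
  have := bform_plucker hx hy hu hw
  rw [h1, h2] at this
  simpa [huw] using this

/-! ## Elements of the maximal relation with explicit behaviour at infinity -/

/-- The function `x.1` equals `g` near infinity, where `A' = g` and `B' = p g`, and its potential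
is `B - p A` there. -/
def HasTail (b : Variant) (α : ℝ) (x : HalfLineL2 × HalfLineL2) (A B g : ℝ → ℂ) : Prop :=
  ∃ Λ : ℝ, 0 < Λ ∧ ∃ l, HasPotential b α x.1 x.2 l ∧
    (∀ p, Λ ≤ p → potentialDeriv b l x.1 p = -A p ∧ potential b l x.1 p = B p - p * A p) ∧
    ∀ᵐ p ∂posMeasure, Λ < p → x.1 p = g p ∧ x.2 p = 0

theorem HasTail.mem_maxRel {b : Variant} {α : ℝ} {x : HalfLineL2 × HalfLineL2} {A B g : ℝ → ℂ}
    (h : HasTail b α x A B g) : x ∈ maxRel b α := by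
  obtain ⟨_, _, l, hl, _⟩ := h
  exact ⟨l, hl⟩

/-- The prescribed value of the moment. -/
def tailMoment (b : Variant) (A B : ℝ → ℂ) (Λ : ℝ) : ℂ :=
  match b with
  | .D => B Λ
  | .N => A Λ

/-- The counterterm. -/
def tailCounterterm (b : Variant) (A B : ℝ → ℂ) (p Λ : ℝ) : ℂ :=
  match b with
  | .D => -p * A Λ
  | .N => B Λ

/-- On the bounded interval `]0, N]` square integrability of the expression is automatic, because
`p²` and the potential are bounded there. Beyond `N` it vanishes by hypothesis. -/
theorem exists_hasPotential_of_tail {b : Variant} {α : ℝ} {ψ : HalfLineL2} {l : ℂ} {N : ℝ}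
    (h0 : ∀ᵐ p ∂posMeasure, N < p →
      (p : ℂ) ^ 2 * ψ p + ((α : ℂ) - 1 / 4) * potential b l ψ p = 0) :
    ∃ h, HasPotential b α ψ h l ∧ ∀ᵐ p ∂posMeasure, N < p → h p = 0 := by
  set f : ℝ → ℂ := fun p => (p : ℂ) ^ 2 * ψ p + ((α : ℂ) - 1 / 4) * potential b l ψ p with hf
  have cw : Continuous fun q : ℝ => (weight b q : ℂ) :=
    Complex.continuous_ofReal.comp (continuous_weight b)
  have hwL : MemLp (fun q : ℝ => (weight b q : ℂ)) 2 (volume.restrict (Ioc 0 N)) := by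
    refine MemLp.of_bound cw.aestronglyMeasurable (1 + N) ?_
    filter_upwards [ae_restrict_mem measurableSet_Ioc] with p hp
    rw [Complex.norm_real, Real.norm_of_nonneg (weight_pos b hp.1).le]
    have := hp.2
    have := hp.1
    cases b <;> simp only [weight] <;> linarith
  have h1 : MemLp f 2 (volume.restrict (Ioc 0 N)) := by
    have h2 := ((memLp_defect b α ψ 0 (N := N)).add (hwL.const_mul (((α : ℂ) - 1 / 4) * l)))
    refine h2.ae_eq ?_
    have h3 : ∀ᵐ p ∂(volume.restrict (Ioc 0 N)), (0 : HalfLineL2) p = 0 :=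
      ae_mono (Measure.restrict_mono Ioc_subset_Ioi_self le_rfl) ae_zero_Lp
    filter_upwards [h3] with p hp
    simp only [Pi.add_apply, defect, hp, hf, potential]; ring
  have h2 : MemLp (indicator (Ioc 0 N) f) 2 posMeasure :=
    ((memLp_indicator_iff_restrict measurableSet_Ioc).2 h1).mono_measure Measure.restrict_le_self
  refine ⟨h2.toLp, ?_, ?_⟩
  · refine (MemLp.coeFn_toLp h2).trans ?_
    filter_upwards [h0, ae_restrict_mem measurableSet_Ioi] with p hp hp0
    by_cases h : p ≤ N
    · rw [indicator_of_mem (show p ∈ Ioc 0 N from ⟨hp0, h⟩)]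
    · rw [indicator_of_notMem (fun h' => h h'.2), hp (not_le.1 h)]
  · filter_upwards [MemLp.coeFn_toLp h2] with p hp hN
    rw [hp, indicator_of_notMem (fun h' => absurd h'.2 (not_le.2 hN))]

theorem intervalIntegral_tail {ψ : HalfLineL2} {Λ : ℝ} (h0 : 0 < Λ) {A g f : ℝ → ℂ}
    (hf : Continuous f) (hA : ∀ p, Λ ≤ p → HasDerivAt A (f p * g p) p)
    (hg : ContinuousOn g (Ici Λ)) (hψ : ∀ᵐ p ∂posMeasure, Λ < p → ψ p = g p) {p : ℝ}
    (hp : Λ ≤ p) :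
    ∫ q in (0 : ℝ)..p, f q * ψ q = (∫ q in (0 : ℝ)..Λ, f q * ψ q) + (A p - A Λ) := by
  have hp0 : 0 ≤ p := h0.le.trans hp
  rw [← intervalIntegral.integral_add_adjacent_intervals
    (intervalIntegrable_mul_Lp hf ψ le_rfl h0.le) (intervalIntegrable_mul_Lp hf ψ h0.le hp0)]
  congr 1
  have e : ∫ q in Λ..p, f q * ψ q = ∫ q in Λ..p, f q * g q := by
    refine intervalIntegral.integral_congr_ae ?_
    rw [uIoc_of_le hp]
    filter_upwards [ae_Ioc_of_ae_pos hψ h0.le] with q hq hq'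
    rw [hq hq' hq'.1]
  rw [e]
  refine intervalIntegral.integral_eq_sub_of_hasDerivAt (fun q hq => ?_) ?_
  · rw [uIcc_of_le hp] at hq; exact hA q hq.1
  · refine ContinuousOn.intervalIntegrable ?_
    rw [uIcc_of_le hp]
    exact hf.continuousOn.mul (hg.mono Icc_subset_Ici_self)

/-- The potential near infinity agrees with `B - p A` up to two integration constants. One is
adjusted by the choice of `l`; the other is fixed by the moment condition `hm`. The equation `hode`
makes the image vanish beyond `Λ`, so `h` lies in `L²`. -/
theorem exists_hasTail {b : Variant} {α : ℝ} {ψ : HalfLineL2} {Λ : ℝ} (h0 : 0 < Λ)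
    {A B g : ℝ → ℂ} (hA : ∀ p, Λ ≤ p → HasDerivAt A (g p) p)
    (hB : ∀ p : ℝ, Λ ≤ p → HasDerivAt B (p * g p) p)
    (hg : ContinuousOn g (Ici Λ)) (hψ : ∀ᵐ p ∂posMeasure, Λ < p → ψ p = g p)
    (hm : ∫ q in (0 : ℝ)..Λ, (weight b q : ℂ) * ψ q = tailMoment b A B Λ)
    (hode : ∀ p : ℝ, Λ < p → (p : ℂ) ^ 2 * g p + ((α : ℂ) - 1 / 4) * (B p - p * A p) = 0) :
    ∃ h, HasTail b α (ψ, h) A B g := by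
  have e0 : ∀ p, Λ ≤ p → prim ψ p = prim ψ Λ + (A p - A Λ) := fun p hp => by
    have := intervalIntegral_tail h0 (f := fun _ => 1) continuous_const
      (by simpa using hA) hg hψ hp
    simpa [prim] using this
  have e1 : ∀ p, Λ ≤ p → primMul ψ p = primMul ψ Λ + (B p - B Λ) := fun p hp =>
    intervalIntegral_tail h0 (f := fun q => (q : ℂ)) Complex.continuous_ofReal hB hg hψ hp
  obtain ⟨l, hl⟩ : ∃ l, ∀ p, Λ ≤ p →
      potentialDeriv b l ψ p = -A p ∧ potential b l ψ p = B p - p * A p := by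
    cases b
    · refine ⟨prim ψ Λ - A Λ, fun p hp => ?_⟩
      change primMul ψ Λ = B Λ at hm
      simp only [potential, potentialDeriv, e0 p hp, e1 p hp, weight, weightDeriv, hm]
      constructor <;> push_cast <;> ring
    · refine ⟨B Λ - primMul ψ Λ, fun p hp => ?_⟩
      simp only [weight, Complex.ofReal_one, one_mul] at hm
      change prim ψ Λ = A Λ at hm
      simp only [potential, potentialDeriv, e0 p hp, e1 p hp, weight, weightDeriv, hm]
      constructor <;> push_cast <;> ring
  obtain ⟨h, hh, hh0⟩ := exists_hasPotential_of_tail (b := b) (α := α) (ψ := ψ) (l := l) (N := Λ) (by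
    filter_upwards [hψ] with p hp hΛ
    rw [hp hΛ, (hl p hΛ.le).2, hode p hΛ])
  refine ⟨h, Λ, h0, l, hh, hl, ?_⟩
  filter_upwards [hψ, hh0] with p a1 a2 hp
  exact ⟨a1 hp, a2 hp⟩

theorem HasTail.bform_eq {b : Variant} {α : ℝ} {x y : HalfLineL2 × HalfLineL2}
    {A B g A' B' g' : ℝ → ℂ} (hx : HasTail b α x A B g) (hy : HasTail b α y A' B' g') {k : ℂ}
    (hk : ∀ᶠ p in atTop, ((α : ℂ) - 1 / 4) * (B p * A' p - A p * B' p) = k) : bform x y = k := by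
  obtain ⟨Λ, _, l, hl, hv, _⟩ := hx
  obtain ⟨Λ', _, l', hl', hv', _⟩ := hy
  refine tendsto_nhds_unique (tendsto_wronskian hl hl') ?_
  refine Tendsto.congr' ?_ tendsto_const_nhds
  filter_upwards [hk, eventually_ge_atTop Λ, eventually_ge_atTop Λ'] with p h1 h2 h3
  rw [← h1, wronskian, (hv p h2).1, (hv p h2).2, (hv' p h3).1, (hv' p h3).2]; ring

/-- Elements whose potential vanishes near infinity belong to the minimal relation. -/
theorem mem_minRel_of_tendsto {b : Variant} {α : ℝ} {x : HalfLineL2 × HalfLineL2} {l : ℂ}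
    (hl : HasPotential b α x.1 x.2 l)
    (h : ∀ᶠ p in atTop, potentialDeriv b l x.1 p = 0 ∧ potential b l x.1 p = 0) :
    x ∈ minRel b α := by
  rw [mem_bilinAdjoint_iff_bform]
  rintro y ⟨k, hk⟩
  refine tendsto_nhds_unique (tendsto_wronskian hl hk) ?_
  refine Tendsto.congr' ?_ tendsto_const_nhds
  filter_upwards [h] with p hp
  rw [wronskian, hp.1, hp.2]; ring

/-- The potential of the difference vanishes near infinity, and so does its Wronskian with anything.
Hence the choice of a function with a given tail is immaterial modulo the minimal domain. -/
theorem HasTail.sub_mem_minRel {b : Variant} {α : ℝ} {x y : HalfLineL2 × HalfLineL2}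
    {A B g : ℝ → ℂ} (hx : HasTail b α x A B g) (hy : HasTail b α y A B g) :
    x - y ∈ minRel b α := by
  obtain ⟨Λ, _, l, hl, hv, _⟩ := hx
  obtain ⟨Λ', _, l', hl', hv', _⟩ := hy
  have e : x - y = x + (-1 : ℂ) • y := by rw [neg_one_smul, sub_eq_add_neg]
  rw [e]
  refine mem_minRel_of_tendsto (hl.add (hl'.smul (-1))) ?_
  filter_upwards [eventually_ge_atTop Λ, eventually_ge_atTop Λ', eventually_ge_atTop 0]
    with p h2 h3 h0
  simp only [Prod.fst_add, Prod.smul_fst]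
  rw [potential_add _ _ _ _ _ h0, potential_smul _ _ _ _ h0, potentialDeriv_add _ _ _ _ _ h0,
    potentialDeriv_smul _ _ _ _ h0, (hv p h2).1, (hv p h2).2, (hv' p h3).1, (hv' p h3).2]
  constructor <;> ring

/-! ## The truncated kernel integral -/

/-- The difference of the potential and the truncated kernel integral. -/
def boundaryTerm (b : Variant) (l : ℂ) (ψ : HalfLineL2) (p Λ : ℝ) : ℂ :=
  match b with
  | .D => p * potentialDeriv b l ψ Λ
  | .N => potential b l ψ Λ - Λ * potentialDeriv b l ψ Λ

/-- As in `integral_kernel_core`, but the part beyond `p` now stops at `Λ`. The boundary term is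
what prevents convergence for a general `ψ`, and what the counterterms are made to cancel. -/
theorem integral_kernel_truncated (b : Variant) (l : ℂ) (ψ : HalfLineL2) {p Λ : ℝ} (hp : 0 ≤ p)
    (hΛ : p ≤ Λ) :
    ∫ q in (0 : ℝ)..Λ, (kernel b p q : ℂ) * ψ q =
      potential b l ψ p - boundaryTerm b l ψ p Λ := by
  have hΛ0 := hp.trans hΛ
  have ck : Continuous fun q : ℝ => (kernel b p q : ℂ) := by
    refine Complex.continuous_ofReal.comp ?_
    cases b
    · exact continuous_const.min continuous_id
    · exact (continuous_const.max continuous_id).neg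
  have s1 := intervalIntegral.integral_add_adjacent_intervals
    (intervalIntegrable_mul_Lp ck ψ le_rfl hp) (intervalIntegrable_mul_Lp ck ψ hp hΛ0)
  have s2 : prim ψ p + (∫ q in p..Λ, ψ q) = prim ψ Λ :=
    intervalIntegral.integral_add_adjacent_intervals
    (intervalIntegrable_Lp ψ le_rfl hp) (intervalIntegrable_Lp ψ hp hΛ0)
  have s3 : primMul ψ p + (∫ q in p..Λ, (q : ℂ) * ψ q) = primMul ψ Λ :=
    intervalIntegral.integral_add_adjacent_intervals
    (intervalIntegrable_mul_Lp Complex.continuous_ofReal ψ le_rfl hp)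
    (intervalIntegrable_mul_Lp Complex.continuous_ofReal ψ hp hΛ0)
  rw [← s1]
  cases b
  · have e1 : ∫ q in (0 : ℝ)..p, (kernel .D p q : ℂ) * ψ q = primMul ψ p := by
      refine intervalIntegral.integral_congr fun q hq => ?_
      rw [uIcc_of_le hp] at hq
      simp [kernel, min_eq_right hq.2]
    have e2 : ∫ q in p..Λ, (kernel .D p q : ℂ) * ψ q = p * ∫ q in p..Λ, ψ q := by
      rw [← intervalIntegral.integral_const_mul]
      refine intervalIntegral.integral_congr fun q hq => ?_
      rw [uIcc_of_le hΛ] at hq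
      simp [kernel, min_eq_left hq.1]
    rw [e1, e2]
    simp only [potential, potentialDeriv, boundaryTerm, weight, weightDeriv, ← s2]
    push_cast; ring
  · have e1 : ∫ q in (0 : ℝ)..p, (kernel .N p q : ℂ) * ψ q = -p * prim ψ p := by
      rw [prim, ← intervalIntegral.integral_const_mul]
      refine intervalIntegral.integral_congr fun q hq => ?_
      rw [uIcc_of_le hp] at hq
      simp [kernel, max_eq_left hq.2]
    have e2 : ∫ q in p..Λ, (kernel .N p q : ℂ) * ψ q = -∫ q in p..Λ, (q : ℂ) * ψ q := by
      rw [← intervalIntegral.integral_neg]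
      refine intervalIntegral.integral_congr fun q hq => ?_
      rw [uIcc_of_le hΛ] at hq
      simp [kernel, max_eq_right hq.1]
    rw [e1, e2]
    simp only [potential, potentialDeriv, boundaryTerm, weight, weightDeriv, ← s3]
    push_cast; ring

theorem boundaryTerm_add (b : Variant) (l k : ℂ) (ψ χ : HalfLineL2) (p : ℝ) {Λ : ℝ} (h : 0 ≤ Λ) :
    boundaryTerm b (l + k) (ψ + χ) p Λ = boundaryTerm b l ψ p Λ + boundaryTerm b k χ p Λ := by
  cases b <;> simp only [boundaryTerm, potential_add _ _ _ _ _ h, potentialDeriv_add _ _ _ _ _ h]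
    <;> ring

theorem boundaryTerm_smul (b : Variant) (c l : ℂ) (ψ : HalfLineL2) (p : ℝ) {Λ : ℝ} (h : 0 ≤ Λ) :
    boundaryTerm b (c * l) (c • ψ) p Λ = c * boundaryTerm b l ψ p Λ := by
  cases b <;> simp only [boundaryTerm, potential_smul _ _ _ _ h, potentialDeriv_smul _ _ _ _ h]
    <;> ring

/-- Power bounds for the data of `HasTail`. -/
def TailBound (A B g : ℝ → ℂ) (σ : ℝ) : Prop :=
  ∃ C : ℝ, 0 ≤ C ∧ ∀ p : ℝ, 1 ≤ p → ‖A p‖ ≤ C * p ^ (-1 / 2 - σ) ∧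
    ‖B p - p * A p‖ ≤ C * p ^ (1 / 2 - σ) ∧ ‖g p‖ ≤ C * p ^ (-3 / 2 - σ)

/-- Decay of the Wronskian of an element of the minimal relation with a tail. -/
theorem exists_wronskian_tail_le {b : Variant} {α : ℝ} {x u : HalfLineL2 × HalfLineL2} {l : ℂ}
    (hx : HasPotential b α x.1 x.2 l) {A B g : ℝ → ℂ} {σ : ℝ} (hσ : -1 < σ)
    (hu : HasTail b α u A B g) (hb : TailBound A B g σ) (h0 : bform x u = 0) :
    ∃ C : ℝ, 0 ≤ C ∧ ∀ᶠ p : ℝ in atTop, ‖((α : ℂ) - 1 / 4) *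
      (potentialDeriv b l x.1 p * (B p - p * A p) + potential b l x.1 p * A p)‖ ≤
        C * p ^ (-1 - σ) := by
  obtain ⟨Λ, hΛ, k, hk, hv, hg⟩ := hu
  obtain ⟨C, hC, hCb⟩ := hb
  set M := ∫ q, ‖x.2 q‖ ^ 2 ∂posMeasure with hM
  refine ⟨(M + C ^ 2 / (2 + 2 * σ)) / 2, ?_, ?_⟩
  · have : 0 ≤ M := integral_nonneg fun q => by positivity
    have : 0 < 2 + 2 * σ := by linarith
    positivity
  filter_upwards [eventually_ge_atTop Λ, eventually_ge_atTop 1] with p hp hp1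
  have hp0 : 0 < p := by linarith
  have hlim := tendsto_wronskian hx hk
  change Tendsto _ _ (𝓝 (bform x u)) at hlim
  rw [h0] at hlim
  have e1 : ((α : ℂ) - 1 / 4) *
      (potentialDeriv b l x.1 p * (B p - p * A p) + potential b l x.1 p * A p) =
      ((α : ℂ) - 1 / 4) * wronskian b l x.1 k u.1 p := by
    rw [wronskian, (hv p hp).1, (hv p hp).2]; ring
  rw [e1]
  have hi : Integrable (fun q => x.2 q * u.1 q - x.1 q * u.2 q) posMeasure :=
    (integrable_mul_Lp x.2 u.1).sub (integrable_mul_Lp x.1 u.2)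
  have green : ∀ R, 0 ≤ R → ((α : ℂ) - 1 / 4) * wronskian b l x.1 k u.1 R =
      ∫ q in (0 : ℝ)..R, (x.2 q * u.1 q - x.1 q * u.2 q) := by
    intro R hR
    rw [← integral_potential_sub b l k x.1 u.1 hR, ← intervalIntegral.integral_const_mul]
    refine intervalIntegral_congr_pos ?_ le_rfl hR
    unfold HasPotential at hx hk
    filter_upwards [hx, hk] with q e1 e2
    rw [e1, e2]; ring
  have hfull : ∫ q, (x.2 q * u.1 q - x.1 q * u.2 q) ∂posMeasure = 0 := by
    rw [integral_sub (integrable_mul_Lp _ _) (integrable_mul_Lp _ _)]; exact h0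
  -- Since `bform x u = 0`, the Green integral over `[0, p]` is minus the one over `]p, ∞[`, where
  -- `u.2` vanishes and `u.1` is the explicit tail.
  have e2 : ((α : ℂ) - 1 / 4) * wronskian b l x.1 k u.1 p =
      -∫ q in Ioi p, (x.2 q * u.1 q - x.1 q * u.2 q) := by
    rw [green p hp0.le]
    have := integral_pos_split hi hp0.le
    rw [hfull] at this
    exact eq_neg_of_add_eq_zero_left this.symm
  rw [e2, norm_neg]
  -- Up to a constant, the `L²` norm of `q^(-3/2-σ)` over `]p, ∞[`. Used as weight in the
  -- arithmetic-geometric mean below, it makes both terms of order `t`.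
  set t : ℝ := p ^ (-1 - σ) with ht
  have ht0 : 0 < t := Real.rpow_pos_of_pos hp0 _
  have hle : volume.restrict (Ioi p) ≤ posMeasure :=
    Measure.restrict_mono (Ioi_subset_Ioi hp0.le) le_rfl
  have i1 : Integrable (fun q => ‖x.2 q‖ ^ 2) (volume.restrict (Ioi p)) :=
    (integrable_norm_sq x.2).mono_measure hle
  have i2 : Integrable (fun q : ℝ => q ^ (-3 - 2 * σ)) (volume.restrict (Ioi p)) :=
    integrableOn_Ioi_rpow_of_lt (by linarith) hp0
  have v2 : ∫ q in Ioi p, q ^ (-3 - 2 * σ) = t ^ 2 / (2 + 2 * σ) := by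
    rw [integral_Ioi_rpow_of_lt (by linarith) hp0, ht, ← Real.rpow_natCast, ← Real.rpow_mul hp0.le]
    have h1 : (-3 - 2 * σ + 1) = -(2 + 2 * σ) := by ring
    have h2 : (-1 - σ) * ((2 : ℕ) : ℝ) = -(2 + 2 * σ) := by push_cast; ring
    rw [h1, h2, neg_div_neg_eq]
  have hσ' : 0 < 2 + 2 * σ := by linarith
  calc ‖∫ q in Ioi p, (x.2 q * u.1 q - x.1 q * u.2 q)‖
      ≤ ∫ q in Ioi p, (t / 2 * ‖x.2 q‖ ^ 2 + C ^ 2 / (2 * t) * q ^ (-3 - 2 * σ)) := by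
        refine norm_integral_le_of_norm_le ((i1.const_mul _).add (i2.const_mul _)) ?_
        filter_upwards [ae_mono hle hg, ae_restrict_mem measurableSet_Ioi] with q a1 hq
        have hq : p < q := hq
        have hq0 : 0 < q := hp0.trans hq
        obtain ⟨a2, a3⟩ := a1 (lt_of_le_of_lt hp hq)
        rw [a3, mul_zero, sub_zero, norm_mul, a2]
        have a4 := (hCb q (hp1.trans hq.le)).2.2
        have a5 : q ^ (-3 - 2 * σ) = (q ^ (-3 / 2 - σ)) ^ 2 := by
          rw [← Real.rpow_natCast, ← Real.rpow_mul hq0.le]; congr 1; push_cast; ring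
        rw [a5]
        set r := q ^ (-3 / 2 - σ)
        have a6 : ‖x.2 q‖ * ‖g q‖ ≤ ‖x.2 q‖ * (C * r) := by gcongr
        have a7 : ‖x.2 q‖ * (C * r) ≤ t / 2 * ‖x.2 q‖ ^ 2 + C ^ 2 / (2 * t) * r ^ 2 := by
          have : t / 2 * ‖x.2 q‖ ^ 2 + C ^ 2 / (2 * t) * r ^ 2 - ‖x.2 q‖ * (C * r) =
              (t * ‖x.2 q‖ - C * r) ^ 2 / (2 * t) := by field_simp; ring
          have : 0 ≤ (t * ‖x.2 q‖ - C * r) ^ 2 / (2 * t) := by positivity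
          linarith
        exact a6.trans a7
    _ = t / 2 * (∫ q in Ioi p, ‖x.2 q‖ ^ 2) + C ^ 2 / (2 * t) * (t ^ 2 / (2 + 2 * σ)) := by
        rw [integral_add (i1.const_mul _) (i2.const_mul _), integral_const_mul,
          integral_const_mul, v2]
    _ ≤ t / 2 * M + C ^ 2 / (2 * t) * (t ^ 2 / (2 + 2 * σ)) := by
        have h3 : ∫ q in Ioi p, ‖x.2 q‖ ^ 2 ≤ M :=
          setIntegral_mono_set (integrable_norm_sq x.2)
            (Eventually.of_forall fun q => by positivity) (Ioi_subset_Ioi hp0.le).eventuallyLE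
        gcongr
    _ = _ := by field_simp

/-- The boundary term of an element of the minimal domain vanishes at infinity. -/
theorem tendsto_boundaryTerm_minRel {b : Variant} {α : ℝ} {x u w : HalfLineL2 × HalfLineL2} {l : ℂ}
    (hx : HasPotential b α x.1 x.2 l) (hmin : x ∈ minRel b α) {A B g A' B' g' : ℝ → ℂ} {σ τ : ℝ}
    (hσ : -1 < σ) (hτ : -1 < τ) (hστ : -1 / 2 < σ + τ)
    (hu : HasTail b α u A B g) (hb : TailBound A B g σ)
    (hw : HasTail b α w A' B' g') (hb' : TailBound A' B' g' τ) (huw : bform u w ≠ 0) (p : ℝ) :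
    Tendsto (boundaryTerm b l x.1 p) atTop (𝓝 0) := by
  have hmin' := mem_bilinAdjoint_iff_bform.1 hmin
  obtain ⟨C, hC, hW⟩ := exists_wronskian_tail_le hx hσ hu hb (hmin' u hu.mem_maxRel)
  obtain ⟨C', hC', hW'⟩ := exists_wronskian_tail_le hx hτ hw hb' (hmin' w hw.mem_maxRel)
  obtain ⟨D, hD, hDb⟩ := hb
  obtain ⟨D', hD', hDb'⟩ := hb'
  obtain ⟨Λ, _, k, hk, hv, _⟩ := hu
  obtain ⟨Λ', _, k', hk', hv', _⟩ := hw
  have hlim := tendsto_wronskian hk hk'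
  change Tendsto _ _ (𝓝 (bform u w)) at hlim
  have hlim' := hlim.inv₀ huw
  set E : ℝ := C * D' + C' * D with hE
  have hE0 : 0 ≤ E := by positivity
  -- Cramer's rule: the small Wronskians of `x` with `u` and with `w` form a linear system for `v'`
  -- and `v`, whose determinant is the Wronskian of `u` and `w` and tends to a non-zero limit. The
  -- condition `-1/2 < σ + τ` makes the resulting power for `v` and `q v'` negative.
  have bound : ∀ᶠ q : ℝ in atTop,
      ‖(((α : ℂ) - 1 / 4) * wronskian b k u.1 k' w.1 q) * potentialDeriv b l x.1 q‖ ≤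
        E * q ^ (-3 / 2 - (σ + τ)) ∧
      ‖(((α : ℂ) - 1 / 4) * wronskian b k u.1 k' w.1 q) * potential b l x.1 q‖ ≤
        E * q ^ (-1 / 2 - (σ + τ)) := by
    filter_upwards [hW, hW', eventually_ge_atTop 1, eventually_ge_atTop Λ, eventually_ge_atTop Λ']
      with q h1 h2 hq1 hqΛ hqΛ'
    have hq0 : 0 < q := by linarith
    obtain ⟨a1, a2, _⟩ := hDb q hq1
    obtain ⟨a1', a2', _⟩ := hDb' q hq1
    set X := ((α : ℂ) - 1 / 4) *
      (potentialDeriv b l x.1 q * (B q - q * A q) + potential b l x.1 q * A q) with hX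
    set X' := ((α : ℂ) - 1 / 4) *
      (potentialDeriv b l x.1 q * (B' q - q * A' q) + potential b l x.1 q * A' q) with hX'
    rw [wronskian, (hv q hqΛ).1, (hv q hqΛ).2, (hv' q hqΛ').1, (hv' q hqΛ').2]
    have pw1 : q ^ (-1 - σ) * q ^ (-1 / 2 - τ) = q ^ (-3 / 2 - (σ + τ)) := by
      rw [← Real.rpow_add hq0]; congr 1; ring
    have pw2 : q ^ (-1 - τ) * q ^ (-1 / 2 - σ) = q ^ (-3 / 2 - (σ + τ)) := by
      rw [← Real.rpow_add hq0]; congr 1; ring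
    have pw3 : q ^ (-1 - σ) * q ^ (1 / 2 - τ) = q ^ (-1 / 2 - (σ + τ)) := by
      rw [← Real.rpow_add hq0]; congr 1; ring
    have pw4 : q ^ (-1 - τ) * q ^ (1 / 2 - σ) = q ^ (-1 / 2 - (σ + τ)) := by
      rw [← Real.rpow_add hq0]; congr 1; ring
    constructor
    · have e : (((α : ℂ) - 1 / 4) * (-A q * (B' q - q * A' q) - (B q - q * A q) * -A' q)) *
          potentialDeriv b l x.1 q = X * A' q - X' * A q := by
        rw [hX, hX']; ring
      rw [e]
      calc ‖X * A' q - X' * A q‖ ≤ ‖X‖ * ‖A' q‖ + ‖X'‖ * ‖A q‖ := by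
            exact (norm_sub_le _ _).trans (add_le_add (norm_mul _ _).le (norm_mul _ _).le)
        _ ≤ (C * q ^ (-1 - σ)) * (D' * q ^ (-1 / 2 - τ)) +
            (C' * q ^ (-1 - τ)) * (D * q ^ (-1 / 2 - σ)) := by gcongr
        _ = C * D' * (q ^ (-1 - σ) * q ^ (-1 / 2 - τ)) +
            C' * D * (q ^ (-1 - τ) * q ^ (-1 / 2 - σ)) := by ring
        _ = _ := by rw [pw1, pw2]; ring
    · have e : (((α : ℂ) - 1 / 4) * (-A q * (B' q - q * A' q) - (B q - q * A q) * -A' q)) *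
          potential b l x.1 q = X' * (B q - q * A q) - X * (B' q - q * A' q) := by
        rw [hX, hX']; ring
      rw [e]
      calc ‖X' * (B q - q * A q) - X * (B' q - q * A' q)‖
          ≤ ‖X'‖ * ‖B q - q * A q‖ + ‖X‖ * ‖B' q - q * A' q‖ := by
            exact (norm_sub_le _ _).trans (add_le_add (norm_mul _ _).le (norm_mul _ _).le)
        _ ≤ (C' * q ^ (-1 - τ)) * (D * q ^ (1 / 2 - σ)) +
            (C * q ^ (-1 - σ)) * (D' * q ^ (1 / 2 - τ)) := by gcongr
        _ = C * D' * (q ^ (-1 - σ) * q ^ (1 / 2 - τ)) +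
            C' * D * (q ^ (-1 - τ) * q ^ (1 / 2 - σ)) := by ring
        _ = _ := by rw [pw3, pw4]; ring
  have pow0 : ∀ s : ℝ, s < 0 → Tendsto (fun q : ℝ => E * q ^ s) atTop (𝓝 0) := fun s hs => by
    have := (tendsto_rpow_neg_atTop (show 0 < -s by linarith)).const_mul E
    simpa using this
  have cancel : ∀ f : ℝ → ℂ, Tendsto (fun q => (((α : ℂ) - 1 / 4) *
      wronskian b k u.1 k' w.1 q) * f q) atTop (𝓝 0) → Tendsto f atTop (𝓝 0) := by
    intro f hf
    have h1 := hlim'.mul hf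
    rw [mul_zero] at h1
    refine h1.congr' ?_
    filter_upwards [hlim.eventually_ne huw] with q hq
    rw [inv_mul_cancel_left₀ hq]
  cases b
  · have h1 : Tendsto (potentialDeriv .D l x.1) atTop (𝓝 0) := by
      refine cancel _ (squeeze_zero_norm' (bound.mono fun q hq => hq.1) (pow0 _ (by linarith)))
    have h2 := h1.const_mul (p : ℂ)
    rw [mul_zero] at h2
    exact h2
  · have h1 : Tendsto (potential .N l x.1) atTop (𝓝 0) :=
      cancel _ (squeeze_zero_norm' (bound.mono fun q hq => hq.2) (pow0 _ (by linarith)))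
    have h2 : Tendsto (fun q : ℝ => (q : ℂ) * potentialDeriv .N l x.1 q) atTop (𝓝 0) := by
      refine cancel _ (squeeze_zero_norm' ?_ (pow0 (-1 / 2 - (σ + τ)) (by linarith)))
      filter_upwards [bound, eventually_gt_atTop 0] with q hq hq0
      rw [mul_left_comm, norm_mul, Complex.norm_real, Real.norm_of_nonneg hq0.le]
      have e : q ^ (-1 / 2 - (σ + τ)) = q * q ^ (-3 / 2 - (σ + τ)) := by
        nth_rewrite 2 [← Real.rpow_one q]
        rw [← Real.rpow_add hq0]; congr 1; ring
      rw [e]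
      calc q * _ ≤ q * (E * q ^ (-3 / 2 - (σ + τ))) := by gcongr; exact hq.1
        _ = _ := by ring
    have h3 := h1.sub h2
    rw [sub_zero] at h3
    exact h3

/-! ## The maximal operator in the momentum representation -/

theorem maxRel_ext {b : Variant} {α : ℝ} {x y y' : HalfLineL2} (h : (x, y) ∈ maxRel b α)
    (h' : (x, y') ∈ maxRel b α) : y = y' := by
  have := (maxRel b α).sub_mem h h'
  rw [Prod.mk_sub_mk, sub_self] at this
  exact sub_eq_zero.1 (maxRel_single_valued _ this)

/-- Membership in the minimal domain is from here on proved through the adjoint relation, without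
approximation by core elements. -/
theorem mem_domain_momMin {b : Variant} {α : ℝ} (hα : (α : ℂ) - 1 / 4 ≠ 0) {x : HalfLineL2} :
    x ∈ (momMin b α).domain ↔ ∃ y, (x, y) ∈ minRel b α := by
  rw [LinearPMap.mem_domain_iff, graph_momMin hα]

theorem mem_minRel_of_domain {b : Variant} {α : ℝ} (hα : (α : ℂ) - 1 / 4 ≠ 0) {x y : HalfLineL2}
    (hx : x ∈ (momMin b α).domain) (hxy : (x, y) ∈ maxRel b α) : (x, y) ∈ minRel b α := by
  obtain ⟨y', hy'⟩ := (mem_domain_momMin hα).1 hx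
  rwa [maxRel_ext hxy (bilinAdjoint_maxRel_le hα hy')]

theorem sup_span_eq_sup_span_singleton {D : Submodule ℂ HalfLineL2} {S : Set HalfLineL2}
    {u : HalfLineL2} {k : ℂ} (hS : S.Nonempty) (hk : k ≠ 0) (h : ∀ s ∈ S, s - k • u ∈ D) :
    D ⊔ Submodule.span ℂ S = D ⊔ Submodule.span ℂ {u} := by
  refine le_antisymm (sup_le le_sup_left (Submodule.span_le.2 fun s hs => ?_))
    (sup_le le_sup_left (Submodule.span_le.2 ?_))
  · rw [SetLike.mem_coe, ← sub_add_cancel s (k • u)]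
    exact Submodule.add_mem _ (Submodule.mem_sup_left (h s hs))
      (Submodule.mem_sup_right (Submodule.smul_mem _ _ (Submodule.mem_span_singleton_self u)))
  · rw [singleton_subset_iff]
    obtain ⟨s, hs⟩ := hS
    have e : u = k⁻¹ • s - k⁻¹ • (s - k • u) := by
      rw [smul_sub, smul_smul, inv_mul_cancel₀ hk, one_smul, sub_sub_cancel]
    rw [SetLike.mem_coe, e]
    exact Submodule.sub_mem _
      (Submodule.mem_sup_right (Submodule.smul_mem _ _ (Submodule.subset_span hs)))
      (Submodule.mem_sup_left (Submodule.smul_mem _ _ (h s hs)))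

/-- All elements of `P` have the same tail, and `ct` is the counterterm of this tail. -/
structure IsTailFamily (b : Variant) (α : ℝ) (P : Set HalfLineL2) (ct : ℝ → ℝ → ℂ)
    (A B g : ℝ → ℂ) : Prop where
  nonempty : P.Nonempty
  hasTail : ∀ ψ ∈ P, ∃ h, HasTail b α (ψ, h) A B g
  counterterm_eq : ∀ p Λ, 0 < Λ → ct p Λ = tailCounterterm b A B p Λ

theorem IsTailFamily.sub_mem {b : Variant} {α : ℝ} (hα : (α : ℂ) - 1 / 4 ≠ 0)
    {P : Set HalfLineL2} {ct : ℝ → ℝ → ℂ}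
    {A B g : ℝ → ℂ} (hP : IsTailFamily b α P ct A B g) {ψ χ : HalfLineL2} (hψ : ψ ∈ P)
    (hχ : χ ∈ P) : ψ - χ ∈ (momMin b α).domain := by
  obtain ⟨h, hh⟩ := hP.hasTail ψ hψ
  obtain ⟨k, hk⟩ := hP.hasTail χ hχ
  exact (mem_domain_momMin hα).2 ⟨_, hh.sub_mem_minRel hk⟩

theorem IsTailFamily.sup_span {b : Variant} {α : ℝ} (hα : (α : ℂ) - 1 / 4 ≠ 0)
    {P : Set HalfLineL2} {ct : ℝ → ℝ → ℂ}
    {A B g : ℝ → ℂ} (hP : IsTailFamily b α P ct A B g) {ψ : HalfLineL2} (hψ : ψ ∈ P) :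
    (momMin b α).domain ⊔ Submodule.span ℂ P =
      (momMin b α).domain ⊔ Submodule.span ℂ {ψ} :=
  sup_span_eq_sup_span_singleton hP.nonempty one_ne_zero fun s hs => by
    rw [one_smul]; exact hP.sub_mem hα hs hψ

/-- Two tail families with non-vanishing boundary form. -/
structure IsBoundaryPair (b : Variant) (α : ℝ) (P M : Set HalfLineL2) (ctP ctM : ℝ → ℝ → ℂ)
    (A B g A' B' g' : ℝ → ℂ) : Prop where
  ne_zero : (α : ℂ) - 1 / 4 ≠ 0
  left : IsTailFamily b α P ctP A B g
  right : IsTailFamily b α M ctM A' B' g'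
  bounds : ∃ σ τ : ℝ, -1 < σ ∧ -1 < τ ∧ -1 / 2 < σ + τ ∧ TailBound A B g σ ∧ TailBound A' B' g' τ
  form : ∃ k : ℂ, k ≠ 0 ∧ ∀ᶠ p in atTop, ((α : ℂ) - 1 / 4) * (B p * A' p - A p * B' p) = k

section BoundaryPair

variable {b : Variant} {α : ℝ} {P M : Set HalfLineL2} {ctP ctM : ℝ → ℝ → ℂ}
  {A B g A' B' g' : ℝ → ℂ}

theorem IsBoundaryPair.bform_ne_zero (H : IsBoundaryPair b α P M ctP ctM A B g A' B' g')
    {x y : HalfLineL2 × HalfLineL2} (hx : HasTail b α x A B g) (hy : HasTail b α y A' B' g') :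
    bform x y ≠ 0 := by
  obtain ⟨k, hk, hk'⟩ := H.form
  rwa [hx.bform_eq hy hk']

theorem HasTail.boundaryTerm_eq {x : HalfLineL2 × HalfLineL2} (hx : HasTail b α x A B g) :
    ∃ l, HasPotential b α x.1 x.2 l ∧ ∀ p : ℝ, ∀ᶠ Λ in atTop,
      boundaryTerm b l x.1 p Λ = tailCounterterm b A B p Λ := by
  obtain ⟨N, _, l, hl, hv, _⟩ := hx
  refine ⟨l, hl, fun p => ?_⟩
  filter_upwards [eventually_ge_atTop N] with Λ hΛ
  cases b
  · simp only [boundaryTerm, tailCounterterm, (hv Λ hΛ).1]; ring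
  · simp only [boundaryTerm, tailCounterterm, (hv Λ hΛ).1, (hv Λ hΛ).2]; ring

/-- The boundary term is additive along the decomposition of `ψ`. Its minimal part tends to `0`, and
each tail part equals its counterterm for large `Λ`, so exactly the potential remains. -/
theorem IsBoundaryPair.exists_limit (H : IsBoundaryPair b α P M ctP ctM A B g A' B' g')
    {ψ ψp ψm : HalfLineL2} {cp cm : ℂ} (hp : ψp ∈ P) (hm : ψm ∈ M)
    (hψ : ψ - cp • ψp - cm • ψm ∈ (momMin b α).domain) :
    ∃ h l, HasPotential b α ψ h l ∧ ∀ p : ℝ, 0 < p →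
      Tendsto (fun Λ : ℝ => (∫ q in (0 : ℝ)..Λ, (kernel b p q : ℂ) * ψ q)
        + cp * ctP p Λ + cm * ctM p Λ) atTop (𝓝 (potential b l ψ p)) := by
  obtain ⟨hρ, hmin⟩ := (mem_domain_momMin H.ne_zero).1 hψ
  obtain ⟨h₁, t₁⟩ := H.left.hasTail ψp hp
  obtain ⟨h₂, t₂⟩ := H.right.hasTail ψm hm
  obtain ⟨l₁, P₁, bt₁⟩ := t₁.boundaryTerm_eq
  obtain ⟨l₂, P₂, bt₂⟩ := t₂.boundaryTerm_eq
  obtain ⟨l₀, P₀⟩ := bilinAdjoint_maxRel_le H.ne_zero hmin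
  obtain ⟨σ, τ, hσ, hτ, hστ, hb, hb'⟩ := H.bounds
  have hsum : (ψ - cp • ψp - cm • ψm) + cp • ψp + cm • ψm = ψ := by abel
  have hP := (P₀.add (P₁.smul cp)).add (P₂.smul cm)
  simp only [hsum] at hP
  refine ⟨_, _, hP, fun p hp0 => ?_⟩
  have lim₀ := tendsto_boundaryTerm_minRel P₀ hmin hσ hτ hστ t₁ hb t₂ hb'
    (H.bform_ne_zero t₁ t₂) p
  have lim := (tendsto_const_nhds (x := potential b (l₀ + cp * l₁ + cm * l₂) ψ p)).sub lim₀
  rw [sub_zero] at lim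
  refine lim.congr' ?_
  filter_upwards [bt₁ p, bt₂ p, eventually_ge_atTop p] with Λ e₁ e₂ hΛ
  have hΛ0 : 0 < Λ := hp0.trans_le hΛ
  have e₃ : boundaryTerm b (l₀ + cp * l₁ + cm * l₂) ψ p Λ =
      boundaryTerm b l₀ (ψ - cp • ψp - cm • ψm) p Λ +
        cp * boundaryTerm b l₁ ψp p Λ + cm * boundaryTerm b l₂ ψm p Λ := by
    conv_lhs => rw [← hsum]
    rw [boundaryTerm_add _ _ _ _ _ _ hΛ0.le, boundaryTerm_add _ _ _ _ _ _ hΛ0.le,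
      boundaryTerm_smul _ _ _ _ _ hΛ0.le, boundaryTerm_smul _ _ _ _ _ hΛ0.le]
  rw [integral_kernel_truncated b (l₀ + cp * l₁ + cm * l₂) ψ hp0.le hΛ, e₃,
    H.left.counterterm_eq p Λ hΛ0, H.right.counterterm_eq p Λ hΛ0, e₁, e₂]
  ring

theorem IsBoundaryPair.momMaxDomain_eq (H : IsBoundaryPair b α P M ctP ctM A B g A' B' g')
    {ψp ψm : HalfLineL2} (hp : ψp ∈ P) (hm : ψm ∈ M) :
    momMaxDomain b α P M =
      (momMin b α).domain ⊔ Submodule.span ℂ {ψp} ⊔ Submodule.span ℂ {ψm} := by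
  rw [momMaxDomain, H.left.sup_span H.ne_zero hp, sup_right_comm, H.right.sup_span H.ne_zero hm,
    sup_right_comm]

/-- The renormalized limit exists on the whole domain and yields a pair in `maxRel`. Since `maxRel`
is single-valued, the coefficients and representatives used in the decomposition do not affect the
value. -/
theorem IsBoundaryPair.mem_graph_momMaxOf (H : IsBoundaryPair b α P M ctP ctM A B g A' B' g')
    {x y : HalfLineL2} : (x, y) ∈ (momMaxOf b α P M ctP ctM).graph ↔
      x ∈ momMaxDomain b α P M ∧ (x, y) ∈ maxRel b α := by
  refine mem_graph_operatorOn _ maxRel_single_valued ?_ ?_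
  · intro x hx
    obtain ⟨ψp, hp⟩ := H.left.nonempty
    obtain ⟨ψm, hm⟩ := H.right.nonempty
    rw [H.momMaxDomain_eq hp hm] at hx
    obtain ⟨y, hy, z, hz, rfl⟩ := Submodule.mem_sup.1 hx
    obtain ⟨d, hd, z', hz', rfl⟩ := Submodule.mem_sup.1 hy
    obtain ⟨cp, rfl⟩ := Submodule.mem_span_singleton.1 hz'
    obtain ⟨cm, rfl⟩ := Submodule.mem_span_singleton.1 hz
    have hd' : d + cp • ψp + cm • ψm - cp • ψp - cm • ψm ∈ (momMin b α).domain := by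
      have : d + cp • ψp + cm • ψm - cp • ψp - cm • ψm = d := by abel
      rwa [this]
    obtain ⟨h, l, hl, lim⟩ := H.exists_limit hp hm hd'
    refine ⟨h, ⟨l, hl⟩, cp, cm, ⟨ψp, hp, ψm, hm, hd'⟩, ?_⟩
    unfold HasPotential at hl
    filter_upwards [hl, ae_restrict_mem measurableSet_Ioi] with p e hp0
    exact ⟨_, lim p hp0, e⟩
  · rintro x hx y ⟨cp, cm, ⟨ψp, hp, ψm, hm, hd⟩, hy⟩
    obtain ⟨h, l, hl, lim⟩ := H.exists_limit hp hm hd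
    refine ⟨l, ?_⟩
    unfold HasPotential
    filter_upwards [hy, ae_restrict_mem measurableSet_Ioi] with p hp' hp0
    obtain ⟨l', lim', e⟩ := hp'
    rw [e, tendsto_nhds_unique lim' (lim p hp0)]

/-- The graph of a restriction of the maximal operator to an extension of the minimal domain. -/
theorem IsBoundaryPair.mem_graph_domRestrict
    (H : IsBoundaryPair b α P M ctP ctM A B g A' B' g') {S : Submodule ℂ HalfLineL2}
    (hS : S ≤ momMaxDomain b α P M) {x y : HalfLineL2} :
    (x, y) ∈ ((momMaxOf b α P M ctP ctM).domRestrict S).graph ↔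
      x ∈ S ∧ (x, y) ∈ maxRel b α := by
  rw [Bessel.mem_graph_domRestrict, H.mem_graph_momMaxOf]
  exact ⟨fun h => ⟨h.1, h.2.2⟩, fun h => ⟨h.1, hS h.1, h.2⟩⟩

end BoundaryPair

/-! ## Self-adjointness -/

/-- Complex conjugation of pairs. -/
def starPair (x : HalfLineL2 × HalfLineL2) : HalfLineL2 × HalfLineL2 := (star x.1, star x.2)

theorem starPair_starPair (x : HalfLineL2 × HalfLineL2) : starPair (starPair x) = x := by
  simp [starPair]

theorem starPair_add (x y : HalfLineL2 × HalfLineL2) :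
    starPair (x + y) = starPair x + starPair y := by
  simp [starPair, Lp_star_add]

theorem starPair_smul (c : ℂ) (x : HalfLineL2 × HalfLineL2) :
    starPair (c • x) = star c • starPair x := by
  simp [starPair, Lp_star_smul]

theorem pair_star_star (f g : HalfLineL2) : pair (star f) (star g) = star (pair f g) := by
  rw [← inner_eq_pair, pair_comm f g, ← star_star g, ← inner_eq_pair, star_star]
  exact (inner_conj_symm _ _).symm

theorem bform_starPair (x y : HalfLineL2 × HalfLineL2) :
    bform (starPair x) (starPair y) = star (bform x y) := by
  simp [bform, starPair, pair_star_star]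

theorem intervalIntegral_star {f : ℝ → ℝ} (ψ : HalfLineL2) {p : ℝ} (hp : 0 ≤ p) :
    ∫ q in (0 : ℝ)..p, (f q : ℂ) * (star ψ) q = star (∫ q in (0 : ℝ)..p, (f q : ℂ) * ψ q) := by
  have e : ∫ q in (0 : ℝ)..p, (f q : ℂ) * (star ψ) q =
      ∫ q in (0 : ℝ)..p, (starRingEnd ℂ) ((f q : ℂ) * ψ q) := by
    refine intervalIntegral_congr_pos ?_ le_rfl hp
    filter_upwards [Lp.coeFn_star ψ] with q hq
    rw [hq]; simp
  rw [e]
  simp only [intervalIntegral.integral_of_le hp]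
  exact integral_conj

theorem prim_star (ψ : HalfLineL2) {p : ℝ} (hp : 0 ≤ p) : prim (star ψ) p = star (prim ψ p) := by
  simpa [prim] using intervalIntegral_star (f := fun _ => 1) ψ hp

theorem primMul_star (ψ : HalfLineL2) {p : ℝ} (hp : 0 ≤ p) :
    primMul (star ψ) p = star (primMul ψ p) :=
  intervalIntegral_star (f := fun q => q) ψ hp

theorem starPair_mem_maxRel {b : Variant} {α : ℝ} {x : HalfLineL2 × HalfLineL2}
    (hx : x ∈ maxRel b α) : starPair x ∈ maxRel b α := by
  obtain ⟨l, hl⟩ := hx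
  refine ⟨star l, ?_⟩
  unfold HasPotential at *
  filter_upwards [hl, Lp.coeFn_star x.1, Lp.coeFn_star x.2, ae_restrict_mem measurableSet_Ioi]
    with p h1 h2 h3 hp
  have hp : 0 < p := hp
  simp only [starPair]
  rw [h2, h3, Pi.star_apply, Pi.star_apply, h1]
  simp only [potential, prim_star _ hp.le, primMul_star _ hp.le]
  simp

theorem starPair_mem_minRel {b : Variant} {α : ℝ} {x : HalfLineL2 × HalfLineL2}
    (hx : x ∈ minRel b α) : starPair x ∈ minRel b α := by
  rw [mem_bilinAdjoint_iff_bform] at hx ⊢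
  intro y hy
  rw [← starPair_starPair y, bform_starPair, hx _ (starPair_mem_maxRel hy), star_zero]

/-- If `f` is orthogonal to the core, then `(0, star f)` lies in the adjoint of the core operator,
that is in `maxRel`, which is single-valued. -/
theorem dense_momCore {b : Variant} {α : ℝ} (hα : (α : ℂ) - 1 / 4 ≠ 0) :
    Dense (momCore b : Set HalfLineL2) := by
  rw [Submodule.dense_iff_topologicalClosure_eq_top, Submodule.topologicalClosure_eq_top_iff,
    Submodule.eq_bot_iff]
  intro f hf
  rw [Submodule.mem_orthogonal'] at hf
  have h1 : (0, star f) ∈ bilinAdjoint (momPre b α).graph := by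
    rintro ⟨φ, k⟩ hφ
    have := hf φ (mem_graph_momPre.1 hφ).1
    rw [inner_eq_pair] at this
    simp [this]
  rw [bilinAdjoint_momPre hα] at h1
  have h2 := Lp_star_smul 0 (0 : HalfLineL2)
  rw [zero_smul, star_zero, zero_smul] at h2
  rw [← star_star f, maxRel_single_valued _ h1, h2]

theorem bilinAdjoint_minRel {b : Variant} {α : ℝ} (hα : (α : ℂ) - 1 / 4 ≠ 0) :
    bilinAdjoint (minRel b α) = maxRel b α := by
  rw [bilinAdjoint_bilinAdjoint, ← bilinAdjoint_momPre hα]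
  exact (isClosed_bilinAdjoint _).submodule_topologicalClosure_eq

theorem momCore_le_domain {b : Variant} {α : ℝ} : momCore b ≤ (momMin b α).domain :=
  (LinearPMap.le_closure (momPre b α)).1

/-- A restriction of the maximal operator to the sum of the minimal domain and a line spanned by
an element that is conjugation-invariant up to a factor is self-adjoint. -/
theorem isSelfAdjoint_of_graph {b : Variant} {α : ℝ} (hα : (α : ℂ) - 1 / 4 ≠ 0)
    {u w : HalfLineL2 × HalfLineL2} (hu : u ∈ maxRel b α) (hw : w ∈ maxRel b α)
    (huw : bform u w ≠ 0) {θ : ℂ} (hθ : star u.1 - θ • u.1 ∈ (momMin b α).domain)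
    {T : HalfLineL2 →ₗ.[ℂ] HalfLineL2}
    (hT : ∀ x y, (x, y) ∈ T.graph ↔
      x ∈ (momMin b α).domain ⊔ Submodule.span ℂ {u.1} ∧ (x, y) ∈ maxRel b α) :
    IsSelfAdjoint T := by
  have mem : ∀ z, z ∈ T.graph ↔ ∃ d ∈ minRel b α, ∃ t : ℂ, z = d + t • u := by
    rintro ⟨x, y⟩
    rw [hT]
    constructor
    · rintro ⟨hx, hxy⟩
      obtain ⟨d, hd, v, hv, rfl⟩ := Submodule.mem_sup.1 hx
      obtain ⟨t, rfl⟩ := Submodule.mem_span_singleton.1 hv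
      obtain ⟨k, hk⟩ := (mem_domain_momMin hα).1 hd
      refine ⟨(d, k), hk, t, ?_⟩
      have h1 : (d, k) + t • u ∈ maxRel b α :=
        (maxRel b α).add_mem (bilinAdjoint_maxRel_le hα hk) ((maxRel b α).smul_mem _ hu)
      exact Prod.ext rfl (maxRel_ext hxy h1)
    · rintro ⟨d, hd, t, h⟩
      have h1 : d + t • u ∈ maxRel b α :=
        (maxRel b α).add_mem (bilinAdjoint_maxRel_le hα hd) ((maxRel b α).smul_mem _ hu)
      rw [← h] at h1
      refine ⟨?_, h1⟩
      have h2 : x = d.1 + t • u.1 := congrArg Prod.fst h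
      rw [h2]
      exact Submodule.add_mem _ (Submodule.mem_sup_left ((mem_domain_momMin hα).2 ⟨d.2, hd⟩))
        (Submodule.mem_sup_right (Submodule.smul_mem _ _ (Submodule.mem_span_singleton_self _)))
  have hstar : starPair u - θ • u ∈ minRel b α := by
    refine mem_minRel_of_domain hα hθ ?_
    exact (maxRel b α).sub_mem (starPair_mem_maxRel hu) ((maxRel b α).smul_mem _ hu)
  -- Conjugation invariance of the graph is what turns the bilinear adjoint computed below into the
  -- Hilbert space adjoint.
  have mem_star : ∀ z ∈ T.graph, starPair z ∈ T.graph := by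
    intro z hz
    obtain ⟨d, hd, t, rfl⟩ := (mem z).1 hz
    refine (mem _).2 ⟨starPair d + star t • (starPair u - θ • u),
      Submodule.add_mem _ (starPair_mem_minRel hd) (Submodule.smul_mem _ _ hstar), star t * θ, ?_⟩
    rw [starPair_add, starPair_smul, smul_sub, smul_smul]; abel
  have hdense : Dense (T.domain : Set HalfLineL2) := by
    refine (dense_momCore (b := b) hα).mono fun x hx => ?_
    obtain ⟨k, hk⟩ := (mem_domain_momMin hα).1 (momCore_le_domain (α := α) hx)
    exact LinearPMap.mem_domain_of_mem_graph
      ((mem (x, k)).2 ⟨(x, k), hk, 0, by rw [zero_smul, add_zero]⟩)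
  -- The graph is its own annihilator. It is isotropic because the form is alternating; conversely,
  -- if `z` annihilates `u`, then subtracting the multiple of `u` dictated by `w` leaves an element
  -- annihilating both `u` and `w`, which is minimal.
  have hbil : ∀ z, z ∈ T.graph ↔ ∀ y ∈ T.graph, bform y z = 0 := by
    intro z
    constructor
    · intro hz y hy
      obtain ⟨d, hd, t, rfl⟩ := (mem y).1 hy
      obtain ⟨e, he, s, rfl⟩ := (mem z).1 hz
      have hd' := mem_bilinAdjoint_iff_bform.1 hd
      have he' := mem_bilinAdjoint_iff_bform.1 he
      have hem : e + s • u ∈ maxRel b α :=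
        (maxRel b α).add_mem (bilinAdjoint_maxRel_le hα he) ((maxRel b α).smul_mem _ hu)
      rw [bform_add_left, hd' _ hem, bform_smul_left, bform_swap, bform_add_left, bform_smul_left,
        bform_self, he' _ hu]
      simp
    · intro hz
      have h1 : z ∈ maxRel b α := by
        rw [← bilinAdjoint_minRel hα, mem_bilinAdjoint_iff_bform]
        intro y hy
        rw [bform_swap, hz y ((mem y).2 ⟨y, hy, 0, by rw [zero_smul, add_zero]⟩), neg_zero]
      have h2 : bform z u = 0 := by
        rw [bform_swap, hz u ((mem u).2 ⟨0, Submodule.zero_mem _, 1, by rw [one_smul, zero_add]⟩),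
          neg_zero]
      refine (mem z).2 ⟨z - (bform z w / bform u w) • u, ?_, bform z w / bform u w, by abel⟩
      refine mem_minRel_of_bform ((maxRel b α).sub_mem h1 ((maxRel b α).smul_mem _ hu)) hu hw huw
        ?_ ?_
      · rw [bform_sub_left, bform_smul_left, bform_self, h2]; ring
      · rw [bform_sub_left, bform_smul_left, div_mul_cancel₀ _ huw, sub_self]
  rw [LinearPMap.isSelfAdjoint_def]
  refine LinearPMap.eq_of_eq_graph ?_
  rw [LinearPMap.adjoint_graph_eq_graph_adjoint hdense]
  ext z
  rw [Submodule.mem_adjoint_iff, hbil z]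
  constructor
  · intro h y hy
    have := h (star y.1) (star y.2) (mem_star y hy)
    rw [inner_eq_pair, inner_eq_pair, star_star, star_star] at this
    exact this
  · intro h a c hac
    rw [inner_eq_pair, inner_eq_pair]
    exact h _ (mem_star _ hac)

/-! ## Power and logarithmic tails -/

theorem norm_ofReal_cpow {p : ℝ} (hp : 0 < p) (z : ℂ) : ‖(p : ℂ) ^ z‖ = p ^ z.re :=
  Complex.norm_cpow_eq_rpow_re_of_pos hp z

theorem star_ofReal_cpow {p : ℝ} (hp : 0 < p) (z : ℂ) :
    (starRingEnd ℂ) ((p : ℂ) ^ z) = (p : ℂ) ^ (starRingEnd ℂ z) := by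
  rw [Complex.cpow_conj _ _ (by rw [Complex.arg_ofReal_of_nonneg hp.le]; exact Real.pi_ne_zero.symm),
    Complex.conj_ofReal]

theorem hasDerivAt_ofReal_cpow_div {p : ℝ} (hp : 0 < p) {z w : ℂ} (hz : z ≠ 0) (hw : w = z - 1) :
    HasDerivAt (fun y : ℝ => (y : ℂ) ^ z / z) ((p : ℂ) ^ w) p := by
  subst hw
  have := hasDerivAt_ofReal_cpow_const' hp.ne' (r := z - 1)
    (fun h => hz (by linear_combination h))
  simpa using this

/-- A primitive of `p^(-3/2-s)`. -/
def powA (s : ℂ) (p : ℝ) : ℂ := (p : ℂ) ^ (-1 / 2 - s) / (-1 / 2 - s)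

/-- A primitive of `p^(-1/2-s)`. -/
def powB (s : ℂ) (p : ℝ) : ℂ := (p : ℂ) ^ (1 / 2 - s) / (1 / 2 - s)

/-- The tail `p^(-3/2-s)`. -/
def powG (s : ℂ) (p : ℝ) : ℂ := (p : ℂ) ^ (-3 / 2 - s)

theorem ofReal_mul_cpow {p : ℝ} (hp : 0 < p) {z w : ℂ} (h : w = z + 1) :
    (p : ℂ) * (p : ℂ) ^ z = (p : ℂ) ^ w := by
  rw [h, Complex.cpow_add _ _ (Complex.ofReal_ne_zero.2 hp.ne'), Complex.cpow_one, mul_comm]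

theorem half_sub_ne {s : ℂ} (h1 : s ≠ 1 / 2) : 1 / 2 - s ≠ 0 := fun h =>
  h1 (by linear_combination -h)

theorem neg_half_sub_ne {s : ℂ} (h2 : s ≠ -1 / 2) : -1 / 2 - s ≠ 0 := fun h =>
  h2 (by linear_combination -h)

theorem half_add_ne {s : ℂ} (h2 : s ≠ -1 / 2) : 1 / 2 + s ≠ 0 := fun h =>
  h2 (by linear_combination h)

theorem memLp_powG {s : ℂ} (hs : -1 < s.re) : MemLp (powG s) 2 (volume.restrict (Ioi (1 : ℝ))) := by
  have hc : ContinuousOn (powG s) (Ioi 1) := fun p hp =>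
    ((Complex.continuousAt_ofReal_cpow_const p _ (Or.inr
      (zero_lt_one.trans hp).ne')).continuousWithinAt)
  rw [memLp_two_iff_integrable_sq_norm (hc.aestronglyMeasurable measurableSet_Ioi)]
  have h1 : IntegrableOn (fun p : ℝ => p ^ (-3 - 2 * s.re)) (Ioi 1) :=
    integrableOn_Ioi_rpow_of_lt (by linarith) zero_lt_one
  refine IntegrableOn.congr_fun h1 (fun p hp => ?_) measurableSet_Ioi
  have hp0 : 0 < p := zero_lt_one.trans hp
  simp only [powG]
  rw [norm_ofReal_cpow hp0, ← Real.rpow_natCast, ← Real.rpow_mul hp0.le]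
  congr 1
  norm_num
  ring

/-- Existence of functions with a prescribed tail and a prescribed moment. -/
theorem exists_tail_moment (b : Variant) {g : ℝ → ℂ}
    (hg : MemLp g 2 (volume.restrict (Ioi (1 : ℝ)))) (V : ℂ) :
    ∃ ψ : HalfLineL2, (∀ᵐ p ∂posMeasure, 1 < p → ψ p = g p) ∧
      ∫ q in (0 : ℝ)..1, (weight b q : ℂ) * ψ q = V := by
  obtain ⟨k, hk⟩ : ∃ k : ℂ, ∫ q in (0 : ℝ)..1, (weight b q : ℂ) * k = V := by
    cases b
    · refine ⟨2 * V, ?_⟩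
      simp only [weight]
      rw [intervalIntegral.integral_mul_const, intervalIntegral.integral_ofReal, integral_id]
      push_cast; ring
    · exact ⟨V, by simp [weight]⟩
  have h1 : MemLp (indicator (Ioi 1) g) 2 posMeasure :=
    ((memLp_indicator_iff_restrict measurableSet_Ioi).2 hg).mono_measure Measure.restrict_le_self
  have h2 : MemLp (indicator (Ioc 0 1) fun _ : ℝ => k) 2 posMeasure :=
    (memLp_indicator_const 2 measurableSet_Ioc k (Or.inr (by simp))).mono_measure
      Measure.restrict_le_self
  refine ⟨(h1.add h2).toLp, ?_, ?_⟩
  · filter_upwards [MemLp.coeFn_toLp (h1.add h2)] with p hp h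
    rw [hp, Pi.add_apply, indicator_of_mem (mem_Ioi.2 h),
      indicator_of_notMem (s := Ioc (0 : ℝ) 1) (fun h' => absurd h'.2 (not_le.2 h)), add_zero]
  · rw [← hk]
    refine intervalIntegral.integral_congr_ae ?_
    rw [uIoc_of_le zero_le_one]
    filter_upwards [ae_Ioc_of_ae_pos (MemLp.coeFn_toLp (h1.add h2)) le_rfl] with p hp h
    rw [hp h, Pi.add_apply, indicator_of_mem h,
      indicator_of_notMem (s := Ioi (1 : ℝ)) (fun h' => absurd h.2 (not_le.2 h')), zero_add]

/-- With `g = p^(-3/2-s)` the function `B - p A` is a multiple of `p^(1/2-s)`, and `p² g + (α -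
1/4)(B - p A) = 0` reduces to `α = s²`. The exclusion of `s = ±1/2` keeps the primitives free of
logarithms, and `Re s > -1` gives square integrability. -/
theorem isTailFamily_powG (b : Variant) {α : ℝ} {s : ℂ} (hα : (α : ℂ) = s ^ 2) (h1 : s ≠ 1 / 2)
    (h2 : s ≠ -1 / 2) (hs : -1 < s.re) :
    IsTailFamily b α {ψ | IsPsi b s ψ} (counterterm b s) (powA s) (powB s) (powG s) where
  nonempty := by
    obtain ⟨ψ, hψ, hm⟩ := exists_tail_moment b (memLp_powG hs) (momentValue b s 1)
    exact ⟨ψ, 1, one_pos, hψ, hm⟩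
  hasTail := by
    rintro ψ ⟨Λ, h0, hψ, hm⟩
    have hz1 := neg_half_sub_ne h2
    have hz2 := half_sub_ne h1
    refine exists_hasTail h0 (fun p hp => ?_) (fun p hp => ?_) ?_ hψ ?_ (fun p hp => ?_)
    · exact hasDerivAt_ofReal_cpow_div (h0.trans_le hp) hz1 (by ring)
    · have := hasDerivAt_ofReal_cpow_div (h0.trans_le hp) (w := -1 / 2 - s) hz2 (by ring)
      rwa [← ofReal_mul_cpow (h0.trans_le hp) (z := -3 / 2 - s) (by ring)] at this
    · exact fun p hp => (Complex.continuousAt_ofReal_cpow_const p _ (Or.inr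
        (h0.trans_le hp).ne')).continuousWithinAt
    · rw [hm]; cases b <;> rfl
    · have hp0 := h0.trans hp
      simp only [powA, powB, powG]
      have e1 : (p : ℂ) * (p : ℂ) ^ (-3 / 2 - s) = (p : ℂ) ^ (-1 / 2 - s) :=
        ofReal_mul_cpow hp0 (by ring)
      have e2 : (p : ℂ) * (p : ℂ) ^ (-1 / 2 - s) = (p : ℂ) ^ (1 / 2 - s) :=
        ofReal_mul_cpow hp0 (by ring)
      have e3 : (p : ℂ) ^ 2 * (p : ℂ) ^ (-3 / 2 - s) = (p : ℂ) ^ (1 / 2 - s) := by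
        rw [← e2, ← e1]; ring
      rw [e3, mul_div_assoc', e2, hα]
      have hz1' : -1 - s * 2 ≠ 0 := fun h => hz1 (by linear_combination h / 2)
      have hz2' : 1 - s * 2 ≠ 0 := fun h => hz2 (by linear_combination h / 2)
      have e4 : (s ^ 2 - 1 / 4) * (1 / (1 / 2 - s) - 1 / (-1 / 2 - s)) = -1 := by
        field_simp
        ring
      linear_combination (p : ℂ) ^ (1 / 2 - s) * e4
  counterterm_eq := by
    intro p Λ _
    cases b
    · simp only [counterterm, tailCounterterm, powA]
      have e : -1 / 2 - s = -(1 / 2 + s) := by ring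
      rw [e, div_neg]; ring
    · rfl

theorem tailBound_powG (s : ℂ) : TailBound (powA s) (powB s) (powG s) s.re := by
  obtain ⟨a, ea⟩ : ∃ a, a = ‖(-1 / 2 - s)⁻¹‖ := ⟨_, rfl⟩
  obtain ⟨c, ec⟩ : ∃ c, c = ‖(1 / 2 - s)⁻¹‖ := ⟨_, rfl⟩
  have ha : 0 ≤ a := ea ▸ norm_nonneg _
  have hc : 0 ≤ c := ec ▸ norm_nonneg _
  refine ⟨a + c + 1, by positivity, fun p hp => ?_⟩
  have hp0 : 0 < p := by linarith
  have n1 : ‖(p : ℂ) ^ (-1 / 2 - s)‖ = p ^ (-1 / 2 - s.re) := by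
    rw [norm_ofReal_cpow hp0]; congr 1; norm_num
  have n2 : ‖(p : ℂ) ^ (1 / 2 - s)‖ = p ^ (1 / 2 - s.re) := by
    rw [norm_ofReal_cpow hp0]; congr 1; norm_num
  have n3 : ‖(p : ℂ) ^ (-3 / 2 - s)‖ = p ^ (-3 / 2 - s.re) := by
    rw [norm_ofReal_cpow hp0]; congr 1; norm_num
  have pos : ∀ t : ℝ, 0 < p ^ t := fun t => Real.rpow_pos_of_pos hp0 t
  refine ⟨?_, ?_, ?_⟩
  · rw [powA, div_eq_mul_inv, norm_mul, n1, mul_comm, ← ea]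
    exact mul_le_mul_of_nonneg_right (by linarith) (pos _).le
  · have e : powB s p - p * powA s p = (p : ℂ) ^ (1 / 2 - s) * (1 / 2 - s)⁻¹ -
        (p : ℂ) ^ (1 / 2 - s) * (-1 / 2 - s)⁻¹ := by
      rw [← ofReal_mul_cpow hp0 (z := -1 / 2 - s) (w := 1 / 2 - s) (by ring), powA, powB,
        ← ofReal_mul_cpow hp0 (z := -1 / 2 - s) (w := 1 / 2 - s) (by ring)]
      ring
    rw [e]
    refine (norm_sub_le _ _).trans ?_
    rw [norm_mul, norm_mul, n2, ← ea, ← ec]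
    have := pos (1 / 2 - s.re)
    nlinarith
  · rw [powG, n3]
    exact le_mul_of_one_le_left (pos _).le (by linarith)

/-- The pair of families with the tails `p^(-3/2-m)` and `p^(-3/2+m)`. -/
theorem isBoundaryPair_powG (b : Variant) {α : ℝ} {m : ℂ} (hα : (α : ℂ) = m ^ 2) (h0 : m ≠ 0)
    (h1 : m ≠ 1 / 2) (h2 : m ≠ -1 / 2) (hl : -1 < m.re) (hr : m.re < 1) :
    IsBoundaryPair b α {ψ | IsPsi b m ψ} {ψ | IsPsi b (-m) ψ} (counterterm b m)
      (counterterm b (-m)) (powA m) (powB m) (powG m) (powA (-m)) (powB (-m)) (powG (-m)) where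
  ne_zero := by
    rw [hα]
    intro h
    have : (m - 1 / 2) * (m + 1 / 2) = 0 := by linear_combination h
    rcases mul_eq_zero.1 this with h' | h'
    · exact h1 (by linear_combination h')
    · exact h2 (by linear_combination h')
  left := isTailFamily_powG b hα h1 h2 hl
  right := isTailFamily_powG b (by rw [hα]; ring) (fun h => h2 (by linear_combination -h))
    (fun h => h1 (by linear_combination -h)) (by rw [Complex.neg_re]; linarith)
  bounds := ⟨m.re, (-m).re, hl, by rw [Complex.neg_re]; linarith,
    by rw [Complex.neg_re]; linarith, tailBound_powG m, tailBound_powG (-m)⟩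
  form := by
    have a1 := half_sub_ne h1
    have a2 := half_add_ne h2
    -- The powers in the Wronskian of the tails for `m` and `-m` cancel, so it is constant. It
    -- vanishes only for `m = 0`, where the two tails coincide.
    refine ⟨2 * m / ((1 / 2 - m) * (1 / 2 + m)),
      div_ne_zero (mul_ne_zero two_ne_zero h0) (mul_ne_zero a1 a2), ?_⟩
    · filter_upwards [eventually_gt_atTop 0] with p hp
      have hpc : (p : ℂ) ≠ 0 := Complex.ofReal_ne_zero.2 hp.ne'
      have e1 : (p : ℂ) ^ (1 / 2 - m) * (p : ℂ) ^ (-1 / 2 - -m) = 1 := by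
        rw [← Complex.cpow_add _ _ hpc]
        have : (1 / 2 - m + (-1 / 2 - -m)) = 0 := by ring
        rw [this, Complex.cpow_zero]
      have e2 : (p : ℂ) ^ (-1 / 2 - m) * (p : ℂ) ^ (1 / 2 - -m) = 1 := by
        rw [← Complex.cpow_add _ _ hpc]
        have : (-1 / 2 - m + (1 / 2 - -m)) = 0 := by ring
        rw [this, Complex.cpow_zero]
      simp only [powA, powB]
      rw [div_mul_div_comm, div_mul_div_comm, e1, e2, hα]
      have f1 : -1 / 2 - -m = -(1 / 2 - m) := by ring
      have f2 : -1 / 2 - m = -(1 / 2 + m) := by ring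
      have f3 : 1 / 2 - -m = 1 / 2 + m := by ring
      have f4 : m ^ 2 - 1 / 4 = -((1 / 2 - m) * (1 / 2 + m)) := by ring
      have f5 : 2 * m = ((1 / 2 + m) - (1 / 2 - m)) * ((1 / 2 - m) + (1 / 2 + m)) := by ring
      rw [f1, f2, f3, f4, f5]
      generalize 1 / 2 - m = X at *
      generalize 1 / 2 + m = Y at *
      field_simp
      ring

/-- A primitive of `p^(-3/2) log p`. -/
def logA (p : ℝ) : ℂ := ((-4 / √p - 2 / √p * Real.log p : ℝ) : ℂ)

/-- A primitive of `p^(-1/2) log p`. -/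
def logB (p : ℝ) : ℂ := ((-4 * √p + 2 * √p * Real.log p : ℝ) : ℂ)

/-- The tail `p^(-3/2) log p`. -/
def logG (p : ℝ) : ℂ := (p : ℂ) ^ (-3 / 2 : ℂ) * Real.log p

theorem logG_eq {p : ℝ} (hp : 0 < p) : logG p = ((Real.log p / (p * √p) : ℝ) : ℂ) := by
  have e : (p : ℂ) ^ (-3 / 2 : ℂ) = ((p * √p : ℝ) : ℂ)⁻¹ := by
    have h1 : (-3 / 2 : ℂ) = ((-(3 / 2) : ℝ) : ℂ) := by push_cast; ring
    rw [h1, ← Complex.ofReal_cpow hp.le, Real.rpow_neg hp.le, Complex.ofReal_inv]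
    congr 2
    rw [Real.sqrt_eq_rpow]
    nth_rewrite 2 [← Real.rpow_one p]
    rw [← Real.rpow_add hp]; norm_num
  rw [logG, e]; push_cast; ring

theorem abs_log_le {p : ℝ} (hp : 1 ≤ p) : |Real.log p| ≤ 8 * p ^ (1 / 8 : ℝ) := by
  rw [abs_of_nonneg (Real.log_nonneg hp)]
  have := Real.log_le_rpow_div (zero_le_one.trans hp) (show (0 : ℝ) < 1 / 8 by norm_num)
  linarith

/-- The logarithm is bounded by `8 p^(1/8)`. The small loss in the exponent is harmless: paired with
`σ = 0` the sum stays above `-1/2`. -/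
theorem tailBound_logG : TailBound logA logB logG (-1 / 8) := by
  refine ⟨32, by norm_num, fun p hp => ?_⟩
  have hp0 : 0 < p := by linarith
  have hl := abs_log_le hp
  have hs : 0 < √p := Real.sqrt_pos.2 hp0
  have ht : 0 < p ^ (1 / 8 : ℝ) := Real.rpow_pos_of_pos hp0 _
  have ht1 : 1 ≤ p ^ (1 / 8 : ℝ) := Real.one_le_rpow hp (by norm_num)
  have r1 : p ^ (-1 / 2 - -1 / 8 : ℝ) = (√p)⁻¹ * p ^ (1 / 8 : ℝ) := by
    rw [Real.sqrt_eq_rpow, ← Real.rpow_neg hp0.le, ← Real.rpow_add hp0]; norm_num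
  have r2 : p ^ (1 / 2 - -1 / 8 : ℝ) = √p * p ^ (1 / 8 : ℝ) := by
    rw [Real.sqrt_eq_rpow, ← Real.rpow_add hp0]; norm_num
  have r3 : p ^ (-3 / 2 - -1 / 8 : ℝ) = (p * √p)⁻¹ * p ^ (1 / 8 : ℝ) := by
    have : p * √p = p ^ (3 / 2 : ℝ) := by
      rw [Real.sqrt_eq_rpow]
      nth_rewrite 1 [← Real.rpow_one p]
      rw [← Real.rpow_add hp0]; norm_num
    rw [this, ← Real.rpow_neg hp0.le, ← Real.rpow_add hp0]; norm_num
  refine ⟨?_, ?_, ?_⟩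
  · rw [logA, Complex.norm_real, Real.norm_eq_abs, r1]
    have e : -4 / √p - 2 / √p * Real.log p = -((√p)⁻¹ * (4 + 2 * Real.log p)) := by
      field_simp; ring
    rw [e, abs_neg, abs_mul, abs_of_pos (inv_pos.2 hs)]
    have : |4 + 2 * Real.log p| ≤ 32 * p ^ (1 / 8 : ℝ) := by
      refine (abs_add_le _ _).trans ?_
      rw [abs_mul, abs_of_pos (show (0 : ℝ) < 4 by norm_num), abs_of_pos (show (0 : ℝ) < 2 by norm_num)]
      linarith
    calc (√p)⁻¹ * |4 + 2 * Real.log p| ≤ (√p)⁻¹ * (32 * p ^ (1 / 8 : ℝ)) := by gcongr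
      _ = _ := by ring
  · have e : logB p - p * logA p = ((√p * (4 * Real.log p) : ℝ) : ℂ) := by
      rw [logA, logB, ← Complex.ofReal_mul, ← Complex.ofReal_sub]
      congr 1
      field_simp
      rw [Real.sq_sqrt hp0.le]
      ring
    rw [e, Complex.norm_real, Real.norm_eq_abs, r2, abs_mul, abs_of_pos hs, abs_mul,
      abs_of_pos (show (0 : ℝ) < 4 by norm_num)]
    nlinarith
  · rw [logG_eq hp0, Complex.norm_real, Real.norm_eq_abs, r3, abs_div,
      abs_of_pos (show 0 < p * √p by positivity), div_eq_inv_mul]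
    calc (p * √p)⁻¹ * |Real.log p| ≤ (p * √p)⁻¹ * (32 * p ^ (1 / 8 : ℝ)) := by
          gcongr; linarith
      _ = _ := by ring

theorem continuousOn_logG : ContinuousOn logG (Ioi 0) := fun p hp =>
  ((Complex.continuousAt_ofReal_cpow_const p _ (Or.inr (ne_of_gt hp))).mul
    (Complex.continuous_ofReal.continuousAt.comp
      (Real.continuousAt_log (ne_of_gt hp)))).continuousWithinAt

theorem memLp_logG : MemLp logG 2 (volume.restrict (Ioi (1 : ℝ))) := by
  obtain ⟨C, hC, h⟩ := tailBound_logG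
  have h1 : MemLp (powG (((-1 / 8 : ℝ)) : ℂ)) 2 (volume.restrict (Ioi (1 : ℝ))) :=
    memLp_powG (by rw [Complex.ofReal_re]; norm_num)
  refine MemLp.of_le_mul (c := C) h1
    ((continuousOn_logG.mono (Ioi_subset_Ioi zero_le_one)).aestronglyMeasurable
      measurableSet_Ioi) ?_
  filter_upwards [ae_restrict_mem measurableSet_Ioi] with p hp
  have hp : 1 < p := hp
  have := (h p hp.le).2.2
  rwa [powG, norm_ofReal_cpow (by linarith), Complex.sub_re, Complex.ofReal_re,
    show (-3 / 2 : ℂ).re = -3 / 2 by norm_num]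

theorem hasDerivAt_logA {p : ℝ} (hp : 0 < p) : HasDerivAt logA (logG p) p := by
  rw [logG_eq hp]
  refine HasDerivAt.ofReal_comp ?_
  have hs := Real.sqrt_pos.2 hp
  have h1 := Real.hasDerivAt_sqrt hp.ne'
  have h2 := Real.hasDerivAt_log hp.ne'
  have h3 := (((hasDerivAt_const p (-4 : ℝ)).fun_div h1 hs.ne').fun_sub
    (((hasDerivAt_const p (2 : ℝ)).fun_div h1 hs.ne').fun_mul h2))
  refine h3.congr_deriv ?_
  rw [Real.sq_sqrt hp.le]
  field_simp
  ring

theorem hasDerivAt_logB {p : ℝ} (hp : 0 < p) : HasDerivAt logB (p * logG p) p := by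
  rw [logG_eq hp, ← Complex.ofReal_mul]
  refine HasDerivAt.ofReal_comp ?_
  have hs := Real.sqrt_pos.2 hp
  have h1 := Real.hasDerivAt_sqrt hp.ne'
  have h2 := Real.hasDerivAt_log hp.ne'
  have h3 := (h1.const_mul (-4 : ℝ)).fun_add ((h1.const_mul (2 : ℝ)).fun_mul h2)
  refine h3.congr_deriv ?_
  field_simp
  rw [Real.sq_sqrt hp.le]
  field_simp
  ring

theorem isTailFamily_logG (b : Variant) :
    IsTailFamily b 0 {ψ | IsPsiLog b ψ} (fun p Λ => (countertermLog b p Λ : ℂ)) logA logB logG where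
  nonempty := by
    obtain ⟨ψ, hψ, hm⟩ := exists_tail_moment b memLp_logG (momentValueLog b 1)
    exact ⟨ψ, 1, one_pos, hψ, hm⟩
  hasTail := by
    rintro ψ ⟨Λ, h0, hψ, hm⟩
    refine exists_hasTail h0 (fun p hp => hasDerivAt_logA (h0.trans_le hp))
      (fun p hp => hasDerivAt_logB (h0.trans_le hp))
      (continuousOn_logG.mono fun p hp => h0.trans_le hp) hψ ?_ (fun p hp => ?_)
    · rw [hm]; cases b <;> rfl
    · have hp0 := h0.trans hp
      rw [logG_eq hp0, logA, logB]
      have hs := Real.sqrt_pos.2 hp0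
      have hq := Real.mul_self_sqrt hp0.le
      have : p ^ 2 * (Real.log p / (p * √p)) + ((0 : ℝ) - 1 / 4) *
          ((-4 * √p + 2 * √p * Real.log p) - p * (-4 / √p - 2 / √p * Real.log p)) = 0 := by
        field_simp
        rw [Real.sq_sqrt hp0.le]
        ring
      have := congrArg ((↑) : ℝ → ℂ) this
      push_cast at this ⊢
      exact this
  counterterm_eq := by
    intro p Λ _
    cases b
    · simp only [countertermLog, tailCounterterm, logA]; push_cast; ring
    · simp only [countertermLog, tailCounterterm, logB]; push_cast; ring

/-- The pair of families with the tails `p^(-3/2) log p` and `p^(-3/2)`. -/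
theorem isBoundaryPair_logG (b : Variant) :
    IsBoundaryPair b 0 {ψ | IsPsiLog b ψ} {ψ | IsPsi b 0 ψ}
      (fun p Λ => (countertermLog b p Λ : ℂ)) (counterterm b 0)
      logA logB logG (powA 0) (powB 0) (powG 0) where
  ne_zero := by norm_num
  left := isTailFamily_logG b
  right := isTailFamily_powG b (by simp) (by norm_num) (by norm_num) (by simp)
  bounds := ⟨-1 / 8, 0, by norm_num, by norm_num, by norm_num, tailBound_logG,
    by simpa using tailBound_powG 0⟩
  form := by
    -- The logarithms cancel in the Wronskian of the tails `p^(-3/2) log p` and `p^(-3/2)`.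
    refine ⟨-4, by norm_num, ?_⟩
    filter_upwards [eventually_gt_atTop 0] with p hp
    have hs := Real.sqrt_pos.2 hp
    have e1 : powA 0 p = ((-2 / √p : ℝ) : ℂ) := by
      have h1 : (-1 / 2 - 0 : ℂ) = ((-(1 / 2) : ℝ) : ℂ) := by push_cast; ring
      rw [powA, h1, ← Complex.ofReal_cpow hp.le, Real.rpow_neg hp.le, ← Real.sqrt_eq_rpow,
        ← Complex.ofReal_div]
      congr 1; field_simp
    have e2 : powB 0 p = ((2 * √p : ℝ) : ℂ) := by
      have h1 : (1 / 2 - 0 : ℂ) = ((1 / 2 : ℝ) : ℂ) := by push_cast; ring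
      rw [powB, h1, ← Complex.ofReal_cpow hp.le, ← Real.sqrt_eq_rpow, ← Complex.ofReal_div]
      congr 1; field_simp
    rw [e1, e2, logA, logB]
    have : ((0 : ℝ) - 1 / 4) * ((-4 * √p + 2 * √p * Real.log p) * (-2 / √p) -
        (-4 / √p - 2 / √p * Real.log p) * (2 * √p)) = -4 := by
      field_simp; ring
    have := congrArg ((↑) : ℝ → ℂ) this
    push_cast at this ⊢
    exact this

/-! ## Conjugation of the tail families -/

/-- The defining data of `ψ_s` are conjugated by replacing `s` with its conjugate. So the families
for `m` and `-m` are each invariant for real `m` and are exchanged for imaginary `m`. -/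
theorem IsPsi.star {b : Variant} {s : ℂ} {ψ : HalfLineL2} (h : IsPsi b s ψ) :
    IsPsi b (starRingEnd ℂ s) (star ψ) := by
  obtain ⟨Λ, h0, hψ, hm⟩ := h
  have two : (starRingEnd ℂ) (2 : ℂ) = 2 := Complex.conj_ofNat 2
  have three : (starRingEnd ℂ) (3 : ℂ) = 3 := Complex.conj_ofNat 3
  refine ⟨Λ, h0, ?_, ?_⟩
  · filter_upwards [hψ, Lp.coeFn_star ψ, ae_restrict_mem measurableSet_Ioi] with p h1 h2 hp hΛ
    rw [h2, Pi.star_apply, h1 hΛ]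
    refine (star_ofReal_cpow hp _).trans ?_
    simp [two, three]
  · rw [intervalIntegral_star ψ h0.le, hm]
    cases b
    · refine (map_div₀ (starRingEnd ℂ) _ _).trans ?_
      rw [star_ofReal_cpow h0]
      simp [momentValue, two]
    · refine (map_div₀ (starRingEnd ℂ) _ _).trans ?_
      rw [star_ofReal_cpow h0]
      simp [momentValue, two]

theorem IsPsiLog.star {b : Variant} {ψ : HalfLineL2} (h : IsPsiLog b ψ) :
    IsPsiLog b (star ψ) := by
  obtain ⟨Λ, h0, hψ, hm⟩ := h
  refine ⟨Λ, h0, ?_, ?_⟩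
  · filter_upwards [hψ, Lp.coeFn_star ψ, ae_restrict_mem measurableSet_Ioi] with p h1 h2 hp hΛ
    have h3 : (p : ℂ) ^ (-3 / 2 : ℂ) * Real.log p = logG p := rfl
    rw [h2, Pi.star_apply, h1 hΛ, h3, logG_eq hp]
    exact Complex.conj_ofReal _
  · rw [intervalIntegral_star ψ h0.le, hm]
    exact Complex.conj_ofReal _

/-! ## Graphs of the realizations in momentum space -/

/-- The lines defining the realizations for a pair of families. -/
def lineSet (P M : Set HalfLineL2) (κ : OnePoint ℂ) : Set HalfLineL2 :=
  κ.elim M fun k => {ψ | ∃ ψp ψm, ψp ∈ P ∧ ψm ∈ M ∧ ψ = ψp + k • ψm}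

/-- A generator of the line, modulo the minimal domain. -/
def lineGen (ψp ψm : HalfLineL2) (κ : OnePoint ℂ) : HalfLineL2 :=
  κ.elim ψm fun k => ψp + k • ψm

section
variable {b : Variant} {α : ℝ} {P M : Set HalfLineL2} {ctP ctM : ℝ → ℝ → ℂ}
  {A B g A' B' g' : ℝ → ℂ}

theorem IsBoundaryPair.sup_span_lineSet (H : IsBoundaryPair b α P M ctP ctM A B g A' B' g')
    {ψp ψm : HalfLineL2} (hp : ψp ∈ P) (hm : ψm ∈ M) (κ : OnePoint ℂ) :
    (momMin b α).domain ⊔ Submodule.span ℂ (lineSet P M κ) =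
      (momMin b α).domain ⊔ Submodule.span ℂ {lineGen ψp ψm κ} := by
  induction κ using OnePoint.rec with
  | infty => exact H.right.sup_span H.ne_zero hm
  | coe k =>
    refine sup_span_eq_sup_span_singleton ⟨_, ψp, ψm, hp, hm, rfl⟩ one_ne_zero ?_
    rintro _ ⟨χp, χm, hχp, hχm, rfl⟩
    have e : χp + k • χm - (1 : ℂ) • lineGen ψp ψm (k : OnePoint ℂ) =
        (χp - ψp) + k • (χm - ψm) := by
      rw [one_smul, smul_sub]
      change _ - (ψp + k • ψm) = _
      abel
    rw [e]
    exact Submodule.add_mem _ (H.left.sub_mem H.ne_zero hχp hp)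
      (Submodule.smul_mem _ _ (H.right.sub_mem H.ne_zero hχm hm))

theorem lineGen_mem (ψp ψm : HalfLineL2) (κ : OnePoint ℂ) (D : Submodule ℂ HalfLineL2) :
    lineGen ψp ψm κ ∈ D ⊔ Submodule.span ℂ {ψp} ⊔ Submodule.span ℂ {ψm} := by
  have hm : ψm ∈ D ⊔ Submodule.span ℂ {ψp} ⊔ Submodule.span ℂ {ψm} :=
    Submodule.mem_sup_right (Submodule.mem_span_singleton_self _)
  induction κ using OnePoint.rec with
  | infty => exact hm
  | coe k =>
    exact Submodule.add_mem _ (Submodule.mem_sup_left (Submodule.mem_sup_right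
      (Submodule.mem_span_singleton_self _))) (Submodule.smul_mem _ _ hm)

theorem IsBoundaryPair.mem_graph_line (H : IsBoundaryPair b α P M ctP ctM A B g A' B' g')
    {ψp ψm : HalfLineL2} (hp : ψp ∈ P) (hm : ψm ∈ M) (κ : OnePoint ℂ) {x y : HalfLineL2} :
    (x, y) ∈ ((momMaxOf b α P M ctP ctM).domRestrict
      ((momMin b α).domain ⊔ Submodule.span ℂ (lineSet P M κ))).graph ↔
      x ∈ (momMin b α).domain ⊔ Submodule.span ℂ {lineGen ψp ψm κ} ∧ (x, y) ∈ maxRel b α := by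
  rw [H.mem_graph_domRestrict, H.sup_span_lineSet hp hm]
  rw [H.sup_span_lineSet hp hm, H.momMaxDomain_eq hp hm]
  refine sup_le (le_sup_left.trans le_sup_left) (Submodule.span_le.2 ?_)
  rw [singleton_subset_iff]
  exact lineGen_mem _ _ _ _

/-- The second vector needed to detect the boundary space is the other tail: `ψp` if the line is
spanned by `ψm`, and `ψm` otherwise, since `ψp + k ψm` has the same form with `ψm` as `ψp`. -/
theorem IsBoundaryPair.isSelfAdjoint_line (H : IsBoundaryPair b α P M ctP ctM A B g A' B' g')
    {ψp ψm : HalfLineL2} (hp : ψp ∈ P) (hm : ψm ∈ M) (κ : OnePoint ℂ) {θ : ℂ}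
    (hθ : star (lineGen ψp ψm κ) - θ • lineGen ψp ψm κ ∈ (momMin b α).domain) :
    IsSelfAdjoint ((momMaxOf b α P M ctP ctM).domRestrict
      ((momMin b α).domain ⊔ Submodule.span ℂ (lineSet P M κ))) := by
  obtain ⟨h₁, t₁⟩ := H.left.hasTail ψp hp
  obtain ⟨h₂, t₂⟩ := H.right.hasTail ψm hm
  have hne := H.bform_ne_zero t₁ t₂
  have hT := fun x y => H.mem_graph_line hp hm κ (x := x) (y := y)
  induction κ using OnePoint.rec with
  | infty =>
    refine isSelfAdjoint_of_graph H.ne_zero (u := (ψm, h₂)) t₂.mem_maxRel t₁.mem_maxRel ?_ hθ hT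
    rwa [bform_swap, neg_ne_zero]
  | coe k =>
    refine isSelfAdjoint_of_graph H.ne_zero (u := (ψp, h₁) + k • (ψm, h₂))
      ((maxRel b α).add_mem t₁.mem_maxRel ((maxRel b α).smul_mem _ t₂.mem_maxRel)) t₂.mem_maxRel
      ?_ hθ hT
    rwa [bform_add_left, bform_smul_left, bform_self, mul_zero, add_zero]

/-- Self-adjointness for conjugation-invariant families and a real parameter. -/
theorem IsBoundaryPair.isSelfAdjoint_real (H : IsBoundaryPair b α P M ctP ctM A B g A' B' g')
    (hP : ∀ ψ ∈ P, star ψ ∈ P) (hM : ∀ ψ ∈ M, star ψ ∈ M) (κ : OnePoint ℝ) :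
    IsSelfAdjoint ((momMaxOf b α P M ctP ctM).domRestrict
      ((momMin b α).domain ⊔ Submodule.span ℂ (lineSet P M (κ.map ((↑) : ℝ → ℂ))))) := by
  obtain ⟨ψp, hp⟩ := H.left.nonempty
  obtain ⟨ψm, hm⟩ := H.right.nonempty
  refine H.isSelfAdjoint_line hp hm _ (θ := 1) ?_
  have d1 := H.left.sub_mem H.ne_zero (hP _ hp) hp
  have d2 := H.right.sub_mem H.ne_zero (hM _ hm) hm
  rw [one_smul]
  induction κ using OnePoint.rec with
  | infty => exact d2
  | coe k =>
    change star (ψp + (k : ℂ) • ψm) - (ψp + (k : ℂ) • ψm) ∈ _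
    have e : star (ψp + (k : ℂ) • ψm) - (ψp + (k : ℂ) • ψm) =
        (star ψp - ψp) + (k : ℂ) • (star ψm - ψm) := by
      rw [Lp_star_add, Lp_star_smul, smul_sub]
      have : star (k : ℂ) = k := Complex.conj_ofReal k
      rw [this]; abel
    rw [e]
    exact Submodule.add_mem _ d1 (Submodule.smul_mem _ _ d2)

/-- Self-adjointness for families exchanged by conjugation and a parameter of modulus one. -/
theorem IsBoundaryPair.isSelfAdjoint_unit (H : IsBoundaryPair b α P M ctP ctM A B g A' B' g')
    (hP : ∀ ψ ∈ P, star ψ ∈ M) (hM : ∀ ψ ∈ M, star ψ ∈ P) {κ : ℂ} (hκ : ‖κ‖ = 1) :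
    IsSelfAdjoint ((momMaxOf b α P M ctP ctM).domRestrict
      ((momMin b α).domain ⊔ Submodule.span ℂ (lineSet P M (κ : OnePoint ℂ)))) := by
  obtain ⟨ψp, hp⟩ := H.left.nonempty
  obtain ⟨ψm, hm⟩ := H.right.nonempty
  -- Modulo the minimal domain, conjugation sends `ψp + κ ψm` to `ψm + κ̄ ψp`, which equals `κ̄ (ψp
  -- + κ ψm)` because `κ̄ κ = 1`.
  refine H.isSelfAdjoint_line hp hm _ (θ := star κ) ?_
  have d1 := H.right.sub_mem H.ne_zero (hP _ hp) hm
  have d2 := H.left.sub_mem H.ne_zero (hM _ hm) hp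
  change star (ψp + κ • ψm) - star κ • (ψp + κ • ψm) ∈ _
  have hk : star κ * κ = 1 := by
    change (starRingEnd ℂ) κ * κ = 1
    rw [mul_comm, Complex.mul_conj, Complex.normSq_eq_norm_sq, hκ]; simp
  have e : star (ψp + κ • ψm) - star κ • (ψp + κ • ψm) =
      (star ψp - ψm) + star κ • (star ψm - ψp) := by
    rw [Lp_star_add, Lp_star_smul, smul_add, smul_smul, hk, one_smul, smul_sub]; abel
  rw [e]
  exact Submodule.add_mem _ d1 (Submodule.smul_mem _ _ d2)

end

theorem momH_eq {b : Variant} {m : ℂ} (hm : m ≠ 0) (κ : OnePoint ℂ) :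
    momH b m κ = (momMaxOf b (m ^ 2).re {ψ | IsPsi b m ψ} {ψ | IsPsi b (-m) ψ}
      (counterterm b m) (counterterm b (-m))).domRestrict ((momMin b (m ^ 2).re).domain ⊔
        Submodule.span ℂ (lineSet {ψ | IsPsi b m ψ} {ψ | IsPsi b (-m) ψ} κ)) := by
  rw [momH, momMax, if_neg hm]; rfl

theorem momHLog_eq (b : Variant) (ν : OnePoint ℂ) :
    momHLog b ν = (momMaxOf b 0 {ψ | IsPsiLog b ψ} {ψ | IsPsi b 0 ψ}
      (fun p Λ => (countertermLog b p Λ : ℂ)) (counterterm b 0)).domRestrict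
        ((momMin b 0).domain ⊔
        Submodule.span ℂ (lineSet {ψ | IsPsiLog b ψ} {ψ | IsPsi b 0 ψ} ν)) := by
  rw [momHLog, momMax, if_pos rfl]; rfl

theorem isSelfAdjoint_momH_real (b : Variant) {m : ℝ} (hm : m ∈ Ioo (-1 : ℝ) 1) (h0 : m ≠ 0)
    (h1 : m ≠ 1 / 2) (h2 : m ≠ -1 / 2) (κ : OnePoint ℝ) :
    IsSelfAdjoint (momH b (m : ℂ) (κ.map ((↑) : ℝ → ℂ))) := by
  rw [momH_eq (Complex.ofReal_ne_zero.2 h0)]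
  have e1 : (m : ℂ) ≠ 1 / 2 := fun h => h1 (by
    have : (m : ℂ) = ((1 / 2 : ℝ) : ℂ) := by rw [h]; push_cast; ring
    exact_mod_cast this)
  have e2 : (m : ℂ) ≠ -1 / 2 := fun h => h2 (by
    have : (m : ℂ) = ((-1 / 2 : ℝ) : ℂ) := by rw [h]; push_cast; ring
    exact_mod_cast this)
  refine (isBoundaryPair_powG b ?_ (Complex.ofReal_ne_zero.2 h0) e1 e2 ?_ ?_).isSelfAdjoint_real
    (fun ψ hψ => ?_) (fun ψ hψ => ?_) κ
  · rw [← Complex.ofReal_pow, Complex.ofReal_re]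
  · exact hm.1
  · exact hm.2
  · have := IsPsi.star hψ
    rwa [Complex.conj_ofReal] at this
  · have := IsPsi.star hψ
    rwa [map_neg, Complex.conj_ofReal] at this

theorem isSelfAdjoint_momH_imaginary (b : Variant) {t : ℝ} (ht : t ≠ 0) {κ : ℂ} (hκ : ‖κ‖ = 1) :
    IsSelfAdjoint (momH b (Complex.I * t) (κ : OnePoint ℂ)) := by
  have h0 : Complex.I * t ≠ 0 := mul_ne_zero Complex.I_ne_zero (Complex.ofReal_ne_zero.2 ht)
  rw [momH_eq h0]
  have hre : (Complex.I * t).re = 0 := by simp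
  have hsq : ((((Complex.I * t) ^ 2).re : ℝ) : ℂ) = (Complex.I * t) ^ 2 := by
    rw [mul_pow, Complex.I_sq, ← Complex.ofReal_pow, ← Complex.ofReal_one, ← Complex.ofReal_neg,
      ← Complex.ofReal_mul, Complex.ofReal_re]
  have hc : (starRingEnd ℂ) (Complex.I * t) = -(Complex.I * t) := by
    rw [map_mul, Complex.conj_I, Complex.conj_ofReal, neg_mul]
  refine (isBoundaryPair_powG b hsq h0 ?_ ?_ ?_ ?_).isSelfAdjoint_unit
    (fun ψ hψ => ?_) (fun ψ hψ => ?_) hκ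
  · intro h; rw [h] at hre; norm_num at hre
  · intro h; rw [h] at hre; norm_num at hre
  · rw [hre]; norm_num
  · rw [hre]; norm_num
  · have := IsPsi.star hψ
    rwa [hc] at this
  · have := IsPsi.star hψ
    rwa [map_neg, hc, neg_neg] at this

theorem isSelfAdjoint_momHLog (b : Variant) (ν : OnePoint ℝ) :
    IsSelfAdjoint (momHLog b (ν.map ((↑) : ℝ → ℂ))) := by
  rw [momHLog_eq]
  refine (isBoundaryPair_logG b).isSelfAdjoint_real (fun ψ hψ => IsPsiLog.star hψ)
    (fun ψ hψ => ?_) ν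
  have := IsPsi.star hψ
  rwa [map_zero] at this

/-! ## The sine and cosine transformations -/

/-- The sine or the cosine. -/
def trig : Variant → ℝ → ℝ
  | .D, y => Real.sin y
  | .N, y => Real.cos y

/-- The sine or the cosine transformation. -/
def transform : Variant → HalfLineL2 →ₗ[ℂ] HalfLineL2
  | .D => sineTransform
  | .N => cosineTransform

/-- The integral formula for the transformations. -/
def trigInt (b : Variant) (u : ℝ → ℂ) (p : ℝ) : ℂ :=
  √(2 / Real.pi) * ∫ x, (trig b (p * x) : ℂ) * u x ∂posMeasure

theorem transform_ae_eq (b : Variant) {f : HalfLineL2} (hf : Integrable f posMeasure) :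
    transform b f =ᵐ[posMeasure] trigInt b f := by
  cases b
  · exact sineTransform_ae_eq f hf
  · exact cosineTransform_ae_eq f hf

theorem trigInt_congr (b : Variant) {u v : ℝ → ℂ} (h : u =ᵐ[posMeasure] v) :
    trigInt b u = trigInt b v := by
  funext p
  unfold trigInt
  congr 1
  refine integral_congr_ae ?_
  filter_upwards [h] with x hx
  rw [hx]

theorem continuous_trig (b : Variant) : Continuous (trig b) := by
  cases b
  · exact Real.continuous_sin
  · exact Real.continuous_cos

theorem norm_trig_le (b : Variant) (y : ℝ) : ‖(trig b y : ℂ)‖ ≤ 1 := by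
  rw [Complex.norm_real]
  cases b
  · exact Real.abs_sin_le_one y
  · exact Real.abs_cos_le_one y

theorem integrable_trig_mul (b : Variant) {u : ℝ → ℂ} (hu : Integrable u posMeasure) (p : ℝ) :
    Integrable (fun x => (trig b (p * x) : ℂ) * u x) posMeasure := by
  refine hu.bdd_mul (c := 1) ?_ (Eventually.of_forall fun x => norm_trig_le b _)
  have := continuous_trig b
  exact (by fun_prop : Continuous fun x : ℝ => (trig b (p * x) : ℂ)).aestronglyMeasurable

/-! ### Continuity of the transformations. -/

theorem norm_extendZero (f : HalfLineL2) : ‖extendZero f‖ = ‖f‖ := by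
  rw [Lp.norm_def, Lp.norm_def, eLpNorm_congr_ae (coeFn_extendZero f),
    eLpNorm_indicator_eq_eLpNorm_restrict measurableSet_Ioi]

theorem exists_norm_dilateRestrict_le (c : ℝ) (hc : c ≠ 0) :
    ∃ C : ℝ, ∀ G, ‖dilateRestrict c hc G‖ ≤ C * ‖G‖ := by
  refine ⟨((ENNReal.ofReal |c⁻¹|) ^ (1 / (2 : ENNReal)).toReal).toReal, fun G => ?_⟩
  have h1 : eLpNorm (fun p : ℝ => G (c * p)) 2 posMeasure ≤
      (ENNReal.ofReal |c⁻¹|) ^ (1 / (2 : ENNReal)).toReal * eLpNorm G 2 volume := by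
    refine (eLpNorm_mono_measure _ Measure.restrict_le_self).trans ?_
    have h2 : AEStronglyMeasurable G (Measure.map (fun p : ℝ => c * p) volume) := by
      rw [Real.map_volume_mul_left hc]
      exact (Lp.aestronglyMeasurable G).smul_measure _
    have h3 := eLpNorm_map_measure (p := 2) h2 (measurable_const_mul c).aemeasurable
    rw [Real.map_volume_mul_left hc, eLpNorm_smul_measure_of_ne_top (by norm_num)] at h3
    exact h3.symm.le
  rw [Lp.norm_def, Lp.norm_def, eLpNorm_congr_ae (coeFn_dilateRestrict c hc G),
    ← ENNReal.toReal_mul]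
  refine ENNReal.toReal_mono (ENNReal.mul_ne_top ?_ (Lp.eLpNorm_ne_top G)) h1
  exact ENNReal.rpow_ne_top_of_nonneg (by positivity) ENNReal.ofReal_ne_top

theorem continuous_dilateRestrict (c : ℝ) (hc : c ≠ 0) : Continuous (dilateRestrict c hc) := by
  obtain ⟨C, hC⟩ := exists_norm_dilateRestrict_le c hc
  exact AddMonoidHomClass.continuous_of_bound (dilateRestrict c hc) C hC

theorem continuous_lineFourier : Continuous lineFourier := by
  have h : Continuous extendZero :=
    AddMonoidHomClass.continuous_of_bound extendZero 1 fun f => by rw [norm_extendZero, one_mul]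
  exact (Lp.fourierTransformₗᵢ ℝ ℂ).continuous.comp h

theorem continuous_transform (b : Variant) : Continuous (transform b) := by
  have h1 := (continuous_dilateRestrict _ neg_two_pi_inv_ne_zero).comp continuous_lineFourier
  have h2 := (continuous_dilateRestrict _ two_pi_inv_ne_zero).comp continuous_lineFourier
  cases b
  · exact (h1.sub h2).const_smul ((√(2 / Real.pi) : ℂ) / (2 * Complex.I))
  · exact (h1.add h2).const_smul ((√(2 / Real.pi) : ℂ) / 2)

/-- A function orthogonal to all test functions vanishes almost everywhere on the open half-line.
This density extends inversion and symmetry of the transformations to all of `L²(ℝ₊)`. -/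
theorem dense_testSpace : Dense (testSpace : Set HalfLineL2) := by
  rw [Submodule.dense_iff_topologicalClosure_eq_top, Submodule.topologicalClosure_eq_top_iff,
    Submodule.eq_bot_iff]
  intro f hf
  rw [Submodule.mem_orthogonal] at hf
  have key : ∀ᵐ x ∂(volume : Measure ℝ), x ∈ Ioi (0 : ℝ) → f x = 0 := by
    refine isOpen_Ioi.ae_eq_zero_of_integral_contDiff_smul_eq_zero ?_ fun g hg hgc hgs => ?_
    · refine locallyIntegrableOn_of_locallyIntegrable_restrict ?_
      exact (Lp.memLp f).locallyIntegrable (by norm_num)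
    · have ht : IsTestFunction fun x => (g x : ℂ) :=
        ⟨Complex.ofRealCLM.contDiff.comp hg, hgc.comp_left (g := ((↑) : ℝ → ℂ)) (by simp),
          (closure_mono fun x hx => by
            rw [Function.mem_support] at hx ⊢
            exact fun h => hx (by rw [h, Complex.ofReal_zero])).trans hgs⟩
      have h1 := hf ht.memLp.toLp ⟨_, ht, ht.memLp.coeFn_toLp⟩
      rw [L2.inner_def] at h1
      rw [← setIntegral_eq_integral_of_forall_compl_eq_zero (s := Ioi (0 : ℝ)), ← h1]
      · refine integral_congr_ae ?_
        filter_upwards [ht.memLp.coeFn_toLp] with x hx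
        rw [hx]
        simp [mul_comm]
      · intro x hx
        have : g x = 0 := by
          by_contra h
          exact hx (hgs (subset_tsupport _ h))
        rw [this, zero_smul]
  refine Lp.ext ?_
  filter_upwards [(ae_restrict_iff' measurableSet_Ioi).2 key, ae_zero_Lp] with x h1 h2
  rw [h1, h2]

/-- The parity of the sine and the cosine. -/
def trigSign : Variant → ℂ
  | .D => -1
  | .N => 1

/-- The coefficient in Euler's formula. -/
def trigCoef : Variant → ℂ
  | .D => 1 / (2 * Complex.I)
  | .N => 1 / 2

theorem trig_eq_exp (b : Variant) (y : ℝ) :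
    (trig b y : ℂ) = trigCoef b * (Complex.exp ((y : ℝ) * Complex.I) +
      trigSign b * Complex.exp ((-y : ℝ) * Complex.I)) := by
  cases b
  · simp only [trig, trigCoef, trigSign]
    rw [Complex.ofReal_sin, Complex.sin]
    push_cast
    have hI : Complex.I ≠ 0 := Complex.I_ne_zero
    field_simp
    rw [Complex.I_sq]
    ring
  · simp only [trig, trigCoef, trigSign]
    rw [Complex.ofReal_cos, Complex.cos]
    push_cast
    ring

theorem trigSign_mul_self (b : Variant) : trigSign b * trigSign b = 1 := by
  cases b <;> simp [trigSign]

theorem trigCoef_sq (b : Variant) : trigCoef b ^ 2 * trigSign b = 1 / 4 := by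
  cases b
  · simp only [trigSign, trigCoef]
    rw [div_pow, mul_pow, Complex.I_sq]; norm_num
  · simp only [trigSign, trigCoef]; norm_num

theorem trigInt_eq_fourier (b : Variant) {u : ℝ → ℂ} (hu : Integrable u posMeasure) (p : ℝ) :
    trigInt b u p = √(2 / Real.pi) * trigCoef b *
      (𝓕 ((Ioi (0 : ℝ)).indicator u) (-(p / (2 * Real.pi))) +
        trigSign b * 𝓕 ((Ioi (0 : ℝ)).indicator u) (p / (2 * Real.pi))) := by
  have key : ∀ t : ℝ, 𝓕 ((Ioi (0 : ℝ)).indicator u) (t / (2 * Real.pi)) =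
      ∫ x, Complex.exp ((-t * x : ℝ) * Complex.I) * u x ∂posMeasure := by
    intro t
    rw [Real.fourier_eq', ← integral_indicator measurableSet_Ioi]
    congr 1
    funext x
    by_cases hx : x ∈ Ioi (0 : ℝ)
    · rw [indicator_of_mem hx, indicator_of_mem hx, smul_eq_mul]
      congr 3
      have : (2 * Real.pi) ≠ 0 := by positivity
      simp only [RCLike.inner_apply, conj_trivial]
      congr 1
      field_simp
    · simp [indicator_of_notMem hx]
  rw [← neg_div, key, key, trigInt, mul_assoc]
  congr 1
  rw [neg_neg, ← integral_const_mul, ← integral_add (integrable_exp_mul hu p)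
    ((integrable_exp_mul hu (-p)).const_mul _), ← integral_const_mul]
  congr 1
  funext x
  rw [trig_eq_exp]
  have : -(p * x) = -p * x := by ring
  rw [this]; ring

theorem integral_add_comp_neg {g : ℝ → ℂ} (hg : Integrable g) :
    ∫ p, (g p + g (-p)) ∂posMeasure = ∫ p, g p := by
  have h2 : IntegrableOn (fun p => g (-p)) (Ioi (0 : ℝ)) := hg.comp_neg.integrableOn
  rw [integral_add hg.integrableOn h2, integral_comp_neg_Ioi, neg_zero, add_comm]
  exact intervalIntegral.integral_Iic_add_Ioi hg.integrableOn hg.integrableOn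

theorem IsTestFunction.eq_zero {φ : ℝ → ℂ} (h : IsTestFunction φ) {x : ℝ} (hx : x ≤ 0) :
    φ x = 0 := by
  by_contra h'
  exact absurd (h.tsupport_subset (subset_tsupport _ h')) (not_lt.2 hx)

theorem IsTestFunction.integrable {φ : ℝ → ℂ} (h : IsTestFunction φ) : Integrable φ :=
  h.contDiff.continuous.integrable_of_hasCompactSupport h.hasCompactSupport

theorem IsTestFunction.indicator_eq {φ : ℝ → ℂ} (h : IsTestFunction φ) :
    (Ioi (0 : ℝ)).indicator φ = φ := by
  funext x
  by_cases hx : x ∈ Ioi (0 : ℝ)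
  · rw [indicator_of_mem hx]
  · rw [indicator_of_notMem hx, h.eq_zero (not_lt.1 hx)]

theorem IsTestFunction.deriv {φ : ℝ → ℂ} (h : IsTestFunction φ) : IsTestFunction (deriv φ) :=
  ⟨((contDiff_infty_iff_deriv (𝕜 := ℝ)).1 h.contDiff).2, h.hasCompactSupport.deriv,
    tsupport_deriv_subset.trans h.tsupport_subset⟩

/-- A test function extended by zero is a Schwartz function on the line. Both rapid decay of its
sine and cosine transforms and the inversion formula are inherited from its Fourier transform. -/
theorem IsTestFunction.exists_schwartz {φ : ℝ → ℂ} (h : IsTestFunction φ) :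
    ∃ S : SchwartzMap ℝ ℂ, (∀ (b : Variant) (p : ℝ), trigInt b φ p =
      √(2 / Real.pi) * trigCoef b * (S (-(p / (2 * Real.pi))) +
        trigSign b * S (p / (2 * Real.pi)))) ∧ ∀ x, 𝓕⁻ (S : ℝ → ℂ) x = φ x := by
  refine ⟨𝓕 (h.hasCompactSupport.toSchwartzMap h.contDiff), fun b p => ?_, fun x => ?_⟩
  · rw [trigInt_eq_fourier b h.integrable.integrableOn, h.indicator_eq, SchwartzMap.fourier_coe]
    rfl
  · rw [← SchwartzMap.fourierInv_coe, FourierTransform.fourierInv_fourier_eq]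
    rfl

theorem IsTestFunction.integrable_pow_trigInt {φ : ℝ → ℂ} (h : IsTestFunction φ) (b : Variant)
    (n : ℕ) : Integrable (fun p : ℝ => (p : ℂ) ^ n * trigInt b φ p) := by
  obtain ⟨S, hS, -⟩ := h.exists_schwartz
  have hpi : (2 * Real.pi) ≠ 0 := by positivity
  have i0 : Integrable (fun p : ℝ => (p : ℂ) ^ n * S p) := by
    refine (S.integrable_pow_mul volume n).mono' ?_ (Eventually.of_forall fun p => ?_)
    · exact ((by fun_prop : Continuous fun p : ℝ => (p : ℂ) ^ n).mul
        S.continuous).aestronglyMeasurable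
    · rw [norm_mul, norm_pow, Complex.norm_real]
  have i1 := (i0.comp_div hpi).const_mul ((2 * Real.pi : ℂ) ^ n)
  have i2 := i1.comp_neg
  refine (((i2.const_mul ((-1) ^ n)).add (i1.const_mul (trigSign b))).const_mul
    (√(2 / Real.pi) * trigCoef b)).congr (Eventually.of_forall fun p => ?_)
  have hpc : (2 * Real.pi : ℂ) ≠ 0 := by exact_mod_cast hpi
  simp only [Pi.add_apply]
  rw [hS, neg_div]
  have e : ∀ q : ℝ, (2 * Real.pi : ℂ) ^ n * (((q / (2 * Real.pi) : ℝ) : ℂ) ^ n) = (q : ℂ) ^ n := by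
    intro q
    push_cast
    rw [← mul_pow, mul_div_cancel₀ _ hpc]
  have e1 : ((-1 : ℂ)) ^ n * ((2 * Real.pi : ℂ) ^ n *
      (((-(p / (2 * Real.pi)) : ℝ) : ℂ) ^ n)) = (p : ℂ) ^ n := by
    rw [← neg_div, e]; push_cast; rw [← mul_pow]; ring
  rw [← e p]
  rw [← e p] at e1
  linear_combination (√(2 / Real.pi) * trigCoef b) * S (-(p / (2 * Real.pi))) * e1

/-- The inversion formula for test functions. -/
theorem IsTestFunction.trigInt_trigInt {φ : ℝ → ℂ} (h : IsTestFunction φ) (b : Variant) (x : ℝ) :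
    trigInt b (trigInt b φ) x = φ x + trigSign b * φ (-x) := by
  obtain ⟨S, hS, hinv⟩ := h.exists_schwartz
  have hpi : (2 * Real.pi) ≠ 0 := by positivity
  set g : ℝ → ℝ → ℂ := fun y p => Complex.exp ((y * p : ℝ) * Complex.I) * S (p / (2 * Real.pi))
  have hg : ∀ y, Integrable (g y) := fun y => by
    refine (S.integrable.comp_div hpi).bdd_mul (c := 1) (by fun_prop)
      (Eventually.of_forall fun p => ?_)
    rw [Complex.norm_exp_ofReal_mul_I]
  have hgi : ∀ y, ∫ p, g y p = 2 * Real.pi * φ y := fun y => by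
    have h1 := Measure.integral_comp_div
      (fun w : ℝ => Complex.exp ((2 * Real.pi * y * w : ℝ) * Complex.I) * S w) (2 * Real.pi)
    have h2 : ∀ p, Complex.exp ((2 * Real.pi * y * (p / (2 * Real.pi)) : ℝ) * Complex.I) *
        S (p / (2 * Real.pi)) = g y p := fun p => by
      have : 2 * Real.pi * y * (p / (2 * Real.pi)) = y * p := by field_simp
      rw [this]
    simp only [h2] at h1
    rw [h1, ← hinv y, Real.fourierInv_eq', abs_of_pos (by positivity), Complex.real_smul]
    push_cast
    congr 1
    refine integral_congr_ae (Eventually.of_forall fun w => ?_)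
    simp only [smul_eq_mul, RCLike.inner_apply, conj_trivial]
    congr 2
    push_cast; ring
  -- Written in exponentials the integrand is even in `p`: it is a sum of terms `g(p) + g(-p)`.
  -- Integrals over the half-line become integrals over the line, to which Fourier inversion applies
  -- at `x` and at `-x`.
  have h1 : ∀ p, (trig b (x * p) : ℂ) * trigInt b φ p = √(2 / Real.pi) * trigCoef b ^ 2 *
      (trigSign b * (g x p + g x (-p)) + (g (-x) p + g (-x) (-p))) := fun p => by
    rw [hS, trig_eq_exp]
    simp only [g]
    have e1 : -x * p = -(x * p) := by ring
    have e2 : x * -p = -(x * p) := by ring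
    have e3 : -x * -p = x * p := by ring
    rw [e1, e2, e3, neg_div]
    linear_combination (√(2 / Real.pi) * trigCoef b ^ 2) *
      Complex.exp ((-(x * p) : ℝ) * Complex.I) * S (p / (2 * Real.pi)) * trigSign_mul_self b
  have ii : ∀ y, Integrable (fun p => g y p + g y (-p)) posMeasure := fun y =>
    ((hg y).add (hg y).comp_neg).integrableOn
  rw [trigInt]
  simp only [h1]
  rw [integral_const_mul, integral_add ((ii x).const_mul _) (ii (-x)), integral_const_mul,
    integral_add_comp_neg (hg x), integral_add_comp_neg (hg (-x)), hgi, hgi]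
  have e : (√(2 / Real.pi) : ℂ) * √(2 / Real.pi) = 2 / Real.pi := by
    rw [← Complex.ofReal_mul, Real.mul_self_sqrt (by positivity)]
    push_cast; rfl
  have hpc : (Real.pi : ℂ) ≠ 0 := Complex.ofReal_ne_zero.2 Real.pi_ne_zero
  have e4 := trigCoef_sq b
  have e5 := trigSign_mul_self b
  have e6 : trigCoef b ^ 2 = trigSign b / 4 := by
    linear_combination trigSign b * e4 - trigCoef b ^ 2 * e5
  calc (√(2 / Real.pi) : ℂ) * (√(2 / Real.pi) * trigCoef b ^ 2 *
        (trigSign b * (2 * Real.pi * φ x) + 2 * Real.pi * φ (-x)))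
      = (√(2 / Real.pi) * √(2 / Real.pi)) * trigCoef b ^ 2 *
        (trigSign b * (2 * Real.pi * φ x) + 2 * Real.pi * φ (-x)) := by ring
    _ = φ x + trigSign b * φ (-x) := by
      rw [e, e6]
      field_simp
      linear_combination (4 * φ x) * e5

/-- Integration by parts turns the sine transformation into the cosine transformation. -/
theorem IsTestFunction.mul_trigInt {φ : ℝ → ℂ} (h : IsTestFunction φ) (p : ℝ) :
    (p : ℂ) * trigInt .D φ p = trigInt .N (_root_.deriv φ) p := by
  have full : ∀ (b : Variant) {χ : ℝ → ℂ}, IsTestFunction χ →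
      ∫ x, (trig b (p * x) : ℂ) * χ x ∂posMeasure = ∫ x, (trig b (p * x) : ℂ) * χ x := by
    intro b χ hχ
    refine setIntegral_eq_integral_of_forall_compl_eq_zero fun x hx => ?_
    rw [hχ.eq_zero (not_lt.1 hx), mul_zero]
  have ii : ∀ (b : Variant) {χ : ℝ → ℂ}, IsTestFunction χ →
      Integrable (fun x => (trig b (p * x) : ℂ) * χ x) := by
    intro b χ hχ
    refine hχ.integrable.bdd_mul (c := 1) ?_ (Eventually.of_forall fun x => norm_trig_le b _)
    have := continuous_trig b
    exact (by fun_prop : Continuous fun x : ℝ => (trig b (p * x) : ℂ)).aestronglyMeasurable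
  have hu : ∀ x : ℝ, HasDerivAt (fun x : ℝ => (trig .N (p * x) : ℂ))
      (-p * (trig .D (p * x) : ℂ)) x := by
    intro x
    have h1 : HasDerivAt (fun x : ℝ => Real.cos (p * x)) (-Real.sin (p * x) * (p * 1)) x :=
      ((hasDerivAt_id x).const_mul p).cos
    refine h1.ofReal_comp.congr_deriv ?_
    simp only [trig]; push_cast; ring
  have hv : ∀ x : ℝ, HasDerivAt φ (_root_.deriv φ x) x := fun x =>
    (h.contDiff.differentiable (by simp) x).hasDerivAt
  have key := integral_mul_deriv_eq_deriv_mul_of_integrable (fun x _ => hu x) (fun x _ => hv x) (ii .N h.deriv)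
    (by
      refine ((ii .D h).const_mul (-p)).congr (Eventually.of_forall fun x => ?_)
      simp only [Pi.mul_apply]; ring) (ii .N h)
  rw [trigInt, trigInt, full .D h, full .N h.deriv, key]
  have : ∀ x, -(p : ℂ) * (trig .D (p * x) : ℂ) * φ x = -(p : ℂ) * ((trig .D (p * x) : ℂ) * φ x) :=
    fun x => by ring
  simp only [this]
  rw [integral_const_mul]
  ring

/-- This is the inversion formula at `x = 0`, where a test function vanishes. -/
theorem IsTestFunction.integral_trigInt_cos {φ : ℝ → ℂ} (h : IsTestFunction φ) :
    ∫ p, trigInt .N φ p ∂posMeasure = 0 := by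
  have h1 := h.trigInt_trigInt .N 0
  rw [neg_zero, h.eq_zero le_rfl, mul_zero, add_zero, trigInt] at h1
  have h2 : (√(2 / Real.pi) : ℂ) ≠ 0 :=
    Complex.ofReal_ne_zero.2 (Real.sqrt_ne_zero'.2 (by positivity))
  simpa [trig, h2] using (mul_eq_zero.1 h1).resolve_left h2

theorem transform_test_ae_eq (b : Variant) {f : HalfLineL2} {φ : ℝ → ℂ} (h : IsTestFunction φ)
    (hf : f =ᵐ[posMeasure] φ) : transform b f =ᵐ[posMeasure] trigInt b φ := by
  rw [← trigInt_congr b hf]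
  exact transform_ae_eq b (Integrable.congr h.integrable.integrableOn hf.symm)

/-- Rapid decay gives the moments. The moment condition reflects vanishing at the origin: for the
cosine it is `φ(0) = 0`, and for the sine, after one integration by parts, `φ'(0) = 0`. -/
theorem transform_test_mem_momCore (b : Variant) {f : HalfLineL2} (hf : f ∈ testSpace) :
    transform b f ∈ momCore b := by
  obtain ⟨φ, h, hf⟩ := hf
  have e := transform_test_ae_eq b h hf
  have ew : (fun q => (weight b q : ℂ) * transform b f q) =ᵐ[posMeasure]
      fun q => (weight b q : ℂ) * trigInt b φ q := by
    filter_upwards [e] with q hq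
    rw [hq]
  obtain ⟨C, hC⟩ : ∃ C, ∀ p, ‖trigInt b φ p‖ ≤ C := by
    refine ⟨√(2 / Real.pi) * ∫ x, ‖φ x‖ ∂posMeasure, fun p => ?_⟩
    rw [trigInt, norm_mul, Complex.norm_real, Real.norm_of_nonneg (Real.sqrt_nonneg _)]
    refine mul_le_mul_of_nonneg_left ?_ (Real.sqrt_nonneg _)
    refine norm_integral_le_of_norm_le h.integrable.norm.integrableOn
      (Eventually.of_forall fun x => ?_)
    rw [norm_mul]
    exact mul_le_of_le_one_left (norm_nonneg _) (norm_trig_le b _)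
  refine ⟨fun n => ?_, ?_, ?_⟩
  · have h1 : Integrable (fun p : ℝ => C * ‖(p : ℂ) ^ n * trigInt b φ p‖) posMeasure :=
      ((h.integrable_pow_trigInt b n).norm.integrableOn).const_mul C
    refine h1.mono' ?_ ?_
    · exact ((Lp.aestronglyMeasurable _).norm.pow 2).mul (by fun_prop)
    · filter_upwards [e, ae_restrict_mem measurableSet_Ioi] with p hp hp0
      have hp0 : 0 < p := hp0
      rw [hp, Real.norm_of_nonneg (by positivity), norm_mul, norm_pow, Complex.norm_real,
        Real.norm_of_nonneg hp0.le, sq]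
      have := mul_le_mul_of_nonneg_right (hC p)
        (mul_nonneg (pow_nonneg hp0.le n) (norm_nonneg (trigInt b φ p)))
      linarith
  · refine Integrable.congr ?_ ew.symm
    cases b
    · have : Integrable _ posMeasure := (h.integrable_pow_trigInt .D 1).integrableOn
      simpa [weight] using this
    · have : Integrable _ posMeasure := (h.integrable_pow_trigInt .N 0).integrableOn
      simpa [weight] using this
  · rw [integral_congr_ae ew]
    cases b
    · simp only [weight, h.mul_trigInt]
      exact h.deriv.integral_trigInt_cos
    · simpa [weight] using h.integral_trigInt_cos

/-- By density it suffices to treat test functions. There the inversion formula has the extra term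
`± φ(-x)`, which vanishes for `x > 0`. -/
theorem transform_transform (b : Variant) (f : HalfLineL2) : transform b (transform b f) = f := by
  have hc : Continuous fun f => transform b (transform b f) :=
    (continuous_transform b).comp (continuous_transform b)
  refine congrFun (hc.ext_on dense_testSpace continuous_id fun f hf => ?_) f
  have hm := transform_test_mem_momCore b hf
  obtain ⟨φ, h, hf⟩ := hf
  refine Lp.ext ?_
  refine (transform_ae_eq b (integrable_core hm)).trans ?_
  rw [trigInt_congr b (transform_test_ae_eq b h hf)]
  filter_upwards [hf, ae_restrict_mem measurableSet_Ioi] with x hx hx0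
  have hx0 : 0 < x := hx0
  rw [h.trigInt_trigInt, h.eq_zero (by linarith : -x ≤ 0), mul_zero, add_zero, id, hx]

theorem pair_transform_of_integrable (b : Variant) {f g : HalfLineL2}
    (hf : Integrable f posMeasure) (hg : Integrable g posMeasure) :
    pair (transform b f) g = pair f (transform b g) := by
  have hprod : Integrable (fun z : ℝ × ℝ => (trig b (z.1 * z.2) : ℂ) * (f z.2 * g z.1))
      (posMeasure.prod posMeasure) := by
    have h1 : Integrable (fun z : ℝ × ℝ => f z.2 * g z.1) (posMeasure.prod posMeasure) := by
      simpa only [mul_comm] using hg.mul_prod hf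
    refine h1.bdd_mul (c := 1) ?_ (Eventually.of_forall fun z => norm_trig_le b _)
    have := continuous_trig b
    exact (by fun_prop : Continuous fun z : ℝ × ℝ =>
      (trig b (z.1 * z.2) : ℂ)).aestronglyMeasurable
  have e1 : pair (transform b f) g =
      ∫ p, ∫ x, √(2 / Real.pi) * ((trig b (p * x) : ℂ) * (f x * g p)) ∂posMeasure ∂posMeasure := by
    refine integral_congr_ae ?_
    filter_upwards [transform_ae_eq b hf] with p hp
    rw [hp, trigInt, integral_const_mul, mul_assoc, ← integral_mul_const]
    simp only [mul_assoc]
  have e2 : pair f (transform b g) =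
      ∫ x, ∫ p, √(2 / Real.pi) * ((trig b (p * x) : ℂ) * (f x * g p)) ∂posMeasure ∂posMeasure := by
    refine integral_congr_ae ?_
    filter_upwards [transform_ae_eq b hg] with x hx
    rw [hx, trigInt, integral_const_mul, mul_left_comm, ← integral_const_mul]
    congr 2
    funext p
    rw [mul_comm x p, mul_left_comm]
  rw [e1, e2]
  exact integral_integral_swap (hprod.const_mul (√(2 / Real.pi) : ℂ))

/-- Fubini with the symmetric kernel for integrable functions, then density in each argument
separately. -/
theorem pair_transform (b : Variant) (f g : HalfLineL2) :
    pair (transform b f) g = pair f (transform b g) := by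
  have hint : ∀ f ∈ testSpace, Integrable f posMeasure := by
    rintro f ⟨φ, h, hf⟩
    exact Integrable.congr h.integrable.integrableOn hf.symm
  have h1 : ∀ f ∈ testSpace, ∀ g, pair (transform b f) g = pair f (transform b g) := by
    intro f hf g
    refine congrFun ((continuous_pair_right _).ext_on dense_testSpace
      ((continuous_pair_right f).comp (continuous_transform b)) fun g hg => ?_) g
    exact pair_transform_of_integrable b (hint f hf) (hint g hg)
  have h2 : Continuous fun f => pair (transform b f) g := by
    simp only [pair_comm _ g]
    exact (continuous_pair_right g).comp (continuous_transform b)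
  have h3 : Continuous fun f => pair f (transform b g) := by
    simp only [pair_comm _ (transform b g)]
    exact continuous_pair_right _
  exact congrFun (h2.ext_on dense_testSpace h3 fun f hf => h1 f hf g) f

/-! ## Position space: the minimal and the maximal relation -/

theorem integrable_mul_test {u φ : ℝ → ℂ} (hu : ContinuousOn u (Ioi 0)) (h : IsTestFunction φ) :
    Integrable (fun x => u x * φ x) := by
  refine Continuous.integrable_of_hasCompactSupport ?_ h.hasCompactSupport.mul_left
  refine continuous_of_tsupport fun x hx => ?_
  have hx0 := h.tsupport_subset (tsupport_mul_subset_right hx)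
  exact (hu.continuousAt (Ioi_mem_nhds hx0)).mul h.contDiff.continuous.continuousAt

/-- Two integrations by parts against a test function. -/
theorem integral_mul_deriv_deriv_test {u u' u'' φ : ℝ → ℂ}
    (h1 : ∀ x, 0 < x → HasDerivAt u (u' x) x) (h2 : ∀ x, 0 < x → HasDerivAt u' (u'' x) x)
    (hc : ContinuousOn u'' (Ioi 0)) (h : IsTestFunction φ) :
    ∫ x, u x * deriv (deriv φ) x = ∫ x, u'' x * φ x := by
  have c0 : ContinuousOn u (Ioi 0) := fun x hx => (h1 x hx).continuousAt.continuousWithinAt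
  have c1 : ContinuousOn u' (Ioi 0) := fun x hx => (h2 x hx).continuousAt.continuousWithinAt
  have d : ∀ {χ : ℝ → ℂ}, IsTestFunction χ → ∀ x, HasDerivAt χ (deriv χ x) x := fun hχ x =>
    (hχ.contDiff.differentiable (by simp) x).hasDerivAt
  rw [integral_mul_deriv_eq_deriv_mul_of_integrable (u' := u')
      (fun x hx => h1 x (h.deriv.tsupport_subset hx)) (fun x _ => d h.deriv x)
      (integrable_mul_test c0 h.deriv.deriv) (integrable_mul_test c1 h.deriv)
      (integrable_mul_test c0 h.deriv),
    integral_mul_deriv_eq_deriv_mul_of_integrable (u' := u'')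
      (fun x hx => h2 x (h.tsupport_subset hx)) (fun x _ => d h x)
      (integrable_mul_test c1 h.deriv) (integrable_mul_test hc h) (integrable_mul_test c1 h),
    neg_neg]

theorem continuousOn_const_div_sq (c : ℂ) : ContinuousOn (fun x : ℝ => c / (x : ℂ) ^ 2) (Ioi 0) :=
  continuousOn_const.div (by fun_prop) fun _ hx =>
    pow_ne_zero 2 (Complex.ofReal_ne_zero.2 (ne_of_gt hx))

theorem integral_mul_besselExpr {α : ℝ} {u u' u'' φ : ℝ → ℂ}
    (h1 : ∀ x, 0 < x → HasDerivAt u (u' x) x) (h2 : ∀ x, 0 < x → HasDerivAt u' (u'' x) x)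
    (hc : ContinuousOn u'' (Ioi 0)) (h : IsTestFunction φ) :
    ∫ x, u x * besselExpr α φ x ∂posMeasure =
      ∫ x, (-u'' x + ((α : ℂ) - 1 / 4) / (x : ℂ) ^ 2 * u x) * φ x ∂posMeasure := by
  have c0 : ContinuousOn u (Ioi 0) := fun x hx => (h1 x hx).continuousAt.continuousWithinAt
  have e := integral_mul_deriv_deriv_test h1 h2 hc h
  have i1 := (integrable_mul_test c0 h.deriv.deriv).integrableOn (s := Ioi 0)
  have i2 := (integrable_mul_test hc h).integrableOn (s := Ioi 0)
  have i3 : Integrable (fun x : ℝ => ((α : ℂ) - 1 / 4) / (x : ℂ) ^ 2 * u x * φ x) posMeasure :=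
    (integrable_mul_test ((continuousOn_const_div_sq ((α : ℂ) - 1 / 4)).mul c0) h).integrableOn
  have full : ∀ {v χ : ℝ → ℂ}, IsTestFunction χ →
      ∫ x, v x * χ x ∂posMeasure = ∫ x, v x * χ x := fun hχ =>
    setIntegral_eq_integral_of_forall_compl_eq_zero fun x hx => by
      rw [hχ.eq_zero (not_lt.1 hx), mul_zero]
  rw [← full h.deriv.deriv, ← full h] at e
  have e1 : ∀ x, u x * besselExpr α φ x = ((α : ℂ) - 1 / 4) / (x : ℂ) ^ 2 * u x *
      φ x - u x * deriv (deriv φ) x := fun x => by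
    rw [besselExpr]; ring
  have e2 : ∀ x, (-u'' x + ((α : ℂ) - 1 / 4) / (x : ℂ) ^ 2 * u x) * φ x =
      ((α : ℂ) - 1 / 4) / (x : ℂ) ^ 2 * u x * φ x - u'' x * φ x := fun x => by
    ring
  simp only [e1, e2]
  rw [integral_sub i3 i1, integral_sub i3 i2, e]

theorem besselExpr_eq {α : ℝ} {u u' u'' : ℝ → ℂ} (h1 : ∀ x, 0 < x → HasDerivAt u (u' x) x)
    (h2 : ∀ x, 0 < x → HasDerivAt u' (u'' x) x) {x : ℝ} (hx : 0 < x) :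
    besselExpr α u x = -u'' x + ((α : ℂ) - 1 / 4) / (x : ℂ) ^ 2 * u x := by
  have e : deriv u =ᶠ[𝓝 x] u' := by
    filter_upwards [Ioi_mem_nhds hx] with y hy
    exact (h1 y hy).deriv
  rw [besselExpr, e.deriv_eq, (h2 x hx).deriv]

/-- The maximal relation in position space. -/
def weakRel (α : ℝ) : Submodule ℂ (HalfLineL2 × HalfLineL2) where
  carrier := {z | IsWeakBessel α z.1 z.2}
  add_mem' := by
    intro a b ha hb φ hφ
    have e := hφ.memLp_besselExpr α
    have h : ∀ f : HalfLineL2, ∫ x, f x * besselExpr α φ x ∂posMeasure = pair f e.toLp := fun f =>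
      integral_congr_ae (by filter_upwards [e.coeFn_toLp] with x hx; rw [hx])
    have h' : ∀ f : HalfLineL2, ∫ x, f x * φ x ∂posMeasure = pair f hφ.memLp.toLp := fun f =>
      integral_congr_ae (by filter_upwards [hφ.memLp.coeFn_toLp] with x hx; rw [hx])
    have h1 := ha φ hφ
    have h2 := hb φ hφ
    rw [h, h'] at h1 h2 ⊢
    simp only [Prod.fst_add, Prod.snd_add, map_add, LinearMap.add_apply, h1, h2]
  zero_mem' := (posMaxDomain α).zero_mem.elim fun h hh => by
    intro φ hφ
    rw [integral_eq_zero_of_ae, integral_eq_zero_of_ae]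
    · filter_upwards [ae_zero_Lp] with x hx
      simp only [Prod.snd_zero, hx, Pi.zero_apply, zero_mul]
    · filter_upwards [ae_zero_Lp] with x hx
      simp only [Prod.fst_zero, hx, Pi.zero_apply, zero_mul]
  smul_mem' := by
    intro c a ha φ hφ
    have e := hφ.memLp_besselExpr α
    have h : ∀ f : HalfLineL2, ∫ x, f x * besselExpr α φ x ∂posMeasure = pair f e.toLp := fun f =>
      integral_congr_ae (by filter_upwards [e.coeFn_toLp] with x hx; rw [hx])
    have h' : ∀ f : HalfLineL2, ∫ x, f x * φ x ∂posMeasure = pair f hφ.memLp.toLp := fun f =>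
      integral_congr_ae (by filter_upwards [hφ.memLp.coeFn_toLp] with x hx; rw [hx])
    have h1 := ha φ hφ
    rw [h, h'] at h1 ⊢
    simp only [Prod.smul_fst, Prod.smul_snd, map_smul, LinearMap.smul_apply, h1]

theorem weakRel_single_valued {α : ℝ} (y : HalfLineL2) (h : (0, y) ∈ weakRel α) : y = 0 := by
  refine eq_zero_of_pair fun g => ?_
  refine congrFun ((continuous_pair_right y).ext_on dense_testSpace continuous_const
    fun f hf => ?_) g
  obtain ⟨φ, hφ, hf⟩ := hf
  have h1 := h φ hφ
  have h2 : ∫ x, (0 : HalfLineL2) x * besselExpr α φ x ∂posMeasure = 0 := by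
    refine integral_eq_zero_of_ae ?_
    filter_upwards [ae_zero_Lp] with x hx
    rw [hx, zero_mul, Pi.zero_apply]
  rw [h2] at h1
  rw [h1, pair_apply]
  refine integral_congr_ae ?_
  filter_upwards [hf] with x hx
  rw [hx]

theorem mem_weakRel_of_hasDerivAt {α : ℝ} {u u' u'' : ℝ → ℂ}
    (h1 : ∀ x, 0 < x → HasDerivAt u (u' x) x) (h2 : ∀ x, 0 < x → HasDerivAt u' (u'' x) x)
    (hc : ContinuousOn u'' (Ioi 0)) {f h : HalfLineL2} (hf : f =ᵐ[posMeasure] u)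
    (hh : h =ᵐ[posMeasure] fun x => -u'' x + ((α : ℂ) - 1 / 4) / (x : ℂ) ^ 2 * u x) :
    (f, h) ∈ weakRel α := by
  intro φ hφ
  have e1 : ∫ x, f x * besselExpr α φ x ∂posMeasure = ∫ x, u x * besselExpr α φ x ∂posMeasure :=
    integral_congr_ae (by filter_upwards [hf] with x hx; rw [hx])
  have e2 : ∫ x, h x * φ x ∂posMeasure =
      ∫ x, (-u'' x + ((α : ℂ) - 1 / 4) / (x : ℂ) ^ 2 * u x) * φ x ∂posMeasure :=
    integral_congr_ae (by filter_upwards [hh] with x hx; rw [hx])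
  exact e1.trans ((integral_mul_besselExpr h1 h2 hc hφ).trans e2.symm)

/-- The operator whose closure is `posMin α`. -/
abbrev posPre (α : ℝ) : HalfLineL2 →ₗ.[ℂ] HalfLineL2 :=
  operatorOn testSpace fun f h => ∃ φ, IsTestFunction φ ∧ f =ᵐ[posMeasure] φ ∧
    h =ᵐ[posMeasure] besselExpr α φ

theorem IsTestFunction.hasDerivAt {φ : ℝ → ℂ} (h : IsTestFunction φ) (x : ℝ) :
    HasDerivAt φ (_root_.deriv φ x) x :=
  (h.contDiff.differentiable (by simp) x).hasDerivAt

theorem mem_weakRel_of_test {α : ℝ} {φ : ℝ → ℂ} (hφ : IsTestFunction φ) {f h : HalfLineL2}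
    (hf : f =ᵐ[posMeasure] φ) (hh : h =ᵐ[posMeasure] besselExpr α φ) : (f, h) ∈ weakRel α :=
  mem_weakRel_of_hasDerivAt (fun x _ => hφ.hasDerivAt x) (fun x _ => hφ.deriv.hasDerivAt x)
    hφ.deriv.deriv.contDiff.continuous.continuousOn hf hh

theorem mem_graph_posPre {α : ℝ} {f h : HalfLineL2} : (f, h) ∈ (posPre α).graph ↔
    ∃ φ, IsTestFunction φ ∧ f =ᵐ[posMeasure] φ ∧ h =ᵐ[posMeasure] besselExpr α φ := by
  rw [mem_graph_operatorOn (weakRel α) weakRel_single_valued]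
  · constructor
    · rintro ⟨⟨φ, hφ, hf⟩, hm⟩
      refine ⟨φ, hφ, hf, ?_⟩
      have e := (hφ.memLp_besselExpr α).coeFn_toLp
      have := (weakRel α).sub_mem hm (mem_weakRel_of_test hφ hf e)
      rw [Prod.mk_sub_mk, sub_self] at this
      rwa [sub_eq_zero.1 (weakRel_single_valued _ this)]
    · rintro ⟨φ, hφ, hf, hh⟩
      exact ⟨⟨φ, hφ, hf⟩, mem_weakRel_of_test hφ hf hh⟩
  · rintro f ⟨φ, hφ, hf⟩
    have e := (hφ.memLp_besselExpr α).coeFn_toLp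
    exact ⟨_, mem_weakRel_of_test hφ hf e, φ, hφ, hf, e⟩
  · rintro f - h ⟨φ, hφ, hf, hh⟩
    exact mem_weakRel_of_test hφ hf hh

theorem mem_graph_posMax {α : ℝ} {f h : HalfLineL2} :
    (f, h) ∈ (posMax α).graph ↔ (f, h) ∈ weakRel α := by
  unfold posMax
  rw [mem_graph_operatorOn (weakRel α) weakRel_single_valued]
  · exact ⟨fun h => h.2, fun hm => ⟨⟨h, hm⟩, hm⟩⟩
  · rintro f ⟨h, hm⟩
    exact ⟨h, hm, hm⟩
  · exact fun f _ h hm => hm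

/-- A distributional solution is by definition an element of the adjoint on test functions. This
makes the position space discussion parallel to the momentum one. -/
theorem bilinAdjoint_posPre (α : ℝ) : bilinAdjoint (posPre α).graph = weakRel α := by
  ext ⟨f, h⟩
  constructor
  · intro hm φ hφ
    have e1 := hφ.memLp.coeFn_toLp
    have e2 := (hφ.memLp_besselExpr α).coeFn_toLp
    have := hm (hφ.memLp.toLp, (hφ.memLp_besselExpr α).toLp) (mem_graph_posPre.2 ⟨φ, hφ, e1, e2⟩)
    rw [pair_apply, pair_apply] at this
    refine Eq.trans ?_ (this.symm.trans ?_)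
    · exact integral_congr_ae (by filter_upwards [e2] with x hx; rw [hx])
    · exact integral_congr_ae (by filter_upwards [e1] with x hx; rw [hx])
  · rintro hm ⟨g, k⟩ hg
    obtain ⟨φ, hφ, hg, hk⟩ := mem_graph_posPre.1 hg
    rw [pair_apply, pair_apply]
    refine Eq.trans ?_ ((hm φ hφ).symm.trans ?_)
    · exact integral_congr_ae (by filter_upwards [hg] with x hx; rw [hx])
    · exact integral_congr_ae (by filter_upwards [hk] with x hx; rw [hx])

/-- Same mechanism as `graph_momMin`: the closure is the double adjoint, and the first adjoint is
the weak relation. -/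
theorem graph_posMin (α : ℝ) : (posMin α).graph = bilinAdjoint (weakRel α) := by
  have h : (posPre α).IsClosable := isClosable_of_closure_graph fun y hy => by
    refine weakRel_single_valued (α := α) y
      (Submodule.topologicalClosure_minimal _ ?_ ?_ hy)
    · rintro ⟨f, k⟩ hf
      obtain ⟨φ, hφ, hf, hk⟩ := mem_graph_posPre.1 hf
      exact mem_weakRel_of_test hφ hf hk
    · rw [← bilinAdjoint_posPre]
      exact isClosed_bilinAdjoint _
  rw [← bilinAdjoint_posPre, bilinAdjoint_bilinAdjoint]
  exact h.graph_closure_eq_closure_graph.symm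

/-! ## Cutting off near the origin and near infinity -/

/-- The quantities `y r'` and `y² r''` are invariant under dilations; bounding them gives estimates
uniform in the scale for the cutoffs built from `r`. -/
theorem exists_ramp : ∃ r r₁ r₂ : ℝ → ℝ, ∃ C : ℝ, ContDiff ℝ ∞ r ∧
    (∀ y, HasDerivAt r (r₁ y) y) ∧ (∀ y, HasDerivAt r₁ (r₂ y) y) ∧
    (∀ y, |r y| ≤ 1 ∧ |1 - r y| ≤ 1 ∧ |y * r₁ y| ≤ C ∧ |y ^ 2 * r₂ y| ≤ C) ∧
    (∀ y < 1, r y = 0 ∧ r₁ y = 0 ∧ r₂ y = 0) ∧ ∀ y > 2, r y = 1 ∧ r₁ y = 0 ∧ r₂ y = 0 := by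
  set r : ℝ → ℝ := fun y => Real.smoothTransition (y - 1) with hr
  have hs : ContDiff ℝ ∞ r := Real.smoothTransition.contDiff.comp (by fun_prop)
  have hs1 : ContDiff ℝ ∞ (deriv r) := ((contDiff_infty_iff_deriv (𝕜 := ℝ)).1 hs).2
  have hs2 : ContDiff ℝ ∞ (deriv (deriv r)) := ((contDiff_infty_iff_deriv (𝕜 := ℝ)).1 hs1).2
  have low : ∀ y < 1, r =ᶠ[𝓝 y] fun _ => 0 := fun y hy => by
    filter_upwards [Iio_mem_nhds hy] with z hz
    exact Real.smoothTransition.zero_of_nonpos (by have : z < 1 := hz; linarith)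
  have high : ∀ y > 2, r =ᶠ[𝓝 y] fun _ => 1 := fun y hy => by
    filter_upwards [Ioi_mem_nhds hy] with z hz
    exact Real.smoothTransition.one_of_one_le (by have : 2 < z := hz; linarith)
  have low1 : ∀ y < 1, deriv r =ᶠ[𝓝 y] fun _ => 0 := fun y hy => by
    refine (low y hy).deriv.trans (Eventually.of_forall fun z => ?_)
    simp
  have high1 : ∀ y > 2, deriv r =ᶠ[𝓝 y] fun _ => 0 := fun y hy => by
    refine (high y hy).deriv.trans (Eventually.of_forall fun z => ?_)
    simp
  have low2 : ∀ y < 1, deriv (deriv r) y = 0 := fun y hy => by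
    rw [(low1 y hy).deriv_eq]; simp
  have high2 : ∀ y > 2, deriv (deriv r) y = 0 := fun y hy => by
    rw [(high1 y hy).deriv_eq]; simp
  have bound : ∀ g : ℝ → ℝ, Continuous g → (∀ y < 1, g y = 0) → (∀ y > 2, g y = 0) →
      ∃ C, ∀ y, |g y| ≤ C := fun g hg h1 h2 => by
    obtain ⟨C, hC⟩ := isCompact_Icc.exists_bound_of_continuousOn
      (s := Icc (1 : ℝ) 2) hg.continuousOn
    refine ⟨max C 0, fun y => ?_⟩
    by_cases hy : y ∈ Icc (1 : ℝ) 2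
    · exact (hC y hy).trans (le_max_left _ _)
    · have : g y = 0 := by
        by_cases hy1 : y < 1
        · exact h1 y hy1
        · exact h2 y (by
            by_contra h
            exact hy ⟨not_lt.1 hy1, not_lt.1 h⟩)
      rw [this, abs_zero]
      exact le_max_right _ _
  obtain ⟨C₁, hC₁⟩ := bound (fun y => y * deriv r y) (continuous_id.mul hs1.continuous)
    (fun y hy => by simp only [(low1 y hy).eq_of_nhds, mul_zero])
    (fun y hy => by simp only [(high1 y hy).eq_of_nhds, mul_zero])
  obtain ⟨C₂, hC₂⟩ := bound (fun y => y ^ 2 * deriv (deriv r) y)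
    ((continuous_id.pow 2).mul hs2.continuous)
    (fun y hy => by simp only [low2 y hy, mul_zero])
    (fun y hy => by simp only [high2 y hy, mul_zero])
  refine ⟨r, deriv r, deriv (deriv r), max C₁ C₂, hs,
    fun y => (hs.differentiable (by simp) y).hasDerivAt,
    fun y => (hs1.differentiable (by simp) y).hasDerivAt, fun y => ⟨?_, ?_, ?_, ?_⟩,
    fun y hy => ⟨(low y hy).eq_of_nhds, (low1 y hy).eq_of_nhds, low2 y hy⟩,
    fun y hy => ⟨(high y hy).eq_of_nhds, (high1 y hy).eq_of_nhds, high2 y hy⟩⟩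
  · rw [abs_le]
    constructor <;> linarith [Real.smoothTransition.nonneg (y - 1),
      Real.smoothTransition.le_one (y - 1)]
  · rw [abs_le]
    constructor <;> linarith [Real.smoothTransition.nonneg (y - 1),
      Real.smoothTransition.le_one (y - 1)]
  · exact (hC₁ y).trans (le_max_left _ _)
  · exact (hC₂ y).trans (le_max_right _ _)

/-- A sequence of cutoffs, equal to one on larger and larger compact subsets of the half-line. -/
theorem exists_cut : ∃ χ χ₁ χ₂ : ℕ → ℝ → ℝ, ∃ C : ℝ, 0 ≤ C ∧ ∀ n, ContDiff ℝ ∞ (χ n) ∧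
    HasCompactSupport (χ n) ∧ tsupport (χ n) ⊆ Ioi 0 ∧ ∀ x, 0 < x →
      HasDerivAt (χ n) (χ₁ n x) x ∧ HasDerivAt (χ₁ n) (χ₂ n x) x ∧
      |χ n x| ≤ C ∧ |χ₁ n x| ≤ C / x ∧ |χ₂ n x| ≤ C / x ^ 2 ∧
      ∀ᶠ k in atTop, χ k x = 1 ∧ χ₁ k x = 0 ∧ χ₂ k x = 0 := by
  obtain ⟨r, r₁, r₂, C, hs, d1, d2, hb, hl, hh⟩ := exists_ramp
  have hC : 0 ≤ C := (abs_nonneg _).trans (hb 0).2.2.1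
  set N : ℕ → ℝ := fun n => (n : ℝ) + 1
  have hN : ∀ n, 0 < N n := fun n => by positivity
  -- With `N = n + 1` the cutoff rises on `[1/N, 2/N]` and falls on `[N, 2N]`. The next two entries
  -- are its first and second derivatives, and dilation invariance yields the bounds `C/x` and
  -- `C/x²` independently of `n`.
  refine ⟨fun n x => r (N n * x) * (1 - r (x / N n)),
    fun n x => N n * r₁ (N n * x) * (1 - r (x / N n)) - r (N n * x) * (r₁ (x / N n) / N n),
    fun n x => N n * (N n * r₂ (N n * x)) * (1 - r (x / N n)) -
      2 * (N n * r₁ (N n * x) * (r₁ (x / N n) / N n)) -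
      r (N n * x) * (r₂ (x / N n) / N n / N n), 1 + 2 * C + 2 * C ^ 2, by positivity,
    fun n => ?_⟩
  have supp : tsupport (fun x => r (N n * x) * (1 - r (x / N n))) ⊆
      Icc (1 / N n) (2 * N n) := by
    refine closure_minimal (fun x hx => ?_) isClosed_Icc
    rw [Function.mem_support] at hx
    by_contra h
    refine hx ?_
    by_cases h1 : N n * x < 1
    · rw [(hl _ h1).1, zero_mul]
    · have h2 : 2 < x / N n := by
        by_contra h2
        refine h ⟨?_, ?_⟩
        · rw [div_le_iff₀ (hN n)]; linarith
        · exact (div_le_iff₀ (hN n)).1 (not_lt.1 h2)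
      rw [(hh _ h2).1, sub_self, mul_zero]
  refine ⟨?_, ?_, ?_, fun x hx => ?_⟩
  · exact (hs.comp (by fun_prop)).mul (contDiff_const.sub (hs.comp (by fun_prop)))
  · exact isCompact_Icc.of_isClosed_subset (isClosed_tsupport _) supp
  · exact supp.trans fun x hx => lt_of_lt_of_le (by have := hN n; positivity) hx.1
  have a1 : ∀ {g g' : ℝ → ℝ} (_ : ∀ y, HasDerivAt g (g' y) y),
      HasDerivAt (fun x => g (N n * x)) (N n * g' (N n * x)) x := fun {g g'} hg => by
    have := (hg (N n * x)).comp x ((hasDerivAt_id x).const_mul (N n))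
    refine this.congr_deriv ?_
    ring
  have a2 : ∀ {g g' : ℝ → ℝ} (_ : ∀ y, HasDerivAt g (g' y) y),
      HasDerivAt (fun x => g (x / N n)) (g' (x / N n) / N n) x := fun {g g'} hg => by
    have := (hg (x / N n)).comp x ((hasDerivAt_id x).div_const (N n))
    refine this.congr_deriv ?_
    ring
  have hNn := (hN n).ne'
  have hxn := hx.ne'
  have bnd : ∀ {a t y : ℝ}, 0 < y → |t| ≤ C → t = a * y → |a| ≤ C / y := fun {a t y} hy h e => by
    rw [le_div_iff₀ hy]
    rwa [e, abs_mul, abs_of_pos hy] at h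
  have hx2 : 0 < x ^ 2 := by positivity
  have b1 : |N n * r₁ (N n * x)| ≤ C / x := bnd hx (hb (N n * x)).2.2.1 (by ring)
  have b2 : |N n * (N n * r₂ (N n * x))| ≤ C / x ^ 2 := bnd hx2 (hb (N n * x)).2.2.2 (by ring)
  have b3 : |r₁ (x / N n) / N n| ≤ C / x := bnd hx (hb (x / N n)).2.2.1 (by ring)
  have b4 : |r₂ (x / N n) / N n / N n| ≤ C / x ^ 2 :=
    bnd hx2 (hb (x / N n)).2.2.2 (by field_simp)
  have p1 := (hb (N n * x)).1
  have p2 := (hb (x / N n)).2.1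
  have mul1 : ∀ {a b c : ℝ}, |a| ≤ c → |b| ≤ 1 → |a * b| ≤ c := fun {a b c} h h' => by
    rw [abs_mul]
    exact (mul_le_of_le_one_right (abs_nonneg _) h').trans h
  refine ⟨?_, ?_, ?_, ?_, ?_, ?_⟩
  · refine ((a1 d1).fun_mul ((hasDerivAt_const x (1 : ℝ)).fun_sub (a2 d1))).congr_deriv ?_
    ring
  · refine ((((a1 d2).const_mul (N n)).fun_mul ((hasDerivAt_const x (1 : ℝ)).fun_sub
      (a2 d1))).fun_sub ((a1 d1).fun_mul ((a2 d2).div_const (N n)))).congr_deriv ?_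
    ring
  · refine (mul1 p1 p2).trans ?_
    nlinarith [sq_nonneg C]
  · refine (abs_sub _ _).trans ?_
    have q1 := mul1 b1 p2
    have q2 : |r (N n * x) * (r₁ (x / N n) / N n)| ≤ C / x := by
      rw [mul_comm]; exact mul1 b3 p1
    have : C / x + C / x ≤ (1 + 2 * C + 2 * C ^ 2) / x := by
      rw [← add_div]
      exact div_le_div_of_nonneg_right (by nlinarith [sq_nonneg C]) hx.le
    linarith
  · have q1 := mul1 b2 p2
    have q2 : |r (N n * x) * (r₂ (x / N n) / N n / N n)| ≤ C / x ^ 2 := by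
      rw [mul_comm]; exact mul1 b4 p1
    have q3 : |2 * (N n * r₁ (N n * x) * (r₁ (x / N n) / N n))| ≤ 2 * C ^ 2 / x ^ 2 := by
      rw [abs_mul, abs_mul, abs_two, mul_div_assoc]
      have : C ^ 2 / x ^ 2 = C / x * (C / x) := by ring
      rw [this]
      gcongr
    refine (abs_sub _ _).trans ((add_le_add (abs_sub _ _) le_rfl).trans ?_)
    have : C / x ^ 2 + 2 * C ^ 2 / x ^ 2 + C / x ^ 2 ≤ (1 + 2 * C + 2 * C ^ 2) / x ^ 2 := by
      rw [← add_div, ← add_div]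
      exact div_le_div_of_nonneg_right (by linarith) hx2.le
    linarith
  · obtain ⟨k₀, hk₀⟩ := exists_nat_gt (max (2 / x) x)
    filter_upwards [eventually_ge_atTop k₀] with k hk
    have hk' : (k₀ : ℝ) ≤ k := by exact_mod_cast hk
    have m1 : 2 < N k * x := by
      have := (le_max_left (2 / x) x).trans_lt hk₀
      rw [div_lt_iff₀ hx] at this
      have : (k₀ : ℝ) * x ≤ N k * x := by
        gcongr
        simp only [N]; linarith
      linarith
    have m2 : x / N k < 1 := by
      rw [div_lt_one (hN k)]
      have := (le_max_right (2 / x) x).trans_lt hk₀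
      simp only [N]; linarith
    simp only [(hh _ m1).1, (hh _ m1).2.1, (hh _ m1).2.2, (hl _ m2).1, (hl _ m2).2.1,
      (hl _ m2).2.2]
    norm_num

theorem norm_cut_le {C x χ χ₁ χ₂ : ℝ} (hx : 0 < x) (h0 : |χ| ≤ C) (h1 : |χ₁| ≤ C / x)
    (h2 : |χ₂| ≤ C / x ^ 2) (c a₀ a₁ a₂ : ℂ) :
    ‖-((χ₂ : ℂ) * a₀ + 2 * χ₁ * a₁ + χ * a₂) + c / (x : ℂ) ^ 2 * (χ * a₀)‖ ≤
      C * (1 + ‖c‖) * ‖a₀ / (x : ℂ) ^ 2‖ + 2 * C * ‖a₁ / x‖ + C * ‖a₂‖ := by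
  have n0 : ‖(χ : ℂ)‖ ≤ C := by rwa [Complex.norm_real]
  have n1 : ‖(χ₁ : ℂ)‖ ≤ C / x := by rwa [Complex.norm_real]
  have n2 : ‖(χ₂ : ℂ)‖ ≤ C / x ^ 2 := by rwa [Complex.norm_real]
  have nx : ‖(x : ℂ)‖ = x := by rw [Complex.norm_real, Real.norm_of_nonneg hx.le]
  have e : C * (1 + ‖c‖) * ‖a₀ / (x : ℂ) ^ 2‖ + 2 * C * ‖a₁ / x‖ + C * ‖a₂‖ =
      (C / x ^ 2 * ‖a₀‖ + 2 * (C / x) * ‖a₁‖ + C * ‖a₂‖) + ‖c‖ / x ^ 2 * (C * ‖a₀‖) := by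
    rw [norm_div, norm_div, norm_pow, nx]
    ring
  rw [e]
  refine (norm_add_le _ _).trans ?_
  rw [norm_neg]
  refine add_le_add ((norm_add_le _ _).trans (add_le_add ((norm_add_le _ _).trans
    (add_le_add ?_ ?_)) ?_)) ?_
  · rw [norm_mul]
    exact mul_le_mul_of_nonneg_right n2 (norm_nonneg _)
  · rw [norm_mul, norm_mul, Complex.norm_ofNat]
    gcongr
  · rw [norm_mul]
    exact mul_le_mul_of_nonneg_right n0 (norm_nonneg _)
  · rw [norm_mul, norm_mul, norm_div, norm_pow, nx]
    gcongr

/-- A smooth function with the right behaviour at the origin belongs to the minimal domain. -/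
theorem mem_graph_posMin_of_smooth {α : ℝ} {u u' u'' : ℝ → ℂ} (hs : ContDiffOn ℝ ∞ u (Ioi 0))
    (h1 : ∀ x, 0 < x → HasDerivAt u (u' x) x) (h2 : ∀ x, 0 < x → HasDerivAt u' (u'' x) x)
    (m0 : MemLp u 2 posMeasure) (m1 : MemLp (fun x : ℝ => u' x / x) 2 posMeasure)
    (m2 : MemLp (fun x : ℝ => u x / (x : ℂ) ^ 2) 2 posMeasure) (m3 : MemLp u'' 2 posMeasure)
    {f h : HalfLineL2} (hf : f =ᵐ[posMeasure] u)
    (hh : h =ᵐ[posMeasure] fun x => -u'' x + ((α : ℂ) - 1 / 4) / (x : ℂ) ^ 2 * u x) :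
    (f, h) ∈ bilinAdjoint (weakRel α) := by
  obtain ⟨χ, χ₁, χ₂, C, hC, H⟩ := exists_cut
  set c : ℂ := (α : ℂ) - 1 / 4
  have d1 : ∀ n x, 0 < x → HasDerivAt (fun x => (χ n x : ℂ) * u x)
      ((χ₁ n x : ℂ) * u x + χ n x * u' x) x := fun n x hx =>
    (((H n).2.2.2 x hx).1.ofReal_comp).fun_mul (h1 x hx)
  have d2 : ∀ n x, 0 < x → HasDerivAt (fun x => (χ₁ n x : ℂ) * u x + χ n x * u' x)
      ((χ₂ n x : ℂ) * u x + 2 * χ₁ n x * u' x + χ n x * u'' x) x := fun n x hx => by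
    refine (((((H n).2.2.2 x hx).2.1.ofReal_comp).fun_mul (h1 x hx)).fun_add
      ((((H n).2.2.2 x hx).1.ofReal_comp).fun_mul (h2 x hx))).congr_deriv ?_
    ring
  have ht : ∀ n, IsTestFunction fun x => (χ n x : ℂ) * u x := fun n => by
    obtain ⟨s1, s2, s3, -⟩ := H n
    have hsub : tsupport (fun x => (χ n x : ℂ) * u x) ⊆ tsupport (χ n) := by
      refine closure_mono fun x hx => ?_
      rw [Function.mem_support] at hx ⊢
      exact fun h => hx (by rw [h, Complex.ofReal_zero, zero_mul])
    refine ⟨?_, s2.mono' (subset_closure.trans hsub), hsub.trans s3⟩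
    refine contDiff_iff_contDiffAt.2 fun x => ?_
    by_cases hx : x ∈ tsupport (fun x => (χ n x : ℂ) * u x)
    swap
    · exact (contDiffAt_const (c := (0 : ℂ))).congr_of_eventuallyEq
        (notMem_tsupport_iff_eventuallyEq.1 hx)
    have hx0 := s3 (hsub hx)
    exact (Complex.ofRealCLM.contDiff.comp s1).contDiffAt.mul
      (hs.contDiffAt (Ioi_mem_nhds hx0))
  rintro ⟨v, w⟩ hvw
  -- The truncated function is a test function, so the weak equation of `(v, w)` applies to it.
  -- Since derivatives of the cutoff cost `1/x` and `1/x²`, the limit is dominated by `u/x²`, `u'/x`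
  -- and `u''`, exactly the functions assumed square integrable.
  have key : ∀ n, ∫ x, v x * (-((χ₂ n x : ℂ) * u x + 2 * χ₁ n x * u' x + χ n x * u'' x) +
      c / (x : ℂ) ^ 2 * (χ n x * u x)) ∂posMeasure =
        ∫ x, w x * (χ n x * u x) ∂posMeasure := fun n => by
    rw [← hvw _ (ht n)]
    refine integral_congr_ae ?_
    filter_upwards [ae_restrict_mem measurableSet_Ioi] with x hx
    rw [besselExpr_eq (d1 n) (d2 n) hx]
  have hu : ContinuousOn u (Ioi 0) := hs.continuousOn
  have lim1 : Tendsto (fun n => ∫ x, w x * (χ n x * u x) ∂posMeasure) atTop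
      (𝓝 (∫ x, w x * u x ∂posMeasure)) := by
    refine tendsto_integral_of_dominated_convergence (fun x => C * ‖w x * u x‖) (fun n => ?_)
      (((Lp.memLp w).integrable_mul m0).norm.const_mul C) (fun n => ?_) ?_
    · exact (Lp.aestronglyMeasurable w).mul
        ((Complex.continuous_ofReal.comp (H n).1.continuous).aestronglyMeasurable.mul m0.1)
    · filter_upwards [ae_restrict_mem measurableSet_Ioi] with x hx
      have := ((H n).2.2.2 x hx).2.2.1
      rw [mul_left_comm, norm_mul, Complex.norm_real]
      exact mul_le_mul_of_nonneg_right this (norm_nonneg _)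
    · filter_upwards [ae_restrict_mem measurableSet_Ioi] with x hx
      refine tendsto_const_nhds.congr' ?_
      filter_upwards [((H 0).2.2.2 x hx).2.2.2.2.2] with n hn
      rw [hn.1, Complex.ofReal_one, one_mul]
  have lim2 : Tendsto (fun n => ∫ x, v x * (-((χ₂ n x : ℂ) * u x + 2 * χ₁ n x * u' x +
      χ n x * u'' x) + c / (x : ℂ) ^ 2 * (χ n x * u x)) ∂posMeasure) atTop
      (𝓝 (∫ x, v x * (-u'' x + c / (x : ℂ) ^ 2 * u x) ∂posMeasure)) := by
    have mc : ∀ n, AEStronglyMeasurable (fun x => v x * (-((χ₂ n x : ℂ) * u x +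
        2 * χ₁ n x * u' x + χ n x * u'' x) + c / (x : ℂ) ^ 2 * (χ n x * u x))) posMeasure := by
      intro n
      have hb := (ht n).memLp_besselExpr α
      refine (Lp.aestronglyMeasurable v).mul (hb.1.congr ?_)
      filter_upwards [ae_restrict_mem measurableSet_Ioi] with x hx
      rw [besselExpr_eq (d1 n) (d2 n) hx]
    have i0 : Integrable (fun x : ℝ => v x * (u x / (x : ℂ) ^ 2)) posMeasure :=
      (Lp.memLp v).integrable_mul m2
    have i1 : Integrable (fun x : ℝ => v x * (u' x / x)) posMeasure :=
      (Lp.memLp v).integrable_mul m1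
    have i2 : Integrable (fun x : ℝ => v x * u'' x) posMeasure :=
      (Lp.memLp v).integrable_mul m3
    have i3 : Integrable (fun x : ℝ => C * (1 + ‖c‖) * ‖v x * (u x / (x : ℂ) ^ 2)‖ +
        2 * C * ‖v x * (u' x / x)‖ + C * ‖v x * u'' x‖) posMeasure :=
      ((i0.norm.const_mul _).add (i1.norm.const_mul _)).add (i2.norm.const_mul _)
    refine tendsto_integral_of_dominated_convergence _ mc i3 (fun n => ?_) ?_
    · filter_upwards [ae_restrict_mem measurableSet_Ioi] with x hx
      have hx : 0 < x := hx
      obtain ⟨-, -, b0, b1, b2, -⟩ := (H n).2.2.2 x hx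
      have := mul_le_mul_of_nonneg_left (norm_cut_le hx b0 b1 b2 c (u x) (u' x) (u'' x))
        (norm_nonneg (v x))
      rw [norm_mul, norm_mul (v x) (u x / _), norm_mul (v x) (u' x / _), norm_mul (v x) (u'' x)]
      refine this.trans (le_of_eq ?_)
      ring
    · filter_upwards [ae_restrict_mem measurableSet_Ioi] with x hx
      refine tendsto_const_nhds.congr' ?_
      filter_upwards [((H 0).2.2.2 x hx).2.2.2.2.2] with n hn
      rw [hn.1, hn.2.1, hn.2.2]
      push_cast
      ring
  have := tendsto_nhds_unique (lim1.congr fun n => (key n).symm) lim2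
  rw [pair_comm, pair_comm f, pair_apply, pair_apply]
  refine Eq.trans ?_ (this.symm.trans ?_)
  · exact integral_congr_ae (by filter_upwards [hh] with x hx; rw [hx])
  · exact integral_congr_ae (by filter_upwards [hf] with x hx; rw [hx])

/-! ## Transformation of the momentum core -/

/-- The exchange of the Dirichlet and the Neumann variant. -/
def Variant.flip : Variant → Variant
  | .D => .N
  | .N => .D

/-- The sign in the derivative of the sine or the cosine. -/
def Variant.derivSign : Variant → ℂ
  | .D => 1
  | .N => -1

theorem Variant.derivSign_mul_flip (b : Variant) : b.derivSign * b.flip.derivSign = -1 := by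
  cases b <;> simp [Variant.derivSign, Variant.flip]

theorem Variant.flip_flip (b : Variant) : b.flip.flip = b := by cases b <;> rfl

theorem hasDerivAt_trig (b : Variant) (y : ℝ) :
    HasDerivAt (fun y : ℝ => (trig b y : ℂ)) (b.derivSign * trig b.flip y) y := by
  cases b
  · refine (Real.hasDerivAt_sin y).ofReal_comp.congr_deriv ?_
    simp [trig, Variant.flip, Variant.derivSign]
  · refine (Real.hasDerivAt_cos y).ofReal_comp.congr_deriv ?_
    simp [trig, Variant.flip, Variant.derivSign]

theorem hasDerivAt_trig_mul (b : Variant) (q x : ℝ) :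
    HasDerivAt (fun x : ℝ => (trig b (x * q) : ℂ)) (b.derivSign * (trig b.flip (x * q) * q)) x := by
  have := (hasDerivAt_trig b (x * q)).scomp x ((hasDerivAt_id x).mul_const q)
  refine this.congr_deriv ?_
  rw [one_mul, Complex.real_smul]; ring

theorem norm_derivSign (b : Variant) : ‖b.derivSign‖ = 1 := by
  cases b <;> simp [Variant.derivSign]

theorem trigInt_const_mul (b : Variant) (c : ℂ) (u : ℝ → ℂ) (x : ℝ) :
    trigInt b (fun q => c * u q) x = c * trigInt b u x := by
  unfold trigInt
  simp only [mul_left_comm _ c]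
  rw [integral_const_mul]; ring

theorem trigInt_add (b : Variant) {u v : ℝ → ℂ} (hu : Integrable u posMeasure)
    (hv : Integrable v posMeasure) (x : ℝ) :
    trigInt b (fun q => u q + v q) x = trigInt b u x + trigInt b v x := by
  unfold trigInt
  simp only [mul_add]
  rw [integral_add (integrable_trig_mul b hu x) (integrable_trig_mul b hv x), mul_add]

theorem exists_norm_trigInt_le {u : ℝ → ℂ} (hu : Integrable u posMeasure) :
    ∃ C, 0 ≤ C ∧ ∀ (b : Variant) (x : ℝ), ‖trigInt b u x‖ ≤ C := by
  refine ⟨√(2 / Real.pi) * ∫ x, ‖u x‖ ∂posMeasure, by positivity, fun b x => ?_⟩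
  rw [trigInt, norm_mul, Complex.norm_real, Real.norm_of_nonneg (Real.sqrt_nonneg _)]
  refine mul_le_mul_of_nonneg_left ?_ (Real.sqrt_nonneg _)
  refine norm_integral_le_of_norm_le hu.norm (Eventually.of_forall fun q => ?_)
  rw [norm_mul]
  exact mul_le_of_le_one_left (norm_nonneg _) (norm_trig_le b _)

theorem hasDerivAt_trigInt (b : Variant) {u : ℝ → ℂ} (h0 : Integrable u posMeasure)
    (h1 : Integrable (fun q : ℝ => (q : ℂ) * u q) posMeasure) (x : ℝ) :
    HasDerivAt (trigInt b u) (b.derivSign * trigInt b.flip (fun q => (q : ℂ) * u q) x) x := by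
  have key := hasDerivAt_integral_of_dominated_loc_of_deriv_le (μ := posMeasure) (𝕜 := ℝ)
    (F := fun x q => (trig b (x * q) : ℂ) * u q)
    (F' := fun x q => b.derivSign * (trig b.flip (x * q) * q) * u q) (x₀ := x) (s := univ)
    (bound := fun q => ‖(q : ℂ) * u q‖) univ_mem
    (Eventually.of_forall fun y => (integrable_trig_mul b h0 y).1)
    (integrable_trig_mul b h0 x) ?_ ?_ h1.norm ?_
  · refine (key.2.const_mul (√(2 / Real.pi) : ℂ)).congr_deriv ?_
    rw [trigInt, mul_left_comm]
    congr 1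
    rw [← integral_const_mul]
    congr 1
    funext q
    ring
  · refine (((integrable_trig_mul b.flip h1 x).const_mul b.derivSign).congr
      (Eventually.of_forall fun q => ?_)).1
    ring
  · refine Eventually.of_forall fun q y _ => ?_
    rw [norm_mul, norm_mul, norm_mul, norm_derivSign, one_mul, norm_mul]
    gcongr
    exact mul_le_of_le_one_left (norm_nonneg _) (norm_trig_le _ _)
  · exact Eventually.of_forall fun q y _ => (hasDerivAt_trig_mul b q y).mul_const (u q)

/-- All moments of a core function are integrable, so its Fourier transform is smooth on the whole
line. -/
theorem contDiff_trigInt_core {b : Variant} {φ : HalfLineL2} (hφ : φ ∈ momCore b) :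
    ContDiff ℝ ∞ (trigInt b φ) := by
  have h : ContDiff ℝ ∞ (𝓕 ((Ioi (0 : ℝ)).indicator φ)) := by
    refine Real.contDiff_fourier fun n _ => ?_
    have h1 : Integrable (fun q : ℝ => (q : ℂ) ^ n * φ q) posMeasure :=
      integrable_cpow_mul_core hφ n
    have h2 := ((integrable_indicator_iff measurableSet_Ioi).2 h1).norm
    refine h2.congr (Eventually.of_forall fun q => ?_)
    by_cases hq : q ∈ Ioi (0 : ℝ)
    · simp only [indicator_of_mem hq, norm_mul, norm_pow, Complex.norm_real]
    · simp only [indicator_of_notMem hq, norm_zero, mul_zero]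
  rw [funext (trigInt_eq_fourier b (integrable_core hφ))]
  have h1 : ContDiff ℝ ∞ fun p : ℝ => 𝓕 ((Ioi (0 : ℝ)).indicator φ) (p / (2 * Real.pi)) :=
    h.comp (contDiff_id.div_const _)
  have h2 : ContDiff ℝ ∞ fun p : ℝ => 𝓕 ((Ioi (0 : ℝ)).indicator φ) (-(p / (2 * Real.pi))) :=
    h.comp (contDiff_id.div_const _).neg
  exact contDiff_const.mul (h2.add (contDiff_const.mul h1))

/-- Inner integral of `trigInt_potential_core` after exchanging the order of integration. The term
`k w` stems from the endpoint `p = 0` and is killed by the moment condition. -/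
theorem integral_trig_mul_sub (b : Variant) {x : ℝ} (hx : x ≠ 0) : ∃ k : ℂ, ∀ q : ℝ,
    ∫ p in (0 : ℝ)..q, (trig b (x * p) : ℂ) * (p - q) =
      trig b (x * q) / (x : ℂ) ^ 2 - k * weight b q := by
  have hxc : (x : ℂ) ≠ 0 := Complex.ofReal_ne_zero.2 hx
  have hd : ∀ (b : Variant) (p : ℝ), HasDerivAt (fun p : ℝ => (trig b (x * p) : ℂ))
      (b.derivSign * (trig b.flip (x * p) * x)) p := fun b p => by
    have := hasDerivAt_trig_mul b x p
    simpa only [mul_comm _ x] using this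
  have ii : ∀ q : ℝ, IntervalIntegrable (fun p : ℝ => (trig b (x * p) : ℂ) * (p - q)) volume 0 q :=
    fun q => by
    have := continuous_trig b
    exact (by fun_prop : Continuous fun p : ℝ => (trig b (x * p) : ℂ) * (p - q)).intervalIntegrable
      _ _
  have key : ∀ q p : ℝ, HasDerivAt (fun p : ℝ => (trig b (x * p) : ℂ) / (x : ℂ) ^ 2 -
      b.derivSign * (p - q) * trig b.flip (x * p) / x) ((trig b (x * p) : ℂ) * (p - q)) p := by
    intro q p
    have h1 : HasDerivAt (fun p : ℝ => (p : ℂ) - q) 1 p :=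
      (hasDerivAt_id p).ofReal_comp.sub_const _
    refine (((hd b p).div_const _).fun_sub
      (((h1.const_mul b.derivSign).fun_mul (hd b.flip p)).div_const (x : ℂ))).congr_deriv ?_
    have e := b.derivSign_mul_flip
    rw [Variant.flip_flip]
    field_simp
    linear_combination -((p : ℂ) - q) * x * trig b (x * p) * e
  cases b
  · refine ⟨1 / x, fun q => ?_⟩
    rw [intervalIntegral.integral_eq_sub_of_hasDerivAt (fun p _ => key q p) (ii q)]
    simp only [trig, Variant.flip, Variant.derivSign, weight]
    simp
    ring
  · refine ⟨1 / (x : ℂ) ^ 2, fun q => ?_⟩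
    rw [intervalIntegral.integral_eq_sub_of_hasDerivAt (fun p _ => key q p) (ii q)]
    simp only [trig, Variant.flip, Variant.derivSign, weight]
    simp

/-- The kernel becomes multiplication by `x⁻²`. -/
theorem trigInt_potential_core {b : Variant} {φ : HalfLineL2} (hφ : φ ∈ momCore b) {x : ℝ}
    (hx : 0 < x) :
    trigInt b (potential b (coreParam b φ) φ) x = trigInt b φ x / (x : ℂ) ^ 2 := by
  set J : ℝ → ℝ → ℂ := fun p q => (Ioi p).indicator (fun q => ((p : ℂ) - q) * φ q) q with hJ
  -- For a core function the potential is the absolutely convergent integral of `(p - q) φ(q)` over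
  -- `q > p`; in this form Fubini is available, unlike for the kernel `k_b`, which is not decaying.
  have hK : ∀ p, 0 < p → potential b (coreParam b φ) φ p = ∫ q, J p q ∂posMeasure := by
    intro p hp
    rw [(potential_core hφ hp.le).2, hJ, integral_indicator measurableSet_Ioi,
      Measure.restrict_restrict measurableSet_Ioi, Ioi_inter_Ioi, max_eq_left hp.le]
    have sub : Ioi p ⊆ Ioi 0 := Ioi_subset_Ioi hp.le
    have i0 : IntegrableOn φ (Ioi p) := (show IntegrableOn φ (Ioi 0) volume from
      integrable_core hφ).mono_set sub
    have i1 : IntegrableOn (fun q : ℝ => (q : ℂ) * φ q) (Ioi p) :=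
      (show IntegrableOn (fun q : ℝ => (q : ℂ) * φ q) (Ioi 0) volume from
        integrable_mul_core hφ).mono_set sub
    simp only [sub_mul]
    rw [integral_sub (i0.const_mul _) i1, integral_const_mul]
  have hmeas : AEStronglyMeasurable (fun z : ℝ × ℝ => (trig b (x * z.1) : ℂ) * J z.1 z.2)
      (posMeasure.prod posMeasure) := by
    have e : (fun z : ℝ × ℝ => (trig b (x * z.1) : ℂ) * J z.1 z.2) =
        {z : ℝ × ℝ | z.1 < z.2}.indicator
          (fun z : ℝ × ℝ => (trig b (x * z.1) : ℂ) * (((z.1 : ℂ) - z.2) * φ z.2)) := by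
      funext z
      by_cases hz : z.1 < z.2
      · rw [indicator_of_mem (show z ∈ {z : ℝ × ℝ | z.1 < z.2} from hz), hJ]
        simp only
        rw [indicator_of_mem (mem_Ioi.2 hz)]
      · rw [indicator_of_notMem (show z ∉ {z : ℝ × ℝ | z.1 < z.2} from hz), hJ]
        simp only
        rw [indicator_of_notMem (s := Ioi z.1) hz, mul_zero]
    rw [e]
    refine AEStronglyMeasurable.indicator ?_ (measurableSet_lt measurable_fst measurable_snd)
    have h1 := continuous_trig b
    have h2 : AEStronglyMeasurable (fun z : ℝ × ℝ => φ z.2) (posMeasure.prod posMeasure) :=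
      (Lp.aestronglyMeasurable φ).comp_snd
    exact (by fun_prop : Continuous fun z : ℝ × ℝ =>
      (trig b (x * z.1) : ℂ)).aestronglyMeasurable.mul
      ((by fun_prop : Continuous fun z : ℝ × ℝ =>
        ((z.1 : ℂ) - z.2)).aestronglyMeasurable.mul h2)
  have hint : Integrable (fun z : ℝ × ℝ => (trig b (x * z.1) : ℂ) * J z.1 z.2)
      (posMeasure.prod posMeasure) := by
    have h1 : Integrable (fun p : ℝ => (1 + p ^ 2)⁻¹) posMeasure :=
      integrable_inv_one_add_sq.integrableOn
    have h2 := integrable_pow_mul_core hφ 3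
    -- For `0 < p < q` one has `(q - p)(1 + p²) ≤ (1 + q)³`.
    refine (h1.mul_prod h2).mono' hmeas ?_
    have hpos : ∀ᵐ z ∂(posMeasure.prod posMeasure), z ∈ Ioi (0 : ℝ) ×ˢ Ioi (0 : ℝ) := by
      rw [Measure.prod_restrict]
      exact ae_restrict_mem (measurableSet_Ioi.prod measurableSet_Ioi)
    filter_upwards [hpos] with z hz
    obtain ⟨hz1, hz2⟩ := hz
    have hz1 : 0 < z.1 := hz1
    have hz2 : 0 < z.2 := hz2
    rw [norm_mul]
    refine (mul_le_of_le_one_left (norm_nonneg _) (norm_trig_le b _)).trans ?_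
    by_cases hlt : z.1 < z.2
    · rw [hJ]
      simp only
      rw [indicator_of_mem (mem_Ioi.2 hlt), norm_mul, ← mul_assoc]
      refine mul_le_mul_of_nonneg_right ?_ (norm_nonneg _)
      rw [← Complex.ofReal_sub, Complex.norm_real, Real.norm_eq_abs, abs_sub_comm,
        abs_of_pos (sub_pos.2 hlt), inv_mul_eq_div, le_div_iff₀ (by positivity)]
      have : z.1 ^ 2 ≤ z.2 ^ 2 := by gcongr
      nlinarith [mul_pos hz2 hz2, mul_nonneg hz2.le (sub_nonneg.2 this),
        mul_pos hz1 (show 0 < 1 + z.1 ^ 2 by positivity)]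
    · rw [hJ]
      simp only
      rw [indicator_of_notMem (s := Ioi z.1) hlt, norm_zero]
      positivity
  have e1 : ∫ p, (trig b (x * p) : ℂ) * potential b (coreParam b φ) φ p ∂posMeasure =
      ∫ p, ∫ q, (trig b (x * p) : ℂ) * J p q ∂posMeasure ∂posMeasure := by
    refine integral_congr_ae ?_
    filter_upwards [ae_restrict_mem measurableSet_Ioi] with p hp
    rw [hK p hp, integral_const_mul]
  obtain ⟨k, hk⟩ := integral_trig_mul_sub b hx.ne'
  have e2 : ∀ q : ℝ, 0 < q → ∫ p, (trig b (x * p) : ℂ) * J p q ∂posMeasure =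
      (trig b (x * q) / (x : ℂ) ^ 2 - k * weight b q) * φ q := by
    intro q hq
    rw [← hk, ← intervalIntegral.integral_mul_const, intervalIntegral.integral_of_le hq.le,
      integral_Ioc_eq_integral_Ioo,
      ← integral_indicator measurableSet_Ioo, ← integral_indicator measurableSet_Ioi]
    congr 1
    funext p
    by_cases hp : 0 < p
    · by_cases hpq : p < q
      · rw [indicator_of_mem (mem_Ioi.2 hp), indicator_of_mem (s := Ioo 0 q) ⟨hp, hpq⟩, hJ]
        simp only
        rw [indicator_of_mem (mem_Ioi.2 hpq), mul_assoc]
      · rw [indicator_of_mem (mem_Ioi.2 hp), indicator_of_notMem (s := Ioo 0 q)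
          (fun h => hpq h.2), hJ]
        simp only
        rw [indicator_of_notMem (s := Ioi p) hpq, mul_zero]
    · rw [indicator_of_notMem (s := Ioi 0) hp, indicator_of_notMem (s := Ioo 0 q)
          (fun h => hp h.1)]
  rw [trigInt, e1, integral_integral_swap hint]
  have e3 : ∫ q, ∫ p, (trig b (x * p) : ℂ) * J p q ∂posMeasure ∂posMeasure =
      ∫ q, ((trig b (x * q) : ℂ) * φ q / (x : ℂ) ^ 2 - k * (weight b q * φ q)) ∂posMeasure := by
    refine integral_congr_ae ?_
    filter_upwards [ae_restrict_mem measurableSet_Ioi] with q hq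
    rw [e2 q hq]; ring
  rw [e3, integral_sub ((integrable_trig_mul b (integrable_core hφ) x).div_const _)
    (hφ.2.1.const_mul k), integral_const_mul, hφ.2.2, mul_zero, sub_zero, integral_div, trigInt,
    mul_div_assoc]

theorem integrable_sq_mul_core {b : Variant} {φ : HalfLineL2} (hφ : φ ∈ momCore b) :
    Integrable (fun q : ℝ => (q : ℂ) * ((q : ℂ) * φ q)) posMeasure := by
  simpa only [sq, mul_assoc] using integrable_cpow_mul_core hφ 2

theorem integrable_potential_core {b : Variant} {φ : HalfLineL2} (hφ : φ ∈ momCore b) :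
    Integrable (potential b (coreParam b φ) φ) posMeasure := by
  obtain ⟨C, hC, h⟩ := exists_decay_core hφ
  have h1 : Integrable (fun p : ℝ => C * (1 + p ^ 2)⁻¹) posMeasure :=
    integrable_inv_one_add_sq.integrableOn.const_mul C
  refine h1.mono' (aestronglyMeasurable_potential _ _ _) ?_
  filter_upwards [ae_restrict_mem measurableSet_Ioi] with p hp
  have hp : 0 < p := hp
  refine (h p hp.le).2.trans ?_
  gcongr
  nlinarith [mul_pos hp hp]

/-- The transform of a core function: its derivatives and the transform of its image. -/
theorem transform_core {b : Variant} {α : ℝ} {φ h : HalfLineL2} (hφ : φ ∈ momCore b)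
    (hh : HasPotential b α φ h (coreParam b φ)) :
    ∃ u' u'' : ℝ → ℂ, (∀ x, HasDerivAt (trigInt b φ) (u' x) x) ∧ (∀ x, HasDerivAt u' (u'' x) x) ∧
      (∃ C, 0 ≤ C ∧ ∀ x, ‖trigInt b φ x‖ ≤ C ∧ ‖u' x‖ ≤ C ∧ ‖u'' x‖ ≤ C) ∧ u' 0 = 0 ∧
      trigInt b φ 0 = 0 ∧ MemLp u'' 2 posMeasure ∧
      transform b h =ᵐ[posMeasure] fun x =>
        -u'' x + ((α : ℂ) - 1 / 4) / (x : ℂ) ^ 2 * trigInt b φ x := by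
  have i0 := integrable_core hφ
  have i1 := integrable_mul_core hφ
  have i2 := integrable_sq_mul_core hφ
  have iK := integrable_potential_core hφ
  have i2' : Integrable (fun q : ℝ => (q : ℂ) ^ 2 * φ q) posMeasure :=
    integrable_cpow_mul_core hφ 2
  have d1 := fun x => hasDerivAt_trigInt b i0 i1 x
  have d2 : ∀ x, HasDerivAt (fun x => b.derivSign * trigInt b.flip (fun q => (q : ℂ) * φ q) x)
      (-trigInt b (fun q : ℝ => (q : ℂ) ^ 2 * φ q) x) x := fun x => by
    refine ((hasDerivAt_trigInt b.flip i1 i2 x).const_mul b.derivSign).congr_deriv ?_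
    rw [← mul_assoc, b.derivSign_mul_flip, Variant.flip_flip, neg_one_mul]
    simp only [sq, mul_assoc]
  have m2 : MemLp (fun q : ℝ => (q : ℂ) ^ 2 * φ q) 2 posMeasure := memLp_sq_mul_core hφ
  have e2 : transform b m2.toLp =ᵐ[posMeasure] trigInt b (fun q : ℝ => (q : ℂ) ^ 2 * φ q) := by
    rw [← trigInt_congr b m2.coeFn_toLp]
    exact transform_ae_eq b (i2'.congr m2.coeFn_toLp.symm)
  refine ⟨_, _, d1, d2, ?_, ?_, ?_, ?_, ?_⟩
  · obtain ⟨C₀, h0, c0⟩ := exists_norm_trigInt_le i0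
    obtain ⟨C₁, h1, c1⟩ := exists_norm_trigInt_le i1
    obtain ⟨C₂, h2, c2⟩ := exists_norm_trigInt_le i2'
    refine ⟨C₀ + C₁ + C₂, by positivity, fun x => ⟨?_, ?_, ?_⟩⟩
    · linarith [c0 b x]
    · rw [norm_mul, norm_derivSign, one_mul]; linarith [c1 b.flip x]
    · rw [norm_neg]; linarith [c2 b x]
  · have h0 := hφ.2.2
    cases b
    · simp only [weight] at h0
      simp [Variant.flip, trigInt, trig, h0]
    · simp [Variant.flip, trigInt, trig]
  · have h0 := hφ.2.2
    cases b
    · simp [trigInt, trig]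
    · simp only [weight, Complex.ofReal_one, one_mul] at h0
      simp [trigInt, trig, h0]
  · exact ((memLp_congr_ae e2).1 (Lp.memLp _)).neg
  · have hi : Integrable h posMeasure :=
      (i2'.add (iK.const_mul ((α : ℂ) - 1 / 4))).congr hh.symm
    refine (transform_ae_eq b hi).trans ?_
    rw [trigInt_congr b hh]
    filter_upwards [ae_restrict_mem measurableSet_Ioi] with x hx
    rw [trigInt_add b i2' (iK.const_mul _), trigInt_const_mul, trigInt_potential_core hφ hx]
    ring

theorem memLp_inv_one_add : MemLp (fun x : ℝ => (1 + x)⁻¹) 2 posMeasure := by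
  have hc : ContinuousOn (fun x : ℝ => (1 + x)⁻¹) (Ioi 0) :=
    ContinuousOn.inv₀ (by fun_prop) fun x hx => by
      have : 0 < x := hx
      positivity
  have hm := hc.aestronglyMeasurable (μ := volume) measurableSet_Ioi
  rw [memLp_two_iff_integrable_sq hm]
  have h1 : Integrable (fun p : ℝ => (1 + p ^ 2)⁻¹) posMeasure :=
    integrable_inv_one_add_sq.integrableOn
  refine h1.mono' (hm.pow 2) ?_
  filter_upwards [ae_restrict_mem measurableSet_Ioi] with x hx
  have hx : 0 < x := hx
  rw [Real.norm_of_nonneg (by positivity), inv_pow]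
  gcongr
  nlinarith

theorem norm_le_of_hasDerivAt {u u' : ℝ → ℂ} (h : ∀ x, HasDerivAt u (u' x) x) (h0 : u 0 = 0)
    {x C : ℝ} (hx : 0 ≤ x) (hC : ∀ y ∈ Icc 0 x, ‖u' y‖ ≤ C) : ‖u x‖ ≤ C * x := by
  have := (convex_Icc (0 : ℝ) x).norm_image_sub_le_of_norm_hasDerivWithin_le
    (fun y _ => (h y).hasDerivWithinAt) hC (left_mem_Icc.2 hx) (right_mem_Icc.2 hx)
  rwa [h0, sub_zero, sub_zero, Real.norm_of_nonneg hx] at this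

/-- The transform `u` is smooth with bounded second derivative, and `u(0) = u'(0) = 0`: one of these
is the parity of sine or cosine, the other the moment condition. Hence `u = O(x²)` and `u' = O(x)`
at the origin, as `mem_graph_posMin_of_smooth` requires. -/
theorem transform_core_mem {b : Variant} {α : ℝ} {φ h : HalfLineL2} (hφ : φ ∈ momCore b)
    (hh : HasPotential b α φ h (coreParam b φ)) :
    (transform b φ, transform b h) ∈ bilinAdjoint (weakRel α) := by
  obtain ⟨u', u'', d1, d2, ⟨C, hC, hb⟩, z1, z0, m2, e⟩ := transform_core hφ hh
  have et := transform_ae_eq b (integrable_core hφ)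
  have b1 : ∀ x, 0 ≤ x → ‖u' x‖ ≤ C * x := fun x hx =>
    norm_le_of_hasDerivAt d2 z1 hx fun y _ => (hb y).2.2
  have b0 : ∀ x, 0 ≤ x → ‖trigInt b φ x‖ ≤ C * x * x := fun x hx =>
    norm_le_of_hasDerivAt d1 z0 hx fun y hy =>
      (b1 y hy.1).trans (mul_le_mul_of_nonneg_left hy.2 hC)
  have c0 : Continuous (trigInt b φ) := continuous_iff_continuousAt.2 fun x => (d1 x).continuousAt
  have c1 : Continuous u' := continuous_iff_continuousAt.2 fun x => (d2 x).continuousAt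
  refine mem_graph_posMin_of_smooth (contDiff_trigInt_core hφ).contDiffOn (fun x _ => d1 x)
    (fun x _ => d2 x) ((memLp_congr_ae et).1 (Lp.memLp _)) ?_ ?_ m2 et e
  · refine (memLp_inv_one_add.const_mul (2 * C)).mono' ?_ ?_
    · exact (c1.measurable.div Complex.measurable_ofReal).aestronglyMeasurable
    · filter_upwards [ae_restrict_mem measurableSet_Ioi] with x hx
      have hx : 0 < x := hx
      rw [norm_div, Complex.norm_real, Real.norm_of_nonneg hx.le, ← div_eq_mul_inv,
        div_le_div_iff₀ hx (by positivity)]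
      nlinarith [b1 x hx.le, mul_le_mul_of_nonneg_right (hb x).2.1 hx.le]
  · refine (memLp_inv_one_add_sq.const_mul (2 * C)).mono' ?_ ?_
    · exact (c0.measurable.div (Complex.measurable_ofReal.pow_const 2)).aestronglyMeasurable
    · filter_upwards [ae_restrict_mem measurableSet_Ioi] with x hx
      have hx : 0 < x := hx
      rw [norm_div, norm_pow, Complex.norm_real, Real.norm_of_nonneg hx.le, ← div_eq_mul_inv,
        div_le_div_iff₀ (by positivity) (by positivity)]
      nlinarith [b0 x hx.le, mul_le_mul_of_nonneg_right (hb x).1 (sq_nonneg x)]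

/-- The transform of a test function lies in the core, and by inversion `transform_core` then
describes the test function itself. So the image of the core element transforms back to `besselExpr
α φ`. -/
theorem transform_posPre {b : Variant} {α : ℝ} {f h : HalfLineL2}
    (hf : (f, h) ∈ (posPre α).graph) :
    (transform b f, transform b h) ∈ (momPre b α).graph := by
  obtain ⟨φ, hφ, hf, hh⟩ := mem_graph_posPre.1 hf
  have hm := transform_test_mem_momCore b ⟨φ, hφ, hf⟩
  obtain ⟨k, hk⟩ := exists_hasPotential_core α hm
  obtain ⟨u', u'', d1, d2, -, -, -, -, e⟩ := transform_core hm hk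
  have hu : ∀ x, 0 < x → trigInt b (transform b f) x = φ x := fun x hx => by
    rw [trigInt_congr b (transform_test_ae_eq b hφ hf), hφ.trigInt_trigInt,
      hφ.eq_zero (by linarith : -x ≤ 0), mul_zero, add_zero]
  have d1' : ∀ x, 0 < x → HasDerivAt φ (u' x) x := fun x hx =>
    (d1 x).congr_of_eventuallyEq (by
      filter_upwards [Ioi_mem_nhds hx] with y hy
      exact (hu y hy).symm)
  have hk' : transform b k = h := by
    refine Lp.ext (e.trans ?_)
    filter_upwards [hh, ae_restrict_mem measurableSet_Ioi] with x hx hx0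
    rw [hx, besselExpr_eq d1' (fun y _ => d2 y) hx0, hu x hx0]
  rw [← hk', transform_transform]
  exact mem_graph_momPre.2 ⟨hm, hk⟩

/-- The transformation of relations. -/
def transformRel (b : Variant) (G : Submodule ℂ (HalfLineL2 × HalfLineL2)) :
    Submodule ℂ (HalfLineL2 × HalfLineL2) :=
  G.comap ((transform b).prodMap (transform b))

theorem mem_transformRel {b : Variant} {G : Submodule ℂ (HalfLineL2 × HalfLineL2)}
    {f h : HalfLineL2} : (f, h) ∈ transformRel b G ↔ (transform b f, transform b h) ∈ G := Iff.rfl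

theorem bilinAdjoint_transformRel (b : Variant) (G : Submodule ℂ (HalfLineL2 × HalfLineL2)) :
    bilinAdjoint (transformRel b G) = transformRel b (bilinAdjoint G) := by
  ext ⟨f, h⟩
  constructor
  · rintro hm ⟨g, k⟩ hg
    have := hm (transform b g, transform b k) (by
      rw [mem_transformRel, transform_transform, transform_transform]; exact hg)
    simp only at this
    rwa [← pair_transform, ← pair_transform] at this
  · rintro hm ⟨g, k⟩ hg
    have := hm _ hg
    simp only [LinearMap.prodMap_apply] at this
    rwa [pair_transform, pair_transform, transform_transform, transform_transform] at this

/-- The transformation intertwines the maximal relations. -/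
theorem weakRel_eq (b : Variant) {α : ℝ} (hα : (α : ℂ) - 1 / 4 ≠ 0) :
    weakRel α = transformRel b (maxRel b α) := by
  refine le_antisymm ?_ ?_
  -- Core elements transform into the minimal relation of position space; taking adjoints reverses
  -- this inclusion. The other inclusion comes in the same way from test functions being transformed
  -- into the core.
  · have h1 : transformRel b (momPre b α).graph ≤ bilinAdjoint (weakRel α) := by
      rintro ⟨f, h⟩ hf
      obtain ⟨hm, hp⟩ := mem_graph_momPre.1 (mem_transformRel.1 hf)
      have := transform_core_mem hm hp
      rwa [transform_transform, transform_transform] at this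
    have h2 := (le_bilinAdjoint_bilinAdjoint (weakRel α)).trans (bilinAdjoint_anti h1)
    rwa [bilinAdjoint_transformRel, bilinAdjoint_momPre hα] at h2
  · rw [← bilinAdjoint_momPre hα, ← bilinAdjoint_transformRel, ← bilinAdjoint_posPre]
    exact bilinAdjoint_anti fun x hx => transform_posPre hx

theorem graph_posMin_eq (b : Variant) {α : ℝ} (hα : (α : ℂ) - 1 / 4 ≠ 0) :
    (posMin α).graph = transformRel b (minRel b α) := by
  rw [graph_posMin, weakRel_eq b hα, bilinAdjoint_transformRel]

/-! ## Rapidly decaying elements of the maximal relation are minimal -/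

theorem integral_tail_le {f : ℝ → ℂ} {C r Λ p : ℝ} (hr : 0 < r) (hΛ : 0 < Λ) (hp : Λ ≤ p)
    (h : ∀ᵐ q ∂posMeasure, Λ < q → ‖f q‖ ≤ C * q ^ (-1 - r)) :
    ‖∫ q in Ioi p, f q‖ ≤ C / r * p ^ (-r) := by
  have hp0 : 0 < p := hΛ.trans_le hp
  have hle : volume.restrict (Ioi p) ≤ posMeasure :=
    Measure.restrict_mono (Ioi_subset_Ioi hp0.le) le_rfl
  have i : Integrable (fun q : ℝ => C * q ^ (-1 - r)) (volume.restrict (Ioi p)) :=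
    (integrableOn_Ioi_rpow_of_lt (by linarith) hp0).const_mul C
  refine (norm_integral_le_of_norm_le i ?_).trans (le_of_eq ?_)
  · filter_upwards [ae_mono hle h, ae_restrict_mem measurableSet_Ioi] with q hq hq'
    exact hq (lt_of_le_of_lt hp hq')
  · rw [integral_const_mul, integral_Ioi_rpow_of_lt (by linarith) hp0]
    have : -1 - r + 1 = -r := by ring
    rw [this, neg_div_neg_eq]; ring

theorem integrable_of_tail {f : ℝ → ℂ} {C r Λ : ℝ} (hr : 0 < r) (hΛ : 0 < Λ)
    (hm : AEStronglyMeasurable f posMeasure) (hi : IntervalIntegrable f volume 0 Λ)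
    (h : ∀ᵐ q ∂posMeasure, Λ < q → ‖f q‖ ≤ C * q ^ (-1 - r)) : Integrable f posMeasure := by
  have hle : volume.restrict (Ioi Λ) ≤ posMeasure :=
    Measure.restrict_mono (Ioi_subset_Ioi hΛ.le) le_rfl
  rw [posMeasure, ← Ioc_union_Ioi_eq_Ioi hΛ.le]
  refine IntegrableOn.union ?_ ?_
  · exact (intervalIntegrable_iff_integrableOn_Ioc_of_le hΛ.le).1 hi
  · have i : IntegrableOn (fun q : ℝ => C * q ^ (-1 - r)) (Ioi Λ) :=
      (integrableOn_Ioi_rpow_of_lt (by linarith) hΛ).const_mul C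
    refine Integrable.mono' i (hm.mono_measure hle) ?_
    filter_upwards [ae_mono hle h, ae_restrict_mem measurableSet_Ioi] with q hq hq'
    exact hq hq'

/-- A non-zero affine function stays bounded away from `0` near infinity. -/
theorem eq_zero_of_memLp_affine {a β : ℂ} {Λ : ℝ}
    (h : MemLp (fun p : ℝ => a * p + β) 2 (volume.restrict (Ioi Λ))) : a = 0 ∧ β = 0 := by
  have hi := (memLp_two_iff_integrable_sq_norm h.1).1 h
  by_contra hne
  obtain ⟨N, ε, hε, hN⟩ : ∃ N ε : ℝ, 0 < ε ∧ ∀ p ≥ N, ε ≤ ‖a * p + β‖ ^ 2 := by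
    by_cases ha : a = 0
    · have hβ : β ≠ 0 := fun h => hne ⟨ha, h⟩
      refine ⟨0, ‖β‖ ^ 2, by positivity, fun p _ => ?_⟩
      rw [ha, zero_mul, zero_add]
    · have ha' : 0 < ‖a‖ := norm_pos_iff.2 ha
      refine ⟨(1 + ‖β‖) / ‖a‖, 1, one_pos, fun p hp => ?_⟩
      have h1 : 1 + ‖β‖ ≤ ‖a‖ * p := by
        rw [ge_iff_le, div_le_iff₀ ha'] at hp; linarith
      have hp0 : 0 ≤ p := le_trans (by positivity) hp
      have h2 : ‖a * p‖ - ‖β‖ ≤ ‖a * p + β‖ := by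
        have := norm_sub_norm_le (a * p) (-β)
        rwa [norm_neg, sub_neg_eq_add] at this
      rw [norm_mul, Complex.norm_real, Real.norm_of_nonneg hp0] at h2
      nlinarith [norm_nonneg (a * p + β)]
  have h2 : IntegrableOn (fun _ : ℝ => ε) (Ioi (max Λ N)) := by
    have h3 : IntegrableOn (fun p : ℝ => ‖a * p + β‖ ^ 2) (Ioi (max Λ N)) :=
      IntegrableOn.mono_set hi (Ioi_subset_Ioi (le_max_left _ _))
    refine Integrable.mono' h3 aestronglyMeasurable_const ?_
    filter_upwards [ae_restrict_mem measurableSet_Ioi] with p hp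
    rw [Real.norm_of_nonneg hε.le]
    exact hN p ((le_max_right _ _).trans (le_of_lt hp))
  rw [integrableOn_const_iff] at h2
  rcases h2 with h2 | h2
  · exact hε.ne' (by simpa using h2)
  · simp at h2

theorem memLp_rpow_neg {r Λ : ℝ} (hr : 1 / 2 < r) (hΛ : 0 < Λ) :
    MemLp (fun p : ℝ => p ^ (-r)) 2 (volume.restrict (Ioi Λ)) := by
  have hc : ContinuousOn (fun p : ℝ => p ^ (-r)) (Ioi Λ) := fun p hp =>
    (Real.continuousAt_rpow_const p _ (Or.inl (hΛ.trans hp).ne')).continuousWithinAt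
  rw [memLp_two_iff_integrable_sq (hc.aestronglyMeasurable measurableSet_Ioi)]
  have h1 : IntegrableOn (fun p : ℝ => p ^ (-(2 * r))) (Ioi Λ) :=
    integrableOn_Ioi_rpow_of_lt (by linarith) hΛ
  refine IntegrableOn.congr_fun h1 (fun p hp => ?_) measurableSet_Ioi
  have hp0 : 0 < p := hΛ.trans hp
  rw [← Real.rpow_natCast, ← Real.rpow_mul hp0.le]
  congr 1; push_cast; ring

/-- The potential of a rapidly decaying element decays. -/
theorem exists_potential_decay {b : Variant} {α : ℝ} (hα : (α : ℂ) - 1 / 4 ≠ 0)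
    {x : HalfLineL2 × HalfLineL2} {l : ℂ} (hl : HasPotential b α x.1 x.2 l) {C r Λ : ℝ}
    (hr : 1 / 2 < r) (hΛ : 0 < Λ)
    (hd : ∀ᵐ p ∂posMeasure, Λ < p → ‖x.1 p‖ ≤ C * p ^ (-2 - r)) :
    ∃ K : ℝ, 0 ≤ K ∧ ∀ p, Λ ≤ p → ‖potentialDeriv b l x.1 p‖ ≤ K * p ^ (-1 - r) ∧
      ‖potential b l x.1 p‖ ≤ K * p ^ (-r) := by
  set ψ := x.1
  have hd1 : ∀ᵐ p ∂posMeasure, Λ < p → ‖ψ p‖ ≤ C * p ^ (-1 - (1 + r)) := by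
    filter_upwards [hd] with p hp h
    have : -1 - (1 + r) = -2 - r := by ring
    rw [this]; exact hp h
  have hd2 : ∀ᵐ p ∂posMeasure, Λ < p → ‖(p : ℂ) * ψ p‖ ≤ C * p ^ (-1 - r) := by
    filter_upwards [hd, ae_restrict_mem measurableSet_Ioi] with p hp hp0 h
    have hp0 : 0 < p := hp0
    have : p ^ (-1 - r) = p * p ^ (-2 - r) := by
      nth_rewrite 2 [← Real.rpow_one p]
      rw [← Real.rpow_add hp0]; congr 1; ring
    rw [norm_mul, Complex.norm_real, Real.norm_of_nonneg hp0.le, this]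
    calc p * ‖ψ p‖ ≤ p * (C * p ^ (-2 - r)) := mul_le_mul_of_nonneg_left (hp h) hp0.le
      _ = _ := by ring
  have i0 : Integrable ψ posMeasure := integrable_of_tail (by linarith : 0 < 1 + r) hΛ
    (Lp.aestronglyMeasurable ψ) (intervalIntegrable_Lp ψ le_rfl hΛ.le) hd1
  have i1 : Integrable (fun p : ℝ => (p : ℂ) * ψ p) posMeasure :=
    integrable_of_tail (by linarith : 0 < r) hΛ
    (Complex.continuous_ofReal.aestronglyMeasurable.mul (Lp.aestronglyMeasurable ψ))
    (intervalIntegrable_mul_Lp Complex.continuous_ofReal ψ le_rfl hΛ.le) hd2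
  -- Since `ψ` and `q ψ` are integrable, the potential is an affine function plus integrals over
  -- `]p, ∞[`.
  obtain ⟨a, β, hv⟩ : ∃ a β : ℂ, ∀ p, 0 ≤ p →
      potentialDeriv b l ψ p = a + ∫ q in Ioi p, ψ q ∧
      potential b l ψ p = a * p + β + (p * (∫ q in Ioi p, ψ q) - ∫ q in Ioi p, (q : ℂ) * ψ q) := by
    set P := ∫ q, ψ q ∂posMeasure
    set Q := ∫ q, (q : ℂ) * ψ q ∂posMeasure
    have e0 : ∀ p, 0 ≤ p → prim ψ p = P - ∫ q in Ioi p, ψ q := fun p hp =>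
      eq_sub_of_add_eq (integral_pos_split i0 hp).symm
    have e1 : ∀ p, 0 ≤ p → primMul ψ p = Q - ∫ q in Ioi p, (q : ℂ) * ψ q := fun p hp =>
      eq_sub_of_add_eq (integral_pos_split i1 hp).symm
    cases b
    · refine ⟨l - P, Q, fun p hp => ?_⟩
      simp only [potential, potentialDeriv, e0 p hp, e1 p hp, weight, weightDeriv]
      constructor <;> push_cast <;> ring
    · refine ⟨-P, l + Q, fun p hp => ?_⟩
      simp only [potential, potentialDeriv, e0 p hp, e1 p hp, weight, weightDeriv]
      constructor <;> push_cast <;> ring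
  have hC : 0 ≤ |C| := abs_nonneg C
  have t0 : ∀ p, Λ ≤ p → ‖∫ q in Ioi p, ψ q‖ ≤ |C| / r * p ^ (-1 - r) := fun p hp => by
    have hp0 : 0 < p := hΛ.trans_le hp
    have h1 := integral_tail_le (by linarith : 0 < 1 + r) hΛ hp hd1
    have : -(1 + r) = -1 - r := by ring
    rw [this] at h1
    refine h1.trans (mul_le_mul_of_nonneg_right ?_ (Real.rpow_nonneg hp0.le _))
    calc C / (1 + r) ≤ |C| / (1 + r) := by
          have : 0 < 1 + r := by linarith
          gcongr; exact le_abs_self C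
      _ ≤ |C| / r := by
          have : 0 < r := by linarith
          gcongr; linarith
  have t1 : ∀ p, Λ ≤ p → ‖∫ q in Ioi p, (q : ℂ) * ψ q‖ ≤ |C| / r * p ^ (-r) := fun p hp => by
    have hp0 : 0 < p := hΛ.trans_le hp
    refine (integral_tail_le (by linarith : 0 < r) hΛ hp hd2).trans
      (mul_le_mul_of_nonneg_right ?_ (Real.rpow_nonneg hp0.le _))
    have : 0 < r := by linarith
    gcongr; exact le_abs_self C
  have hK : 0 ≤ |C| / r := div_nonneg hC (by linarith)
  have t2 : ∀ p, Λ ≤ p →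
      ‖(p : ℂ) * (∫ q in Ioi p, ψ q) - ∫ q in Ioi p, (q : ℂ) * ψ q‖ ≤ 2 * (|C| / r) * p ^ (-r) :=
    fun p hp => by
      have hp0 : 0 < p := hΛ.trans_le hp
      have e : p ^ (-r) = p * p ^ (-1 - r) := by
        nth_rewrite 2 [← Real.rpow_one p]
        rw [← Real.rpow_add hp0]; congr 1; ring
      have h1 : ‖(p : ℂ) * ∫ q in Ioi p, ψ q‖ ≤ |C| / r * p ^ (-r) := by
        rw [norm_mul, Complex.norm_real, Real.norm_of_nonneg hp0.le, e]
        calc p * ‖∫ q in Ioi p, ψ q‖ ≤ p * (|C| / r * p ^ (-1 - r)) :=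
              mul_le_mul_of_nonneg_left (t0 p hp) hp0.le
          _ = _ := by ring
      refine (norm_sub_le _ _).trans ?_
      linarith [t1 p hp]
  have hle : volume.restrict (Ioi Λ) ≤ posMeasure :=
    Measure.restrict_mono (Ioi_subset_Ioi hΛ.le) le_rfl
  -- No moment is computed: `h`, `p² ψ` and the tail integrals are all in `L²` near infinity, the
  -- latter two because they are of order `p^(-r)` with `r > 1/2`. Hence so is the affine part,
  -- which must vanish.
  have haff : MemLp (fun p : ℝ => a * p + β) 2 (volume.restrict (Ioi Λ)) := by
    have m0 : MemLp x.2 2 (volume.restrict (Ioi Λ)) := (Lp.memLp x.2).mono_measure hle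
    have mr := memLp_rpow_neg hr hΛ
    have m1 : MemLp (fun p : ℝ => (p : ℂ) ^ 2 * ψ p) 2 (volume.restrict (Ioi Λ)) := by
      refine (mr.const_mul C).mono' ?_ ?_
      · exact ((by fun_prop : Continuous fun p : ℝ => (p : ℂ) ^ 2).aestronglyMeasurable.mul
          (Lp.aestronglyMeasurable ψ)).mono_measure hle
      · filter_upwards [ae_mono hle hd, ae_restrict_mem measurableSet_Ioi] with p hp hp'
        have hp0 : 0 < p := hΛ.trans hp'
        have e : p ^ (-r) = p ^ 2 * p ^ (-2 - r) := by
          rw [← Real.rpow_natCast, ← Real.rpow_add hp0]; congr 1; push_cast; ring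
        rw [norm_mul, norm_pow, Complex.norm_real, Real.norm_of_nonneg hp0.le, e]
        calc p ^ 2 * ‖ψ p‖ ≤ p ^ 2 * (C * p ^ (-2 - r)) :=
              mul_le_mul_of_nonneg_left (hp hp') (by positivity)
          _ = _ := by ring
    have hmeas : AEStronglyMeasurable (fun p : ℝ => a * p + β) (volume.restrict (Ioi Λ)) :=
      (by fun_prop : Continuous fun p : ℝ => a * p + β).aestronglyMeasurable
    have m2 : MemLp (fun p : ℝ => (p : ℂ) * (∫ q in Ioi p, ψ q) - ∫ q in Ioi p, (q : ℂ) * ψ q) 2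
        (volume.restrict (Ioi Λ)) := by
      refine (mr.const_mul (2 * (|C| / r))).mono' ?_ ?_
      · have hpot := (aestronglyMeasurable_potential b l ψ).mono_measure hle
        refine (hpot.sub hmeas).congr ?_
        filter_upwards [ae_restrict_mem measurableSet_Ioi] with p hp
        have hp : Λ < p := hp
        rw [Pi.sub_apply, (hv p (hΛ.trans hp).le).2]; ring
      · filter_upwards [ae_restrict_mem measurableSet_Ioi] with p hp
        exact t2 p (le_of_lt hp)
    refine (((m0.sub m1).const_mul ((α : ℂ) - 1 / 4)⁻¹).sub m2).ae_eq ?_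
    have hl' : ∀ᵐ p ∂posMeasure, x.2 p = _ := hl
    filter_upwards [ae_mono hle hl', ae_restrict_mem measurableSet_Ioi] with p e hp
    have hp : Λ < p := hp
    have e2 := (hv p (hΛ.trans hp).le).2
    simp only [Pi.sub_apply]
    rw [e, e2, add_sub_cancel_left, inv_mul_cancel_left₀ hα]
    ring
  obtain ⟨rfl, rfl⟩ := eq_zero_of_memLp_affine haff
  refine ⟨2 * (|C| / r), by positivity, fun p hp => ?_⟩
  have hp0 : 0 < p := hΛ.trans_le hp
  obtain ⟨e1, e2⟩ := hv p hp0.le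
  constructor
  · rw [e1, zero_add]
    refine (t0 p hp).trans (mul_le_mul_of_nonneg_right (by linarith) (Real.rpow_nonneg hp0.le _))
  · rw [e2, zero_mul, zero_add, zero_add]
    exact t2 p hp

/-- The Wronskian with a tail is of order `p^(-(1/2 + r + σ))`, and the exponent is negative because
`r > 1/2` and `σ > -1`. -/
theorem bform_eq_zero_of_decay {b : Variant} {α : ℝ} (hα : (α : ℂ) - 1 / 4 ≠ 0)
    {x u : HalfLineL2 × HalfLineL2} (hx : x ∈ maxRel b α) {C r Λ : ℝ}
    (hr : 1 / 2 < r) (hΛ : 0 < Λ)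
    (hd : ∀ᵐ p ∂posMeasure, Λ < p → ‖x.1 p‖ ≤ C * p ^ (-2 - r)) {A B g : ℝ → ℂ} {σ : ℝ}
    (hσ : -1 < σ) (hu : HasTail b α u A B g) (hb : TailBound A B g σ) : bform x u = 0 := by
  obtain ⟨l, hl⟩ := hx
  obtain ⟨K, hK, hv⟩ := exists_potential_decay hα hl hr hΛ hd
  obtain ⟨N, hN, k, hk, hw, _⟩ := hu
  obtain ⟨D, hD, hDb⟩ := hb
  refine tendsto_nhds_unique (tendsto_wronskian hl hk) ?_
  have h0 : Tendsto (fun p : ℝ => 2 * K * D * p ^ (-(1 / 2 + r + σ))) atTop (𝓝 0) := by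
    have := (tendsto_rpow_neg_atTop (show 0 < 1 / 2 + r + σ by linarith)).const_mul (2 * K * D)
    simpa using this
  have h1 : Tendsto (wronskian b l x.1 k u.1) atTop (𝓝 0) := by
    refine squeeze_zero_norm' ?_ h0
    filter_upwards [eventually_ge_atTop 1, eventually_ge_atTop Λ, eventually_ge_atTop N]
      with p p1 p2 p3
    have hp0 : 0 < p := by linarith
    obtain ⟨a1, a2, -⟩ := hDb p p1
    obtain ⟨v1, v2⟩ := hv p p2
    obtain ⟨w1, w2⟩ := hw p p3
    rw [wronskian, w1, w2]
    have q1 : p ^ (-1 - r) * p ^ (1 / 2 - σ) = p ^ (-(1 / 2 + r + σ)) := by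
      rw [← Real.rpow_add hp0]; congr 1; ring
    have q2 : p ^ (-r) * p ^ (-1 / 2 - σ) = p ^ (-(1 / 2 + r + σ)) := by
      rw [← Real.rpow_add hp0]; congr 1; ring
    have n0 := Real.rpow_nonneg hp0.le
    calc _ ≤ ‖potentialDeriv b l x.1 p‖ * ‖B p - p * A p‖ + ‖potential b l x.1 p‖ * ‖-A p‖ :=
          (norm_sub_le _ _).trans (add_le_add (norm_mul _ _).le (norm_mul _ _).le)
      _ ≤ (K * p ^ (-1 - r)) * (D * p ^ (1 / 2 - σ)) + (K * p ^ (-r)) * (D * p ^ (-1 / 2 - σ)) := by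
          rw [norm_neg]
          have := n0 (-1 - r)
          have := n0 (-r)
          gcongr
      _ = K * D * (p ^ (-1 - r) * p ^ (1 / 2 - σ)) + K * D * (p ^ (-r) * p ^ (-1 / 2 - σ)) := by
          ring
      _ = _ := by rw [q1, q2]; ring
  simpa using h1.const_mul ((α : ℂ) - 1 / 4)

/-- Criterion for equality modulo the minimal domain that looks only at the leading behaviour at
infinity. It spares the moments of the transformed boundary vectors. -/
theorem IsBoundaryPair.mem_minRel_of_decay {b : Variant} {α : ℝ} {P M : Set HalfLineL2}
    {ctP ctM : ℝ → ℝ → ℂ} {A B g A' B' g' : ℝ → ℂ}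
    (H : IsBoundaryPair b α P M ctP ctM A B g A' B' g')
    {x : HalfLineL2 × HalfLineL2} (hx : x ∈ maxRel b α) {C r Λ : ℝ}
    (hr : 1 / 2 < r) (hΛ : 0 < Λ)
    (hd : ∀ᵐ p ∂posMeasure, Λ < p → ‖x.1 p‖ ≤ C * p ^ (-2 - r)) : x ∈ minRel b α := by
  obtain ⟨ψp, hp⟩ := H.left.nonempty
  obtain ⟨ψm, hm⟩ := H.right.nonempty
  obtain ⟨h₁, t₁⟩ := H.left.hasTail ψp hp
  obtain ⟨h₂, t₂⟩ := H.right.hasTail ψm hm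
  obtain ⟨σ, τ, hσ, hτ, -, hb, hb'⟩ := H.bounds
  exact mem_minRel_of_bform hx t₁.mem_maxRel t₂.mem_maxRel (H.bform_ne_zero t₁ t₂)
    (bform_eq_zero_of_decay H.ne_zero hx hr hΛ hd hσ t₁ hb)
    (bform_eq_zero_of_decay H.ne_zero hx hr hΛ hd hτ t₂ hb')

/-! ## The boundary elements in position space -/

/-- A smooth solution `a` of `a'' = (α - 1/4) x⁻² a` on the half-line, of size `x^(-1/2+δ)` near
`0` and of polynomial growth. -/
structure IsEuler (α : ℝ) (a a' : ℝ → ℂ) (δ : ℝ) : Prop where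
  contDiffOn : ContDiffOn ℝ ∞ a (Ioi 0)
  hasDerivAt : ∀ x, 0 < x → HasDerivAt a (a' x) x
  hasDerivAt_deriv : ∀ x : ℝ, 0 < x → HasDerivAt a' (((α : ℂ) - 1 / 4) / (x : ℂ) ^ 2 * a x) x
  pos : 0 < δ
  bound : ∃ C, 0 ≤ C ∧ ∀ x : ℝ, 0 < x → ‖a x‖ ≤ C * (x ^ (-1 / 2 + δ) * (1 + x) ^ 2) ∧
    ‖(x : ℂ) * a' x‖ ≤ C * (x ^ (-1 / 2 + δ) * (1 + x) ^ 2)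

/-- The weight `(1 + x) e^{-x}`. -/
def expWeight (x : ℝ) : ℝ := (1 + x) * Real.exp (-x)

theorem expWeight_pos {x : ℝ} (hx : 0 < x) : 0 < expWeight x :=
  mul_pos (by linarith) (Real.exp_pos _)

theorem hasDerivAt_expWeight (x : ℝ) : HasDerivAt expWeight (-x * Real.exp (-x)) x := by
  have h1 : HasDerivAt (fun x : ℝ => 1 + x) 1 x := (hasDerivAt_id x).const_add 1
  have h2 : HasDerivAt (fun x : ℝ => Real.exp (-x)) (Real.exp (-x) * (-1)) x :=
    (hasDerivAt_neg x).exp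
  exact (h1.fun_mul h2).congr_deriv (by ring)

theorem hasDerivAt_deriv_expWeight (x : ℝ) :
    HasDerivAt (fun x : ℝ => -x * Real.exp (-x)) ((x - 1) * Real.exp (-x)) x := by
  have h1 : HasDerivAt (fun x : ℝ => -x) (-1) x := hasDerivAt_neg x
  have h2 : HasDerivAt (fun x : ℝ => Real.exp (-x)) (Real.exp (-x) * (-1)) x :=
    (hasDerivAt_neg x).exp
  exact (h1.fun_mul h2).congr_deriv (by ring)

theorem contDiff_expWeight : ContDiff ℝ ∞ expWeight :=
  (contDiff_const.add contDiff_id).mul (Real.contDiff_exp.comp contDiff_neg)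

theorem integrable_gammaWeight {δ : ℝ} (hδ : 0 < δ) (K : ℝ) :
    Integrable (fun x : ℝ => K * (x ^ (δ - 1) * Real.exp (-x))) posMeasure := by
  have h := Real.GammaIntegral_convergent hδ
  exact (h.congr_fun (fun x _ => mul_comm _ _) measurableSet_Ioi).const_mul K

theorem pow_le_exp {x : ℝ} (hx : 0 < x) (n : ℕ) :
    (1 + x) ^ n ≤ n.factorial * (Real.exp 1 * Real.exp x) := by
  have h := Real.pow_div_factorial_le_exp (1 + x) (by linarith) n
  rw [div_le_iff₀ (by positivity), Real.exp_add] at h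
  linarith

/-- The square of the bound is `x^(2δ-1) e^{-x}` times a factor bounded by `pow_le_exp`, so it is
dominated by a convergent Gamma integrand. -/
theorem memLp_of_euler_bound {u : ℝ → ℂ} {δ K : ℝ} (hδ : 0 < δ) (hc : ContinuousOn u (Ioi 0))
    (hb : ∀ x, 0 < x → ‖u x‖ ≤ K * (x ^ (-1 / 2 + δ) * (1 + x) ^ 2 * expWeight x)) :
    MemLp u 2 posMeasure := by
  have hm := hc.aestronglyMeasurable (μ := volume) measurableSet_Ioi
  rw [memLp_two_iff_integrable_sq_norm hm]
  refine (integrable_gammaWeight (by linarith : 0 < 2 * δ)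
    (K ^ 2 * ((6 : ℕ).factorial * Real.exp 1))).mono' (hm.norm.pow 2) ?_
  filter_upwards [ae_restrict_mem measurableSet_Ioi] with x hx
  have hx : 0 < x := hx
  rw [Real.norm_of_nonneg (by positivity)]
  have h1 : ‖u x‖ ^ 2 ≤ (K * (x ^ (-1 / 2 + δ) * (1 + x) ^ 2 * expWeight x)) ^ 2 :=
    pow_le_pow_left₀ (norm_nonneg _) (hb x hx) 2
  have e1 : (x ^ (-1 / 2 + δ)) ^ 2 = x ^ (2 * δ - 1) := by
    rw [← Real.rpow_natCast, ← Real.rpow_mul hx.le]; congr 1; push_cast; ring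
  have e2 : Real.exp x * Real.exp (-x) = 1 := by rw [← Real.exp_add]; simp
  refine h1.trans ?_
  have h6 := pow_le_exp hx 6
  calc (K * (x ^ (-1 / 2 + δ) * (1 + x) ^ 2 * expWeight x)) ^ 2
      = K ^ 2 * (x ^ (2 * δ - 1) * Real.exp (-x)) * ((1 + x) ^ 6 * Real.exp (-x)) := by
        rw [← e1, expWeight]; ring
    _ ≤ K ^ 2 * (x ^ (2 * δ - 1) * Real.exp (-x)) *
        ((6 : ℕ).factorial * (Real.exp 1 * Real.exp x) * Real.exp (-x)) := by gcongr
    _ = K ^ 2 * ((6 : ℕ).factorial * Real.exp 1) * (x ^ (2 * δ - 1) * Real.exp (-x)) *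
        (Real.exp x * Real.exp (-x)) := by ring
    _ = _ := by rw [e2, mul_one]

theorem integrable_of_euler_bound {u : ℝ → ℂ} {δ K : ℝ} (hδ : 0 < δ) (hc : ContinuousOn u (Ioi 0))
    (hb : ∀ x, 0 < x → ‖u x‖ ≤ K * (x ^ (-1 / 2 + δ) * (1 + x) ^ 2 * expWeight x)) :
    Integrable u posMeasure := by
  have hm := hc.aestronglyMeasurable (μ := volume) measurableSet_Ioi
  have h0 := Real.GammaIntegral_convergent (by linarith : 0 < 1 / 2 + δ)
  have hw : Integrable (fun x : ℝ => x ^ (-1 / 2 + δ) * (1 + x) ^ 2 * expWeight x) posMeasure := by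
    have h1 : MemLp (fun x : ℝ => ((x ^ ((-1 / 2 + δ)) * (1 + x) ^ 3 * Real.exp (-x) : ℝ))) 1
      posMeasure := by
      rw [memLp_one_iff_integrable]
      have hsum : Integrable (fun x : ℝ => ∑ k ∈ Finset.range 4, (Nat.choose 3 k : ℝ) *
          (x ^ ((1 / 2 + δ + k) - 1) * Real.exp (-x))) posMeasure :=
        integrable_finsetSum _ fun k _ => integrable_gammaWeight (by positivity) _
      refine hsum.congr ?_
      filter_upwards [ae_restrict_mem measurableSet_Ioi] with x hx
      have hx : 0 < x := hx
      have e : ∀ k : ℕ, x ^ ((1 / 2 + δ + k) - 1) = x ^ (-1 / 2 + δ) * x ^ k := fun k => by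
        rw [← Real.rpow_natCast, ← Real.rpow_add hx]; congr 1; ring
      simp only [e, Finset.sum_range_succ, Finset.sum_range_zero]
      norm_num [Nat.choose]
      ring
    rw [memLp_one_iff_integrable] at h1
    refine h1.congr (Eventually.of_forall fun x => ?_)
    simp only [expWeight]; ring
  refine (hw.const_mul K).mono' hm ?_
  filter_upwards [ae_restrict_mem measurableSet_Ioi] with x hx
  exact hb x hx

namespace IsEuler

variable {α : ℝ} {a a' : ℝ → ℂ} {δ : ℝ}

theorem continuousOn (H : IsEuler α a a' δ) : ContinuousOn a (Ioi 0) := H.contDiffOn.continuousOn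

theorem continuousOn_deriv (H : IsEuler α a a' δ) : ContinuousOn a' (Ioi 0) := fun x hx =>
  (H.hasDerivAt_deriv x hx).continuousAt.continuousWithinAt

theorem norm_mul_le {C K : ℝ} {z w : ℂ} {e d : ℝ} (hz : ‖z‖ ≤ C * d) (hw : ‖w‖ ≤ K * e)
    (hK : 0 ≤ K * e) : ‖w * z‖ ≤ C * K * (d * e) := by
  rw [norm_mul]
  calc ‖w‖ * ‖z‖ ≤ (K * e) * (C * d) := mul_le_mul hw hz (norm_nonneg _) hK
    _ = _ := by ring

/-- The derivatives of a product of a weight and an Euler solution. -/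
theorem hasDerivAt_mul (H : IsEuler α a a' δ) {w w' w'' : ℝ → ℂ} {x : ℝ} (hx : 0 < x)
    (h1 : HasDerivAt w (w' x) x) (h2 : HasDerivAt w' (w'' x) x) :
    HasDerivAt (fun x => w x * a x) (w' x * a x + w x * a' x) x ∧
    HasDerivAt (fun x => w' x * a x + w x * a' x) (w'' x * a x + 2 * (w' x * a' x) +
      w x * (((α : ℂ) - 1 / 4) / (x : ℂ) ^ 2 * a x)) x :=
  ⟨h1.fun_mul (H.hasDerivAt x hx),
    ((h2.fun_mul (H.hasDerivAt x hx)).fun_add (h1.fun_mul (H.hasDerivAt_deriv x hx))).congr_deriv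
      (by ring)⟩

/-- With `w = (1 + x) e^{-x}` the Euler equation removes the singular term, and the image of `w a`
is `-w'' a - 2 w' a'`. Since `w' = -x e^{-x}`, only `x a'` occurs, which is of the same size as `a`.
-/
theorem exists_regular (H : IsEuler α a a' δ) : ∃ E : HalfLineL2,
    E =ᵐ[posMeasure] (fun x => (expWeight x : ℂ) * a x) ∧ Integrable E posMeasure ∧
      ∃ h, (E, h) ∈ weakRel α := by
  obtain ⟨C, hC, hb⟩ := H.bound
  have hcw : Continuous fun x : ℝ => (expWeight x : ℂ) :=
    Complex.continuous_ofReal.comp contDiff_expWeight.continuous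
  have hc : ContinuousOn (fun x => (expWeight x : ℂ) * a x) (Ioi 0) :=
    hcw.continuousOn.mul H.continuousOn
  have hB : ∀ x, 0 < x → ‖(expWeight x : ℂ) * a x‖ ≤
      C * 1 * (x ^ (-1 / 2 + δ) * (1 + x) ^ 2 * expWeight x) := fun x hx => by
    have hw := expWeight_pos hx
    refine norm_mul_le (hb x hx).1 ?_ (by linarith)
    rw [Complex.norm_real, Real.norm_of_nonneg hw.le, one_mul]
  have m0 := memLp_of_euler_bound H.pos hc hB
  have hLc : ContinuousOn (fun x : ℝ => -(((x - 1) * Real.exp (-x) : ℝ) : ℂ) * a x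
      - 2 * (((-Real.exp (-x) : ℝ) : ℂ) * (x * a' x))) (Ioi 0) := by
    have c1 : Continuous fun x : ℝ => -(((x - 1) * Real.exp (-x) : ℝ) : ℂ) := by fun_prop
    have c2 : Continuous fun x : ℝ => ((-Real.exp (-x) : ℝ) : ℂ) := by fun_prop
    exact (c1.continuousOn.mul H.continuousOn).sub (continuousOn_const.mul
      (c2.continuousOn.mul (Complex.continuous_ofReal.continuousOn.mul H.continuousOn_deriv)))
  have mL := memLp_of_euler_bound (K := 3 * C) H.pos hLc fun x hx => by
    have he := Real.exp_pos (-x)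
    have h1 : ‖-(((x - 1) * Real.exp (-x) : ℝ) : ℂ) * a x‖ ≤
        C * 1 * (x ^ (-1 / 2 + δ) * (1 + x) ^ 2 * expWeight x) := by
      refine norm_mul_le (hb x hx).1 ?_ (by linarith [expWeight_pos hx])
      rw [norm_neg, Complex.norm_real, norm_mul, Real.norm_of_nonneg he.le, one_mul, expWeight]
      refine mul_le_mul_of_nonneg_right ?_ he.le
      rw [Real.norm_eq_abs, abs_le]; constructor <;> linarith
    have h2 : ‖((-Real.exp (-x) : ℝ) : ℂ) * ((x : ℂ) * a' x)‖ ≤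
        C * 1 * (x ^ (-1 / 2 + δ) * (1 + x) ^ 2 * expWeight x) := by
      refine norm_mul_le (hb x hx).2 ?_ (by linarith [expWeight_pos hx])
      rw [Complex.norm_real, norm_neg, Real.norm_of_nonneg he.le, one_mul, expWeight]
      nlinarith
    refine (norm_sub_le _ _).trans ?_
    rw [norm_mul (2 : ℂ), Complex.norm_ofNat]
    linarith
  have dd : ∀ x : ℝ, 0 < x → _ := fun x hx => H.hasDerivAt_mul hx (w := fun x => (expWeight x : ℂ))
    (w' := fun x => ((-x * Real.exp (-x) : ℝ) : ℂ))
    (w'' := fun x => (((x - 1) * Real.exp (-x) : ℝ) : ℂ))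
    (hasDerivAt_expWeight x).ofReal_comp (hasDerivAt_deriv_expWeight x).ofReal_comp
  refine ⟨m0.toLp, m0.coeFn_toLp, (integrable_of_euler_bound H.pos hc hB).congr
    m0.coeFn_toLp.symm, mL.toLp, ?_⟩
  refine mem_weakRel_of_hasDerivAt
    (u := fun x => (expWeight x : ℂ) * a x)
    (u' := fun x => ((-x * Real.exp (-x) : ℝ) : ℂ) * a x + (expWeight x : ℂ) * a' x)
    (u'' := fun x => (((x - 1) * Real.exp (-x) : ℝ) : ℂ) * a x +
      2 * (((-x * Real.exp (-x) : ℝ) : ℂ) * a' x) +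
      (expWeight x : ℂ) * (((α : ℂ) - 1 / 4) / (x : ℂ) ^ 2 * a x))
    (fun x hx => (dd x hx).1) (fun x hx => (dd x hx).2)
    ?_ m0.coeFn_toLp ?_
  · have c1 : Continuous fun x : ℝ => (((x - 1) * Real.exp (-x) : ℝ) : ℂ) := by fun_prop
    have c2 : Continuous fun x : ℝ => ((-x * Real.exp (-x) : ℝ) : ℂ) := by fun_prop
    have c3 : ContinuousOn (fun x : ℝ => ((α : ℂ) - 1 / 4) / (x : ℂ) ^ 2) (Ioi 0) := by
      refine continuousOn_const.div (Complex.continuous_ofReal.pow 2).continuousOn fun x hx => ?_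
      exact pow_ne_zero 2 (Complex.ofReal_ne_zero.2 (ne_of_gt hx))
    exact ((c1.continuousOn.mul H.continuousOn).add (continuousOn_const.mul
      (c2.continuousOn.mul H.continuousOn_deriv))).add
      (hcw.continuousOn.mul (c3.mul H.continuousOn))
  · refine mL.coeFn_toLp.trans (Eventually.of_forall fun x => ?_)
    simp only []
    push_cast
    ring

theorem exists_expWeight_bound {g : ℝ → ℂ} (hg : Continuous g) (hs : HasCompactSupport g) :
    ∃ K, 0 ≤ K ∧ ∀ x, 0 < x → ‖g x‖ ≤ K * expWeight x := by
  have h1 : Continuous fun x : ℝ => (Real.exp x : ℂ) * g x := by fun_prop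
  obtain ⟨K, hK⟩ := hs.mul_left.exists_bound_of_continuous (f := fun x : ℝ => (Real.exp x : ℂ) * g x) h1
  have hK0 : 0 ≤ K := (norm_nonneg _).trans (hK 0)
  refine ⟨K, hK0, fun x hx => ?_⟩
  have h2 := hK x
  rw [norm_mul, Complex.norm_real, Real.norm_of_nonneg (Real.exp_pos x).le] at h2
  have e : Real.exp (-x) * Real.exp x = 1 := by rw [← Real.exp_add]; simp
  have he := Real.exp_pos (-x)
  calc ‖g x‖ = Real.exp (-x) * (Real.exp x * ‖g x‖) := by rw [← mul_assoc, e, one_mul]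
    _ ≤ Real.exp (-x) * K := by gcongr
    _ ≤ K * expWeight x := by
      rw [expWeight, mul_comm]
      refine mul_le_mul_of_nonneg_left ?_ hK0
      nlinarith

/-- The difference of a cutoff and `expWeight` vanishes to second order at `0`. -/
theorem exists_diff_bound {ξ : ℝ → ℂ} (hξ : IsCutoff ξ) : ∃ (θ' θ'' : ℝ → ℂ) (K : ℝ), 0 ≤ K ∧
    Continuous θ' ∧ Continuous θ'' ∧
    (∀ x, HasDerivAt (fun x => ξ x - expWeight x) (θ' x) x) ∧
    (∀ x, HasDerivAt θ' (θ'' x) x) ∧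
    ∀ x, 0 < x → ‖ξ x - expWeight x‖ ≤ K * expWeight x ∧
      ‖(ξ x - expWeight x) / (x : ℂ) ^ 2‖ ≤ K * expWeight x ∧
      ‖θ' x / x‖ ≤ K * expWeight x ∧ ‖θ'' x‖ ≤ K * expWeight x := by
  have s1 : ContDiff ℝ ∞ (deriv ξ) := hξ.contDiff.deriv'
  have s2 : ContDiff ℝ ∞ (deriv (deriv ξ)) := s1.deriv'
  obtain ⟨K0, hK0, b0⟩ := exists_expWeight_bound hξ.contDiff.continuous hξ.hasCompactSupport
  obtain ⟨K1, hK1, b1⟩ := exists_expWeight_bound s1.continuous hξ.hasCompactSupport.deriv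
  obtain ⟨K2, hK2, b2⟩ := exists_expWeight_bound s2.continuous hξ.hasCompactSupport.deriv.deriv
  set θ : ℝ → ℂ := fun x => ξ x - expWeight x with hθ
  set θ' : ℝ → ℂ := fun x => deriv ξ x - ((-x * Real.exp (-x) : ℝ) : ℂ)
  set θ'' : ℝ → ℂ := fun x => deriv (deriv ξ) x - (((x - 1) * Real.exp (-x) : ℝ) : ℂ)
  have d1 : ∀ x, HasDerivAt θ (θ' x) x := fun x =>
    ((hξ.contDiff.differentiable (by simp)) x).hasDerivAt.sub (hasDerivAt_expWeight x).ofReal_comp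
  have d2 : ∀ x, HasDerivAt θ' (θ'' x) x := fun x =>
    ((s1.differentiable (by simp)) x).hasDerivAt.sub (hasDerivAt_deriv_expWeight x).ofReal_comp
  have c1 : Continuous θ' := s1.continuous.sub (by fun_prop)
  have c2 : Continuous θ'' := s2.continuous.sub (by fun_prop)
  have o0 : ξ 0 = 1 := Eventually.self_of_nhds (p := fun x => ξ x = 1) hξ.eq_one
  have oe : ξ =ᶠ[𝓝 0] fun _ => 1 := hξ.eq_one
  -- Both the cutoff and `(1 + x) e^{-x}` have value `1` and derivative `0` at the origin, so `θ =
  -- O(x²)` and `θ' = O(x)` on `[0, 1]`.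
  have z0 : θ 0 = 0 := by
    simp only [hθ, o0, expWeight]; norm_num
  have z1 : θ' 0 = 0 := by
    have : deriv ξ 0 = 0 := by
      rw [oe.deriv_eq]; simp
    simp only [θ', this]; norm_num
  obtain ⟨M, hM⟩ := (isCompact_Icc (a := (0 : ℝ)) (b := 1)).exists_bound_of_continuousOn
    c2.continuousOn
  have hM0 : 0 ≤ M := (norm_nonneg _).trans (hM 0 ⟨le_rfl, zero_le_one⟩)
  have near1 : ∀ x, 0 ≤ x → x ≤ 1 → ‖θ' x‖ ≤ M * x := fun x hx hx1 =>
    norm_le_of_hasDerivAt d2 z1 hx (fun y hy => hM y ⟨hy.1, hy.2.trans hx1⟩)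
  have near0 : ∀ x, 0 ≤ x → x ≤ 1 → ‖θ x‖ ≤ M * x * x := fun x hx hx1 =>
    norm_le_of_hasDerivAt d1 z0 hx (fun y hy => (near1 y hy.1 (hy.2.trans hx1)).trans
      (mul_le_mul_of_nonneg_left hy.2 hM0))
  have w1 : ∀ x, 0 < x → x ≤ 1 → M ≤ M * Real.exp 1 * expWeight x := fun x hx hx1 => by
    have : 1 ≤ Real.exp 1 * expWeight x := by
      have h : Real.exp 1 * Real.exp (-x) = Real.exp (1 - x) := by rw [← Real.exp_add]; ring_nf
      have h' : 1 ≤ Real.exp (1 - x) := Real.one_le_exp (by linarith)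
      rw [expWeight]
      nlinarith [Real.exp_pos 1, Real.exp_pos (-x)]
    nlinarith
  have f0 : ∀ x, 0 < x → ‖θ x‖ ≤ (K0 + 1) * expWeight x := fun x hx => by
    refine (norm_sub_le _ _).trans ?_
    rw [Complex.norm_real, Real.norm_of_nonneg (expWeight_pos hx).le]
    linarith [b0 x hx]
  have f1 : ∀ x, 0 < x → ‖θ' x‖ ≤ (K1 + 1) * expWeight x := fun x hx => by
    refine (norm_sub_le _ _).trans ?_
    have he := Real.exp_pos (-x)
    have : ‖((-x * Real.exp (-x) : ℝ) : ℂ)‖ ≤ expWeight x := by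
      rw [Complex.norm_real, neg_mul, norm_neg, Real.norm_of_nonneg (by positivity), expWeight]
      nlinarith
    linarith [b1 x hx]
  have f2 : ∀ x, 0 < x → ‖θ'' x‖ ≤ (K2 + 1) * expWeight x := fun x hx => by
    refine (norm_sub_le _ _).trans ?_
    have he := Real.exp_pos (-x)
    have : ‖(((x - 1) * Real.exp (-x) : ℝ) : ℂ)‖ ≤ expWeight x := by
      rw [Complex.norm_real, norm_mul, Real.norm_of_nonneg he.le, expWeight]
      refine mul_le_mul_of_nonneg_right ?_ he.le
      rw [Real.norm_eq_abs, abs_le]; constructor <;> linarith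
    linarith [b2 x hx]
  have hMe : 0 ≤ M * Real.exp 1 := mul_nonneg hM0 (Real.exp_pos 1).le
  refine ⟨θ', θ'', K0 + 1 + (K1 + 1) + (K2 + 1) + M * Real.exp 1, by positivity, c1, c2, d1, d2,
    fun x hx => ?_⟩
  have hw := expWeight_pos hx
  have g : ∀ {y k : ℝ}, y ≤ k * expWeight x → k ≤ K0 + 1 + (K1 + 1) + (K2 + 1) + M * Real.exp 1 →
      y ≤ (K0 + 1 + (K1 + 1) + (K2 + 1) + M * Real.exp 1) * expWeight x := fun h h' =>
    h.trans (mul_le_mul_of_nonneg_right h' hw.le)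
  refine ⟨g (f0 x hx) (by linarith), ?_, ?_, g (f2 x hx) (by linarith)⟩
  · rw [norm_div, norm_pow, Complex.norm_real, Real.norm_of_nonneg hx.le]
    rcases le_total x 1 with h | h
    · refine g (k := M * Real.exp 1) ?_ (by linarith)
      refine le_trans ?_ (w1 x hx h)
      rw [div_le_iff₀ (by positivity)]
      linarith [near0 x hx.le h]
    · refine g (k := K0 + 1) ?_ (by linarith)
      refine le_trans (div_le_self (norm_nonneg _) ?_) (f0 x hx)
      nlinarith
  · rw [norm_div, Complex.norm_real, Real.norm_of_nonneg hx.le]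
    rcases le_total x 1 with h | h
    · refine g (k := M * Real.exp 1) ?_ (by linarith)
      refine le_trans ?_ (w1 x hx h)
      rw [div_le_iff₀ hx]
      exact near1 x hx.le h
    · refine g (k := K1 + 1) ?_ (by linarith)
      exact le_trans (div_le_self (norm_nonneg _) h) (f1 x hx)

/-- The factor `ξ - (1 + x) e^{-x}` is `O(x²)`, so its product with `a` remains square integrable
after division by `x²`; it is therefore in the minimal domain by `mem_graph_posMin_of_smooth`. The
cutoff may thus be exchanged for a weight with explicit transforms. -/
theorem exists_cutoff_sub (H : IsEuler α a a' δ) {ξ : ℝ → ℂ} (hξ : IsCutoff ξ) :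
    ∃ g : HalfLineL2, g =ᵐ[posMeasure] (fun x => (ξ x - expWeight x) * a x) ∧
      g ∈ (posMin α).domain := by
  obtain ⟨C, hC, hb⟩ := H.bound
  obtain ⟨θ', θ'', K, hK, c1, c2, d1, d2, hB⟩ := exists_diff_bound hξ
  set θ : ℝ → ℂ := fun x => ξ x - expWeight x with hθ
  have c0 : Continuous θ := continuous_iff_continuousAt.2 fun x => (d1 x).continuousAt
  have hKe : ∀ x, 0 < x → 0 ≤ K * expWeight x := fun x hx => mul_nonneg hK (expWeight_pos hx).le
  have cx : ContinuousOn (fun x : ℝ => (x : ℂ)) (Ioi 0) := Complex.continuous_ofReal.continuousOn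
  have nx : ∀ x ∈ Ioi (0 : ℝ), (x : ℂ) ≠ 0 := fun x hx => Complex.ofReal_ne_zero.2 (ne_of_gt hx)
  have ca := H.continuousOn
  have ca' := H.continuousOn_deriv
  have q0 : ContinuousOn (fun x => θ x / (x : ℂ) ^ 2) (Ioi 0) :=
    c0.continuousOn.div (cx.pow 2) fun x hx => pow_ne_zero 2 (nx x hx)
  have q1 : ContinuousOn (fun x => θ' x / (x : ℂ)) (Ioi 0) := c1.continuousOn.div cx nx
  have m0 := memLp_of_euler_bound (u := fun x => θ x * a x) (K := C * K) H.pos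
    (c0.continuousOn.mul ca) fun x hx => norm_mul_le (hb x hx).1 (hB x hx).1 (hKe x hx)
  have m2 := memLp_of_euler_bound (u := fun x => θ x / (x : ℂ) ^ 2 * a x) (K := C * K) H.pos
    (q0.mul ca) fun x hx => norm_mul_le (hb x hx).1 (hB x hx).2.1 (hKe x hx)
  have m2' := memLp_of_euler_bound (u := fun x : ℝ => θ x / (x : ℂ) ^ 2 * (x * a' x)) (K := C * K)
    H.pos (q0.mul (cx.mul ca')) fun x hx =>
      norm_mul_le (hb x hx).2 (hB x hx).2.1 (hKe x hx)
  have m1 := memLp_of_euler_bound (u := fun x : ℝ => θ' x / x * a x) (K := C * K) H.pos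
    (q1.mul ca) fun x hx => norm_mul_le (hb x hx).1 (hB x hx).2.2.1 (hKe x hx)
  have m1' := memLp_of_euler_bound (u := fun x : ℝ => θ' x / x * (x * a' x)) (K := C * K) H.pos
    (q1.mul (cx.mul ca')) fun x hx =>
      norm_mul_le (hb x hx).2 (hB x hx).2.2.1 (hKe x hx)
  have m3 := memLp_of_euler_bound (u := fun x => θ'' x * a x) (K := C * K) H.pos
    (c2.continuousOn.mul ca) fun x hx => norm_mul_le (hb x hx).1 (hB x hx).2.2.2 (hKe x hx)
  have sθ : ContDiff ℝ ∞ θ :=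
    hξ.contDiff.sub (Complex.ofRealCLM.contDiff.comp contDiff_expWeight)
  have M3 : MemLp (fun x => θ'' x * a x + 2 * (θ' x * a' x) +
      θ x * (((α : ℂ) - 1 / 4) / (x : ℂ) ^ 2 * a x)) 2 posMeasure := by
    refine ((m3.add (m1'.const_mul 2)).add (m2.const_mul ((α : ℂ) - 1 / 4))).ae_eq ?_
    filter_upwards [ae_restrict_mem measurableSet_Ioi] with x hx
    have := nx x hx
    simp only [Pi.add_apply]
    field_simp
  have M1 : MemLp (fun x : ℝ => (θ' x * a x + θ x * a' x) / x) 2 posMeasure := by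
    refine (m1.add m2').ae_eq ?_
    filter_upwards [ae_restrict_mem measurableSet_Ioi] with x hx
    have := nx x hx
    simp only [Pi.add_apply]
    field_simp
  have M2 : MemLp (fun x : ℝ => θ x * a x / (x : ℂ) ^ 2) 2 posMeasure :=
    m2.ae_eq (Eventually.of_forall fun x => by ring)
  have MH : MemLp (fun x => -(θ'' x * a x + 2 * (θ' x * a' x) +
      θ x * (((α : ℂ) - 1 / 4) / (x : ℂ) ^ 2 * a x)) +
      ((α : ℂ) - 1 / 4) / (x : ℂ) ^ 2 * (θ x * a x)) 2 posMeasure := by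
    refine (M3.neg.add (m2.const_mul ((α : ℂ) - 1 / 4))).ae_eq (Eventually.of_forall fun x => ?_)
    simp only [Pi.add_apply, Pi.neg_apply]
    ring
  refine ⟨m0.toLp, m0.coeFn_toLp, LinearPMap.mem_domain_iff.2 ⟨MH.toLp, ?_⟩⟩
  rw [graph_posMin]
  exact mem_graph_posMin_of_smooth (sθ.contDiffOn.mul H.contDiffOn)
    (fun x hx => (H.hasDerivAt_mul hx (d1 x) (d2 x)).1)
    (fun x hx => (H.hasDerivAt_mul hx (w := θ) (d1 x) (d2 x)).2) m0 M1 M2 M3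
    m0.coeFn_toLp MH.coeFn_toLp

end IsEuler

theorem exists_isCutoff : ∃ ξ : ℝ → ℂ, IsCutoff ξ := by
  let f : ContDiffBump (0 : ℝ) := ⟨1, 2, one_pos, one_lt_two⟩
  refine ⟨fun x => (f x : ℂ), Complex.ofRealCLM.contDiff.comp f.contDiff,
    f.hasCompactSupport.comp_left (g := ((↑) : ℝ → ℂ)) (by simp), ?_⟩
  filter_upwards [f.eventuallyEq_one] with x hx
  rw [hx]; simp

/-- The solution `x^(1/2+s)`. -/
def eulerPow (s : ℂ) (x : ℝ) : ℂ := (x : ℂ) ^ (1 / 2 + s)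

/-- The solution `x^(1/2) log x`. -/
def eulerLog (x : ℝ) : ℂ := √x * Real.log x

/-- Here `x^(1/2+s)` has size `x^(-1/2+δ)` with `δ = 1 + Re s`, positive exactly for `Re s > -1`. -/
theorem isEuler_pow {α : ℝ} {s : ℂ} (hα : (α : ℂ) = s ^ 2) (hs : -1 < s.re) :
    IsEuler α (eulerPow s) (fun x => (1 / 2 + s) * (x : ℂ) ^ (-1 / 2 + s)) (1 + s.re) where
  contDiffOn := fun x hx => by
    have h : ContDiffAt ℝ ∞ (fun x : ℝ => Complex.exp (Real.log x * (1 / 2 + s))) x :=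
      Complex.contDiff_exp.contDiffAt.comp x ((Complex.ofRealCLM.contDiff.contDiffAt.comp x
        (Real.contDiffAt_log.2 (ne_of_gt hx))).mul contDiffAt_const)
    refine h.contDiffWithinAt.congr (fun y hy => ?_) ?_
    · rw [eulerPow, Complex.cpow_def_of_ne_zero (Complex.ofReal_ne_zero.2 (ne_of_gt hy)),
        Complex.ofReal_log (le_of_lt hy)]
    · rw [eulerPow, Complex.cpow_def_of_ne_zero (Complex.ofReal_ne_zero.2 (ne_of_gt hx)),
        Complex.ofReal_log (le_of_lt hx)]
  hasDerivAt := fun x hx => by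
    have h := (hasDerivAt_id (x : ℂ)).cpow_const (c := 1 / 2 + s) (Complex.ofReal_mem_slitPlane.2 hx)
    refine h.comp_ofReal.congr_deriv ?_
    simp only [id, mul_one]
    congr 2; ring
  hasDerivAt_deriv := fun x hx => by
    have hx0 : (x : ℂ) ≠ 0 := Complex.ofReal_ne_zero.2 hx.ne'
    have h := (hasDerivAt_id (x : ℂ)).cpow_const (c := -1 / 2 + s)
      (Complex.ofReal_mem_slitPlane.2 hx)
    refine (h.comp_ofReal.const_mul (1 / 2 + s)).congr_deriv ?_
    have e : (x : ℂ) ^ (-1 / 2 + s - 1) = (x : ℂ) ^ (1 / 2 + s) / (x : ℂ) ^ 2 := by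
      rw [show -1 / 2 + s - 1 = (1 / 2 + s) - (2 : ℕ) by push_cast; ring, Complex.cpow_sub _ _ hx0,
        Complex.cpow_natCast]
    simp only [id, mul_one, eulerPow, e, hα]
    ring
  pos := by linarith
  bound := by
    refine ⟨1 + ‖1 / 2 + s‖, by positivity, fun x hx => ?_⟩
    have e : ‖(x : ℂ) ^ (1 / 2 + s)‖ = x ^ (-1 / 2 + (1 + s.re)) := by
      rw [norm_ofReal_cpow hx]; congr 1; simp; ring
    have h0 : (0 : ℝ) ≤ x ^ (-1 / 2 + (1 + s.re)) := Real.rpow_nonneg hx.le _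
    have h1 : x ^ (-1 / 2 + (1 + s.re)) ≤ x ^ (-1 / 2 + (1 + s.re)) * (1 + x) ^ 2 :=
      le_mul_of_one_le_right h0 (by nlinarith)
    have hn := norm_nonneg (1 / 2 + s)
    constructor
    · rw [eulerPow, e]
      nlinarith
    · have e2 : (x : ℂ) * ((1 / 2 + s) * (x : ℂ) ^ (-1 / 2 + s)) =
          (1 / 2 + s) * (x : ℂ) ^ (1 / 2 + s) := by
        rw [← ofReal_mul_cpow hx (by ring : 1 / 2 + s = (-1 / 2 + s) + 1)]; ring
      rw [e2, norm_mul, e]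
      nlinarith

theorem sqrt_mul_abs_log_le {x : ℝ} (hx : 0 < x) :
    √x * |Real.log x| ≤ 8 * (x ^ (-1 / 2 + 3 / 4 : ℝ) * (1 + x) ^ 2) := by
  have h1 : (-1 / 2 + 3 / 4 : ℝ) = 1 / 4 := by norm_num
  rw [h1, Real.sqrt_eq_rpow]
  have key : |Real.log x| * x ^ (1 / 4 : ℝ) ≤ 8 * (1 + x) ^ 2 := by
    rcases le_total 1 x with h | h
    · have h2 : |Real.log x| ≤ x := by
        rw [abs_of_nonneg (Real.log_nonneg h)]; linarith [Real.log_le_sub_one_of_pos hx]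
      have h3 : x ^ (1 / 4 : ℝ) ≤ x := Real.rpow_le_self_of_one_le h (by norm_num)
      have := mul_le_mul h2 h3 (Real.rpow_nonneg hx.le _) hx.le
      nlinarith
    · have h2 := Real.abs_log_mul_self_rpow_lt x (1 / 4) hx h (by norm_num)
      rw [abs_mul, abs_of_nonneg (Real.rpow_nonneg hx.le _)] at h2
      nlinarith
  have e : x ^ (1 / 2 : ℝ) = x ^ (1 / 4 : ℝ) * x ^ (1 / 4 : ℝ) := by
    rw [← Real.rpow_add hx]; norm_num
  rw [e]
  nlinarith [Real.rpow_nonneg hx.le (1 / 4 : ℝ)]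

/-- The value `δ = 3/4` leaves a factor `x^(1/4)` to absorb the logarithm at the origin. -/
theorem isEuler_log : IsEuler 0 eulerLog
    (fun x => ((Real.log x / (2 * √x) + 1 / √x : ℝ) : ℂ)) (3 / 4) where
  contDiffOn := fun x hx => by
    have hx : 0 < x := hx
    exact ((Complex.ofRealCLM.contDiff.contDiffAt.comp x (Real.contDiffAt_sqrt hx.ne')).mul
      (Complex.ofRealCLM.contDiff.contDiffAt.comp x
        (Real.contDiffAt_log.2 hx.ne'))).contDiffWithinAt
  hasDerivAt := fun x hx => by
    have h := (Real.hasDerivAt_sqrt hx.ne').fun_mul (Real.hasDerivAt_log hx.ne')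
    have hs : 0 < √x := Real.sqrt_pos.2 hx
    have h2 := Real.mul_self_sqrt hx.le
    refine (h.congr_deriv (g' := Real.log x / (2 * √x) + 1 / √x) ?_).ofReal_comp.congr_of_eventuallyEq
      (Eventually.of_forall fun y => by simp [eulerLog])
    nth_rewrite 4 [← h2]
    field_simp
  hasDerivAt_deriv := fun x hx => by
    have hs : 0 < √x := Real.sqrt_pos.2 hx
    have h2 := Real.mul_self_sqrt hx.le
    have d := ((Real.hasDerivAt_log hx.ne').fun_div ((Real.hasDerivAt_sqrt hx.ne').const_mul 2)
      (by positivity)).fun_add ((hasDerivAt_const x (1 : ℝ)).fun_div (Real.hasDerivAt_sqrt hx.ne') hs.ne')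
    have e : (((0 : ℝ) : ℂ) - 1 / 4) / (x : ℂ) ^ 2 * eulerLog x =
        ((-1 / 4 / x ^ 2 * (√x * Real.log x) : ℝ) : ℂ) := by
      simp only [eulerLog]; push_cast; ring
    rw [e]
    refine (d.congr_deriv ?_).ofReal_comp
    obtain ⟨y, hy, rfl⟩ : ∃ y, 0 < y ∧ x = y ^ 2 := ⟨√x, hs, (Real.sq_sqrt hx.le).symm⟩
    rw [Real.sqrt_sq hy.le]
    field_simp
    ring
  pos := by norm_num
  bound := by
    refine ⟨9, by norm_num, fun x hx => ?_⟩
    have h1 := sqrt_mul_abs_log_le hx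
    have hs : 0 < √x := Real.sqrt_pos.2 hx
    have h0 : 0 ≤ x ^ (-1 / 2 + 3 / 4 : ℝ) * (1 + x) ^ 2 := by positivity
    have h3 : √x ≤ x ^ (-1 / 2 + 3 / 4 : ℝ) * (1 + x) ^ 2 := by
      have e : √x = x ^ (-1 / 2 + 3 / 4 : ℝ) * x ^ (1 / 4 : ℝ) := by
        rw [Real.sqrt_eq_rpow, ← Real.rpow_add hx]; norm_num
      rw [e]
      refine mul_le_mul_of_nonneg_left ?_ (Real.rpow_nonneg hx.le _)
      calc x ^ (1 / 4 : ℝ) ≤ (1 + x) ^ (1 / 4 : ℝ) :=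
            Real.rpow_le_rpow hx.le (by linarith) (by norm_num)
        _ ≤ 1 + x := Real.rpow_le_self_of_one_le (by linarith) (by norm_num)
        _ ≤ (1 + x) ^ 2 := by nlinarith
    constructor
    · rw [eulerLog, norm_mul, Complex.norm_real, Complex.norm_real, Real.norm_of_nonneg hs.le,
        Real.norm_eq_abs]
      linarith
    · have e : (x : ℂ) * ((Real.log x / (2 * √x) + 1 / √x : ℝ) : ℂ) =
          ((√x * Real.log x / 2 + √x : ℝ) : ℂ) := by
        rw [← Complex.ofReal_mul]
        congr 1
        nth_rewrite 1 [← Real.mul_self_sqrt hx.le]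
        field_simp
      rw [e, Complex.norm_real, Real.norm_eq_abs]
      refine (abs_add_le _ _).trans ?_
      rw [abs_div, abs_mul, abs_of_pos hs, abs_two]
      linarith

/-! ## The Laplace transforms of powers and logarithms -/

theorem isBigO_cexp_bot (z : ℂ) :
    (fun t : ℝ => Complex.exp (-(z * t))) =O[𝓝[>] 0] fun t : ℝ => t ^ (-(0 : ℝ)) := by
  simp_rw [neg_zero, Real.rpow_zero]
  have hc : Continuous fun t : ℝ => Complex.exp (-(z * t)) := by fun_prop
  exact (hc.tendsto 0).mono_left nhdsWithin_le_nhds |>.isBigO_one ℝ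

theorem norm_cexp_neg_mul (z : ℂ) (t : ℝ) : ‖Complex.exp (-(z * t))‖ = Real.exp (-(z.re * t)) := by
  rw [Complex.norm_exp]; simp

theorem isBigO_cexp_top (z : ℂ) :
    (fun t : ℝ => Complex.exp (-(z * t))) =O[atTop] fun t : ℝ => Real.exp (-z.re * t) := by
  refine Asymptotics.isBigO_of_le _ fun t => ?_
  rw [norm_cexp_neg_mul, Real.norm_of_nonneg (Real.exp_pos _).le, neg_mul]

theorem locallyIntegrableOn_cexp (z : ℂ) :
    LocallyIntegrableOn (fun t : ℝ => Complex.exp (-(z * t))) (Ioi 0) :=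
  (by fun_prop : Continuous fun t : ℝ => Complex.exp (-(z * t))).continuousOn.locallyIntegrableOn
    measurableSet_Ioi

theorem mellinConvergent_cexp {s z : ℂ} (hs : 0 < s.re) (hz : 0 < z.re) :
    MellinConvergent (fun t : ℝ => Complex.exp (-(z * t))) s :=
  mellinConvergent_of_isBigO_rpow_exp hz (locallyIntegrableOn_cexp z) (isBigO_cexp_top z)
    (isBigO_cexp_bot z) hs

theorem differentiableAt_mellin_cexp {s z : ℂ} (hs : 0 < s.re) (hz : 0 < z.re) :
    DifferentiableAt ℂ (fun z : ℂ => mellin (fun t : ℝ => Complex.exp (-(z * t))) s) z := by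
  have hU : {w : ℂ | z.re / 2 < w.re} ∈ 𝓝 z :=
    (Complex.continuous_re.isOpen_preimage _ isOpen_Ioi).mem_nhds (by
      simp only [mem_preimage, mem_Ioi]; linarith)
  have hb := (mellinConvergent_cexp (s := s + 1) (z := ((z.re / 2 : ℝ) : ℂ))
    (by simp; linarith) (by rw [Complex.ofReal_re]; linarith)).norm
  have hF : ∀ w : ℂ, 0 < w.re → Integrable (fun t : ℝ => (t : ℂ) ^ (s - 1) •
      Complex.exp (-(w * t))) posMeasure := fun w hw => mellinConvergent_cexp hs hw
  refine (hasDerivAt_integral_of_dominated_loc_of_deriv_le (μ := posMeasure)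
    (F := fun w (t : ℝ) => (t : ℂ) ^ (s - 1) • Complex.exp (-(w * t)))
    (F' := fun w (t : ℝ) => (t : ℂ) ^ (s - 1) • (Complex.exp (-(w * t)) * (-(1 * (t : ℂ)))))
    hU ?_ (hF z hz) ?_ ?_ hb ?_).2.differentiableAt
  · filter_upwards [hU] with w hw
    have hw : z.re / 2 < w.re := hw
    exact (hF w (by linarith)).aestronglyMeasurable
  · have := (hF z hz).aestronglyMeasurable
    refine (this.mul (by fun_prop : Continuous fun t : ℝ => -(1 * (t : ℂ))).aestronglyMeasurable).congr
      (Eventually.of_forall fun t => ?_)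
    simp only [Pi.mul_apply, smul_eq_mul]; ring
  · filter_upwards [ae_restrict_mem measurableSet_Ioi] with t ht w hw
    have ht : 0 < t := ht
    have hw : z.re / 2 < w.re := hw
    simp only [smul_eq_mul, norm_mul, norm_cexp_neg_mul, norm_neg, one_mul,
      norm_ofReal_cpow ht, Complex.ofReal_re, Complex.norm_real, Real.norm_of_nonneg ht.le]
    have e : t ^ (s + 1 - 1).re = t ^ (s - 1).re * t := by
      nth_rewrite 3 [← Real.rpow_one t]
      rw [← Real.rpow_add ht]; congr 1; simp
    rw [e]
    have h1 : Real.exp (-(w.re * t)) ≤ Real.exp (-(z.re / 2 * t)) :=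
      Real.exp_le_exp.2 (neg_le_neg (mul_le_mul_of_nonneg_right hw.le ht.le))
    have h2 : 0 ≤ t ^ (s - 1).re := Real.rpow_nonneg ht.le _
    calc t ^ (s - 1).re * (Real.exp (-(w.re * t)) * t)
        = t ^ (s - 1).re * t * Real.exp (-(w.re * t)) := by ring
      _ ≤ _ := mul_le_mul_of_nonneg_left h1 (mul_nonneg h2 ht.le)
  · refine Eventually.of_forall fun t w _ => ?_
    have h1 : HasDerivAt (fun w : ℂ => -(w * t)) (-(1 * (t : ℂ))) w :=
      ((hasDerivAt_id w).mul_const _).neg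
    simpa only [smul_eq_mul] using (h1.cexp).const_mul ((t : ℂ) ^ (s - 1))

/-- The Laplace transform of `t^(s-1)`. -/
theorem mellin_cexp {s z : ℂ} (hs : 0 < s.re) (hz : 0 < z.re) :
    mellin (fun t : ℝ => Complex.exp (-(z * t))) s = Complex.Gamma s * z ^ (-s) := by
  set U : Set ℂ := {w | 0 < w.re}
  have hU : IsOpen U := Complex.continuous_re.isOpen_preimage _ isOpen_Ioi
  have hc : IsPreconnected U := (convex_halfSpace_re_gt 0).isPreconnected
  have hf : AnalyticOnNhd ℂ (fun z : ℂ => mellin (fun t : ℝ => Complex.exp (-(z * t))) s) U :=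
    DifferentiableOn.analyticOnNhd (fun w hw =>
      (differentiableAt_mellin_cexp hs hw).differentiableWithinAt) hU
  have hg : AnalyticOnNhd ℂ (fun z : ℂ => Complex.Gamma s * z ^ (-s)) U :=
    DifferentiableOn.analyticOnNhd (fun w hw =>
      (((hasDerivAt_id w).cpow_const (Or.inl hw)).const_mul _).differentiableAt.differentiableWithinAt)
      hU
  have hr : ∀ r : ℝ, 0 < r → mellin (fun t : ℝ => Complex.exp (-((r : ℂ) * t))) s =
      Complex.Gamma s * (r : ℂ) ^ (-s) := fun r hr => by
    have := Complex.integral_cpow_mul_exp_neg_mul_Ioi hs hr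
    simp only [mellin, smul_eq_mul]
    rw [this, one_div, mul_comm, Complex.cpow_neg, Complex.inv_cpow _ _ (by
      rw [Complex.arg_ofReal_of_nonneg hr.le]; exact Real.pi_pos.ne)]
  have h1 : (1 : ℂ) ∈ U := by simp [U]
  refine hf.eqOn_of_preconnected_of_frequently_eq hg hc h1 ?_ hz
  -- Identity theorem on the right half-plane: both sides are holomorphic in `z` and agree for
  -- positive real `z`, here at points accumulating at `1`.
  have ht : Tendsto (fun n : ℕ => ((1 + 1 / ((n : ℝ) + 1) : ℝ) : ℂ)) atTop (𝓝[≠] 1) := by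
    refine tendsto_nhdsWithin_iff.2 ⟨?_, Eventually.of_forall fun n => ?_⟩
    · have := (tendsto_one_div_add_atTop_nhds_zero_nat (𝕜 := ℝ)).const_add 1
      rw [add_zero] at this
      exact (Complex.continuous_ofReal.tendsto 1).comp this
    · have : (0 : ℝ) < 1 / ((n : ℝ) + 1) := by positivity
      simp only [mem_compl_iff, mem_singleton_iff]
      intro h
      have h2 : (1 + 1 / ((n : ℝ) + 1) : ℝ) = 1 := by exact_mod_cast h
      linarith
  exact ht.frequently (Eventually.of_forall fun n => hr _ (by positivity)).frequently

/-- The Laplace transform of `t^(s-1) log t`. -/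
theorem mellin_log_cexp {s z : ℂ} (hs : 0 < s.re) (hz : 0 < z.re) :
    MellinConvergent (fun t : ℝ => Real.log t • Complex.exp (-(z * t))) s ∧
    mellin (fun t : ℝ => Real.log t • Complex.exp (-(z * t))) s =
      (deriv Complex.Gamma s - Complex.Gamma s * Complex.log z) * z ^ (-s) := by
  have hz0 : z ≠ 0 := fun h => by simp [h] at hz
  -- A factor `log t` arises by differentiating in `s`; the closed form is differentiated in the
  -- same variable and the two derivatives are compared.
  obtain ⟨h1, h2⟩ := mellin_hasDerivAt_of_isBigO_rpow (locallyIntegrableOn_cexp z)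
    ((isBigO_cexp_top z).trans (isLittleO_exp_neg_mul_rpow_atTop hz _).isBigO)
    (lt_add_one s.re) (isBigO_cexp_bot z) hs
  refine ⟨h1, h2.unique ?_⟩
  have hG : DifferentiableAt ℂ Complex.Gamma s := Complex.differentiableAt_Gamma s fun m h => by
    have : (0 : ℝ) ≤ m := m.cast_nonneg
    rw [h] at hs; simp at hs; linarith
  have h3 : HasDerivAt (fun s : ℂ => z ^ (-s)) (z ^ (-s) * Complex.log z * (-1)) s :=
    (hasDerivAt_neg s).const_cpow (Or.inl hz0)
  refine ((hG.hasDerivAt.fun_mul h3).congr_deriv (by ring)).congr_of_eventuallyEq ?_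
  filter_upwards [(Complex.continuous_re.isOpen_preimage _ isOpen_Ioi).mem_nhds hs] with w hw
  exact mellin_cexp hw hz

/-- The oscillating integral `∫ e^{-pcx} u(x) dx`. -/
def expInt (c : ℂ) (u : ℝ → ℂ) (p : ℝ) : ℂ := ∫ x, Complex.exp (-(p * c * x)) * u x ∂posMeasure

theorem trigInt_eq_expInt (b : Variant) {u : ℝ → ℂ} (hu : Integrable u posMeasure) (p : ℝ) :
    trigInt b u p = √(2 / Real.pi) * (trigCoef b * (expInt (-Complex.I) u p +
      trigSign b * expInt Complex.I u p)) := by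
  have hi : ∀ c : ℂ, c.re = 0 →
      Integrable (fun x : ℝ => Complex.exp (-(p * c * x)) * u x) posMeasure := fun c hc => by
    refine hu.bdd_mul (c := 1) (by fun_prop : Continuous fun x : ℝ =>
      Complex.exp (-(p * c * x))).aestronglyMeasurable (Eventually.of_forall fun x => ?_)
    rw [norm_cexp_neg_mul]; simp [hc]
  unfold trigInt expInt
  rw [← integral_const_mul (trigSign b), ← integral_add (hi _ (by simp))
    ((hi _ (by simp)).const_mul _), ← integral_const_mul (trigCoef b)]
  congr 2
  funext x
  rw [trig_eq_exp]
  have e1 : ((p * x : ℝ) : ℂ) * Complex.I = -(p * -Complex.I * x) := by push_cast; ring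
  have e2 : ((-(p * x) : ℝ) : ℂ) * Complex.I = -(p * Complex.I * x) := by push_cast; ring
  rw [e1, e2]
  ring

theorem expWeight_eq {c : ℂ} {p : ℝ} (x : ℝ) : Complex.exp (-(p * c * x)) * (expWeight x : ℂ) =
    (1 + x) * Complex.exp (-((1 + p * c) * x)) := by
  have e : -((1 + p * c) * (x : ℂ)) = -(p * c * x) + -x := by ring
  rw [e, Complex.exp_add, expWeight]
  push_cast
  ring

theorem expInt_pow {s c : ℂ} (hs : 0 < s.re) (hc : c.re = 0) (p : ℝ) :
    expInt c (fun x => (expWeight x : ℂ) * (x : ℂ) ^ (s - 1)) p =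
      Complex.Gamma s * (1 + p * c) ^ (-s) + Complex.Gamma (s + 1) * (1 + p * c) ^ (-(s + 1)) := by
  have hz : 0 < (1 + p * c).re := by simp [hc]
  have hs1 : 0 < (s + 1).re := by simp; linarith
  rw [← mellin_cexp hs hz, ← mellin_cexp hs1 hz, mellin, mellin,
    ← integral_add (mellinConvergent_cexp hs hz) (mellinConvergent_cexp hs1 hz)]
  refine integral_congr_ae ?_
  filter_upwards [ae_restrict_mem measurableSet_Ioi] with x hx
  simp only [smul_eq_mul]
  rw [← mul_assoc, expWeight_eq, ← ofReal_mul_cpow hx (by ring : s + 1 - 1 = (s - 1) + 1)]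
  ring

theorem expInt_log {s c : ℂ} (hs : 0 < s.re) (hc : c.re = 0) (p : ℝ) :
    expInt c (fun x => (expWeight x : ℂ) * (Real.log x * (x : ℂ) ^ (s - 1))) p =
      (deriv Complex.Gamma s - Complex.Gamma s * Complex.log (1 + p * c)) * (1 + p * c) ^ (-s) +
      (deriv Complex.Gamma (s + 1) - Complex.Gamma (s + 1) * Complex.log (1 + p * c)) *
        (1 + p * c) ^ (-(s + 1)) := by
  have hz : 0 < (1 + p * c).re := by simp [hc]
  have hs1 : 0 < (s + 1).re := by simp; linarith
  rw [← (mellin_log_cexp hs hz).2, ← (mellin_log_cexp hs1 hz).2, mellin, mellin,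
    ← integral_add (mellin_log_cexp hs hz).1 (mellin_log_cexp hs1 hz).1]
  refine integral_congr_ae ?_
  filter_upwards [ae_restrict_mem measurableSet_Ioi] with x hx
  simp only [smul_eq_mul, Complex.real_smul]
  rw [← mul_assoc, expWeight_eq, ← ofReal_mul_cpow hx (by ring : s + 1 - 1 = (s - 1) + 1)]
  ring

/-! ## Asymptotics at infinity -/

/-- Factoring out `p` turns behaviour at `p = ∞` into smooth behaviour at `w = 1/p = 0`. For
non-real `c` the point `w + c` never meets the branch cut. -/
theorem ofReal_mul_add_cpow {p : ℝ} (hp : 0 < p) {c : ℂ} (hc : c.im ≠ 0) (s : ℂ) :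
    (1 + p * c) ^ s = (p : ℂ) ^ s * (((p⁻¹ : ℝ) : ℂ) + c) ^ s ∧
      Complex.log (1 + p * c) = Real.log p + Complex.log (((p⁻¹ : ℝ) : ℂ) + c) := by
  have hu : ((p⁻¹ : ℝ) : ℂ) + c ≠ 0 := fun h => hc (by simpa using congrArg Complex.im h)
  have hp0 : (p : ℂ) ≠ 0 := Complex.ofReal_ne_zero.2 hp.ne'
  have e : 1 + p * c = p * (((p⁻¹ : ℝ) : ℂ) + c) := by
    push_cast; rw [mul_add, mul_inv_cancel₀ hp0]
  have hl : Complex.log (1 + p * c) = Real.log p + Complex.log (((p⁻¹ : ℝ) : ℂ) + c) := by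
    rw [e, Complex.log_ofReal_mul hp hu]
  refine ⟨?_, hl⟩
  rw [Complex.cpow_def_of_ne_zero (e ▸ mul_ne_zero hp0 hu), hl, Complex.cpow_def_of_ne_zero hp0,
    Complex.cpow_def_of_ne_zero hu, ← Complex.exp_add, ← Complex.ofReal_log hp.le, add_mul]

theorem add_mem_slitPlane {c : ℂ} (hc : c.im ≠ 0) (w : ℝ) : (w : ℂ) + c ∈ Complex.slitPlane :=
  Or.inr (by simpa using hc)

theorem hasDerivAt_add_cpow {c : ℂ} (hc : c.im ≠ 0) (s : ℂ) (w : ℝ) :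
    HasDerivAt (fun w : ℝ => ((w : ℂ) + c) ^ s) (s * ((w : ℂ) + c) ^ (s - 1)) w := by
  have h := ((hasDerivAt_id (w : ℂ)).add_const c).cpow_const (c := s) (add_mem_slitPlane hc w)
  exact h.comp_ofReal.congr_deriv (by simp)

theorem hasDerivAt_add_log {c : ℂ} (hc : c.im ≠ 0) (w : ℝ) :
    HasDerivAt (fun w : ℝ => Complex.log ((w : ℂ) + c)) ((w : ℂ) + c)⁻¹ w := by
  have h := ((hasDerivAt_id (w : ℂ)).add_const c).clog (add_mem_slitPlane hc w)
  exact h.comp_ofReal.congr_deriv (by simp)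

/-- A function whose derivative is `w R(w)` is constant at `0` to second order. -/
theorem exists_norm_sub_le {N R : ℝ → ℂ} (hN : ∀ w : ℝ, HasDerivAt N ((w : ℂ) * R w) w)
    (hR : Continuous R) : ∃ C, 0 ≤ C ∧ ∀ w ∈ Icc (0 : ℝ) 1, ‖N w - N 0‖ ≤ C * w ^ 2 := by
  obtain ⟨C, hC⟩ := (isCompact_Icc (a := (0 : ℝ)) (b := 1)).exists_bound_of_continuousOn
    hR.continuousOn
  have hC0 : 0 ≤ C := (norm_nonneg _).trans (hC 0 ⟨le_rfl, zero_le_one⟩)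
  refine ⟨C, hC0, fun w hw => ?_⟩
  have := norm_le_of_hasDerivAt (u := fun w => N w - N 0) (x := w) (C := C * w)
    (fun w => (hN w).sub_const _) (sub_self _) hw.1 fun y hy => by
      rw [norm_mul, Complex.norm_real, Real.norm_of_nonneg hy.1, mul_comm y]
      exact mul_le_mul (hC y ⟨hy.1, hy.2.trans hw.2⟩) hy.2 hy.1 hC0
  refine this.trans (le_of_eq (by ring))

/-- The profile of the Laplace transform of a power. -/
def profile (s c : ℂ) (w : ℝ) : ℂ :=
  Complex.Gamma s * ((w + c) ^ (-s) + w * (s * (w + c) ^ (-(s + 1))))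

/-- The profile of the Laplace transform of a power times a logarithm. -/
def profileLog (s c : ℂ) (w : ℝ) : ℂ :=
  (deriv Complex.Gamma s - Complex.Gamma s * Complex.log (w + c)) * (w + c) ^ (-s) +
    w * ((Complex.Gamma s + s * deriv Complex.Gamma s -
      s * Complex.Gamma s * Complex.log (w + c)) * (w + c) ^ (-(s + 1)))

theorem continuous_add_cpow {c : ℂ} (hc : c.im ≠ 0) (s : ℂ) :
    Continuous fun w : ℝ => ((w : ℂ) + c) ^ s :=
  continuous_iff_continuousAt.2 fun w => (hasDerivAt_add_cpow hc s w).continuousAt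

/-- The terms of first order in `w = 1/p` cancel between the two Gamma integrals coming from `1` and
`x` in the factor `1 + x`. This is the gain of `p^(-2)` over the leading term. -/
theorem exists_profile_le (s : ℂ) {c : ℂ} (hc : c.im ≠ 0) :
    ∃ C, 0 ≤ C ∧ ∀ w ∈ Icc (0 : ℝ) 1, ‖profile s c w - profile s c 0‖ ≤ C * w ^ 2 := by
  refine exists_norm_sub_le
    (R := fun w => -(Complex.Gamma s * (s * (s + 1))) * (w + c) ^ (-(s + 2))) (fun w => ?_)
    (continuous_const.mul (continuous_add_cpow hc _))
  have h1 := hasDerivAt_add_cpow hc (-s) w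
  have h2 := hasDerivAt_add_cpow hc (-(s + 1)) w
  rw [show -s - 1 = -(s + 1) by ring] at h1
  rw [show -(s + 1) - 1 = -(s + 2) by ring] at h2
  have hw : HasDerivAt (fun w : ℝ => (w : ℂ)) 1 w := (hasDerivAt_id (w : ℂ)).comp_ofReal
  exact ((h1.fun_add (hw.fun_mul (h2.const_mul s))).const_mul (Complex.Gamma s)).congr_deriv
    (by ring)

/-- The cancellation is the same as for `profile`; the extra summand `Gamma s` matches the
derivative of the logarithm. -/
theorem exists_profileLog_le (s : ℂ) {c : ℂ} (hc : c.im ≠ 0) :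
    ∃ C, 0 ≤ C ∧ ∀ w ∈ Icc (0 : ℝ) 1, ‖profileLog s c w - profileLog s c 0‖ ≤ C * w ^ 2 := by
  set G := Complex.Gamma s
  set G' := deriv Complex.Gamma s
  have cl : Continuous fun w : ℝ => Complex.log ((w : ℂ) + c) :=
    continuous_iff_continuousAt.2 fun w => (hasDerivAt_add_log hc w).continuousAt
  refine exists_norm_sub_le (R := fun w => (-(s * G) - (s + 1) *
    (G + s * G' - s * G * Complex.log (w + c))) * (w + c) ^ (-(s + 2))) (fun w => ?_)
    (((continuous_const.sub (continuous_const.mul (continuous_const.sub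
      (continuous_const.mul cl))))).mul (continuous_add_cpow hc _))
  have hu : (w : ℂ) + c ≠ 0 := Complex.slitPlane_ne_zero (add_mem_slitPlane hc w)
  have h1 := hasDerivAt_add_cpow hc (-s) w
  have h2 := hasDerivAt_add_cpow hc (-(s + 1)) w
  rw [show -s - 1 = -(s + 1) by ring] at h1
  rw [show -(s + 1) - 1 = -(s + 2) by ring] at h2
  have hw : HasDerivAt (fun w : ℝ => (w : ℂ)) 1 w := (hasDerivAt_id (w : ℂ)).comp_ofReal
  have hl := hasDerivAt_add_log hc w
  have d1 := ((hl.const_mul G).const_sub G').fun_mul h1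
  have d2 := ((hl.const_mul (s * G)).const_sub (G + s * G')).fun_mul h2
  have e1 : ((w : ℂ) + c) ^ (-(s + 1)) = ((w : ℂ) + c)⁻¹ * (w + c) ^ (-s) := by
    rw [show -(s + 1) = -s - 1 by ring, Complex.cpow_sub _ _ hu, Complex.cpow_one]
    field_simp
  have e2 : ((w : ℂ) + c) ^ (-(s + 2)) = ((w : ℂ) + c)⁻¹ * (w + c) ^ (-(s + 1)) := by
    rw [show -(s + 2) = -(s + 1) - 1 by ring, Complex.cpow_sub _ _ hu, Complex.cpow_one]
    field_simp
  refine (d1.fun_add (hw.fun_mul d2)).congr_deriv ?_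
  rw [e2, e1]
  ring

theorem ofReal_cpow_neg_add_one {p : ℝ} (hp : 0 < p) (s : ℂ) :
    (p : ℂ) ^ (-(s + 1)) = (p : ℂ) ^ (-s) * ((p⁻¹ : ℝ) : ℂ) := by
  rw [show -(s + 1) = -s - 1 by ring, Complex.cpow_sub _ _ (Complex.ofReal_ne_zero.2 hp.ne'),
    Complex.cpow_one, Complex.ofReal_inv, div_eq_mul_inv]

theorem ne_zero_of_re_pos {s : ℂ} (hs : 0 < s.re) : s ≠ 0 := fun h => by simp [h] at hs

theorem expInt_pow_eq {s c : ℂ} (hs : 0 < s.re) (hc : c.re = 0) (hc' : c.im ≠ 0) {p : ℝ}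
    (hp : 0 < p) : expInt c (fun x => (expWeight x : ℂ) * (x : ℂ) ^ (s - 1)) p =
      (p : ℂ) ^ (-s) * profile s c p⁻¹ := by
  rw [expInt_pow hs hc, (ofReal_mul_add_cpow hp hc' _).1, (ofReal_mul_add_cpow hp hc' _).1,
    ofReal_cpow_neg_add_one hp, Complex.Gamma_add_one s (ne_zero_of_re_pos hs), profile]
  ring

theorem expInt_log_eq {s c : ℂ} (hs : 0 < s.re) (hc : c.re = 0) (hc' : c.im ≠ 0) {p : ℝ}
    (hp : 0 < p) : expInt c (fun x => (expWeight x : ℂ) * (Real.log x * (x : ℂ) ^ (s - 1))) p =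
      (p : ℂ) ^ (-s) * (profileLog s c p⁻¹ - Real.log p * profile s c p⁻¹) := by
  have hs0 := ne_zero_of_re_pos hs
  rw [expInt_log hs hc, (ofReal_mul_add_cpow hp hc' _).1, (ofReal_mul_add_cpow hp hc' (-(s + 1))).1,
    (ofReal_mul_add_cpow hp hc' s).2, ofReal_cpow_neg_add_one hp, Complex.Gamma_add_one s hs0,
    Complex.deriv_Gamma_add_one s hs0, profile, profileLog]
  ring

/-- The sine or the cosine of a complex number. -/
def ctrig : Variant → ℂ → ℂ
  | .D, z => Complex.sin z
  | .N, z => Complex.cos z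

/-- The derivative of `ctrig`. -/
def ctrigDeriv : Variant → ℂ → ℂ
  | .D, z => Complex.cos z
  | .N, z => -Complex.sin z

/-- The leading coefficient of the transform of `(1 + x) e^{-x} x^(s-1)`. -/
def leadCoef (b : Variant) (s : ℂ) : ℂ :=
  √(2 / Real.pi) * (Complex.Gamma s * ctrig b (Real.pi * s / 2))

/-- The leading coefficient of the transform of `(1 + x) e^{-x} x^(s-1) log x`. -/
def leadCoefLog (b : Variant) (s : ℂ) : ℂ :=
  √(2 / Real.pi) * (deriv Complex.Gamma s * ctrig b (Real.pi * s / 2) +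
    Complex.Gamma s * (Real.pi / 2 * ctrigDeriv b (Real.pi * s / 2)))

theorem neg_I_cpow (s : ℂ) :
    (-Complex.I) ^ (-s) = Complex.exp (Real.pi * s / 2 * Complex.I) := by
  rw [Complex.cpow_def_of_ne_zero (neg_ne_zero.2 Complex.I_ne_zero), Complex.log_neg_I]
  congr 1; ring

theorem I_cpow (s : ℂ) :
    Complex.I ^ (-s) = Complex.exp (-(Real.pi * s / 2) * Complex.I) := by
  rw [Complex.cpow_def_of_ne_zero Complex.I_ne_zero, Complex.log_I]
  congr 1; ring

theorem ctrig_eq (b : Variant) (z : ℂ) : ctrig b z =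
    trigCoef b * (Complex.exp (z * Complex.I) + trigSign b * Complex.exp (-z * Complex.I)) := by
  have hI : Complex.I ≠ 0 := Complex.I_ne_zero
  cases b
  · simp only [ctrig, trigCoef, trigSign, Complex.sin]
    field_simp
    rw [Complex.I_sq]
    ring
  · simp only [ctrig, trigCoef, trigSign, Complex.cos]
    ring

theorem ctrigDeriv_eq (b : Variant) (z : ℂ) : ctrigDeriv b z = Complex.I *
    (trigCoef b * (Complex.exp (z * Complex.I) - trigSign b * Complex.exp (-z * Complex.I))) := by
  have hI : Complex.I ≠ 0 := Complex.I_ne_zero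
  cases b
  · simp only [ctrigDeriv, trigCoef, trigSign, Complex.cos]
    field_simp
    ring
  · simp only [ctrigDeriv, trigCoef, trigSign, Complex.sin]
    ring

theorem profile_lead (b : Variant) (s : ℂ) : √(2 / Real.pi) * (trigCoef b *
    (profile s (-Complex.I) 0 + trigSign b * profile s Complex.I 0)) = leadCoef b s := by
  rw [leadCoef, ctrig_eq]
  simp only [profile, Complex.ofReal_zero, zero_add, zero_mul, add_zero, neg_I_cpow, I_cpow]
  ring

theorem profileLog_lead (b : Variant) (s : ℂ) : √(2 / Real.pi) * (trigCoef b *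
    (profileLog s (-Complex.I) 0 + trigSign b * profileLog s Complex.I 0)) = leadCoefLog b s := by
  rw [leadCoefLog, ctrig_eq, ctrigDeriv_eq]
  simp only [profileLog, Complex.ofReal_zero, zero_add, zero_mul, add_zero, neg_I_cpow, I_cpow,
    Complex.log_I, Complex.log_neg_I]
  ring

theorem norm_trigCoef_mul_le (b : Variant) (x y : ℂ) :
    ‖trigCoef b * (x + trigSign b * y)‖ ≤ ‖x‖ + ‖y‖ := by
  have h1 : ‖trigCoef b‖ ≤ 1 := by cases b <;> simp [trigCoef] <;> norm_num
  have h2 : ‖trigSign b‖ = 1 := by cases b <;> simp [trigSign]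
  rw [norm_mul]
  have h3 : ‖x + trigSign b * y‖ ≤ ‖x‖ + ‖y‖ := by
    refine (norm_add_le _ _).trans ?_
    rw [norm_mul, h2, one_mul]
  calc _ ≤ 1 * (‖x‖ + ‖y‖) := mul_le_mul h1 h3 (norm_nonneg _) zero_le_one
    _ = _ := one_mul _

/-- The asymptotics of the transform of a regularized power. -/
theorem exists_trigInt_pow_le (b : Variant) {s : ℂ} (hs : 0 < s.re)
    (hu : Integrable (fun x => (expWeight x : ℂ) * (x : ℂ) ^ (s - 1)) posMeasure) :
    ∃ C, ∀ p, 1 ≤ p → ‖trigInt b (fun x => (expWeight x : ℂ) * (x : ℂ) ^ (s - 1)) p -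
      leadCoef b s * (p : ℂ) ^ (-s)‖ ≤ C * p ^ (-2 - s.re) := by
  obtain ⟨C₁, hC₁, h₁⟩ := exists_profile_le s (c := -Complex.I) (by simp)
  obtain ⟨C₂, hC₂, h₂⟩ := exists_profile_le s (c := Complex.I) (by simp)
  refine ⟨√(2 / Real.pi) * (C₁ + C₂), fun p hp => ?_⟩
  have hp0 : 0 < p := one_pos.trans_le hp
  have hw : p⁻¹ ∈ Icc (0 : ℝ) 1 := ⟨by positivity, inv_le_one_of_one_le₀ hp⟩
  have e : trigInt b (fun x => (expWeight x : ℂ) * (x : ℂ) ^ (s - 1)) p -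
      leadCoef b s * (p : ℂ) ^ (-s) = √(2 / Real.pi) * ((p : ℂ) ^ (-s) * (trigCoef b *
        ((profile s (-Complex.I) p⁻¹ - profile s (-Complex.I) 0) +
        trigSign b * (profile s Complex.I p⁻¹ - profile s Complex.I 0)))) := by
    rw [trigInt_eq_expInt b hu, expInt_pow_eq hs (by simp) (by simp) hp0,
      expInt_pow_eq hs (by simp) (by simp) hp0, ← profile_lead]
    ring
  have e2 : p ^ (-2 - s.re) = p ^ (-s).re * p⁻¹ ^ 2 := by
    rw [← Real.rpow_neg_one, ← Real.rpow_natCast, ← Real.rpow_mul hp0.le, ← Real.rpow_add hp0]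
    congr 1; simp; ring
  rw [e, norm_mul, Complex.norm_real, Real.norm_of_nonneg (Real.sqrt_nonneg _), norm_mul,
    norm_ofReal_cpow hp0, e2]
  have h3 := (norm_trigCoef_mul_le b (profile s (-Complex.I) p⁻¹ - profile s (-Complex.I) 0)
    (profile s Complex.I p⁻¹ - profile s Complex.I 0)).trans (add_le_add (h₁ _ hw) (h₂ _ hw))
  have h4 := Real.rpow_nonneg hp0.le (-s).re
  calc _ ≤ √(2 / Real.pi) * (p ^ (-s).re * (C₁ * p⁻¹ ^ 2 + C₂ * p⁻¹ ^ 2)) := by gcongr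
    _ = _ := by ring

/-- The asymptotics of the transform of a regularized power times a logarithm. -/
theorem exists_trigInt_log_le (b : Variant) {s : ℂ} (hs : 0 < s.re)
    (hu : Integrable (fun x => (expWeight x : ℂ) * (Real.log x * (x : ℂ) ^ (s - 1))) posMeasure) :
    ∃ C, ∀ p, 1 ≤ p → ‖trigInt b (fun x => (expWeight x : ℂ) * (Real.log x * (x : ℂ) ^ (s - 1))) p -
      (p : ℂ) ^ (-s) * (leadCoefLog b s - leadCoef b s * Real.log p)‖ ≤
        C * p ^ (-2 - (s.re - 1 / 2)) := by
  obtain ⟨C₁, hC₁, h₁⟩ := exists_profile_le s (c := -Complex.I) (by simp)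
  obtain ⟨C₂, hC₂, h₂⟩ := exists_profile_le s (c := Complex.I) (by simp)
  obtain ⟨C₃, hC₃, h₃⟩ := exists_profileLog_le s (c := -Complex.I) (by simp)
  obtain ⟨C₄, hC₄, h₄⟩ := exists_profileLog_le s (c := Complex.I) (by simp)
  refine ⟨√(2 / Real.pi) * ((C₃ + C₄) + 2 * (C₁ + C₂)), fun p hp => ?_⟩
  have hp0 : 0 < p := one_pos.trans_le hp
  have hw : p⁻¹ ∈ Icc (0 : ℝ) 1 := ⟨by positivity, inv_le_one_of_one_le₀ hp⟩
  have e : trigInt b (fun x => (expWeight x : ℂ) * (Real.log x * (x : ℂ) ^ (s - 1))) p -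
      (p : ℂ) ^ (-s) * (leadCoefLog b s - leadCoef b s * Real.log p) =
      √(2 / Real.pi) * ((p : ℂ) ^ (-s) * (trigCoef b *
        ((profileLog s (-Complex.I) p⁻¹ - profileLog s (-Complex.I) 0) +
        trigSign b * (profileLog s Complex.I p⁻¹ - profileLog s Complex.I 0)) -
        Real.log p * (trigCoef b *
        ((profile s (-Complex.I) p⁻¹ - profile s (-Complex.I) 0) +
        trigSign b * (profile s Complex.I p⁻¹ - profile s Complex.I 0))))) := by
    rw [trigInt_eq_expInt b hu, expInt_log_eq hs (by simp) (by simp) hp0,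
      expInt_log_eq hs (by simp) (by simp) hp0, ← profile_lead, ← profileLog_lead]
    ring
  have e2 : p ^ (-2 - (s.re - 1 / 2)) = p ^ (-s).re * p⁻¹ ^ 2 * √p := by
    rw [← Real.rpow_neg_one, ← Real.rpow_natCast, ← Real.rpow_mul hp0.le, ← Real.rpow_add hp0,
      Real.sqrt_eq_rpow, ← Real.rpow_add hp0]
    congr 1; simp; ring
  have h5 := (norm_trigCoef_mul_le b (profile s (-Complex.I) p⁻¹ - profile s (-Complex.I) 0)
    (profile s Complex.I p⁻¹ - profile s Complex.I 0)).trans (add_le_add (h₁ _ hw) (h₂ _ hw))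
  have h6 := (norm_trigCoef_mul_le b (profileLog s (-Complex.I) p⁻¹ - profileLog s (-Complex.I) 0)
    (profileLog s Complex.I p⁻¹ - profileLog s Complex.I 0)).trans
      (add_le_add (h₃ _ hw) (h₄ _ hw))
  have h7 := Real.rpow_nonneg hp0.le (-s).re
  have hq1 : 1 ≤ √p := Real.one_le_sqrt.2 hp
  -- This costs half a power in the error. At `s = 3/2` the remaining decay is `p^(-3)`, still below
  -- the threshold `p^(-5/2)` for being minimal.
  have hlog : ‖(Real.log p : ℂ)‖ ≤ 2 * √p := by
    rw [Complex.norm_real, Real.norm_of_nonneg (Real.log_nonneg hp)]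
    have := Real.log_le_sub_one_of_pos (Real.sqrt_pos.2 hp0)
    rw [Real.log_sqrt hp0.le] at this
    linarith
  rw [e, norm_mul, Complex.norm_real, Real.norm_of_nonneg (Real.sqrt_nonneg _), norm_mul,
    norm_ofReal_cpow hp0, e2]
  have h8 : ∀ x y : ℂ, ‖x‖ ≤ C₃ * p⁻¹ ^ 2 + C₄ * p⁻¹ ^ 2 → ‖y‖ ≤ C₁ * p⁻¹ ^ 2 + C₂ * p⁻¹ ^ 2 →
      ‖x - Real.log p * y‖ ≤ ((C₃ + C₄) + 2 * (C₁ + C₂)) * (p⁻¹ ^ 2 * √p) := fun x y hx hy => by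
    refine (norm_sub_le _ _).trans ?_
    rw [norm_mul]
    have a1 : ‖x‖ ≤ (C₃ + C₄) * (p⁻¹ ^ 2 * √p) := by
      refine hx.trans ?_
      rw [← add_mul]
      refine mul_le_mul_of_nonneg_left ?_ (by positivity)
      exact le_mul_of_one_le_right (by positivity) hq1
    have a2 : ‖(Real.log p : ℂ)‖ * ‖y‖ ≤ 2 * √p * (C₁ * p⁻¹ ^ 2 + C₂ * p⁻¹ ^ 2) :=
      mul_le_mul hlog hy (norm_nonneg _) (by positivity)
    linarith
  calc _ ≤ √(2 / Real.pi) * (p ^ (-s).re *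
        (((C₃ + C₄) + 2 * (C₁ + C₂)) * (p⁻¹ ^ 2 * √p))) := by
        gcongr; exact h8 _ _ h6 h5
    _ = _ := by ring

/-! ## The transforms of the boundary elements -/

section
variable {b : Variant} {α : ℝ} {P M : Set HalfLineL2} {ctP ctM : ℝ → ℝ → ℂ}
  {A B g A' B' g' : ℝ → ℂ}

theorem IsBoundaryPair.transform_sub_mem (H : IsBoundaryPair b α P M ctP ctM A B g A' B' g')
    {E h φ k : HalfLineL2} (hE : (E, h) ∈ weakRel α) (hφ : (φ, k) ∈ maxRel b α) {C r Λ : ℝ}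
    (hr : 1 / 2 < r) (hΛ : 0 < Λ)
    (hd : ∀ᵐ p ∂posMeasure, Λ < p → ‖transform b E p - φ p‖ ≤ C * p ^ (-2 - r)) :
    transform b E - φ ∈ (momMin b α).domain := by
  rw [weakRel_eq b H.ne_zero, mem_transformRel] at hE
  refine (mem_domain_momMin H.ne_zero).2 ⟨transform b h - k,
    H.mem_minRel_of_decay (Submodule.sub_mem _ hE hφ) hr hΛ (C := C) ?_⟩
  filter_upwards [hd, Lp.coeFn_sub (transform b E) φ] with p hp e
  rw [e]
  exact hp

/-- The transform of `(1 + x) e^{-x} x^(1/2+s)` is its leading power `p^(-3/2-s)` up to `p^(-2-r)`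
with `r = Re (3/2 + s)`, and `r > 1/2` is again `Re s > -1`. -/
theorem IsBoundaryPair.transform_pow_sub_mem (H : IsBoundaryPair b α P M ctP ctM A B g A' B' g')
    {s : ℂ} (hα : (α : ℂ) = s ^ 2) (hs : -1 < s.re) {E ψ k : HalfLineL2}
    (hE : E =ᵐ[posMeasure] fun x => (expWeight x : ℂ) * eulerPow s x)
    (hψ : IsPsi b s ψ) (hk : (ψ, k) ∈ maxRel b α) :
    transform b E - leadCoef b (3 / 2 + s) • ψ ∈ (momMin b α).domain := by
  obtain ⟨E', hE', hi, h, hw⟩ := (isEuler_pow hα hs).exists_regular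
  obtain rfl : E = E' := Lp.ext (hE.trans hE'.symm)
  have e0 : (fun x : ℝ => (expWeight x : ℂ) * eulerPow s x) =
      fun x : ℝ => (expWeight x : ℂ) * (x : ℂ) ^ (3 / 2 + s - 1) := by
    funext x; rw [eulerPow]; congr 2; ring
  rw [e0] at hE
  obtain ⟨C, hC⟩ := exists_trigInt_pow_le b (s := 3 / 2 + s) (by simp; linarith) (hi.congr hE)
  obtain ⟨Λ, hΛ, htail, -⟩ := hψ
  refine H.transform_sub_mem hw (Submodule.smul_mem _ (leadCoef b (3 / 2 + s)) hk)
    (C := C) (r := (3 / 2 + s).re) (Λ := max Λ 1) (by simp; linarith)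
    (lt_max_of_lt_right one_pos) ?_
  filter_upwards [transform_ae_eq b hi, htail, Lp.coeFn_smul (leadCoef b (3 / 2 + s)) ψ]
    with p e1 e2 e3 hp
  rw [e1, e3, Pi.smul_apply, smul_eq_mul, e2 ((le_max_left _ _).trans_lt hp), trigInt_congr b hE,
    show -3 / 2 - s = -(3 / 2 + s) by ring]
  exact hC p ((le_max_right _ _).trans hp.le)

end

theorem leadCoefLog_eq (b : Variant) {s : ℂ} (hs : 0 < s.re) : leadCoefLog b s =
    √(2 / Real.pi) * (Complex.Gamma s * (Complex.digamma s * ctrig b (Real.pi * s / 2) +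
      Real.pi / 2 * ctrigDeriv b (Real.pi * s / 2))) := by
  have hG := Complex.Gamma_ne_zero_of_re_pos hs
  rw [leadCoefLog, Complex.digamma_def, logDeriv_apply]
  field_simp

theorem digamma_three_half : Complex.digamma (3 / 2) =
    2 - Real.eulerMascheroniConstant - Real.log 4 := by
  have h := Complex.digamma_apply_add_one (1 / 2) fun m h => by
    have h1 := congrArg Complex.re h
    have h2 : (0 : ℝ) ≤ m := m.cast_nonneg
    simp at h1; linarith
  rw [show (1 / 2 : ℂ) + 1 = 3 / 2 by norm_num, Complex.digamma_one_half] at h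
  have h2 : Complex.log 2 = (Real.log 2 : ℂ) := by
    rw [Complex.ofReal_log zero_le_two, Complex.ofReal_ofNat]
  rw [h, h2, show (4 : ℝ) = 2 ^ 2 by norm_num, Real.log_pow]
  push_cast
  ring

/-- The shift of the logarithmic parameter. -/
def logShift : Variant → ℂ
  | .D => 2 - Real.eulerMascheroniConstant - Real.log 4 - Real.pi / 2
  | .N => 2 - Real.eulerMascheroniConstant - Real.log 4 + Real.pi / 2

/-- At `s = 3/2` the angle is `3π/4`, where sine and cosine are opposite. The logarithmic derivative
of the trigonometric factor therefore contributes `-π/2` for the sine and `+π/2` for the cosine,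
added to the digamma value. -/
theorem leadCoefLog_three_half (b : Variant) :
    leadCoefLog b (3 / 2) = leadCoef b (3 / 2) * logShift b := by
  have e : (Real.pi : ℂ) * (3 / 2) / 2 = Real.pi - Real.pi / 4 := by ring
  have e2 : Complex.cos (Real.pi / 4) = Complex.sin (Real.pi / 4) := by
    rw [← Complex.sin_pi_div_two_sub]; congr 1; ring
  rw [leadCoefLog_eq b (by norm_num), leadCoef, digamma_three_half, e]
  cases b
  · simp only [ctrig, ctrigDeriv, logShift, Complex.sin_pi_sub, Complex.cos_pi_sub, e2]; ring
  · simp only [ctrig, ctrigDeriv, logShift, Complex.sin_pi_sub, Complex.cos_pi_sub, e2]; ring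

/-- Scaling turns `log x` into `-log p` in the leading term. This gives the factor `-leadCoef`, and
the remaining multiple of `p^(-3/2)` becomes `logShift`. -/
theorem transform_log_sub_mem (b : Variant) {E ψ₁ ψ₀ : HalfLineL2}
    (hE : E =ᵐ[posMeasure] fun x => (expWeight x : ℂ) * eulerLog x)
    (h₁ : IsPsiLog b ψ₁) (h₀ : IsPsi b 0 ψ₀) :
    transform b E - (-leadCoef b (3 / 2)) • (ψ₁ - logShift b • ψ₀) ∈ (momMin b 0).domain := by
  have H := isBoundaryPair_logG b
  obtain ⟨k₁, t₁⟩ := H.left.hasTail ψ₁ h₁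
  obtain ⟨k₀, t₀⟩ := H.right.hasTail ψ₀ h₀
  obtain ⟨E', hE', hi, h, hw⟩ := isEuler_log.exists_regular
  obtain rfl : E = E' := Lp.ext (hE.trans hE'.symm)
  have hE2 : E =ᵐ[posMeasure]
      fun x : ℝ => (expWeight x : ℂ) * (Real.log x * (x : ℂ) ^ (3 / 2 - 1 : ℂ)) := by
    filter_upwards [hE, ae_restrict_mem measurableSet_Ioi] with x hx hx0
    have hx0 : 0 < x := hx0
    rw [hx, eulerLog, Real.sqrt_eq_rpow, Complex.ofReal_cpow hx0.le, mul_comm (Real.log x : ℂ)]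
    norm_num
  obtain ⟨C, hC⟩ := exists_trigInt_log_le b (s := 3 / 2) (by norm_num) (hi.congr hE2)
  obtain ⟨Λ₁, hΛ₁, tail₁, -⟩ := h₁
  obtain ⟨Λ₀, hΛ₀, tail₀, -⟩ := h₀
  have hmax : ((-leadCoef b (3 / 2)) • (ψ₁ - logShift b • ψ₀),
      (-leadCoef b (3 / 2)) • (k₁ - logShift b • k₀)) ∈ maxRel b 0 :=
    Submodule.smul_mem _ _ (Submodule.sub_mem _ t₁.mem_maxRel
      (Submodule.smul_mem _ (logShift b) t₀.mem_maxRel))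
  refine H.transform_sub_mem hw hmax (C := C) (r := (3 / 2 : ℂ).re - 1 / 2)
    (Λ := max (max Λ₁ Λ₀) 1) (by norm_num) (lt_max_of_lt_right one_pos) ?_
  filter_upwards [transform_ae_eq b hi, tail₁, tail₀,
    Lp.coeFn_smul (-leadCoef b (3 / 2)) (ψ₁ - logShift b • ψ₀), Lp.coeFn_sub ψ₁ (logShift b • ψ₀),
    Lp.coeFn_smul (logShift b) ψ₀] with p e1 e2 e3 e4 e5 e6 hp
  have hp1 : Λ₁ < p := ((le_max_left _ _).trans (le_max_left _ _)).trans_lt hp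
  have hp2 : Λ₀ < p := ((le_max_right _ _).trans (le_max_left _ _)).trans_lt hp
  rw [e1, e4, Pi.smul_apply, smul_eq_mul, e5, Pi.sub_apply, e6, Pi.smul_apply, smul_eq_mul, e2 hp1,
    e3 hp2, trigInt_congr b hE2]
  refine le_trans (le_of_eq (congrArg norm ?_)) (hC p ((le_max_right _ _).trans hp.le))
  rw [leadCoefLog_three_half, sub_zero, show (-3 / 2 : ℂ) = -(3 / 2) by norm_num]
  ring

/-! ## The relation between the two representations -/

theorem mem_sup_span_singleton {D : Submodule ℂ HalfLineL2} {u x : HalfLineL2} :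
    x ∈ D ⊔ Submodule.span ℂ {u} ↔ ∃ c : ℂ, x - c • u ∈ D := by
  constructor
  · intro h
    obtain ⟨y, hy, z, hz, rfl⟩ := Submodule.mem_sup.1 h
    obtain ⟨c, rfl⟩ := Submodule.mem_span_singleton.1 hz
    exact ⟨c, by rwa [add_sub_cancel_right]⟩
  · rintro ⟨c, hc⟩
    rw [← sub_add_cancel x (c • u)]
    exact Submodule.add_mem _ (Submodule.mem_sup_left hc) (Submodule.mem_sup_right
      (Submodule.smul_mem _ _ (Submodule.mem_span_singleton_self u)))

theorem mem_domain_posMin (b : Variant) {α : ℝ} (hα : (α : ℂ) - 1 / 4 ≠ 0) {f : HalfLineL2} :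
    f ∈ (posMin α).domain ↔ transform b f ∈ (momMin b α).domain := by
  rw [LinearPMap.mem_domain_iff, mem_domain_momMin hα, graph_posMin_eq b hα]
  constructor
  · rintro ⟨y, hy⟩
    exact ⟨_, mem_transformRel.1 hy⟩
  · rintro ⟨y, hy⟩
    exact ⟨transform b y, mem_transformRel.2 (by rwa [transform_transform])⟩

/-- The transform of a realization in position space whose asymptotics are carried by `E`. -/
theorem sandwich_posRealization (b : Variant) {α : ℝ} (hα : (α : ℂ) - 1 / 4 ≠ 0) {a : ℝ → ℂ}
    {T : HalfLineL2 →ₗ.[ℂ] HalfLineL2} {E u : HalfLineL2} {k : ℂ}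
    (hT : ∀ x y, (x, y) ∈ T.graph ↔
      x ∈ (momMin b α).domain ⊔ Submodule.span ℂ {u} ∧ (x, y) ∈ maxRel b α)
    (hne : ∃ ξ, ∃ f : HalfLineL2, IsCutoff ξ ∧ f =ᵐ[posMeasure] fun x => ξ x * a x)
    (hE : ∀ ξ (f : HalfLineL2), IsCutoff ξ → (f =ᵐ[posMeasure] fun x => ξ x * a x) →
      f - E ∈ (posMin α).domain)
    (hk : k ≠ 0) (hu : transform b E - k • u ∈ (momMin b α).domain) :
    sandwich (transform b) (posRealization α a) = T := by
  refine LinearPMap.eq_of_eq_graph (Submodule.ext ?_)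
  rintro ⟨x, y⟩
  have hS : (posMin α).domain ⊔ Submodule.span ℂ
      {f : HalfLineL2 | ∃ ξ, IsCutoff ξ ∧ f =ᵐ[posMeasure] fun x => ξ x * a x} =
      (posMin α).domain ⊔ Submodule.span ℂ {E} := by
    obtain ⟨ξ, f, hξ, hf⟩ := hne
    refine sup_span_eq_sup_span_singleton ⟨f, ξ, hξ, hf⟩ one_ne_zero ?_
    rintro s ⟨η, hη, hs⟩
    rw [one_smul]
    exact hE η s hη hs
  rw [mem_graph_sandwich (transform_transform b), posRealization, mem_graph_domRestrict, hS,
    mem_graph_posMax, weakRel_eq b hα, mem_transformRel, transform_transform, transform_transform,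
    hT]
  refine and_congr_left fun _ => ?_
  -- Modulo the minimal domains, the transformation takes `E` to `k u`; lines correspond, with
  -- coefficients multiplied by `k`.
  have key : ∀ c : ℂ, transform b x - c • E ∈ (posMin α).domain ↔
      x - (c * k) • u ∈ (momMin b α).domain := fun c => by
    rw [mem_domain_posMin b hα, map_sub, map_smul, transform_transform]
    have e : x - c • transform b E = (x - (c * k) • u) - c • (transform b E - k • u) := by
      rw [smul_sub, smul_smul]; abel
    rw [e]
    exact Submodule.sub_mem_iff_left _ (Submodule.smul_mem _ c hu)
  rw [mem_sup_span_singleton, mem_sup_span_singleton]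
  constructor
  · rintro ⟨c, hc⟩
    exact ⟨c * k, (key c).1 hc⟩
  · rintro ⟨c, hc⟩
    exact ⟨c / k, (key _).2 (by rwa [div_mul_cancel₀ c hk])⟩

theorem posRealization_congr (α : ℝ) {a a' : ℝ → ℂ} (h : ∀ x, 0 < x → a x = a' x) :
    posRealization α a = posRealization α a' := by
  have e : {f : HalfLineL2 | ∃ ξ, IsCutoff ξ ∧ f =ᵐ[posMeasure] fun x => ξ x * a x} =
      {f : HalfLineL2 | ∃ ξ, IsCutoff ξ ∧ f =ᵐ[posMeasure] fun x => ξ x * a' x} := by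
    have e1 : ∀ ξ : ℝ → ℂ, (fun x => ξ x * a x) =ᵐ[posMeasure] fun x => ξ x * a' x := fun ξ => by
      filter_upwards [ae_restrict_mem measurableSet_Ioi] with x hx
      rw [h x hx]
    ext f
    exact ⟨fun ⟨ξ, hξ, hf⟩ => ⟨ξ, hξ, hf.trans (e1 ξ)⟩,
      fun ⟨ξ, hξ, hf⟩ => ⟨ξ, hξ, hf.trans (e1 ξ).symm⟩⟩
  rw [posRealization, posRealization, e]

namespace IsEuler

variable {α : ℝ} {a a' : ℝ → ℂ} {δ : ℝ}

theorem sub_mem (H : IsEuler α a a' δ) {ξ : ℝ → ℂ} (hξ : IsCutoff ξ) {f E : HalfLineL2}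
    (hf : f =ᵐ[posMeasure] fun x => ξ x * a x)
    (hE : E =ᵐ[posMeasure] fun x => (expWeight x : ℂ) * a x) : f - E ∈ (posMin α).domain := by
  obtain ⟨g, hg, hgm⟩ := H.exists_cutoff_sub hξ
  have e : f - E = g := by
    refine Lp.ext ?_
    filter_upwards [hf, hE, hg, Lp.coeFn_sub f E] with x h1 h2 h3 h4
    rw [h4, Pi.sub_apply, h1, h2, h3]; ring
  rwa [e]

theorem exists_eq_cutoff_mul (H : IsEuler α a a' δ) {ξ : ℝ → ℂ} (hξ : IsCutoff ξ) :
    ∃ f : HalfLineL2, f =ᵐ[posMeasure] fun x => ξ x * a x := by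
  obtain ⟨g, hg, -⟩ := H.exists_cutoff_sub hξ
  obtain ⟨E, hE, -⟩ := H.exists_regular
  refine ⟨g + E, ?_⟩
  filter_upwards [hE, hg, Lp.coeFn_add g E] with x h2 h3 h4
  rw [h4, Pi.add_apply, h2, h3]; ring

end IsEuler

theorem smul_add_ae {f₁ f₂ : HalfLineL2} {w a₁ a₂ : ℝ → ℂ} (c : ℂ)
    (h₁ : f₁ =ᵐ[posMeasure] fun x => w x * a₁ x) (h₂ : f₂ =ᵐ[posMeasure] fun x => w x * a₂ x) :
    (c • f₁ + f₂ : HalfLineL2) =ᵐ[posMeasure] fun x => w x * (c * a₁ x + a₂ x) := by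
  filter_upwards [h₁, h₂, Lp.coeFn_add (c • f₁) f₂, Lp.coeFn_smul c f₁] with x e1 e2 e3 e4
  rw [e3, Pi.add_apply, e4, Pi.smul_apply, smul_eq_mul, e1, e2]; ring

/-- The conditions on `E` in `sandwich_posRealization` for a combination of two solutions. -/
theorem IsEuler.combination {α : ℝ} {a₁ a₁' a₂ a₂' : ℝ → ℂ} {δ₁ δ₂ : ℝ}
    (H₁ : IsEuler α a₁ a₁' δ₁) (H₂ : IsEuler α a₂ a₂' δ₂) {E₁ E₂ : HalfLineL2}
    (hE₁ : E₁ =ᵐ[posMeasure] fun x => (expWeight x : ℂ) * a₁ x)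
    (hE₂ : E₂ =ᵐ[posMeasure] fun x => (expWeight x : ℂ) * a₂ x) (c : ℂ) :
    (∃ ξ, ∃ f : HalfLineL2, IsCutoff ξ ∧ f =ᵐ[posMeasure] fun x => ξ x * (c * a₁ x + a₂ x)) ∧
    ∀ ξ (f : HalfLineL2), IsCutoff ξ → (f =ᵐ[posMeasure] fun x => ξ x * (c * a₁ x + a₂ x)) →
      f - (c • E₁ + E₂) ∈ (posMin α).domain := by
  have key : ∀ {ξ}, IsCutoff ξ → ∃ f₁ f₂ : HalfLineL2,
      ((c • f₁ + f₂ : HalfLineL2) =ᵐ[posMeasure] fun x => ξ x * (c * a₁ x + a₂ x)) ∧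
      f₁ - E₁ ∈ (posMin α).domain ∧ f₂ - E₂ ∈ (posMin α).domain := fun hξ => by
    obtain ⟨f₁, h₁⟩ := H₁.exists_eq_cutoff_mul hξ
    obtain ⟨f₂, h₂⟩ := H₂.exists_eq_cutoff_mul hξ
    exact ⟨f₁, f₂, smul_add_ae c h₁ h₂, H₁.sub_mem hξ h₁ hE₁, H₂.sub_mem hξ h₂ hE₂⟩
  refine ⟨?_, fun ξ f hξ hf => ?_⟩
  · obtain ⟨ξ, hξ⟩ := exists_isCutoff
    obtain ⟨f₁, f₂, h, -⟩ := key hξ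
    exact ⟨ξ, _, hξ, h⟩
  · obtain ⟨f₁, f₂, h, m₁, m₂⟩ := key hξ
    obtain rfl : f = c • f₁ + f₂ := Lp.ext (hf.trans h.symm)
    have e : c • f₁ + f₂ - (c • E₁ + E₂) = c • (f₁ - E₁) + (f₂ - E₂) := by
      rw [smul_sub]; abel
    rw [e]
    exact Submodule.add_mem _ (Submodule.smul_mem _ _ m₁) m₂

/-- The factor `κ̃ / κ`. -/
def ratio : Variant → ℂ → ℂ
  | .D, m => ratioD m
  | .N, m => ratioN m

/-- The zeros are at `z = 1/2 - 2n` with `n` an integer, and only `n = 0` lies in the strip `|Re z|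
< 1`. -/
theorem sin_quarter_ne_zero {z : ℂ} (h1 : z ≠ 1 / 2) (hl : -1 < z.re) (hr : z.re < 1) :
    Complex.sin (Real.pi / 4 - Real.pi * z / 2) ≠ 0 := fun h => by
  obtain ⟨n, hn⟩ := Complex.sin_eq_zero_iff.1 h
  have hpi : (Real.pi : ℂ) ≠ 0 := Complex.ofReal_ne_zero.2 Real.pi_ne_zero
  have e : z = 1 / 2 - 2 * n := by
    have : (Real.pi : ℂ) * z = Real.pi * (1 / 2 - 2 * n) := by linear_combination -2 * hn
    exact mul_left_cancel₀ hpi this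
  have hre : z.re = 1 / 2 - 2 * n := by rw [e]; simp
  have n1 : (n : ℝ) < 1 := by linarith
  have n0 : (-1 : ℝ) < n := by linarith
  have : n = 0 := by
    have a1 : n < 1 := by exact_mod_cast n1
    have a2 : -1 < n := by exact_mod_cast n0
    omega
  exact h1 (by rw [e, this]; simp)

theorem ctrig_D_eq (z : ℂ) : ctrig .D (Real.pi * (3 / 2 + z) / 2) =
    Complex.sin (Real.pi / 4 - Real.pi * z / 2) := by
  rw [ctrig, ← Complex.sin_pi_sub]; congr 1; ring

theorem ctrig_N_eq (z : ℂ) : ctrig .N (Real.pi * (3 / 2 + z) / 2) =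
    -Complex.cos (Real.pi / 4 - Real.pi * z / 2) := by
  rw [ctrig, ← Complex.cos_pi_sub]; congr 1; ring

theorem cos_quarter (z : ℂ) : Complex.cos (Real.pi / 4 - Real.pi * z / 2) =
    Complex.sin (Real.pi / 4 - Real.pi * (-z) / 2) := by
  rw [← Complex.sin_pi_div_two_sub]; congr 1; ring

theorem ctrig_ne_zero (b : Variant) {z : ℂ} (h1 : z ≠ 1 / 2) (h2 : z ≠ -1 / 2) (hl : -1 < z.re)
    (hr : z.re < 1) : ctrig b (Real.pi * (3 / 2 + z) / 2) ≠ 0 := by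
  cases b
  · rw [ctrig_D_eq]
    exact sin_quarter_ne_zero h1 hl hr
  · rw [ctrig_N_eq, cos_quarter]
    refine neg_ne_zero.2 (sin_quarter_ne_zero (fun h => h2 ?_) ?_ ?_)
    · rw [← neg_neg z, h]; ring
    · rw [Complex.neg_re]; linarith
    · rw [Complex.neg_re]; linarith

theorem leadCoef_ne_zero (b : Variant) {z : ℂ} (h1 : z ≠ 1 / 2) (h2 : z ≠ -1 / 2) (hl : -1 < z.re)
    (hr : z.re < 1) : leadCoef b (3 / 2 + z) ≠ 0 := by
  refine mul_ne_zero (Complex.ofReal_ne_zero.2 (by positivity)) (mul_ne_zero ?_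
    (ctrig_ne_zero b h1 h2 hl hr))
  exact Complex.Gamma_ne_zero_of_re_pos (by simp; linarith)

theorem Gamma_three_half_add {z : ℂ} (h1 : z ≠ 1 / 2) (h2 : z ≠ -1 / 2) :
    Complex.Gamma (3 / 2 + z) = (z ^ 2 - 1 / 4) * Complex.Gamma (-1 / 2 + z) := by
  have a : -1 / 2 + z ≠ 0 := fun h => h1 (by linear_combination h)
  have b : 1 / 2 + z ≠ 0 := fun h => h2 (by linear_combination h)
  rw [show 3 / 2 + z = (1 / 2 + z) + 1 by ring, Complex.Gamma_add_one _ b,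
    show 1 / 2 + z = (-1 / 2 + z) + 1 by ring, Complex.Gamma_add_one _ a]
  ring

/-- By the functional equation, `Γ(3/2 ± m) = (m² - 1/4) Γ(-1/2 ± m)` with the same even factor,
which cancels in the quotient. For the cosine the signs from the shift of the angle cancel too. -/
theorem leadCoef_neg (b : Variant) {m : ℂ} (h1 : m ≠ 1 / 2) (h2 : m ≠ -1 / 2) (hl : -1 < m.re)
    (hr : m.re < 1) : leadCoef b (3 / 2 + -m) = leadCoef b (3 / 2 + m) * ratio b m := by
  have h1' : -m ≠ 1 / 2 := fun h => h2 (by rw [← neg_neg m, h]; ring)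
  have h2' : -m ≠ -1 / 2 := fun h => h1 (by rw [← neg_neg m, h]; ring)
  have hG : Complex.Gamma (3 / 2 + m) ≠ 0 :=
    Complex.Gamma_ne_zero_of_re_pos (by simp; linarith)
  have ht := ctrig_ne_zero b h1 h2 hl hr
  rw [Gamma_three_half_add h1 h2] at hG
  have hG2 := right_ne_zero_of_mul hG
  rw [leadCoef, leadCoef, Gamma_three_half_add h1 h2, Gamma_three_half_add h1' h2']
  have e1 : -1 / 2 + -m = -1 / 2 - m := by ring
  have e2 : (Real.pi : ℂ) / 4 - Real.pi * -m / 2 = Real.pi / 4 + Real.pi * m / 2 := by ring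
  cases b
  · rw [ctrig_D_eq] at ht
    rw [ctrig_D_eq, ctrig_D_eq, ratio, ratioD, e1, e2]
    generalize Complex.Gamma (-1 / 2 + m) = x at *
    generalize Complex.sin (Real.pi / 4 - Real.pi * m / 2) = y at *
    field_simp
  · rw [ctrig_N_eq, neg_ne_zero] at ht
    rw [ctrig_N_eq, ctrig_N_eq, ratio, ratioN, e1, e2]
    generalize Complex.Gamma (-1 / 2 + m) = x at *
    generalize Complex.cos (Real.pi / 4 - Real.pi * m / 2) = y at *
    field_simp

section
variable {b : Variant} {m : ℂ}

theorem exists_weighted {α : ℝ} {a a' : ℝ → ℂ} {δ : ℝ} (H : IsEuler α a a' δ) :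
    ∃ E : HalfLineL2, E =ᵐ[posMeasure] fun x => (expWeight x : ℂ) * a x :=
  H.exists_regular.imp fun _ h => h.1

/-- The boundary vectors for `-m` and `m` transform into `leadCoef b (3/2 - m)` times `ψ_{-m}` and
`leadCoef b (3/2 + m)` times `ψ_m`. Dividing by the second coefficient puts the line into the normal
form with parameter `ratio b m * κ`. -/
theorem sandwich_posH_of_ne_zero (b : Variant) {α : ℝ} (hα : (α : ℂ) = m ^ 2) (h0 : m ≠ 0)
    (h1 : m ≠ 1 / 2) (h2 : m ≠ -1 / 2) (hl : -1 < m.re) (hr : m.re < 1) (κ : OnePoint ℂ) :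
    sandwich (transform b) (posH m κ) = momH b m (κ.map fun k => ratio b m * k) := by
  have hre : (m ^ 2).re = α := by rw [← hα, Complex.ofReal_re]
  have H := isBoundaryPair_powG b hα h0 h1 h2 hl hr
  have hl' : -1 < (-m).re := by rw [Complex.neg_re]; linarith
  have hα' : (α : ℂ) = (-m) ^ 2 := by rw [hα]; ring
  have Ep := isEuler_pow hα hl
  have Em := isEuler_pow hα' hl'
  obtain ⟨P, hP⟩ := exists_weighted Ep
  obtain ⟨M, hM⟩ := exists_weighted Em
  obtain ⟨ψp, hp⟩ := H.left.nonempty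
  obtain ⟨ψm, hm⟩ := H.right.nonempty
  obtain ⟨kp, tp⟩ := H.left.hasTail ψp hp
  obtain ⟨km, tm⟩ := H.right.hasTail ψm hm
  have dp := H.transform_pow_sub_mem hα hl hP hp tp.mem_maxRel
  have dm := H.transform_pow_sub_mem hα' hl' hM hm tm.mem_maxRel
  have np := leadCoef_ne_zero b h1 h2 hl hr
  have nm := leadCoef_ne_zero b (z := -m) (fun h => h2 (by rw [← neg_neg m, h]; ring))
    (fun h => h1 (by rw [← neg_neg m, h]; ring)) hl' (by rw [Complex.neg_re]; linarith)
  rw [momH_eq h0, posH, hre]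
  have ep : ∀ x : ℝ, (x : ℂ) ^ (1 / 2 + m) = eulerPow m x := fun x => rfl
  have em : ∀ x : ℝ, (x : ℂ) ^ (1 / 2 - m) = eulerPow (-m) x := fun x => by
    rw [eulerPow, sub_eq_add_neg]
  induction κ using OnePoint.rec with
  | infty =>
    have ea : posAsymptotics m OnePoint.infty = eulerPow (-m) := funext em
    rw [ea]
    refine sandwich_posRealization b H.ne_zero (E := M) (u := ψm)
      (fun x y => H.mem_graph_line hp hm OnePoint.infty) ?_ (fun ξ f hξ hf => Em.sub_mem hξ hf hM)
      nm dm
    obtain ⟨ξ, hξ⟩ := exists_isCutoff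
    obtain ⟨f, hf⟩ := Em.exists_eq_cutoff_mul hξ
    exact ⟨ξ, f, hξ, hf⟩
  | coe k =>
    have ea : posAsymptotics m (k : OnePoint ℂ) = fun x => k * eulerPow (-m) x + eulerPow m x :=
      funext fun x => by rw [← em, ← ep]; rfl
    rw [ea]
    obtain ⟨c1, c2⟩ := Em.combination Ep hM hP k
    refine sandwich_posRealization b H.ne_zero (E := k • M + P)
      (u := ψp + (ratio b m * k) • ψm)
      (fun x y => H.mem_graph_line hp hm ((ratio b m * k : ℂ) : OnePoint ℂ)) c1 c2 np ?_
    have e : transform b (k • M + P) - leadCoef b (3 / 2 + m) • (ψp + (ratio b m * k) • ψm) =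
        k • (transform b M - leadCoef b (3 / 2 + -m) • ψm) +
          (transform b P - leadCoef b (3 / 2 + m) • ψp) := by
      rw [map_add, map_smul, leadCoef_neg b h1 h2 hl hr, smul_add, smul_sub, smul_smul, smul_smul,
        show leadCoef b (3 / 2 + m) * (ratio b m * k) = k * (leadCoef b (3 / 2 + m) * ratio b m)
          by ring]
      abel
    rw [e]
    exact Submodule.add_mem _ (Submodule.smul_mem _ _ dm) dp

theorem ratio_zero (b : Variant) : ratio b 0 = 1 := by
  have h := leadCoef_neg b (m := 0) (by norm_num) (by norm_num) (by simp) (by simp)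
  have hn := leadCoef_ne_zero b (z := 0) (by norm_num) (by norm_num) (by simp) (by simp)
  rw [neg_zero] at h
  exact mul_left_cancel₀ hn (by rw [← h, mul_one])

/-- Degenerate case: for `m = 0` both boundary vectors coincide, on either side, so the line is
spanned by `(κ + 1)` times one vector and collapses for `κ = -1`. As `ratio b 0 = 1`, the parameters
still match. The maximal operator involved is the logarithmic one. -/
theorem sandwich_posH_zero (b : Variant) (κ : OnePoint ℂ) :
    sandwich (transform b) (posH 0 κ) = momH b 0 (κ.map fun k => ratio b 0 * k) := by
  have H := isBoundaryPair_logG b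
  have hα : ((0 : ℝ) : ℂ) = (0 : ℂ) ^ 2 := by simp
  have E0 := isEuler_pow hα (by simp)
  obtain ⟨P, hP⟩ := exists_weighted E0
  obtain ⟨ψp, hp⟩ := H.left.nonempty
  obtain ⟨ψ, hψ⟩ := H.right.nonempty
  obtain ⟨k₀, t⟩ := H.right.hasTail ψ hψ
  have d := H.transform_pow_sub_mem hα (by simp) hP hψ t.mem_maxRel
  have n := leadCoef_ne_zero b (z := 0) (by norm_num) (by norm_num) (by simp) (by simp)
  have hre : ((0 : ℂ) ^ 2).re = 0 := by simp
  have hmom : ∀ κ : OnePoint ℂ, ∀ x y, (x, y) ∈ (momH b 0 κ).graph ↔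
      x ∈ (momMin b 0).domain ⊔ Submodule.span ℂ {κ.elim ψ fun k => (k + 1) • ψ} ∧
        (x, y) ∈ maxRel b 0 := fun κ x y => by
    rw [momH, momMax, if_pos rfl, hre]
    simp only [neg_zero]
    have hS : (momMin b 0).domain ⊔ Submodule.span ℂ (κ.elim {ψ | IsPsi b 0 ψ}
        fun k => {ψ | ∃ ψp ψm, IsPsi b 0 ψp ∧ IsPsi b 0 ψm ∧ ψ = ψp + k • ψm}) =
        (momMin b 0).domain ⊔ Submodule.span ℂ {κ.elim ψ fun k => (k + 1) • ψ} := by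
      induction κ using OnePoint.rec with
      | infty => exact H.right.sup_span H.ne_zero hψ
      | coe k =>
        refine sup_span_eq_sup_span_singleton ⟨_, ψ, ψ, hψ, hψ, rfl⟩ one_ne_zero ?_
        rintro _ ⟨χp, χm, hχp, hχm, rfl⟩
        have e : χp + k • χm - (1 : ℂ) • ((k + 1) • ψ) = (χp - ψ) + k • (χm - ψ) := by
          rw [one_smul, smul_sub, add_smul, one_smul]; abel
        exact e ▸ Submodule.add_mem _ (H.right.sub_mem H.ne_zero hχp hψ)
          (Submodule.smul_mem _ _ (H.right.sub_mem H.ne_zero hχm hψ))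
    rw [hS, H.mem_graph_domRestrict]
    rw [H.momMaxDomain_eq hp hψ]
    refine sup_le (le_sup_left.trans le_sup_left) (Submodule.span_le.2 ?_)
    rw [singleton_subset_iff]
    have hm : ψ ∈ (momMin b 0).domain ⊔ Submodule.span ℂ {ψp} ⊔ Submodule.span ℂ {ψ} :=
      Submodule.mem_sup_right (Submodule.mem_span_singleton_self _)
    induction κ using OnePoint.rec with
    | infty => exact hm
    | coe k => exact Submodule.smul_mem _ _ hm
  rw [posH, hre]
  have ep : ∀ x : ℝ, (x : ℂ) ^ (1 / 2 + 0 : ℂ) = eulerPow 0 x := fun x => rfl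
  have em : ∀ x : ℝ, (x : ℂ) ^ (1 / 2 - 0 : ℂ) = eulerPow 0 x := fun x => by
    rw [eulerPow, sub_zero, add_zero]
  induction κ using OnePoint.rec with
  | infty =>
    have ea : posAsymptotics 0 OnePoint.infty = eulerPow 0 := funext em
    rw [ea]
    refine sandwich_posRealization b H.ne_zero (E := P) (u := ψ)
      (fun x y => hmom OnePoint.infty x y) ?_ (fun ξ f hξ hf => E0.sub_mem hξ hf hP) n d
    obtain ⟨ξ, hξ⟩ := exists_isCutoff
    obtain ⟨f, hf⟩ := E0.exists_eq_cutoff_mul hξ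
    exact ⟨ξ, f, hξ, hf⟩
  | coe k =>
    have ea : posAsymptotics 0 (k : OnePoint ℂ) = fun x => k * eulerPow 0 x + eulerPow 0 x :=
      funext fun x => by
        change k * (x : ℂ) ^ (1 / 2 - 0 : ℂ) + (x : ℂ) ^ (1 / 2 + 0 : ℂ) = _
        rw [em, ep]
    rw [ea]
    obtain ⟨c1, c2⟩ := E0.combination E0 hP hP k
    refine sandwich_posRealization b H.ne_zero (E := k • P + P) (u := (k + 1) • ψ)
      (fun x y => ?_) c1 c2 n ?_
    · have := hmom ((ratio b 0 * k : ℂ) : OnePoint ℂ) x y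
      rw [ratio_zero, one_mul] at this
      rw [OnePoint.map_some, ratio_zero, one_mul]
      exact this
    · have e : transform b (k • P + P) - leadCoef b (3 / 2 + 0) • ((k + 1) • ψ) =
          (k + 1) • (transform b P - leadCoef b (3 / 2 + 0) • ψ) := by
        rw [map_add, map_smul]
        module
      rw [e]
      exact Submodule.smul_mem _ _ d

/-- The relation between the realizations in position and in momentum space. -/
theorem sandwich_posH (b : Variant) (him : (m ^ 2).im = 0) (hlt : (m ^ 2).re < 1)
    (h1 : m ≠ 1 / 2) (h2 : m ≠ -1 / 2) (κ : OnePoint ℂ) :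
    sandwich (transform b) (posH m κ) = momH b m (κ.map fun k => ratio b m * k) := by
  rcases eq_or_ne m 0 with rfl | h0
  · exact sandwich_posH_zero b κ
  have hα : (((m ^ 2).re : ℝ) : ℂ) = m ^ 2 := Complex.ext rfl (by simp [him])
  -- A real `m²` forces `m` to be real or purely imaginary; in the first case `m² < 1` is used.
  have hre : |m.re| < 1 := by
    rw [sq, Complex.mul_im] at him
    rw [sq, Complex.mul_re] at hlt
    have h : m.re = 0 ∨ m.im = 0 := mul_eq_zero.1 (by linarith)
    rcases h with h | h
    · rw [h]; norm_num
    · rw [h] at hlt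
      exact abs_lt_of_sq_lt_sq (by linarith) zero_le_one
  exact sandwich_posH_of_ne_zero b hα h0 h1 h2 (abs_lt.1 hre).1 (abs_lt.1 hre).2 κ

/-- The logarithmic case of `sandwich_posH`. -/
theorem sandwich_posHLog (b : Variant) (ν : OnePoint ℂ) :
    sandwich (transform b) (posHLog ν) = momHLog b (ν.map fun n => -n - logShift b) := by
  have H := isBoundaryPair_logG b
  have hα : ((0 : ℝ) : ℂ) = (0 : ℂ) ^ 2 := by simp
  have E0 := isEuler_pow hα (by simp)
  have E1 := isEuler_log
  obtain ⟨P, hP⟩ := exists_weighted E0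
  obtain ⟨L, hL⟩ := exists_weighted E1
  obtain ⟨ψ₁, h₁⟩ := H.left.nonempty
  obtain ⟨ψ₀, h₀⟩ := H.right.nonempty
  obtain ⟨k₀, t⟩ := H.right.hasTail ψ₀ h₀
  have d0 := H.transform_pow_sub_mem hα (by simp) hP h₀ t.mem_maxRel
  have d1 := transform_log_sub_mem b hL h₁ h₀
  have n := leadCoef_ne_zero b (z := 0) (by norm_num) (by norm_num) (by simp) (by simp)
  rw [momHLog_eq, posHLog]
  have ep : ∀ x : ℝ, 0 < x → (√x : ℂ) = eulerPow 0 x := fun x hx => by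
    rw [eulerPow, Real.sqrt_eq_rpow, Complex.ofReal_cpow hx.le]; norm_num
  rw [add_zero] at n d0
  induction ν using OnePoint.rec with
  | infty =>
    rw [posRealization_congr 0 (a := posAsymptoticsLog OnePoint.infty) (a' := eulerPow 0) ep]
    refine sandwich_posRealization b H.ne_zero (E := P) (u := ψ₀)
      (fun x y => H.mem_graph_line h₁ h₀ OnePoint.infty) ?_
      (fun ξ f hξ hf => E0.sub_mem hξ hf hP) n d0
    obtain ⟨ξ, hξ⟩ := exists_isCutoff
    obtain ⟨f, hf⟩ := E0.exists_eq_cutoff_mul hξ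
    exact ⟨ξ, f, hξ, hf⟩
  | coe k =>
    rw [posRealization_congr 0 (a := posAsymptoticsLog (k : OnePoint ℂ))
      (a' := fun x => k * eulerPow 0 x + eulerLog x) fun x hx => by
        change √x * Real.log x + k * √x = _
        rw [ep x hx, eulerLog, ep x hx, add_comm]]
    obtain ⟨c1, c2⟩ := E0.combination E1 hP hL k
    refine sandwich_posRealization b H.ne_zero (E := k • P + L)
      (u := ψ₁ + (-k - logShift b) • ψ₀)
      (fun x y => H.mem_graph_line h₁ h₀ ((-k - logShift b : ℂ) : OnePoint ℂ)) c1 c2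
      (neg_ne_zero.2 n) ?_
    -- The power part carries `leadCoef` and the logarithmic part `-leadCoef`. Normalizing the
    -- coefficient of `ψ_log` to `1` therefore reverses the sign of `ν`.
    have e : transform b (k • P + L) - (-leadCoef b (3 / 2)) • (ψ₁ + (-k - logShift b) • ψ₀) =
        k • (transform b P - leadCoef b (3 / 2) • ψ₀) +
          (transform b L - (-leadCoef b (3 / 2)) • (ψ₁ - logShift b • ψ₀)) := by
      rw [map_add, map_smul]
      module
    rw [e]
    exact Submodule.add_mem _ (Submodule.smul_mem _ _ d0) d1

end

end Bessel

end

theorem theorem4 :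
    -- real `m ≠ 0`, `κ̃ ∈ ℝ ∪ {∞}`
    (∀ m : ℝ, m ∈ Ioo (-1 : ℝ) 1 → m ≠ 0 → m ≠ 1 / 2 → m ≠ -1 / 2 → ∀ κ : OnePoint ℝ,
      IsSelfAdjoint (Bessel.momH .D (m : ℂ) (κ.map ((↑) : ℝ → ℂ))) ∧
      IsSelfAdjoint (Bessel.momH .N (m : ℂ) (κ.map ((↑) : ℝ → ℂ)))) ∧
    -- imaginary `m = it ≠ 0`, `|κ̃| = 1`
    (∀ t : ℝ, t ≠ 0 → ∀ κ : ℂ, ‖κ‖ = 1 →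
      IsSelfAdjoint (Bessel.momH .D (Complex.I * t) (κ : OnePoint ℂ)) ∧
      IsSelfAdjoint (Bessel.momH .N (Complex.I * t) (κ : OnePoint ℂ))) ∧
    -- `m = 0`, `ν̃ ∈ ℝ ∪ {∞}`
    (∀ ν : OnePoint ℝ,
      IsSelfAdjoint (Bessel.momHLog .D (ν.map ((↑) : ℝ → ℂ))) ∧
      IsSelfAdjoint (Bessel.momHLog .N (ν.map ((↑) : ℝ → ℂ)))) ∧
    -- the relation to the position representation
    (∀ m : ℂ, (m ^ 2).im = 0 → (m ^ 2).re < 1 → m ≠ 1 / 2 → m ≠ -1 / 2 → ∀ κ : OnePoint ℂ,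
      Bessel.sandwich Bessel.sineTransform (Bessel.posH m κ) =
        Bessel.momH .D m (κ.map fun k => Bessel.ratioD m * k) ∧
      Bessel.sandwich Bessel.cosineTransform (Bessel.posH m κ) =
        Bessel.momH .N m (κ.map fun k => Bessel.ratioN m * k)) ∧
    (∀ ν : OnePoint ℂ,
      Bessel.sandwich Bessel.sineTransform (Bessel.posHLog ν) =
        Bessel.momHLog .D (ν.map fun n =>
          -n - 2 + (Real.eulerMascheroniConstant : ℂ) + (Real.pi : ℂ) / 2 + (Real.log 4 : ℂ)) ∧
      Bessel.sandwich Bessel.cosineTransform (Bessel.posHLog ν) =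
        Bessel.momHLog .N (ν.map fun n =>
          -n - 2 + (Real.eulerMascheroniConstant : ℂ) - (Real.pi : ℂ) / 2 + (Real.log 4 : ℂ))) := by
  refine ⟨fun m hm h0 h1 h2 κ => ⟨Bessel.isSelfAdjoint_momH_real .D hm h0 h1 h2 κ,
      Bessel.isSelfAdjoint_momH_real .N hm h0 h1 h2 κ⟩,
    fun t ht κ hκ => ⟨Bessel.isSelfAdjoint_momH_imaginary .D ht hκ,
      Bessel.isSelfAdjoint_momH_imaginary .N ht hκ⟩,
    fun ν => ⟨Bessel.isSelfAdjoint_momHLog .D ν, Bessel.isSelfAdjoint_momHLog .N ν⟩,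
    fun m him hlt h1 h2 κ => ⟨Bessel.sandwich_posH .D him hlt h1 h2 κ,
      Bessel.sandwich_posH .N him hlt h1 h2 κ⟩, fun ν => ⟨?_, ?_⟩⟩
  · refine (Bessel.sandwich_posHLog .D ν).trans (congrArg (fun g => Bessel.momHLog .D (ν.map g)) ?_)
    funext n
    simp only [Bessel.logShift]
    ring
  · refine (Bessel.sandwich_posHLog .N ν).trans (congrArg (fun g => Bessel.momHLog .N (ν.map g)) ?_)
    funext n
    simp only [Bessel.logShift]
    ring
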